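/- Let $(M,g,J)$ be a Kähler manifold of complex dimension $n$: $J$ is an integrable $g$-orthogonal almost complex structure and $\omega=g(J\cdot,\cdot)$ is closed. Let $\nabla$ be the Levi-Civita connection of $g$, $\mathrm{Ric}$ its Ricci tensor, $\bar\rho=\mathrm{Ric}(J\cdot,\cdot)$ the Ricci form, $h=g-i\omega$, and $K_M$ the bundle of $(n,0)$-forms with the induced Hermitian norm and connection. Let $L$ be a compact oriented $n$-manifold without boundary and $\iota:L\to M$ a totally real immersion, i.e. a smooth immersion with $\iota_*(T_pL)\cap J\iota_*(T_pL)=\{0\}$ for all $p$, so that $T_{\iota(p)}M=\iota_*(T_pL)\oplus J\iota_*(T_pL)$; let $\pi_J$ be the projection onto the second summand. * The canonical section $\Omega_J[\iota]$ of $\iota^*K_M$ is, at $p$, the form $$\Omega_J[\iota]=\frac{(v_1^*+i(Jv_1)^*)\wedge\dots\wedge(v_n^*+i(Jv_n)^*)}{|(v_1^*+i(Jv_1)^*)\wedge\dots\wedge(v_n^*+i(Jv_n)^*)|_h},$$ where $v_1,\dots,v_n$ is any positive basis of $\iota_*(T_pL)$ and $v_k^*,(Jv_k)^*$ is the real basis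 dual to $v_1,\dots,v_n,Jv_1,\dots,Jv_n$. * $\mathrm{vol}_J[\iota]=\iota^*\Omega_J[\iota]$, a positive real volume form on $L$, and $\mathrm{Vol}_J(\iota)=\int_L\mathrm{vol}_J[\iota]$. The immersion $\iota$ is *$J$-minimal* if it is a critical point of $\mathrm{Vol}_J$ among totally real immersions, and *minimal* if it is a critical point of the Riemannian volume among immersions. * The $J$-mean curvature field $H_J[\iota]$ is the gradient field of $\mathrm{Vol}_J$ at $\iota$ (with the customary sign): the smooth section of $J\iota_*(TL)$ such that $$\frac{d}{dt}\Big|_{t=0}\mathrm{Vol}_J(\iota_t)=-\int_L g(\pi_JZ,H_J[\iota])\,\mathrm{vol}_J[\iota]$$ for every smooth family $\iota_t$ of totally real immersions with $\iota_0=\iota$ and $Z=\partial_t\iota_t|_{t=0}$. * The Maslov $1$-form $\xi_J[\iota]$ on $L$ is given by letting $\xi_J[\iota](X)$ be the trace of the endomorphism $v\mapsto J\pi_J\nabla_Xv$ of $T_pL\cong\iota_*(T_pL)$. Then $H_J[\iota]$ exists and is unique, and the following conditions are equivalent: 1. $\iota$ is $J$-minimal; 2. $H_J[\iota]=0$; 3.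 $\xi_J[\iota]=0$; 4. $\Omega_J[\iota]$ is parallel, i.e. $\nabla_X\Omega_J[\iota]=0$ for every $X$ tangent to $L$. If $M$ is Kähler–Einstein with non-zero scalar curvature, i.e. $\mathrm{Ric}=c\,g$ for a constant $c\neq0$, these conditions are also equivalent to $\iota$ being minimal and Lagrangian ($\iota^*\omega=0$). If the Ricci form is definite, i.e. $\mathrm{Ric}$ or $-\mathrm{Ric}$ is positive definite everywhere on $M$, these conditions imply that $\iota$ is $\bar\rho$-Lagrangian, i.e. $\iota^*\bar\rho=0$. -/

import Mathlib

open scoped Manifold ContDiff Bundle Topology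
open Bundle VectorField MeasureTheory

noncomputable section
namespace TotRealGeom

/-- The model space `ℝᵐ`. -/
abbrev Eu (m : ℕ) : Type := EuclideanSpace ℝ (Fin m)

section Metric

variable {m : ℕ} {M : Type*} [TopologicalSpace M] [ChartedSpace (Eu m) M]
  [IsManifold (𝓡 m) ∞ M]

/-- A smooth Riemannian metric on the `m`-dimensional manifold `M`. -/
abbrev RMetric (m : ℕ) (M : Type*) [TopologicalSpace M] [ChartedSpace (Eu m) M]
    [IsManifold (𝓡 m) ∞ M] : Type _ :=
  ContMDiffRiemannianMetric (𝓡 m) ∞ (Eu m) (fun x : M ↦ TangentSpace (𝓡 m) x)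

/-- The vector field `X`, as a section of the tangent bundle, is differentiable at `x`. -/
abbrev DiffFieldAt (X : Π x : M, TangentSpace (𝓡 m) x) (x : M) : Prop :=
  MDifferentiableAt (𝓡 m) (𝓡 m).tangent (fun y ↦ (⟨y, X y⟩ : TangentBundle (𝓡 m) M)) x

/-- The vector field `X` is smooth. -/
abbrev SmoothField (X : Π x : M, TangentSpace (𝓡 m) x) : Prop :=
  ContMDiff (𝓡 m) (𝓡 m).tangent ∞ (fun y ↦ (⟨y, X y⟩ : TangentBundle (𝓡 m) M))

/-- The Koszul expression, equal to `2 g(∇_X Y, Z)` for the Levi-Civita connection `∇` of `g`. -/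
def koszul (g : RMetric m M) (X Y Z : Π x : M, TangentSpace (𝓡 m) x) (x : M) : ℝ :=
  mvfderiv (𝓡 m) (fun y ↦ g.inner y (Y y) (Z y)) x (X x)
    + mvfderiv (𝓡 m) (fun y ↦ g.inner y (X y) (Z y)) x (Y x)
    - mvfderiv (𝓡 m) (fun y ↦ g.inner y (X y) (Y y)) x (Z x)
    + g.inner x (mlieBracket (𝓡 m) X Y x) (Z x)
    - g.inner x (mlieBracket (𝓡 m) X Z x) (Y x)
    - g.inner x (mlieBracket (𝓡 m) Y Z x) (X x)

lemma mdiff_inner (g : RMetric m M) {X Y : Π x : M, TangentSpace (𝓡 m) x} {x : M}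
    (hX : DiffFieldAt X x) (hY : DiffFieldAt Y x) :
    MDifferentiableAt (𝓡 m) 𝓘(ℝ) (fun y ↦ g.inner y (X y) (Y y)) x := by
  let _ : RiemannianBundle (fun x : M ↦ TangentSpace (𝓡 m) x) := ⟨g.toRiemannianMetric⟩
  have : IsContMDiffRiemannianBundle (𝓡 m) 1 (Eu m) (fun x : M ↦ TangentSpace (𝓡 m) x) :=
    inferInstance
  exact MDifferentiableAt.inner_bundle hX hY

lemma inner_smul_fun (g : RMetric m M) (f : M → ℝ) (X Y : Π x : M, TangentSpace (𝓡 m) x) :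
    (fun y ↦ g.inner y ((f • X) y) (Y y)) = f * (fun y ↦ g.inner y (X y) (Y y)) := by
  ext y; simp

lemma inner_smul_fun' (g : RMetric m M) (f : M → ℝ) (X Y : Π x : M, TangentSpace (𝓡 m) x) :
    (fun y ↦ g.inner y (X y) ((f • Y) y)) = f * (fun y ↦ g.inner y (X y) (Y y)) := by
  ext y; simp

lemma inner_add_fun (g : RMetric m M) (X X' Y : Π x : M, TangentSpace (𝓡 m) x) :
    (fun y ↦ g.inner y ((X + X') y) (Y y)) =
      (fun y ↦ g.inner y (X y) (Y y)) + (fun y ↦ g.inner y (X' y) (Y y)) := by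
  ext y; simp

lemma inner_add_fun' (g : RMetric m M) (X Y Y' : Π x : M, TangentSpace (𝓡 m) x) :
    (fun y ↦ g.inner y (X y) ((Y + Y') y)) =
      (fun y ↦ g.inner y (X y) (Y y)) + (fun y ↦ g.inner y (X y) (Y' y)) := by
  ext y; simp

lemma koszul_tensorial_left (g : RMetric m M) {Y Z : Π x : M, TangentSpace (𝓡 m) x} {x : M}
    (hY : DiffFieldAt Y x) (hZ : DiffFieldAt Z x) :
    TensorialAt (𝓡 m) (Eu m) (fun X ↦ koszul g X Y Z x) x where
  smul {f X} hf hX := by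
    simp only [koszul, inner_smul_fun]
    rw [mvfderiv_mul hf (mdiff_inner g hX hZ), mvfderiv_mul hf (mdiff_inner g hX hY),
      mlieBracket_smul_left hf hX, mlieBracket_smul_left hf hX]
    simp
    ring
  add {X X'} hX hX' := by
    simp only [koszul, inner_add_fun]
    rw [mvfderiv_add (mdiff_inner g hX hZ) (mdiff_inner g hX' hZ),
      mvfderiv_add (mdiff_inner g hX hY) (mdiff_inner g hX' hY),
      mlieBracket_add_left hX hX', mlieBracket_add_left hX hX']
    simp
    ring

lemma koszul_tensorial_right (g : RMetric m M) {X Y : Π x : M, TangentSpace (𝓡 m) x} {x : M}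
    (hX : DiffFieldAt X x) (hY : DiffFieldAt Y x) :
    TensorialAt (𝓡 m) (Eu m) (fun Z ↦ koszul g X Y Z x) x where
  smul {f Z} hf hZ := by
    simp only [koszul, inner_smul_fun']
    rw [mvfderiv_mul hf (mdiff_inner g hX hZ), mvfderiv_mul hf (mdiff_inner g hY hZ),
      mlieBracket_smul_right hf hZ, mlieBracket_smul_right hf hZ]
    simp [g.symm x (Z x)]
    ring
  add {Z Z'} hZ hZ' := by
    simp only [koszul, inner_add_fun']
    rw [mvfderiv_add (mdiff_inner g hX hZ) (mdiff_inner g hX hZ'),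
      mvfderiv_add (mdiff_inner g hY hZ) (mdiff_inner g hY hZ'),
      mlieBracket_add_right hZ hZ', mlieBracket_add_right hZ hZ']
    simp
    ring

lemma koszul_add (g : RMetric m M) {X Y Y' Z : Π x : M, TangentSpace (𝓡 m) x} {x : M}
    (hX : DiffFieldAt X x) (hY : DiffFieldAt Y x) (hY' : DiffFieldAt Y' x)
    (hZ : DiffFieldAt Z x) :
    koszul g X (Y + Y') Z x = koszul g X Y Z x + koszul g X Y' Z x := by
  simp only [koszul, inner_add_fun, inner_add_fun']
  rw [mvfderiv_add (mdiff_inner g hY hZ) (mdiff_inner g hY' hZ),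
    mvfderiv_add (mdiff_inner g hX hY) (mdiff_inner g hX hY'),
    mlieBracket_add_right hY hY', mlieBracket_add_left hY hY']
  simp
  ring

lemma koszul_smul (g : RMetric m M) {X Y Z : Π x : M, TangentSpace (𝓡 m) x} {f : M → ℝ} {x : M}
    (hf : MDifferentiableAt (𝓡 m) 𝓘(ℝ) f x)
    (hX : DiffFieldAt X x) (hY : DiffFieldAt Y x) (hZ : DiffFieldAt Z x) :
    koszul g X (f • Y) Z x =
      f x * koszul g X Y Z x + 2 * (mvfderiv (𝓡 m) f x (X x) * g.inner x (Y x) (Z x)) := by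
  simp only [koszul, inner_smul_fun, inner_smul_fun']
  rw [mvfderiv_mul hf (mdiff_inner g hY hZ), mvfderiv_mul hf (mdiff_inner g hX hY),
    mlieBracket_smul_right hf hY, mlieBracket_smul_left hf hY]
  simp [g.symm x (Y x) (X x)]
  ring

lemma fieldAt_extend {x : M} (v : TangentSpace (𝓡 m) x) :
    DiffFieldAt (FiberBundle.extend (Eu m) v) x :=
  FiberBundle.mdifferentiableAt_extend (𝓡 m) (Eu m) v

instance (x : M) : FiniteDimensional ℝ (TangentSpace (𝓡 m) x) :=
  inferInstanceAs (FiniteDimensional ℝ (Eu m))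

instance (x : M) : T2Space (TangentSpace (𝓡 m) x) :=
  inferInstanceAs (T2Space (Eu m))

/-- The metric at `x` as a bilinear form. -/
def metricForm (g : RMetric m M) (x : M) : LinearMap.BilinForm ℝ (TangentSpace (𝓡 m) x) :=
  (ContinuousLinearMap.coeLM ℝ).comp (g.inner x).toLinearMap

lemma metricForm_nondegenerate (g : RMetric m M) (x : M) : (metricForm g x).Nondegenerate := by
  refine ⟨fun v hv ↦ ?_, fun v hv ↦ ?_⟩ <;> by_contra h <;>
    exact (g.pos x v h).ne' (hv v)

open Classical in
/-- The covariant derivative `v ↦ ∇_v Y` at `x` of a vector field `Y` (differentiable at `x`),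
defined by the Koszul formula `2 g(∇_X Y, Z) = koszul X Y Z`. -/
def lcDeriv (g : RMetric m M) (Y : Π x : M, TangentSpace (𝓡 m) x) (x : M) :
    TangentSpace (𝓡 m) x →L[ℝ] TangentSpace (𝓡 m) x :=
  if hY : DiffFieldAt Y x then
    LinearMap.toContinuousLinearMap
      (((metricForm g x).toDual (metricForm_nondegenerate g x)).symm.toLinearMap ∘ₗ
        ContinuousLinearMap.coeLM ℝ ∘ₗ
        ((1 / 2 : ℝ) • TensorialAt.mkHom₂ (fun X Z ↦ koszul g X Y Z x) x
          (fun _ hZ ↦ koszul_tensorial_left g hY hZ)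
          (fun _ hX ↦ koszul_tensorial_right g hX hY)).toLinearMap)
  else 0

lemma inner_lcDeriv (g : RMetric m M) {X Y Z : Π x : M, TangentSpace (𝓡 m) x} {x : M}
    (hX : DiffFieldAt X x) (hY : DiffFieldAt Y x) (hZ : DiffFieldAt Z x) :
    g.inner x (lcDeriv g Y x (X x)) (Z x) = 1 / 2 * koszul g X Y Z x := by
  have h := LinearMap.BilinForm.apply_toDual_symm_apply (hB := metricForm_nondegenerate g x)
    (f := ContinuousLinearMap.coeLM ℝ (((1 / 2 : ℝ) • TensorialAt.mkHom₂
          (fun X Z ↦ koszul g X Y Z x) x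
          (fun _ hZ ↦ koszul_tensorial_left g hY hZ)
          (fun _ hX ↦ koszul_tensorial_right g hX hY)) (X x))) (Z x)
  have h2 := TensorialAt.mkHom₂_apply (Φ := fun X Z ↦ koszul g X Y Z x)
    (fun _ hZ ↦ koszul_tensorial_left g hY hZ)
    (fun _ hX ↦ koszul_tensorial_right g hX hY) hX hZ
  rw [lcDeriv, dif_pos hY]
  refine Eq.trans ?_ (h.trans ?_)
  · rfl
  · rw [← h2]; rfl

lemma metric_ext (g : RMetric m M) {x : M} {v w : TangentSpace (𝓡 m) x}
    (h : ∀ z, g.inner x v z = g.inner x w z) : v = w := by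
  by_contra hne
  have := g.pos x (v - w) (sub_ne_zero.2 hne)
  simp [h] at this

/-- The Levi-Civita connection of a Riemannian metric. -/
def leviCivita (g : RMetric m M) :
    CovariantDerivative (𝓡 m) (Eu m) (fun x : M ↦ TangentSpace (𝓡 m) x) where
  toFun := lcDeriv g
  isCovariantDerivativeOnUniv :=
    { add := by
        intro Y Y' x hY hY' _
        ext1 v
        refine metric_ext g fun z ↦ ?_
        have hv := fieldAt_extend v
        have hz := fieldAt_extend z
        have hs : DiffFieldAt (Y + Y') x := mdifferentiableAt_add_section hY hY'
        have h := inner_lcDeriv g hv hs hz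
        have h1 := inner_lcDeriv g hv hY hz
        have h2 := inner_lcDeriv g hv hY' hz
        simp only [FiberBundle.extend_apply_self] at h h1 h2
        rw [h, koszul_add g hv hY hY' hz]
        simp [h1, h2]
        ring
      leibniz := by
        intro Y f x hY hf _
        ext1 v
        refine metric_ext g fun z ↦ ?_
        have hv := fieldAt_extend v
        have hz := fieldAt_extend z
        have hs : DiffFieldAt (f • Y) x := hf.smul_section hY
        have h := inner_lcDeriv g hv hs hz
        have h1 := inner_lcDeriv g hv hY hz
        simp only [FiberBundle.extend_apply_self] at h h1
        rw [h, koszul_smul g hf hv hY hz]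
        simp [h1]
        ring }

/-- The Levi-Civita connection is torsion free. -/
lemma leviCivita_torsion (g : RMetric m M) : (leviCivita g).torsion = 0 := by
  rw [CovariantDerivative.torsion_eq_zero_iff]
  intro X Y x hX hY
  refine metric_ext g fun z ↦ ?_
  have hz := fieldAt_extend z
  have h1 := inner_lcDeriv g hX hY hz
  have h2 := inner_lcDeriv g hY hX hz
  simp only [FiberBundle.extend_apply_self] at h1 h2
  change g.inner x (lcDeriv g Y x (X x) - lcDeriv g X x (Y x)) z = _
  rw [map_sub, sub_apply, h1, h2]
  have e : (fun y ↦ g.inner y (Y y) (X y)) = (fun y ↦ g.inner y (X y) (Y y)) := by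
    ext y; exact g.symm y _ _
  simp only [koszul, e]
  rw [mlieBracket_swap_apply (V := Y) (W := X)]
  simp
  ring

/-- The Levi-Civita connection is compatible with the metric. -/
lemma leviCivita_metric (g : RMetric m M) {X Y Z : Π x : M, TangentSpace (𝓡 m) x} {x : M}
    (hX : DiffFieldAt X x) (hY : DiffFieldAt Y x) (hZ : DiffFieldAt Z x) :
    mvfderiv (𝓡 m) (fun y ↦ g.inner y (Y y) (Z y)) x (X x) =
      g.inner x (leviCivita g Y x (X x)) (Z x) + g.inner x (Y x) (leviCivita g Z x (X x)) := by
  have h1 := inner_lcDeriv g hX hY hZ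
  have h2 := inner_lcDeriv g hX hZ hY
  rw [g.symm x (Y x)]
  change _ = g.inner x (lcDeriv g Y x (X x)) (Z x) + g.inner x (lcDeriv g Z x (X x)) (Y x)
  rw [h1, h2]
  have e : (fun y ↦ g.inner y (Z y) (Y y)) = (fun y ↦ g.inner y (Y y) (Z y)) := by
    ext y; exact g.symm y _ _
  simp only [koszul, e]
  rw [mlieBracket_swap_apply (V := Z) (W := Y)]
  simp
  ring

/-- The curvature `R(X,Y)Z = ∇_X ∇_Y Z - ∇_Y ∇_X Z - ∇_[X,Y] Z` of the Levi-Civita connection. -/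
def curvature (g : RMetric m M) (X Y Z : Π x : M, TangentSpace (𝓡 m) x) :
    Π x : M, TangentSpace (𝓡 m) x :=
  fun x ↦ leviCivita g (fun y ↦ leviCivita g Z y (Y y)) x (X x)
    - leviCivita g (fun y ↦ leviCivita g Z y (X y)) x (Y x)
    - leviCivita g Z x (mlieBracket (𝓡 m) X Y x)

/-- The trace of an endomorphism (given as a bare function) of a finite dimensional space. -/
def traceOf {V : Type*} [AddCommGroup V] [Module ℝ V] [FiniteDimensional ℝ V] (A : V → V) : ℝ :=
  ∑ i, (Module.finBasis ℝ V).coord i (A (Module.finBasis ℝ V i))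

lemma traceOf_linear {V : Type*} [AddCommGroup V] [Module ℝ V] [FiniteDimensional ℝ V]
    (A : V →ₗ[ℝ] V) : traceOf A = LinearMap.trace ℝ V A := by
  rw [LinearMap.trace_eq_matrix_trace ℝ (Module.finBasis ℝ V)]
  simp [traceOf, Matrix.trace, LinearMap.toMatrix_apply]

/-- The Ricci tensor `Ric(v,w) = tr (u ↦ R(u,v)w)`. The curvature is tensorial, so it may be
computed with any extensions of the vectors to vector fields. -/
def ricci (g : RMetric m M) (x : M) (v w : TangentSpace (𝓡 m) x) : ℝ :=
  traceOf fun u : TangentSpace (𝓡 m) x ↦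
    curvature g (FiberBundle.extend (Eu m) u) (FiberBundle.extend (Eu m) v)
      (FiberBundle.extend (Eu m) w) x

end Metric

section Kahler

/-- A Kähler structure on a manifold `M` of real dimension `2n`: a Riemannian metric `g` and an
orthogonal almost complex structure `J` which is integrable (its Nijenhuis tensor vanishes), such
that the form `ω = g(J·,·)` is closed. -/
structure KahlerStructure (n : ℕ) (M : Type*) [TopologicalSpace M]
    [ChartedSpace (Eu (2 * n)) M] [IsManifold (𝓡 (2 * n)) ∞ M] where
  /-- The metric. -/
  g : RMetric (2 * n) M
  /-- The almost complex structure. -/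
  J : Π x : M, TangentSpace (𝓡 (2 * n)) x →L[ℝ] TangentSpace (𝓡 (2 * n)) x
  smooth_J : ContMDiff (𝓡 (2 * n)) ((𝓡 (2 * n)).prod 𝓘(ℝ, Eu (2 * n) →L[ℝ] Eu (2 * n))) ∞
    (fun x ↦ TotalSpace.mk' (Eu (2 * n) →L[ℝ] Eu (2 * n))
      (E := fun x : M ↦ TangentSpace (𝓡 (2 * n)) x →L[ℝ] TangentSpace (𝓡 (2 * n)) x) x (J x))
  J_sq : ∀ x v, J x (J x v) = -v
  J_orthogonal : ∀ x v w, g.inner x (J x v) (J x w) = g.inner x v w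
  integrable : ∀ X Y : Π x : M, TangentSpace (𝓡 (2 * n)) x, SmoothField X → SmoothField Y →
    ∀ x, mlieBracket (𝓡 (2 * n)) (fun y ↦ J y (X y)) (fun y ↦ J y (Y y)) x
      - J x (mlieBracket (𝓡 (2 * n)) (fun y ↦ J y (X y)) Y x)
      - J x (mlieBracket (𝓡 (2 * n)) X (fun y ↦ J y (Y y)) x)
      - mlieBracket (𝓡 (2 * n)) X Y x = 0
  closed : ∀ X Y Z : Π x : M, TangentSpace (𝓡 (2 * n)) x,
    SmoothField X → SmoothField Y → SmoothField Z →
    ∀ x, mvfderiv (𝓡 (2 * n)) (fun y ↦ g.inner y (J y (Y y)) (Z y)) x (X x)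
      + mvfderiv (𝓡 (2 * n)) (fun y ↦ g.inner y (J y (Z y)) (X y)) x (Y x)
      + mvfderiv (𝓡 (2 * n)) (fun y ↦ g.inner y (J y (X y)) (Y y)) x (Z x)
      - g.inner x (J x (mlieBracket (𝓡 (2 * n)) X Y x)) (Z x)
      - g.inner x (J x (mlieBracket (𝓡 (2 * n)) Y Z x)) (X x)
      - g.inner x (J x (mlieBracket (𝓡 (2 * n)) Z X x)) (Y x) = 0

variable {n : ℕ} {M : Type*} [TopologicalSpace M] [ChartedSpace (Eu (2 * n)) M]
  [IsManifold (𝓡 (2 * n)) ∞ M]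

namespace KahlerStructure

variable (K : KahlerStructure n M)

/-- The Kähler form `ω = g(J·,·)`. -/
def omega (x : M) (v w : TangentSpace (𝓡 (2 * n)) x) : ℝ := K.g.inner x (K.J x v) w

/-- The Hermitian metric `h = g - iω`. -/
def herm (x : M) (v w : TangentSpace (𝓡 (2 * n)) x) : ℂ :=
  (K.g.inner x v w : ℂ) - Complex.I * (K.omega x v w : ℂ)

/-- The Ricci form `ρ̄ = Ric(J·,·)`. -/
def ricciForm (x : M) (v w : TangentSpace (𝓡 (2 * n)) x) : ℝ := ricci K.g x (K.J x v) w

/-- `Ric = c g` on all of `M`; the scalar curvature is then the constant `2nc`. -/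
def IsEinstein (c : ℝ) : Prop := ∀ x v w, ricci K.g x v w = c * K.g.inner x v w

/-- The Ricci form is definite: `Ric` or `-Ric` is positive definite at all points. -/
def HasDefiniteRicci : Prop :=
  (∀ x, ∀ v : TangentSpace (𝓡 (2 * n)) x, v ≠ 0 → 0 < ricci K.g x v v) ∨
  (∀ x, ∀ v : TangentSpace (𝓡 (2 * n)) x, v ≠ 0 → ricci K.g x v v < 0)

/-! ### Linear algebra in a tangent space of `M` -/

/-- Complex valued alternating real `n`-linear forms on `T_xM`. -/
abbrev CForm (n : ℕ) {M : Type*} [TopologicalSpace M] [ChartedSpace (Eu (2 * n)) M] (x : M) :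
    Type := TangentSpace (𝓡 (2 * n)) x [⋀^Fin n]→ₗ[ℝ] ℂ

open Classical in
/-- The complex valued forms `v_i^* + i (J v_i)^*`, where `v_1^*, …, v_n^*, (Jv_1)^*, …, (Jv_n)^*`
is the real dual basis of `v_1, …, v_n, Jv_1, …, Jv_n` (and zero if that is not a basis). -/
def dualForm (x : M) (v : Fin n → TangentSpace (𝓡 (2 * n)) x) (i : Fin n) :
    TangentSpace (𝓡 (2 * n)) x →ₗ[ℝ] ℂ :=
  if h : LinearIndependent ℝ (Sum.elim v fun j ↦ K.J x (v j)) ∧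
      ⊤ ≤ Submodule.span ℝ (Set.range (Sum.elim v fun j ↦ K.J x (v j))) then
    Complex.ofRealCLM.toLinearMap ∘ₗ (Module.Basis.mk h.1 h.2).coord (Sum.inl i)
      + (Complex.I • Complex.ofRealCLM.toLinearMap) ∘ₗ
        (Module.Basis.mk h.1 h.2).coord (Sum.inr i)
  else 0

/-- The wedge product `θ_1 ∧ … ∧ θ_n` of complex valued `1`-forms. -/
def wedge {V : Type*} [AddCommGroup V] [Module ℝ V] {n : ℕ} (θ : Fin n → V →ₗ[ℝ] ℂ) :
    V [⋀^Fin n]→ₗ[ℝ] ℂ :=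
  MultilinearMap.alternatization ((MultilinearMap.mkPiAlgebra ℝ (Fin n) ℂ).compLinearMap θ)

lemma wedge_apply {V : Type*} [AddCommGroup V] [Module ℝ V] {n : ℕ} (θ : Fin n → V →ₗ[ℝ] ℂ)
    (w : Fin n → V) :
    wedge θ w = (Matrix.of fun i j ↦ θ i (w j)).det := by
  rw [← Matrix.det_transpose, Matrix.det_apply]
  simp [wedge, MultilinearMap.alternatization_apply]

/-- The norm `|α|_h` of an `(n,0)`-form: the modulus of its value on an `h`-unitary basis (all
unitary bases give the same value), so that `dz_1 ∧ … ∧ dz_n` has norm one. -/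
def formNorm (x : M) (α : CForm n x) : ℝ :=
  sSup {r | ∃ u : Fin n → TangentSpace (𝓡 (2 * n)) x,
    (∀ i j, K.herm x (u i) (u j) = if i = j then 1 else 0) ∧ r = ‖α u‖}

/-- The complex volume form defined by a basis `v` of an oriented totally real plane: the
normalization of `(v_1^* + i(Jv_1)^*) ∧ … ∧ (v_n^* + i(Jv_n)^*)`. -/
def canonicalForm (x : M) (v : Fin n → TangentSpace (𝓡 (2 * n)) x) : CForm n x :=
  (K.formNorm x (wedge (K.dualForm x v)))⁻¹ • wedge (K.dualForm x v)

end KahlerStructure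

/-! ### Immersions of `n`-manifolds -/

variable {L : Type*} [TopologicalSpace L] [ChartedSpace (Eu n) L] [IsManifold (𝓡 n) ∞ L]

/-- An orientation of a manifold: an orientation of each tangent space which is locally constant
when read in the trivializations of the tangent bundle given by the charts. -/
structure ManifoldOrientation (n : ℕ) (L : Type*) [TopologicalSpace L] [ChartedSpace (Eu n) L]
    [IsManifold (𝓡 n) ∞ L] where
  /-- The orientation of the tangent space at a point. -/
  at' : Π p : L, Orientation ℝ (TangentSpace (𝓡 n) p) (Fin n)
  locally_constant : ∀ p : L, ∀ᶠ q in 𝓝 p,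
    ∃ hq : q ∈ (trivializationAt (Eu n) (TangentSpace (𝓡 n)) p).baseSet,
      Orientation.map (Fin n) ((trivializationAt (Eu n) (TangentSpace (𝓡 n)) p
        ).continuousLinearEquivAt ℝ q hq).toLinearEquiv (at' q) =
      Orientation.map (Fin n) ((trivializationAt (Eu n) (TangentSpace (𝓡 n)) p
        ).continuousLinearEquivAt ℝ p
          (FiberBundle.mem_baseSet_trivializationAt (Eu n) (TangentSpace (𝓡 n)) p)).toLinearEquiv
        (at' p)

/-- The differential of `ι : L → M` at `p`. -/
abbrev diffAt (ι : L → M) (p : L) :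
    TangentSpace (𝓡 n) p →L[ℝ] TangentSpace (𝓡 (2 * n)) (ι p) :=
  mfderiv (𝓡 n) (𝓡 (2 * n)) ι p

/-- A smooth immersion. -/
structure IsSmoothImmersion (ι : L → M) : Prop where
  smooth : ContMDiff (𝓡 n) (𝓡 (2 * n)) ∞ ι
  injective : ∀ p, Function.Injective (diffAt (n := n) ι p)

/-- The tangent plane `ι_*(T_pL) ⊆ T_{ι(p)}M`. -/
def tangentPlane (ι : L → M) (p : L) : Submodule ℝ (TangentSpace (𝓡 (2 * n)) (ι p)) :=
  LinearMap.range (diffAt ι p).toLinearMap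

/-- Smoothness of a section of `ι^*TM`. -/
abbrev SmoothAlong (ι : L → M) (Z : Π p : L, TangentSpace (𝓡 (2 * n)) (ι p)) : Prop :=
  ContMDiff (𝓡 n) (𝓡 (2 * n)).tangent ∞ (fun p ↦ (⟨ι p, Z p⟩ : TangentBundle (𝓡 (2 * n)) M))

namespace KahlerStructure

variable (K : KahlerStructure n M)

/-- The plane `J(ι_*(T_pL))`. -/
def jPlane (ι : L → M) (p : L) : Submodule ℝ (TangentSpace (𝓡 (2 * n)) (ι p)) :=
  (tangentPlane ι p).map (K.J (ι p)).toLinearMap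

/-- Totally real immersions. -/
structure IsTotallyReal (ι : L → M) : Prop extends IsSmoothImmersion (n := n) ι where
  disjoint : ∀ p, tangentPlane ι p ⊓ K.jPlane ι p = ⊥

/-- `ι` is Lagrangian for the Kähler form: `ι^*ω = 0`. -/
def IsLagrangian (ι : L → M) : Prop :=
  ∀ p v w, K.omega (ι p) (diffAt ι p v) (diffAt ι p w) = 0

/-- `ι` is Lagrangian for the Ricci form: `ι^*ρ̄ = 0`. -/
def IsRicciLagrangian (ι : L → M) : Prop :=
  ∀ p v w, K.ricciForm (ι p) (diffAt ι p v) (diffAt ι p w) = 0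

open Classical in
/-- The projection `π_J` of `T_{ι(p)}M = ι_*(T_pL) ⊕ J(ι_*(T_pL))` onto the second summand. -/
def piJ (ι : L → M) (p : L) :
    TangentSpace (𝓡 (2 * n)) (ι p) →ₗ[ℝ] TangentSpace (𝓡 (2 * n)) (ι p) :=
  if h : IsCompl (K.jPlane ι p) (tangentPlane ι p) then
    (K.jPlane ι p).projection (tangentPlane ι p) h
  else 0

/-- The pull-back to `ι^*TM` of the Levi-Civita connection: `∇_X Z` at `p`, for a section `Z` of
`ι^*TM`. If `E_1, …, E_2n` is the local frame of `TM` given by the chart at `ι(p)` and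
`Z = ∑ Z^i E_i`, then `∇_X Z = ∑ (dZ^i(X) E_i + Z^i ∇_{ι_*X} E_i)`. -/
def covAlong (ι : L → M) (Z : Π p : L, TangentSpace (𝓡 (2 * n)) (ι p)) (p : L)
    (X : TangentSpace (𝓡 n) p) : TangentSpace (𝓡 (2 * n)) (ι p) :=
  (trivializationAt (Eu (2 * n)) (TangentSpace (𝓡 (2 * n))) (ι p)).symmL ℝ (ι p)
      (mvfderiv (𝓡 n) (fun q ↦ (trivializationAt (Eu (2 * n)) (TangentSpace (𝓡 (2 * n))) (ι p)
        (⟨ι q, Z q⟩ : TangentBundle (𝓡 (2 * n)) M)).2) p X)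
    + leviCivita K.g (FiberBundle.extend (Eu (2 * n)) (Z p)) (ι p) (diffAt ι p X)

/-- The Maslov `1`-form: `ξ_J(X)` is the trace of the endomorphism `v ↦ J π_J ∇_X v` of `T_pL`,
where `T_pL` is identified with `ι_*(T_pL)` and `v` is extended to a local vector field on `L`
(the choice of which is irrelevant). -/
def maslovForm (ι : L → M) (p : L) (X : TangentSpace (𝓡 n) p) : ℝ :=
  traceOf fun v : TangentSpace (𝓡 n) p ↦ Function.invFun (diffAt ι p)
    (K.J (ι p) (K.piJ ι p
      (K.covAlong ι (fun q ↦ diffAt ι q (FiberBundle.extend (Eu n) v q)) p X)))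

open Classical in
/-- The canonical section `Ω_J[ι]` of `ι^*K_M`: at `p` it is the complex volume form defined by a
positive basis of `T_pL`. (It is computed here from one fixed basis, with a sign if this basis is
not positive.) -/
def OmegaJ (o : ManifoldOrientation n L) (ι : L → M) (p : L) : CForm n (ι p) :=
  let b : Module.Basis (Fin n) ℝ (TangentSpace (𝓡 n) p) :=
    (EuclideanSpace.basisFun (Fin n) ℝ).toBasis
  if b.orientation = o.at' p then K.canonicalForm (ι p) (fun i ↦ diffAt ι p (b i))
  else -K.canonicalForm (ι p) (fun i ↦ diffAt ι p (b i))

/-- A section `Ω` of `ι^*K_M` is parallel for the connection induced by the Levi-Civita connection: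
`X(Ω(W_1, …, W_n)) = ∑ Ω(W_1, …, ∇_X W_k, …, W_n)` for all sections `W_k` of `ι^*TM`. -/
def IsParallel (ι : L → M) (Ω : Π p : L, CForm n (ι p)) : Prop :=
  ∀ W : Fin n → Π p : L, TangentSpace (𝓡 (2 * n)) (ι p), (∀ k, SmoothAlong ι (W k)) →
    ∀ p, MDifferentiableAt (𝓡 n) 𝓘(ℝ, ℂ) (fun q ↦ Ω q (fun k ↦ W k q)) p ∧
      ∀ X : TangentSpace (𝓡 n) p,
        mvfderiv (𝓡 n) (fun q ↦ Ω q (fun k ↦ W k q)) p X =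
          ∑ k, Ω p (Function.update (fun j ↦ W j p) k (K.covAlong ι (W k) p X))

end KahlerStructure

/-! ### Integration and the volume functionals -/

section Integration

variable [T2Space L] [CompactSpace L]

/-- A partition of unity subordinate to the charts of `L`. -/
def chartPartition (n : ℕ) (L : Type*) [TopologicalSpace L] [ChartedSpace (Eu n) L]
    [IsManifold (𝓡 n) ∞ L] [T2Space L] [CompactSpace L] :
    SmoothPartitionOfUnity L (𝓡 n) L Set.univ :=
  (SmoothPartitionOfUnity.exists_isSubordinate_chartAt_source (𝓡 n) L).choose

/-- The coordinate frame `∂_1, …, ∂_n` of the chart at `c`, at the point with coordinates `y`. -/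
def coordFrame (c : L) (y : Eu n) (i : Fin n) :
    TangentSpace (𝓡 n) ((chartAt (Eu n) c).symm y) :=
  mfderiv (𝓡 n) (𝓡 n) (chartAt (Eu n) c).symm y (EuclideanSpace.single i (1 : ℝ))

/-- The integral over `L` of a density `D`, which is given by its values on frames. -/
def integralDensity (D : Π p : L, (Fin n → TangentSpace (𝓡 n) p) → ℝ) : ℝ :=
  ∑ᶠ c : L, ∫ y in (chartAt (Eu n) c).target,
    chartPartition n L c ((chartAt (Eu n) c).symm y) *
      D ((chartAt (Eu n) c).symm y) (coordFrame c y)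

namespace KahlerStructure

variable (K : KahlerStructure n M)

/-- The density of the Riemannian volume `vol_g[ι]` of the metric `ι^*g`. -/
def volDensity (ι : L → M) (p : L) (v : Fin n → TangentSpace (𝓡 n) p) : ℝ :=
  √(Matrix.of fun i j ↦ K.g.inner (ι p) (diffAt ι p (v i)) (diffAt ι p (v j))).det

/-- The density of the `J`-volume form `vol_J[ι] = ι^*Ω_J[ι]`, which is real and positive on
positive frames. -/
def volJDensity (o : ManifoldOrientation n L) (ι : L → M) (p : L)
    (v : Fin n → TangentSpace (𝓡 n) p) : ℝ :=
  ‖K.OmegaJ o ι p (fun i ↦ diffAt ι p (v i))‖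

/-- The Riemannian volume functional. -/
def Vol (ι : L → M) : ℝ := integralDensity (K.volDensity ι)

/-- The `J`-volume functional. -/
def VolJ (o : ManifoldOrientation n L) (ι : L → M) : ℝ := integralDensity (K.volJDensity o ι)

end KahlerStructure

/-- A smooth family `F_t : L → M` with `F_0 = ι`. -/
structure IsVariation (ι : L → M) (F : ℝ → L → M) : Prop where
  smooth : ContMDiff (𝓘(ℝ, ℝ).prod (𝓡 n)) (𝓡 (2 * n)) ∞ (fun z : ℝ × L ↦ F z.1 z.2)
  zero : F 0 = ι

/-- The section `Z` of `ι^*TM` is the initial velocity `∂F_t/∂t` at `t = 0` of the variation `F`. -/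
def IsVelocity (ι : L → M) (F : ℝ → L → M) (Z : Π p : L, TangentSpace (𝓡 (2 * n)) (ι p)) : Prop :=
  ∀ p, (⟨ι p, Z p⟩ : TangentBundle (𝓡 (2 * n)) M) =
    ⟨F 0 p, mfderiv 𝓘(ℝ, ℝ) (𝓡 (2 * n)) (fun t : ℝ ↦ F t p) 0 (1 : ℝ)⟩

namespace KahlerStructure

variable (K : KahlerStructure n M)

/-- `ι` is minimal: a critical point of the Riemannian volume among immersions. -/
def IsMinimal (ι : L → M) : Prop :=
  ∀ F : ℝ → L → M, IsVariation (n := n) ι F → (∀ t, IsSmoothImmersion (n := n) (F t)) →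
    HasDerivAt (fun t ↦ K.Vol (F t)) 0 0

/-- `ι` is `J`-minimal: a critical point of the `J`-volume among totally real immersions. -/
def IsJMinimal (o : ManifoldOrientation n L) (ι : L → M) : Prop :=
  ∀ F : ℝ → L → M, IsVariation (n := n) ι F → (∀ t, K.IsTotallyReal (F t)) →
    HasDerivAt (fun t ↦ K.VolJ o (F t)) 0 0

/-- `H` is a `J`-mean curvature field of `ι`, that is (up to the customary sign) a gradient of the
`J`-volume: a smooth section of `J(TL)`, the space of normal directions to the orbit of
reparametrizations, such that `d/dt Vol_J(F_t) = -∫_L g(π_J Z, H) vol_J[ι]` at `t = 0` for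
every variation `F` of `ι` with velocity `Z`. -/
structure IsJMeanCurvature (o : ManifoldOrientation n L) (ι : L → M)
    (H : Π p : L, TangentSpace (𝓡 (2 * n)) (ι p)) : Prop where
  smooth : SmoothAlong ι H
  mem : ∀ p, H p ∈ K.jPlane ι p
  first_variation : ∀ F : ℝ → L → M, IsVariation (n := n) ι F → (∀ t, K.IsTotallyReal (F t)) →
    ∀ Z : Π p : L, TangentSpace (𝓡 (2 * n)) (ι p), IsVelocity (n := n) ι F Z →
      HasDerivAt (fun t ↦ K.VolJ o (F t))
        (-integralDensity fun p v ↦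
          K.g.inner (ι p) (K.piJ ι p (Z p)) (H p) * K.volJDensity o ι p v) 0

/-- The `J`-mean curvature field `H_J[ι]`. -/
def HJ (o : ManifoldOrientation n L) (ι : L → M) : Π p : L, TangentSpace (𝓡 (2 * n)) (ι p) :=
  Classical.epsilon (K.IsJMeanCurvature o ι)

end KahlerStructure

end Integration

end Kahler
end TotRealGeom

end

open TotRealGeom

set_option maxSynthPendingDepth 3
set_option linter.unusedSectionVars false

noncomputable section
namespace TotRealGeom

/-! ### Hermitian linear algebra of a metric with an orthogonal complex structure. -/

section HermPair

open Matrix ComplexConjugate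
open scoped ComplexOrder MatrixOrder

/-! Everything is governed by one complex trace. A basis `v` of a tangent space of `L` is a complex
basis of the tangent space of `M` along `ι`, because `ι` is totally real. As `∇J = 0`, one may write
`∇_X v_k = ∑ τ(X)_{ik} v_i` with a complex matrix `τ(X)`. Tangent vectors have real coordinates in
`v`, and `π_J` keeps the imaginary parts (`piJ_apply`), so `ξ_J = -Im tr τ` (`maslovForm_eq`).

Parallel sections: on vectors `W` the canonical form is the square root of the Hermitian Gram
determinant of `v`, times the determinant of the complex coordinates of `W`. The first factor
contributes `Re tr τ` to the logarithmic derivative and the second `-tr τ`, whence `∇Ω_J = i ξ_J ⊗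
Ω_J` (`mvfderiv_OmegaJ`). As `Ω_J` has no zeros, it is parallel exactly when `ξ_J = 0`.

First variation: the density of `Vol_J` is the root of a Hermitian Gram determinant, whose
logarithmic derivative along a velocity `Z` is the real part of the complex trace of `∇Z`
(`fderiv_dens_volJ`). For `Z = ι_*V + Jι_*W` this is `div V + ξ_J(W)` (`divJ_sub_maslovForm`), and
the divergence theorem leaves `∫ ξ_J(W) vol_J` (`hasDerivAt_VolJ`). So `-Jι_*(ξ_J^♯)` is a `J`-mean
curvature field (`isJMeanCurvature_maslovField`). Testing with cut-off multiples of a field `X` in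
`J(TL)` detects `X` itself (`eq_zero_of_variations`), which gives uniqueness and shows that critical
points are the zeros of the field.

Ricci form: the commutator part of the curvature of `τ` has no trace, so `d(tr τ)` is the complex
trace of the curvature of `M` (`sum_cf_Rc`), and minus its imaginary part is the Ricci form
(`trace_J_curvature`, `trace_J_comp`). Hence `dξ_J = ι^*ρ̄`, and `ξ_J = 0` makes `ι` Lagrangian for
`ρ̄`. In the Einstein case `ρ̄ = cω` with `c ≠ 0`, so `ι` is Lagrangian for `ω`.

Minimality: `Vol_J ≤ Vol`, with equality at Lagrangian immersions (`det_re_le_det_map_re`,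
`VolJ_le_Vol`, `VolJ_eq_Vol`). Along a variation of a Lagrangian the difference has a minimum at
time zero, so both volumes have the same first variation (`first_variation_eq`), and there
`J`-minimal and minimal mean the same.

The computations take place in charts, where the Kähler structure is a `LocalKahler`; that `∇J = 0`
follows from integrability and closedness is `nablaJ_eq_zero`. -/

/-- A Euclidean inner product `g` and an orthogonal complex structure `J` on a real vector space. -/
structure IsHermPair {T : Type*} [AddCommGroup T] [Module ℝ T] (g : T → T → ℝ) (J : T → T) :
    Prop where
  add_left : ∀ u v w, g (u + v) w = g u w + g v w
  smul_left : ∀ (a : ℝ) v w, g (a • v) w = a * g v w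
  symm : ∀ v w, g v w = g w v
  pos : ∀ v, v ≠ 0 → 0 < g v v
  J_add : ∀ v w, J (v + w) = J v + J w
  J_smul : ∀ (a : ℝ) v, J (a • v) = a • J v
  J_sq : ∀ v, J (J v) = -v
  J_orth : ∀ v w, g (J v) (J w) = g v w

variable {T : Type*} [AddCommGroup T] [Module ℝ T] {n : ℕ}

/-- The Hermitian form `g - i g(J·,·)`. -/
def hform (g : T → T → ℝ) (J : T → T) (u v : T) : ℂ :=
  (g u v : ℂ) - Complex.I * (g (J u) v : ℂ)

/-- Multiplication by complex numbers, defined by the complex structure `J`. -/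
def csmul (J : T → T) (c : ℂ) (w : T) : T := c.re • w + c.im • J w

/-- The complex linear combination `∑ c_k v_k`. -/
def combo (J : T → T) (c : Fin n → ℂ) (v : Fin n → T) : T := ∑ k, csmul J (c k) (v k)

/-- The Gram matrix of a family of vectors for the Hermitian form. -/
def gram (g : T → T → ℝ) (J : T → T) (v : Fin n → T) : Matrix (Fin n) (Fin n) ℂ :=
  of fun i j ↦ hform g J (v i) (v j)

/-- The complex coordinates of `w` in the complex frame `v`. -/
def coef (g : T → T → ℝ) (J : T → T) (v : Fin n → T) (w : T) : Fin n → ℂ :=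
  (fun j ↦ hform g J w (v j)) ᵥ* (gram g J v)⁻¹

/-- The vectors `v_1, …, v_n, Jv_1, …, Jv_n` are linearly independent over `ℝ`. -/
def IsTRFrame (J : T → T) (v : Fin n → T) : Prop :=
  LinearIndependent ℝ (Sum.elim v fun j ↦ J (v j))

namespace IsHermPair

variable {g : T → T → ℝ} {J : T → T} (h : IsHermPair g J)
include h

lemma smul_right (a : ℝ) (v w : T) : g v (a • w) = a * g v w := by
  rw [h.symm, h.smul_left, h.symm w]

lemma J_right (v w : T) : g v (J w) = -g (J v) w := by
  have h1 := h.J_orth v (J w)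
  rw [h.J_sq, ← neg_one_smul ℝ w, h.smul_right] at h1
  linarith

lemma hform_add_left (u v w : T) : hform g J (u + v) w = hform g J u w + hform g J v w := by
  simp only [hform, h.J_add, h.add_left]; push_cast; ring

lemma hform_smul_left (a : ℝ) (u w : T) : hform g J (a • u) w = a * hform g J u w := by
  simp only [hform, h.J_smul, h.smul_left]; push_cast; ring

/-- This fixes the convention: the form is complex linear in the first slot, and by `hform_conj`
conjugate linear in the second. -/
lemma hform_J_left (u w : T) : hform g J (J u) w = Complex.I * hform g J u w := by
  simp only [hform, h.J_sq]
  rw [← neg_one_smul ℝ u, h.smul_left]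
  push_cast
  linear_combination (g (J u) w : ℂ) * Complex.I_mul_I

lemma hform_csmul_left (c : ℂ) (u w : T) : hform g J (csmul J c u) w = c * hform g J u w := by
  rw [csmul, h.hform_add_left, h.hform_smul_left, h.hform_smul_left, h.hform_J_left]
  conv_rhs => rw [← Complex.re_add_im c]
  ring

lemma hform_conj (u w : T) : conj (hform g J u w) = hform g J w u := by
  have h1 := h.J_right u w
  rw [h.symm] at h1
  simp only [hform, map_sub, map_mul, Complex.conj_I, Complex.conj_ofReal]
  rw [h.symm w u, h1]
  push_cast; ring

lemma hform_self (u : T) : hform g J u u = (g u u : ℂ) := by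
  have h1 := h.J_right u u
  rw [h.symm] at h1
  have : g (J u) u = 0 := by linarith
  simp [hform, this]

lemma hform_zero_left (w : T) : hform g J 0 w = 0 := by
  simpa using h.hform_smul_left 0 0 w

lemma hform_combo_left (c : Fin n → ℂ) (v : Fin n → T) (w : T) :
    hform g J (combo J c v) w = ∑ k, c k * hform g J (v k) w := by
  have : ∀ s : Finset (Fin n), hform g J (∑ k ∈ s, csmul J (c k) (v k)) w =
      ∑ k ∈ s, c k * hform g J (v k) w := by
    intro s
    induction s using Finset.induction_on with
    | empty => simp [h.hform_zero_left]
    | insert a s ha ih => rw [Finset.sum_insert ha, Finset.sum_insert ha, h.hform_add_left, ih,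
        h.hform_csmul_left]
  exact this _

lemma hform_combo_right (c : Fin n → ℂ) (v : Fin n → T) (w : T) :
    hform g J w (combo J c v) = ∑ k, conj (c k) * hform g J w (v k) := by
  rw [← h.hform_conj, h.hform_combo_left, map_sum]
  simp [h.hform_conj]

omit h in
-- A complex relation among the `v_k` is a real relation among the `v_k` and `Jv_k`, with the real
-- and imaginary parts as coefficients.
lemma combo_eq_zero {v : Fin n → T} (hv : IsTRFrame J v) {c : Fin n → ℂ}
    (hc : combo J c v = 0) : c = 0 := by
  have := Fintype.linearIndependent_iff.1 hv (Sum.elim (fun k ↦ (c k).re) fun k ↦ (c k).im) (by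
    simpa [combo, csmul, Finset.sum_add_distrib] using hc)
  ext k
  exact Complex.ext (this (Sum.inl k)) (this (Sum.inr k))

lemma gram_isHermitian (v : Fin n → T) : (gram g J v).IsHermitian := by
  ext i j
  simp [gram, conjTranspose_apply, h.hform_conj]

lemma gram_quadratic (c : Fin n → ℂ) (v : Fin n → T) :
    c ⬝ᵥ (gram g J v *ᵥ star c) = (g (combo J c v) (combo J c v) : ℂ) := by
  rw [← h.hform_self, h.hform_combo_left]
  simp only [h.hform_combo_right, dotProduct, mulVec, gram, of_apply, Pi.star_apply]
  refine Finset.sum_congr rfl fun i _ ↦ ?_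
  congr 1
  exact Finset.sum_congr rfl fun j _ ↦ mul_comm _ _

lemma gram_posDef {v : Fin n → T} (hv : IsTRFrame J v) : (gram g J v).PosDef := by
  refine Matrix.PosDef.of_dotProduct_mulVec_pos (h.gram_isHermitian v) fun x hx ↦ ?_
  have h1 := h.gram_quadratic (star x) v
  rw [star_star] at h1
  rw [h1]
  have h2 : combo J (star x) v ≠ 0 := fun h0 ↦ hx (star_eq_zero.1 (combo_eq_zero hv h0))
  exact_mod_cast h.pos _ h2

lemma gram_det_pos {v : Fin n → T} (hv : IsTRFrame J v) : 0 < (gram g J v).det :=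
  (h.gram_posDef hv).det_pos

/-- Total reality becomes the nonvanishing of a determinant, which is the source of all openness
statements below. A real relation among `v_k, Jv_k` assembles to a complex row vector killed by the
Gram matrix. -/
lemma isTRFrame_iff (v : Fin n → T) : IsTRFrame J v ↔ (gram g J v).det ≠ 0 := by
  refine ⟨fun hv ↦ (h.gram_det_pos hv).ne', fun hd ↦ ?_⟩
  refine Fintype.linearIndependent_iff.2 fun a ha ↦ ?_
  set c : Fin n → ℂ := fun k ↦ ⟨a (Sum.inl k), a (Sum.inr k)⟩ with hc
  have h0 : combo J c v = 0 := by
    simpa [combo, csmul, Finset.sum_add_distrib, hc] using ha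
  have h1 : c ᵥ* gram g J v = 0 := by
    ext j
    have := h.hform_combo_left c v (v j)
    rw [h0, h.hform_zero_left] at this
    simpa [vecMul, dotProduct, gram] using this.symm
  have h2 : c = 0 := Matrix.eq_zero_of_vecMul_eq_zero hd h1
  intro i
  rcases i with i | i
  · exact congrArg Complex.re (congrFun h2 i)
  · exact congrArg Complex.im (congrFun h2 i)

lemma gram_det_real (v : Fin n → T) : ((gram g J v).det.re : ℂ) = (gram g J v).det := by
  have h1 : star (gram g J v).det = (gram g J v).det := by
    rw [← det_conjTranspose, h.gram_isHermitian v]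
  exact Complex.conj_eq_iff_re.1 h1

lemma gram_det_re_pos {v : Fin n → T} (hv : IsTRFrame J v) : 0 < (gram g J v).det.re :=
  (Complex.lt_def.1 (h.gram_det_pos hv)).1

lemma coef_combo {v : Fin n → T} (hv : IsTRFrame J v) (c : Fin n → ℂ) :
    coef g J v (combo J c v) = c := by
  have h1 : (fun j ↦ hform g J (combo J c v) (v j)) = c ᵥ* gram g J v := by
    ext j
    simp [h.hform_combo_left, vecMul, dotProduct, gram]
  rw [coef, h1, vecMul_vecMul, mul_nonsing_inv _ (isUnit_iff_ne_zero.2 (h.gram_det_pos hv).ne'), vecMul_one]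

omit h in
lemma exists_combo [FiniteDimensional ℝ T] (hT : Module.finrank ℝ T = 2 * n) {v : Fin n → T}
    (hv : IsTRFrame J v) (w : T) : ∃ c, combo J c v = w := by
  have hs : Submodule.span ℝ (Set.range (Sum.elim v fun j ↦ J (v j))) = ⊤ :=
    hv.span_eq_top_of_card_eq_finrank' (by simp [hT]; ring)
  have hw : w ∈ Submodule.span ℝ (Set.range (Sum.elim v fun j ↦ J (v j))) := hs ▸ trivial
  obtain ⟨a, ha⟩ := (Submodule.mem_span_range_iff_exists_fun ℝ).1 hw
  refine ⟨fun k ↦ ⟨a (Sum.inl k), a (Sum.inr k)⟩, ?_⟩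
  simpa [combo, csmul, Finset.sum_add_distrib] using ha

lemma combo_coef [FiniteDimensional ℝ T] (hT : Module.finrank ℝ T = 2 * n) {v : Fin n → T}
    (hv : IsTRFrame J v) (w : T) : combo J (coef g J v w) v = w := by
  obtain ⟨c, rfl⟩ := exists_combo hT hv w
  rw [h.coef_combo hv]

lemma coef_add (v : Fin n → T) (w w' : T) :
    coef g J v (w + w') = coef g J v w + coef g J v w' := by
  rw [coef, coef, coef, ← add_vecMul]
  congr 1
  ext j; exact h.hform_add_left _ _ _

lemma coef_csmul (v : Fin n → T) (c : ℂ) (w : T) :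
    coef g J v (csmul J c w) = c • coef g J v w := by
  rw [coef, coef, ← smul_vecMul]
  congr 1
  ext j; simp [h.hform_csmul_left]

lemma coef_smul (v : Fin n → T) (a : ℝ) (w : T) :
    coef g J v (a • w) = (a : ℂ) • coef g J v w := by
  rw [← h.coef_csmul]; simp [csmul]

lemma coef_J (v : Fin n → T) (w : T) :
    coef g J v (J w) = Complex.I • coef g J v w := by
  rw [← h.coef_csmul]; simp [csmul]

omit h in
lemma combo_real (a : Fin n → ℝ) (v : Fin n → T) :
    combo J (fun k ↦ (a k : ℂ)) v = ∑ k, a k • v k := by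
  simp [combo, csmul]

/-- The complex coordinates as a real linear map. -/
def coefLin (v : Fin n → T) : T →ₗ[ℝ] (Fin n → ℂ) where
  toFun := coef g J v
  map_add' := h.coef_add v
  map_smul' a w := by
    rw [h.coef_smul]; ext; simp

/-- A frame in which the Hermitian form is standard, obtained from any frame. -/
lemma exists_unitary {v : Fin n → T} (hv : IsTRFrame J v) :
    ∃ u : Fin n → T, gram g J u = 1 := by
  obtain ⟨B, hG⟩ := CStarAlgebra.nonneg_iff_eq_star_mul_self.1 (h.gram_posDef hv).posSemidef.nonneg
  rw [star_eq_conjTranspose] at hG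
  have hB' : IsUnit B.det := by
    have := (h.gram_det_pos hv).ne'
    rw [hG, det_mul] at this
    exact isUnit_iff_ne_zero.2 (right_ne_zero_of_mul this)
  -- Under a change of frame `C` the Gram matrix becomes `C G Cᴴ`. With `G = BᴴB`, the choice `C =
  -- (B⁻¹)ᴴ` makes it the identity.
  refine ⟨fun a ↦ combo J (fun k ↦ star (B⁻¹ k a)) v, ?_⟩
  have : gram g J (fun a ↦ combo J (fun k ↦ star (B⁻¹ k a)) v) = (B⁻¹)ᴴ * gram g J v * B⁻¹ := by
    ext a b
    simp only [gram, of_apply, h.hform_combo_left, h.hform_combo_right, Matrix.mul_apply,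
      conjTranspose_apply, Finset.sum_mul, Finset.mul_sum]
    rw [Finset.sum_comm]
    refine Finset.sum_congr rfl fun i _ ↦ Finset.sum_congr rfl fun j _ ↦ ?_
    simp; ring
  rw [this, hG, conjTranspose_nonsing_inv]
  have h1 : (Bᴴ)⁻¹ * Bᴴ = 1 := nonsing_inv_mul _ (by
    rw [det_conjTranspose]; exact hB'.star)
  have h2 : B * B⁻¹ = 1 := mul_nonsing_inv _ hB'
  calc (Bᴴ)⁻¹ * (Bᴴ * B) * B⁻¹ = ((Bᴴ)⁻¹ * Bᴴ) * (B * B⁻¹) := by simp only [Matrix.mul_assoc]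
    _ = 1 := by rw [h1, h2, Matrix.one_mul]

/-- Change of frame: if `w_j = ∑ c_{jk} v_k` then `gram w = C gram v Cᴴ`. -/
lemma gram_combo (C : Matrix (Fin n) (Fin n) ℂ) (v : Fin n → T) :
    gram g J (fun j ↦ combo J (C j) v) = C * gram g J v * Cᴴ := by
  ext a b
  simp only [gram, of_apply, h.hform_combo_left, h.hform_combo_right, Matrix.mul_apply,
    conjTranspose_apply, Finset.sum_mul, Finset.mul_sum]
  rw [Finset.sum_comm]
  refine Finset.sum_congr rfl fun i _ ↦ Finset.sum_congr rfl fun j _ ↦ ?_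
  simp; ring

lemma det_gram_combo (C : Matrix (Fin n) (Fin n) ℂ) (v : Fin n → T) :
    (gram g J (fun j ↦ combo J (C j) v)).det.re = ‖C.det‖ ^ 2 * (gram g J v).det.re := by
  have : (gram g J (fun j ↦ combo J (C j) v)).det = ((‖C.det‖ ^ 2 : ℝ) : ℂ) * (gram g J v).det := by
    rw [h.gram_combo, det_mul, det_mul, det_conjTranspose]
    have := Complex.mul_conj' C.det
    push_cast
    rw [← this]
    simp only [Complex.star_def]; ring
  rw [this, Complex.re_ofReal_mul]

end IsHermPair

/-- This is the arithmetic-geometric mean inequality for the eigenvalues, obtained by multiplying `λ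
≤ exp (λ - 1)` over all of them. -/
lemma det_re_le_one_of_trace {K : Matrix (Fin n) (Fin n) ℂ} (hK : K.PosSemidef)
    (ht : K.trace.re = n) : K.det.re ≤ 1 := by
  have h1 : K.det = ((∏ i, hK.1.eigenvalues i : ℝ) : ℂ) := by
    rw [hK.1.det_eq_prod_eigenvalues]; push_cast; rfl
  have h2 : K.trace = ((∑ i, hK.1.eigenvalues i : ℝ) : ℂ) := by
    rw [hK.1.trace_eq_sum_eigenvalues]; push_cast; rfl
  rw [h2, Complex.ofReal_re] at ht
  rw [h1, Complex.ofReal_re]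
  calc ∏ i, hK.1.eigenvalues i ≤ ∏ i, Real.exp (hK.1.eigenvalues i - 1) :=
        Finset.prod_le_prod (fun i _ ↦ hK.eigenvalues_nonneg i) fun i _ ↦ by
          linarith [Real.add_one_le_exp (hK.1.eigenvalues i - 1)]
    _ = 1 := by rw [← Real.exp_sum]; simp [ht]

lemma map_re_mul_mul (P Q : Matrix (Fin n) (Fin n) ℝ) (H : Matrix (Fin n) (Fin n) ℂ) :
    (P.map Complex.ofReal * H * Q.map Complex.ofReal).map Complex.re =
      P * H.map Complex.re * Q := by
  ext i j
  simp [Matrix.mul_apply]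

/-- The determinant of a positive Hermitian matrix is at most that of its real part. -/
lemma det_re_le_det_map_re {H : Matrix (Fin n) (Fin n) ℂ} (hH : H.PosDef) :
    H.det.re ≤ (H.map Complex.re).det := by
  have hA : (H.map Complex.re).PosDef := by
    refine Matrix.PosDef.of_dotProduct_mulVec_pos ?_ fun x hx ↦ ?_
    · ext i j
      have := congrFun (congrFun hH.1 i) j
      simp only [conjTranspose_apply] at this
      simp [conjTranspose_apply, ← this]
    · have h1 := hH.dotProduct_mulVec_pos (x := fun i ↦ (x i : ℂ)) (fun h0 ↦ hx (by
        ext i; simpa using congrFun h0 i))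
      have h2 := (Complex.lt_def.1 h1).1
      simpa [dotProduct, mulVec] using h2
  -- Conjugation by the real matrix `B⁻¹`, where `Re H = BᴴB`, turns the real part of `H` into the
  -- identity. The trace then has real part `n`, so the conjugated determinant is at most one; both
  -- determinants scale by the same square.
  obtain ⟨B, hG⟩ := CStarAlgebra.nonneg_iff_eq_star_mul_self.1 hA.posSemidef.nonneg
  rw [star_eq_conjTranspose] at hG
  have hB : IsUnit B.det := by
    have := hA.det_pos.ne'
    rw [hG, det_mul] at this
    exact isUnit_iff_ne_zero.2 (right_ne_zero_of_mul this)
  set Q := B⁻¹ with hQ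
  have hBQ : B * Q = 1 := mul_nonsing_inv _ hB
  set C := Q.map Complex.ofReal with hC
  have hCt : Cᴴ = Qᴴ.map Complex.ofReal := by ext i j; simp [hC, conjTranspose_apply]
  have hK : (Cᴴ * H * C).PosSemidef := hH.posSemidef.conjTranspose_mul_mul_same C
  have hre : (Cᴴ * H * C).map Complex.re = 1 := by
    rw [hCt, map_re_mul_mul, hG]
    calc Qᴴ * (Bᴴ * B) * Q = (B * Q)ᴴ * (B * Q) := by
          rw [conjTranspose_mul]; simp only [Matrix.mul_assoc]
      _ = 1 := by simp [hBQ]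
  have htr : (Cᴴ * H * C).trace.re = n := by
    have : (Cᴴ * H * C).trace.re = ((Cᴴ * H * C).map Complex.re).trace := by simp [Matrix.trace]
    rw [this, hre]; simp
  have hle := det_re_le_one_of_trace hK htr
  have hdC : C.det = (Q.det : ℂ) := (RingHom.map_det Complex.ofRealHom Q).symm
  have hdet : (Cᴴ * H * C).det.re = Q.det ^ 2 * H.det.re := by
    rw [det_mul, det_mul, det_conjTranspose, hdC]
    simp; ring
  rw [hdet] at hle
  have hdA : (H.map Complex.re).det = B.det ^ 2 := by
    rw [hG, det_mul, det_conjTranspose]; simp; ring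
  have hone : B.det * Q.det = 1 := by rw [← det_mul, hBQ, det_one]
  rw [hdA]
  have : H.det.re = B.det ^ 2 * (Q.det ^ 2 * H.det.re) := by
    linear_combination -(B.det * Q.det + 1) * H.det.re * hone
  rw [this]
  nlinarith [sq_nonneg B.det]

end HermPair

/-! ### Traces in complex frames and curvature tensors of Kähler type. -/

section RicciAlgebra

namespace IsHermPair

variable {T : Type*} [AddCommGroup T] [Module ℝ T] [FiniteDimensional ℝ T] {n : ℕ}
  {g : T → T → ℝ} {J : T → T} (h : IsHermPair g J)

/-- The real basis `v_1, …, v_n, Jv_1, …, Jv_n` given by a totally real frame. -/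
def frameBasis (hT : Module.finrank ℝ T = 2 * n) {v : Fin n → T} (hv : IsTRFrame J v) :
    Module.Basis (Fin n ⊕ Fin n) ℝ T :=
  basisOfLinearIndependentOfCardEqFinrank' _ hv (by simp [hT]; ring)

lemma frameBasis_apply (hT : Module.finrank ℝ T = 2 * n) {v : Fin n → T} (hv : IsTRFrame J v) :
    ⇑(frameBasis hT hv) = Sum.elim v fun j ↦ J (v j) :=
  coe_basisOfLinearIndependentOfCardEqFinrank' _ _ _

include h

lemma frameBasis_repr (hT : Module.finrank ℝ T = 2 * n) {v : Fin n → T} (hv : IsTRFrame J v)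
    (w : T) : (frameBasis hT hv).equivFun w =
      Sum.elim (fun k ↦ (coef g J v w k).re) fun k ↦ (coef g J v w k).im := by
  rw [← LinearEquiv.eq_symm_apply, Module.Basis.equivFun_symm_apply]
  conv_lhs => rw [← h.combo_coef hT hv w]
  simp [frameBasis_apply, combo, csmul, Finset.sum_add_distrib]

lemma trace_eq_sum_coef (hT : Module.finrank ℝ T = 2 * n) {v : Fin n → T} (hv : IsTRFrame J v)
    (B : T →ₗ[ℝ] T) : LinearMap.trace ℝ T B =
      ∑ k, ((coef g J v (B (v k)) k).re + (coef g J v (B (J (v k))) k).im) := by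
  rw [LinearMap.trace_eq_matrix_trace ℝ (frameBasis hT hv)]
  have key := fun w i ↦ congrFun (h.frameBasis_repr hT hv w) i
  simp only [Module.Basis.equivFun_apply] at key
  simp [Matrix.trace, LinearMap.toMatrix_apply, key, frameBasis_apply, Finset.sum_add_distrib]

/-- The real trace of a complex linear map is twice the real part of its complex trace. -/
lemma trace_comm_J (hT : Module.finrank ℝ T = 2 * n) {v : Fin n → T} (hv : IsTRFrame J v)
    (A : T →ₗ[ℝ] T) (hA : ∀ w, A (J w) = J (A w)) :
    LinearMap.trace ℝ T A = 2 * ∑ k, (coef g J v (A (v k)) k).re := by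
  rw [h.trace_eq_sum_coef hT hv, Finset.mul_sum]
  refine Finset.sum_congr rfl fun k _ ↦ ?_
  rw [hA, h.coef_J]
  simp; ring

/-- Composition with `J` multiplies the complex trace by `i`, so the real trace now sees its
imaginary part. This is how the Ricci form is recognised in the imaginary part of a complex trace.
-/
lemma trace_J_comp (hT : Module.finrank ℝ T = 2 * n) {v : Fin n → T} (hv : IsTRFrame J v)
    (A : T →ₗ[ℝ] T) (hA : ∀ w, A (J w) = J (A w)) (B : T →ₗ[ℝ] T) (hB : ∀ w, B w = J (A w)) :
    LinearMap.trace ℝ T B = -2 * ∑ k, (coef g J v (A (v k)) k).im := by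
  rw [h.trace_comm_J hT hv B (fun w ↦ by rw [hB, hB, hA]), Finset.mul_sum, Finset.mul_sum]
  refine Finset.sum_congr rfl fun k _ ↦ ?_
  rw [hB, h.coef_J]
  simp

/-- In a unitary frame the diagonal entries have real part `g (A u_k) u_k`, which vanishes by
skewness. -/
lemma trace_skew (hT : Module.finrank ℝ T = 2 * n) {v : Fin n → T} (hv : IsTRFrame J v)
    (A : T →ₗ[ℝ] T) (hA : ∀ w, A (J w) = J (A w)) (hs : ∀ w z, g (A w) z = -g w (A z)) :
    LinearMap.trace ℝ T A = 0 := by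
  obtain ⟨u, hu⟩ := h.exists_unitary hv
  have hu' : IsTRFrame J u := (h.isTRFrame_iff u).2 (by rw [hu]; simp)
  rw [h.trace_comm_J hT hu' A hA, Finset.sum_eq_zero, mul_zero]
  intro k _
  have h0 : g (A (u k)) (u k) = 0 := by
    have := hs (u k) (u k)
    rw [h.symm (u k)] at this
    linarith
  simp [coef, hu, hform, h0]

end IsHermPair

variable {E : Type*} [NormedAddCommGroup E] [NormedSpace ℝ E] [FiniteDimensional ℝ E] {n : ℕ}

/-- Algebraic curvature tensors of Kähler type. -/
structure IsKahlerCurvature (g : E → E → ℝ) (J : E → E) (R : E →L[ℝ] E →L[ℝ] E →L[ℝ] E) :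
    Prop where
  anti : ∀ u v w, R u v w = -R v u w
  bianchi : ∀ u v w, R u v w + R v w u + R w u v = 0
  skew : ∀ u v w z, g (R u v w) z = -g w (R u v z)
  comm : ∀ u v w, R u v (J w) = J (R u v w)

/-- The Ricci contraction `tr (u ↦ R(u,v)w)`. -/
def ricContr (R : E →L[ℝ] E →L[ℝ] E →L[ℝ] E) (v w : E) : ℝ :=
  LinearMap.trace ℝ E ((R.flip v).flip w).toLinearMap

namespace IsKahlerCurvature

variable {g : E → E → ℝ} {J : E →L[ℝ] E} {R : E →L[ℝ] E →L[ℝ] E →L[ℝ] E}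
  (hR : IsKahlerCurvature g J R) (h : IsHermPair g J)
include hR h

omit [FiniteDimensional ℝ E] in
-- The classical argument: add four instances of the Bianchi identity and cancel by the skew
-- symmetry in each pair of arguments.
lemma pair_symm (u v w z : E) : g (R u v w) z = g (R w z u) v := by
  have b (a b c d : E) : g (R a b c) d + g (R b c a) d + g (R c a b) d = 0 := by
    have := hR.bianchi a b c
    have h0 : g (R a b c + R b c a + R c a b) d = 0 := by
      rw [this]; simpa using h.smul_left 0 0 d
    rwa [h.add_left, h.add_left] at h0
  have s (a b c d : E) : g (R a b c) d = -g (R a b d) c := by rw [hR.skew, h.symm]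
  have a (a b c d : E) : g (R a b c) d = -g (R b a c) d := by
    rw [hR.anti, ← neg_one_smul ℝ, h.smul_left]; ring
  linarith [b u v w z, b v w z u, b w z u v, b z u v w, s u v w z, s v w u z, s w u v z,
    s v w z u, s w z v u, s z v w u, s w z u v, s z u w v, s u w z v, s z u v w, s u v z w,
    s v z u w, a u v w z, a u v z w, a w z u v, a w z v u, a u w v z, a v z u w, a v w u z,
    a z u w v, a v w z u, a z u v w, a w u v z, a z v w u, a u w z v]

omit [FiniteDimensional ℝ E] in
-- Curvature endomorphisms commute with the isometry `J`, so `J` may be inserted in the last pair of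
-- arguments; pair symmetry carries it to the first pair.
lemma J_J (u v w : E) : R (J u) (J v) w = R u v w := by
  have key : ∀ z, g (R (J u) (J v) w) z = g (R u v w) z := fun z ↦ by
    rw [hR.pair_symm h, hR.comm, h.J_orth, ← hR.pair_symm h]
  by_contra hne
  have := h.pos _ (sub_ne_zero.2 hne)
  rw [sub_eq_add_neg, h.add_left, ← neg_one_smul ℝ (R u v w), h.smul_left, key] at this
  linarith

/-- By `comm` and `J_J` both sides are traces of the same two factors composed in opposite orders.
-/
lemma ricContr_J_J (u v : E) : ricContr R (J u) (J v) = ricContr R u v := by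
  have e1 : ((R.flip (J u)).flip (J v)).toLinearMap =
      J.toLinearMap ∘ₗ ((R.flip (J u)).flip v).toLinearMap := by
    ext z; simp [hR.comm]
  have e2 : ((R.flip u).flip v).toLinearMap =
      ((R.flip (J u)).flip v).toLinearMap ∘ₗ J.toLinearMap := by
    ext z; simp [hR.J_J h]
  rw [ricContr, ricContr, e1, e2, LinearMap.trace_comp_comm']

/-- By Bianchi the antisymmetric part is minus the trace of `R v w`, which is skew and complex
linear. -/
lemma ricContr_symm (hT : Module.finrank ℝ E = 2 * n) {f : Fin n → E} (hf : IsTRFrame J f)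
    (v w : E) : ricContr R v w = ricContr R w v := by
  have e : ((R.flip v).flip w).toLinearMap - ((R.flip w).flip v).toLinearMap =
      -(R v w).toLinearMap := by
    ext z
    have := hR.bianchi z v w
    have h2 := hR.anti z w v
    simp only [LinearMap.sub_apply, ContinuousLinearMap.coe_coe, ContinuousLinearMap.flip_apply,
      LinearMap.neg_apply]
    rw [h2]
    rw [← sub_eq_zero, ← this]; abel
  have h0 : LinearMap.trace ℝ E (R v w).toLinearMap = 0 :=
    h.trace_skew hT hf _ (fun z ↦ hR.comm v w z) (fun a b ↦ hR.skew v w a b)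
  have := congrArg (LinearMap.trace ℝ E) e
  rw [map_sub, map_neg, h0, neg_zero, sub_eq_zero] at this
  exact this

/-- The complex trace of the curvature is the Ricci form. -/
lemma trace_J_curvature (hT : Module.finrank ℝ E = 2 * n) {f : Fin n → E} (hf : IsTRFrame J f)
    (u v : E) :
    LinearMap.trace ℝ E (J.toLinearMap ∘ₗ (R u v).toLinearMap) = 2 * ricContr R (J u) v := by
  -- Bianchi and `R J = J R` give `J R(u,v)z = R(z,v)Ju - R(z,u)Jv`. Symmetry and `J`-invariance of
  -- the contraction make the two resulting traces add up, whence the factor `2`.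
  have e : J.toLinearMap ∘ₗ (R u v).toLinearMap =
      ((R.flip v).flip (J u)).toLinearMap - ((R.flip u).flip (J v)).toLinearMap := by
    ext z
    have h1 := congrArg J (hR.bianchi u v z)
    have h2 := hR.anti v z u
    simp only [LinearMap.sub_apply, ContinuousLinearMap.coe_coe, ContinuousLinearMap.flip_apply,
      LinearMap.comp_apply, hR.comm]
    rw [h2] at h1
    simp only [map_add, map_neg, map_zero] at h1
    rw [← sub_eq_zero, ← h1]; abel
  have h1 := congrArg (LinearMap.trace ℝ E) e
  rw [map_sub] at h1
  rw [h1]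
  change ricContr R v (J u) - ricContr R u (J v) = _
  rw [hR.ricContr_symm h hT hf v (J u), ← hR.ricContr_J_J h u (J v), h.J_sq]
  have : ricContr R (J u) (-v) = -ricContr R (J u) v := by
    have : ((R.flip (J u)).flip (-v)).toLinearMap = -((R.flip (J u)).flip v).toLinearMap := by
      ext z; simp
    rw [ricContr, this, map_neg]; rfl
  rw [this]; ring

end IsKahlerCurvature

end RicciAlgebra

/-! ### The derivative of a determinant. -/

section Determinants

open Matrix

variable {n : ℕ}

lemma hasDerivAt_det {M : ℝ → Matrix (Fin n) (Fin n) ℂ} {M' : Matrix (Fin n) (Fin n) ℂ} {s : ℝ}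
    (hM : ∀ i j, HasDerivAt (fun t ↦ M t i j) (M' i j) s) :
    HasDerivAt (fun t ↦ (M t).det) (∑ i, ((M s).updateCol i fun j ↦ M' j i).det) s := by
  simp only [det_apply]
  have h1 : ∀ σ : Equiv.Perm (Fin n), HasDerivAt (fun t ↦ ∏ i, M t (σ i) i)
      (∑ i, (∏ j ∈ Finset.univ.erase i, M s (σ j) j) • M' (σ i) i) s := fun σ ↦
    HasDerivAt.fun_finsetProd fun i _ ↦ hM (σ i) i
  have h2 := HasDerivAt.fun_sum (u := Finset.univ) fun σ _ ↦
    (h1 σ).const_smul (Equiv.Perm.sign σ)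
  refine h2.congr_deriv ?_
  rw [Finset.sum_comm]
  refine Finset.sum_congr rfl fun σ _ ↦ ?_
  rw [← Finset.smul_sum]
  congr 1
  refine Finset.sum_congr rfl fun i _ ↦ ?_
  rw [← Finset.mul_prod_erase _ _ (Finset.mem_univ i), smul_eq_mul, mul_comm]
  congr 1
  · simp
  · exact Finset.prod_congr rfl fun j hj ↦ by simp [(Finset.mem_erase.1 hj).1]

/-- By Cramer's rule the determinant with column `i` replaced is a diagonal entry of `M.adjugate *
N`; this turns `hasDerivAt_det` into Jacobi's formula. -/
lemma sum_det_updateCol (M N : Matrix (Fin n) (Fin n) ℂ) :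
    ∑ i, (M.updateCol i fun j ↦ N j i).det = (M.adjugate * N).trace := by
  refine Finset.sum_congr rfl fun i _ ↦ ?_
  rw [← cramer_apply, cramer_eq_adjugate_mulVec]
  rfl

/-- With `M' = A M`, and likewise `M' = M A` below, the logarithmic derivative of the determinant is
the trace of `A`. Connection matrices enter in this form. -/
lemma sum_det_updateCol_mul_left (M A : Matrix (Fin n) (Fin n) ℂ) :
    ∑ i, (M.updateCol i fun j ↦ (A * M) j i).det = A.trace * M.det := by
  rw [sum_det_updateCol, trace_mul_comm, Matrix.mul_assoc, mul_adjugate]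
  simp [mul_comm]

lemma sum_det_updateCol_mul_right (M A : Matrix (Fin n) (Fin n) ℂ) :
    ∑ i, (M.updateCol i fun j ↦ (M * A) j i).det = A.trace * M.det := by
  rw [sum_det_updateCol, ← Matrix.mul_assoc, adjugate_mul]
  simp [mul_comm]

lemma sum_det_updateCol_add (M A B : Matrix (Fin n) (Fin n) ℂ) :
    ∑ i, (M.updateCol i fun j ↦ (A + B) j i).det =
      ∑ i, (M.updateCol i fun j ↦ A j i).det + ∑ i, (M.updateCol i fun j ↦ B j i).det := by
  simp only [sum_det_updateCol, Matrix.mul_add, trace_add]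

end Determinants

/-! ### Kähler structures on open sets and covariant derivatives along curves. -/

section Local

open Matrix ComplexConjugate

variable {E : Type*} [NormedAddCommGroup E] [NormedSpace ℝ E] {n : ℕ}

/-- A Kähler structure on an open subset of a vector space, with its Christoffel symbols. -/
structure LocalKahler (E : Type*) [NormedAddCommGroup E] [NormedSpace ℝ E] (U : Set E) where
  /-- The metric. -/
  G : E → E →L[ℝ] E →L[ℝ] ℝ
  /-- The complex structure. -/
  J : E → E →L[ℝ] E
  /-- The Christoffel symbols. -/
  Γ : E → E →L[ℝ] E →L[ℝ] E
  isOpen : IsOpen U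
  smooth_G : ContDiffOn ℝ ∞ G U
  smooth_J : ContDiffOn ℝ ∞ J U
  smooth_Γ : ContDiffOn ℝ ∞ Γ U
  pair : ∀ y ∈ U, IsHermPair (fun u v ↦ G y u v) (J y)
  Γ_symm : ∀ y ∈ U, ∀ u v, Γ y u v = Γ y v u
  dG : ∀ y ∈ U, ∀ u v w, fderiv ℝ G y u v w = G y (Γ y u v) w + G y v (Γ y u w)
  dJ : ∀ y ∈ U, ∀ u v, fderiv ℝ J y u v = J y (Γ y u v) - Γ y u (J y v)

namespace LocalKahler

variable {U : Set E} (K : LocalKahler E U)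

/-- The Hermitian form at a point. -/
def hf (y : E) (u v : E) : ℂ := hform (fun u v ↦ K.G y u v) (K.J y) u v

/-- The Gram matrix at a point. -/
def gm (y : E) (v : Fin n → E) : Matrix (Fin n) (Fin n) ℂ :=
  gram (fun u v ↦ K.G y u v) (K.J y) v

/-- The complex coordinates in a frame at a point. -/
def cf (y : E) (v : Fin n → E) (w : E) : Fin n → ℂ :=
  coef (fun u v ↦ K.G y u v) (K.J y) v w

/-- The covariant derivative along a curve through `y` with velocity `u`, of a field with value `z`
and derivative `z'`. -/
def cov (y u z z' : E) : E := z' + K.Γ y u z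

variable {γ Z W : ℝ → E} {γ' Z' W' : E} {s : ℝ}

lemma diffAt_G {y : E} (hy : y ∈ U) : DifferentiableAt ℝ K.G y :=
  (K.smooth_G.contDiffAt (K.isOpen.mem_nhds hy)).differentiableAt (by simp)

lemma diffAt_J {y : E} (hy : y ∈ U) : DifferentiableAt ℝ K.J y :=
  (K.smooth_J.contDiffAt (K.isOpen.mem_nhds hy)).differentiableAt (by simp)

lemma diffAt_Γ {y : E} (hy : y ∈ U) : DifferentiableAt ℝ K.Γ y :=
  (K.smooth_Γ.contDiffAt (K.isOpen.mem_nhds hy)).differentiableAt (by simp)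

/-- Metric compatibility along a curve: the derivative of `G` supplies exactly the Christoffel terms
that complete `Z'` and `W'` to covariant derivatives. -/
lemma hasDerivAt_G (hU : γ s ∈ U) (hγ : HasDerivAt γ γ' s) (hZ : HasDerivAt Z Z' s)
    (hW : HasDerivAt W W' s) :
    HasDerivAt (fun t ↦ K.G (γ t) (Z t) (W t))
      (K.G (γ s) (K.cov (γ s) γ' (Z s) Z') (W s) + K.G (γ s) (Z s) (K.cov (γ s) γ' (W s) W')) s := by
  have h1 : HasDerivAt (fun t ↦ K.G (γ t)) (fderiv ℝ K.G (γ s) γ') s :=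
    HasFDerivAt.comp_hasDerivAt (l := K.G) (f := γ) s
      (K.diffAt_G hU).hasFDerivAt hγ
  have h2 := (h1.clm_apply hZ).clm_apply hW
  refine h2.congr_deriv ?_
  simp only [cov, map_add, _root_.add_apply]
  rw [K.dG _ hU]
  ring

/-- This is `∇(JZ) = J∇Z`; the last `Γ` term appears because an ordinary derivative is stated. -/
lemma hasDerivAt_J (hU : γ s ∈ U) (hγ : HasDerivAt γ γ' s) (hZ : HasDerivAt Z Z' s) :
    HasDerivAt (fun t ↦ K.J (γ t) (Z t))
      (K.J (γ s) (K.cov (γ s) γ' (Z s) Z') - K.Γ (γ s) γ' (K.J (γ s) (Z s))) s := by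
  have h1 := ((K.diffAt_J hU).hasFDerivAt.comp_hasDerivAt (f := γ) s hγ)
  refine (h1.clm_apply hZ).congr_deriv ?_
  simp only [cov, map_add, Function.comp]
  rw [K.dJ _ hU]
  abel

lemma hasDerivAt_hf (hU : γ s ∈ U) (hγ : HasDerivAt γ γ' s) (hZ : HasDerivAt Z Z' s)
    (hW : HasDerivAt W W' s) :
    HasDerivAt (fun t ↦ K.hf (γ t) (Z t) (W t))
      (K.hf (γ s) (K.cov (γ s) γ' (Z s) Z') (W s) + K.hf (γ s) (Z s) (K.cov (γ s) γ' (W s) W')) s := by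
  have h1 := (K.hasDerivAt_G hU hγ hZ hW).ofReal_comp
  have h2 := (K.hasDerivAt_G hU hγ (K.hasDerivAt_J hU hγ hZ) hW).ofReal_comp
  refine (h1.sub (h2.const_mul Complex.I)).congr_deriv ?_
  simp only [hf, hform, cov, sub_add_cancel]
  push_cast
  ring

variable [FiniteDimensional ℝ E]

lemma hf_eq_sum {y : E} (hy : y ∈ U) (hT : Module.finrank ℝ E = 2 * n) {v : Fin n → E}
    (hv : IsTRFrame (K.J y) v) (w z : E) :
    K.hf y w z = ∑ k, K.cf y v w k * K.hf y (v k) z := by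
  conv_lhs => rw [← (K.pair y hy).combo_coef hT hv w]
  exact (K.pair y hy).hform_combo_left _ _ _

lemma hf_eq_sum' {y : E} (hy : y ∈ U) (hT : Module.finrank ℝ E = 2 * n) {v : Fin n → E}
    (hv : IsTRFrame (K.J y) v) (w z : E) :
    K.hf y z w = ∑ k, conj (K.cf y v w k) * K.hf y z (v k) := by
  conv_lhs => rw [← (K.pair y hy).combo_coef hT hv w]
  exact (K.pair y hy).hform_combo_right _ _ _

/-- The derivative of the Gram determinant of a complex frame. -/
lemma hasDerivAt_det_gm (hT : Module.finrank ℝ E = 2 * n) (hU : γ s ∈ U)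
    (hγ : HasDerivAt γ γ' s) {v : ℝ → Fin n → E} {v' : Fin n → E}
    (hv : ∀ k, HasDerivAt (fun t ↦ v t k) (v' k) s) (hf : IsTRFrame (K.J (γ s)) (v s)) :
    HasDerivAt (fun t ↦ (K.gm (γ t) (v t)).det.re)
      (2 * (∑ k, K.cf (γ s) (v s) (K.cov (γ s) γ' (v s k) (v' k)) k).re *
        (K.gm (γ s) (v s)).det.re) s := by
  set τ : Matrix (Fin n) (Fin n) ℂ :=
    of fun i k ↦ K.cf (γ s) (v s) (K.cov (γ s) γ' (v s i) (v' i)) k with hτ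
  -- If `τ` has as row `i` the coordinates of `∇v_i`, the Gram matrix satisfies `G' = τG + Gτᴴ`. The
  -- two traces add up to twice a real part.
  have h1 := hasDerivAt_det (M := fun t ↦ K.gm (γ t) (v t))
    (M' := τ * K.gm (γ s) (v s) + K.gm (γ s) (v s) * τᴴ) (s := s) (fun i j ↦ by
      refine (K.hasDerivAt_hf hU hγ (hv i) (hv j)).congr_deriv ?_
      rw [K.hf_eq_sum hU hT hf, K.hf_eq_sum' hU hT hf (K.cov (γ s) γ' (v s j) (v' j))]
      simp only [Matrix.add_apply, Matrix.mul_apply, conjTranspose_apply, hτ, of_apply, gm, gram]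
      congr 1
      exact Finset.sum_congr rfl fun k _ ↦ mul_comm _ _)
  rw [sum_det_updateCol_add, sum_det_updateCol_mul_left, sum_det_updateCol_mul_right,
    trace_conjTranspose] at h1
  have h2 : HasDerivAt (fun t ↦ (K.gm (γ t) (v t)).det.re) _ s :=
    Complex.reCLM.hasFDerivAt.comp_hasDerivAt s h1
  refine h2.congr_deriv ?_
  have h3 : τ.trace = ∑ k, K.cf (γ s) (v s) (K.cov (γ s) γ' (v s k) (v' k)) k := rfl
  rw [← h3, ← add_mul]
  have h4 := (K.pair _ hU).gram_det_real (v s)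
  change ((K.gm (γ s) (v s)).det.re : ℂ) = (K.gm (γ s) (v s)).det at h4
  rw [← h4]
  simp only [Complex.reCLM_apply, Complex.re_mul_ofReal, Complex.add_re, Complex.star_def,
    Complex.conj_re, Complex.ofReal_re]
  ring

omit [FiniteDimensional ℝ E] in
lemma hasDerivAt_combo (hU : γ s ∈ U) (hγ : HasDerivAt γ γ' s) {v : ℝ → Fin n → E}
    {v' : Fin n → E} (hv : ∀ k, HasDerivAt (fun t ↦ v t k) (v' k) s)
    {c : ℝ → Fin n → ℂ} {c' : Fin n → ℂ} (hc : ∀ k, HasDerivAt (fun t ↦ c t k) (c' k) s) :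
    HasDerivAt (fun t ↦ combo (K.J (γ t)) (c t) (v t))
      (combo (K.J (γ s)) c' (v s) + ∑ k, csmul (K.J (γ s)) (c s k) (K.cov (γ s) γ' (v s k) (v' k))
        - K.Γ (γ s) γ' (combo (K.J (γ s)) (c s) (v s))) s := by
  have h1 := HasDerivAt.fun_sum (u := Finset.univ) fun k _ ↦
    ((Complex.reCLM.hasFDerivAt.comp_hasDerivAt s (hc k)).smul (hv k)).add
      ((Complex.imCLM.hasFDerivAt.comp_hasDerivAt s (hc k)).smul (K.hasDerivAt_J hU hγ (hv k)))
  refine h1.congr_deriv ?_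
  simp only [combo, map_sum, ← Finset.sum_add_distrib, ← Finset.sum_sub_distrib]
  refine Finset.sum_congr rfl fun k _ ↦ ?_
  simp only [csmul, cov, map_add, map_smul, Function.comp, Complex.reCLM_apply, Complex.imCLM_apply]
  module

omit [FiniteDimensional ℝ E] in
/-- The covariant derivative in terms of coordinates in a complex frame. -/
lemma cf_cov_combo (hU : γ s ∈ U) (hγ : HasDerivAt γ γ' s)
    {v : ℝ → Fin n → E} {v' : Fin n → E} (hv : ∀ k, HasDerivAt (fun t ↦ v t k) (v' k) s)
    {c : ℝ → Fin n → ℂ} {c' : Fin n → ℂ} (hc : ∀ k, HasDerivAt (fun t ↦ c t k) (c' k) s)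
    (hf : IsTRFrame (K.J (γ s)) (v s)) (hZ : HasDerivAt Z Z' s)
    (hZc : Z =ᶠ[𝓝 s] fun t ↦ combo (K.J (γ t)) (c t) (v t)) (i : Fin n) :
    K.cf (γ s) (v s) (K.cov (γ s) γ' (Z s) Z') i =
      c' i + ∑ k, c s k * K.cf (γ s) (v s) (K.cov (γ s) γ' (v s k) (v' k)) i := by
  have h1 := hZ.unique ((K.hasDerivAt_combo hU hγ hv hc).congr_of_eventuallyEq hZc)
  have hp := K.pair _ hU
  have h2 : K.cov (γ s) γ' (Z s) Z' = combo (K.J (γ s)) c' (v s) +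
      ∑ k, csmul (K.J (γ s)) (c s k) (K.cov (γ s) γ' (v s k) (v' k)) := by
    rw [cov, h1, hZc.self_of_nhds]; abel
  have h3 : ∀ w, K.cf (γ s) (v s) w = hp.coefLin (v s) w := fun _ ↦ rfl
  rw [h2, h3, map_add, map_sum]
  simp only [IsHermPair.coefLin, LinearMap.coe_mk, AddHom.coe_mk, hp.coef_combo hf,
    hp.coef_csmul, Pi.add_apply, Finset.sum_apply, Pi.smul_apply, smul_eq_mul]
  rfl

end LocalKahler

end Local

/-! ### The curvature tensor in coordinates and its Kähler symmetries. -/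

section LocalCurvature


namespace LocalKahler

variable {E : Type*} [NormedAddCommGroup E] [NormedSpace ℝ E] {n : ℕ} {U : Set E}
  (K : LocalKahler E U)

/-- The product `(u,v) ↦ Γ_u ∘ Γ_v` of the Christoffel symbols. -/
def ΓΓ (y : E) : E →L[ℝ] E →L[ℝ] E →L[ℝ] E :=
  (ContinuousLinearMap.compL ℝ E E E).bilinearComp (K.Γ y) (K.Γ y)

/-- The curvature tensor in coordinates. -/
def Rc (y : E) : E →L[ℝ] E →L[ℝ] E →L[ℝ] E :=
  fderiv ℝ K.Γ y - (fderiv ℝ K.Γ y).flip + K.ΓΓ y - (K.ΓΓ y).flip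

lemma Rc_apply (y u v w : E) : K.Rc y u v w =
    fderiv ℝ K.Γ y u v w - fderiv ℝ K.Γ y v u w + K.Γ y u (K.Γ y v w) - K.Γ y v (K.Γ y u w) := by
  simp [Rc, ΓΓ]

lemma dΓ_symm {y : E} (hy : y ∈ U) (a u v : E) :
    fderiv ℝ K.Γ y a u v = fderiv ℝ K.Γ y a v u := by
  have h1 : ∀ u v : E, HasFDerivAt (fun z ↦ K.Γ z u v)
      (((fderiv ℝ K.Γ y).flip u).flip v) y := fun u v ↦
    (((K.diffAt_Γ hy).hasFDerivAt.clm_apply (hasFDerivAt_const u y)).clm_apply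
      (hasFDerivAt_const v y)).congr_fderiv (by ext; simp)
  have h2 : (fun z ↦ K.Γ z u v) =ᶠ[𝓝 y] fun z ↦ K.Γ z v u := by
    filter_upwards [K.isOpen.mem_nhds hy] with z hz using K.Γ_symm z hz u v
  have := (h1 u v).unique ((h1 v u).congr_of_eventuallyEq h2)
  simpa using congrArg (fun L ↦ L a) this

lemma hasDerivAt_line {F : Type*} [NormedAddCommGroup F] [NormedSpace ℝ F] {φ : E → F} {y : E}
    (h : DifferentiableAt ℝ φ y) (a : E) :
    HasDerivAt (fun t : ℝ ↦ φ (y + t • a)) (fderiv ℝ φ y a) 0 :=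
  h.hasFDerivAt.hasLineDerivAt a

lemma line_hasDerivAt (y a : E) : HasDerivAt (fun t : ℝ ↦ y + t • a) a 0 := by
  simpa using ((hasDerivAt_id (0 : ℝ)).smul_const a).const_add y

/-- Differentiate `∇J = 0`, written as the formula `dJ`, once more. The second derivative of `J` is
symmetric in the two directions, and equating the two orders leaves the commutator of `J` with the
curvature. -/
lemma Rc_comm {y : E} (hy : y ∈ U) (u v w : E) :
    K.Rc y u v (K.J y w) = K.J y (K.Rc y u v w) := by
  have hs := K.smooth_J.contDiffAt (K.isOpen.mem_nhds hy)
  have hd : DifferentiableAt ℝ (fderiv ℝ K.J) y :=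
    (hs.fderiv_right (m := 1) (by norm_cast)).differentiableAt (by simp)
  have key : ∀ a b, fderiv ℝ (fderiv ℝ K.J) y a b w =
      fderiv ℝ K.J y a (K.Γ y b w) + K.J y (fderiv ℝ K.Γ y a b w)
        - (fderiv ℝ K.Γ y a b (K.J y w) + K.Γ y b (fderiv ℝ K.J y a w)) := by
    intro a b
    have hJ := hasDerivAt_line (K.diffAt_J hy) a
    have hΓ := (hasDerivAt_line (K.diffAt_Γ hy) a).clm_apply (hasDerivAt_const (0 : ℝ) b)
    have hΓw := hΓ.clm_apply (hasDerivAt_const (0 : ℝ) w)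
    have hJw := hJ.clm_apply (hasDerivAt_const (0 : ℝ) w)
    have h1 := (hJ.clm_apply hΓw).sub (hΓ.clm_apply hJw)
    have h2 := ((hasDerivAt_line hd a).clm_apply (hasDerivAt_const (0 : ℝ) b)).clm_apply
      (hasDerivAt_const (0 : ℝ) w)
    have h3 : (fun t : ℝ ↦ fderiv ℝ K.J (y + t • a) b w) =ᶠ[𝓝 0] fun t ↦
        K.J (y + t • a) (K.Γ (y + t • a) b w) - K.Γ (y + t • a) b (K.J (y + t • a) w) := by
      have : ∀ᶠ t : ℝ in 𝓝 0, y + t • a ∈ U :=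
        (line_hasDerivAt y a).continuousAt.eventually
          (by simpa using K.isOpen.mem_nhds hy)
      filter_upwards [this] with t ht using K.dJ _ ht b w
    have := h2.unique (h1.congr_of_eventuallyEq h3)
    simpa using this
  have hsymm := (hs.isSymmSndFDerivAt (by simp; exact ENat.LEInfty.out)).eq u v
  have h1 := key u v
  rw [hsymm, key v u] at h1
  simp only [K.dJ y hy, map_sub] at h1
  simp only [Rc_apply, map_sub, map_add]
  rw [← sub_eq_zero] at h1 ⊢
  rw [← h1]
  abel

/-- The same argument with `dG`: symmetry of the second derivative of the metric leaves the skewness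
of the curvature. -/
lemma Rc_skew {y : E} (hy : y ∈ U) (u v w z : E) :
    K.G y (K.Rc y u v w) z = -K.G y w (K.Rc y u v z) := by
  have hs := K.smooth_G.contDiffAt (K.isOpen.mem_nhds hy)
  have hd : DifferentiableAt ℝ (fderiv ℝ K.G) y :=
    (hs.fderiv_right (m := 1) (by norm_cast)).differentiableAt (by simp)
  have key : ∀ a b, fderiv ℝ (fderiv ℝ K.G) y a b w z =
      (fderiv ℝ K.G y a (K.Γ y b w) z + K.G y (fderiv ℝ K.Γ y a b w) z)
        + (fderiv ℝ K.G y a w (K.Γ y b z) + K.G y w (fderiv ℝ K.Γ y a b z)) := by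
    intro a b
    have hG := hasDerivAt_line (K.diffAt_G hy) a
    have hΓ := (hasDerivAt_line (K.diffAt_Γ hy) a).clm_apply (hasDerivAt_const (0 : ℝ) b)
    have hΓw := hΓ.clm_apply (hasDerivAt_const (0 : ℝ) w)
    have hΓz := hΓ.clm_apply (hasDerivAt_const (0 : ℝ) z)
    have h1 := ((hG.clm_apply hΓw).clm_apply (hasDerivAt_const (0 : ℝ) z)).add
      ((hG.clm_apply (hasDerivAt_const (0 : ℝ) w)).clm_apply hΓz)
    have h2 := (((hasDerivAt_line hd a).clm_apply (hasDerivAt_const (0 : ℝ) b)).clm_apply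
      (hasDerivAt_const (0 : ℝ) w)).clm_apply (hasDerivAt_const (0 : ℝ) z)
    have h3 : (fun t : ℝ ↦ fderiv ℝ K.G (y + t • a) b w z) =ᶠ[𝓝 0] fun t ↦
        K.G (y + t • a) (K.Γ (y + t • a) b w) z + K.G (y + t • a) w (K.Γ (y + t • a) b z) := by
      have : ∀ᶠ t : ℝ in 𝓝 0, y + t • a ∈ U :=
        (line_hasDerivAt y a).continuousAt.eventually
          (by simpa using K.isOpen.mem_nhds hy)
      filter_upwards [this] with t ht using K.dG _ ht b w z
    have := h2.unique (h1.congr_of_eventuallyEq h3)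
    simpa using this
  have hsymm := (hs.isSymmSndFDerivAt (by simp; exact ENat.LEInfty.out)).eq u v
  have h1 := key u v
  rw [hsymm, key v u] at h1
  simp only [K.dG y hy] at h1
  simp only [Rc_apply, map_sub, map_add, sub_apply, add_apply]
  linarith

lemma isKahlerCurvature {y : E} (hy : y ∈ U) :
    IsKahlerCurvature (fun u v ↦ K.G y u v) (K.J y) (K.Rc y) where
  anti u v w := by simp only [Rc_apply]; abel
  bianchi u v w := by
    simp only [Rc_apply]
    rw [K.dΓ_symm hy u w v, K.dΓ_symm hy v w u, K.dΓ_symm hy w v u,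
      K.Γ_symm y hy w v, K.Γ_symm y hy w u, K.Γ_symm y hy v u]
    abel
  skew u v w z := K.Rc_skew hy u v w z
  comm u v w := K.Rc_comm hy u v w

end LocalKahler

end LocalCurvature

/-! ### Coordinates of tangent vectors in charts. -/

section TangentCharts

variable {m : ℕ} {N : Type*} [TopologicalSpace N] [ChartedSpace (Eu m) N]
  [IsManifold (𝓡 m) ∞ N]

/-- The coordinates of a tangent vector in the chart at `c`. -/
def crd (c x : N) : TangentSpace (𝓡 m) x →L[ℝ] Eu m :=
  (trivializationAt (Eu m) (TangentSpace (𝓡 m)) c).continuousLinearMapAt ℝ x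

/-- The tangent vector with given coordinates in the chart at `c`. -/
def frm (c x : N) : Eu m →L[ℝ] TangentSpace (𝓡 m) x :=
  (trivializationAt (Eu m) (TangentSpace (𝓡 m)) c).symmL ℝ x

lemma crd_frm {c x : N} (hx : x ∈ (chartAt (Eu m) c).source) (u : Eu m) :
    crd c x (frm c x u) = u :=
  (trivializationAt (Eu m) (TangentSpace (𝓡 m)) c).continuousLinearMapAt_symmL hx u

lemma frm_crd {c x : N} (hx : x ∈ (chartAt (Eu m) c).source) (v : TangentSpace (𝓡 m) x) :
    frm c x (crd c x v) = v :=
  (trivializationAt (Eu m) (TangentSpace (𝓡 m)) c).symmL_continuousLinearMapAt hx v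

lemma triv_snd {c x : N} (hx : x ∈ (chartAt (Eu m) c).source) (v : TangentSpace (𝓡 m) x) :
    (trivializationAt (Eu m) (TangentSpace (𝓡 m)) c (⟨x, v⟩ : TangentBundle (𝓡 m) N)).2 =
      crd c x v := by
  rw [crd, Trivialization.continuousLinearMapAt_apply,
    Trivialization.linearMapAt_apply, if_pos (by exact hx)]

/-- The extensions used to define the Ricci tensor and the Maslov form are thus fields with constant
coefficients in the chart at `x`. -/
lemma extend_eq_frm {x : N} (v : TangentSpace (𝓡 m) x) {x' : N}
    (hx' : x' ∈ (chartAt (Eu m) x).source) :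
    FiberBundle.extend (Eu m) v x' = frm x x' (crd x x v) := by
  rw [← triv_snd (mem_chart_source _ x)]
  simp only [FiberBundle.extend, frm]
  exact (Trivialization.symmₗ_apply _ hx' _).symm

/-- One criterion serves vector fields (`b` the identity), sections along immersions and families:
any chart around `b a` will do, not only the preferred one. -/
lemma contMDiffAt_along_iff {A : Type*} [TopologicalSpace A] {EA HA : Type*}
    [NormedAddCommGroup EA] [NormedSpace ℝ EA] [TopologicalSpace HA]
    {I : ModelWithCorners ℝ EA HA} [ChartedSpace HA A] {k : WithTop ℕ∞} (hk : k ≤ ∞)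
    {b : A → N} {Z : Π a, TangentSpace (𝓡 m) (b a)} {a : A} {c : N}
    (hc : b a ∈ (chartAt (Eu m) c).source) :
    ContMDiffAt I (𝓡 m).tangent k (fun a ↦ (⟨b a, Z a⟩ : TangentBundle (𝓡 m) N)) a ↔
      ContMDiffAt I (𝓡 m) k b a ∧ ContMDiffAt I 𝓘(ℝ, Eu m) k (fun a ↦ crd c (b a) (Z a)) a := by
  have : IsManifold (𝓡 m) (k + 1) N := IsManifold.of_le (n := ∞) (by
    cases k with
    | top => simp at hk
    | coe k => exact_mod_cast le_top)
  have : IsManifold (𝓡 m) k N := IsManifold.of_le (n := ∞) hk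
  have : ContMDiffVectorBundle k (Eu m) (TangentSpace (𝓡 m) : N → Type _) (𝓡 m) :=
    TangentBundle.contMDiffVectorBundle
  rw [(trivializationAt (Eu m) (TangentSpace (𝓡 m)) c).contMDiffAt_iff
    (f := fun a ↦ (⟨b a, Z a⟩ : TangentBundle (𝓡 m) N)) hc]
  refine and_congr_right fun hb ↦ Filter.EventuallyEq.contMDiffAt_iff ?_
  filter_upwards [hb.continuousAt.eventually ((chartAt (Eu m) c).open_source.mem_nhds hc)]
    with y hy using triv_snd hy _

lemma mdifferentiableAt_along_iff {A : Type*} [TopologicalSpace A] {EA HA : Type*}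
    [NormedAddCommGroup EA] [NormedSpace ℝ EA] [TopologicalSpace HA]
    {I : ModelWithCorners ℝ EA HA} [ChartedSpace HA A]
    {b : A → N} {Z : Π a, TangentSpace (𝓡 m) (b a)} {a : A} {c : N}
    (hc : b a ∈ (chartAt (Eu m) c).source) :
    MDifferentiableAt I (𝓡 m).tangent (fun a ↦ (⟨b a, Z a⟩ : TangentBundle (𝓡 m) N)) a ↔
      MDifferentiableAt I (𝓡 m) b a ∧
        MDifferentiableAt I 𝓘(ℝ, Eu m) (fun a ↦ crd c (b a) (Z a)) a := by
  rw [(trivializationAt (Eu m) (TangentSpace (𝓡 m)) c).mdifferentiableAt_totalSpace_iff (𝓡 m)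
    (f := fun a ↦ (⟨b a, Z a⟩ : TangentBundle (𝓡 m) N)) hc]
  refine and_congr_right fun hb ↦ Filter.EventuallyEq.mdifferentiableAt_iff ?_
  filter_upwards [hb.continuousAt.eventually ((chartAt (Eu m) c).open_source.mem_nhds hc)]
    with y hy using triv_snd hy _

lemma contMDiffAt_frm {c x : N} (hx : x ∈ (chartAt (Eu m) c).source) (u : Eu m) :
    ContMDiffAt (𝓡 m) (𝓡 m).tangent ∞ (fun y ↦ (⟨y, frm c y u⟩ : TangentBundle (𝓡 m) N)) x := by
  refine (contMDiffAt_along_iff le_rfl hx).2 ⟨contMDiffAt_id, ?_⟩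
  refine (contMDiffAt_const (c := u)).congr_of_eventuallyEq ?_
  filter_upwards [(chartAt (Eu m) c).open_source.mem_nhds hx] with y hy using crd_frm hy u

lemma diffField_frm {c x : N} (hx : x ∈ (chartAt (Eu m) c).source) (u : Eu m) :
    DiffFieldAt (fun y ↦ frm c y u) x :=
  (contMDiffAt_frm hx u).mdifferentiableAt (by simp)

lemma hasMFDerivAt_chart {c x : N} (hx : x ∈ (chartAt (Eu m) c).source) :
    HasMFDerivAt (𝓡 m) 𝓘(ℝ, Eu m) (chartAt (Eu m) c) x (crd c x) := by
  have h := (mdifferentiableAt_extChartAt (I := 𝓡 m) hx).hasMFDerivAt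
  rw [← TangentBundle.continuousLinearMapAt_trivializationAt hx] at h
  exact h

lemma contMDiffAt_chart_symm {c : N} {y : Eu m} (hy : y ∈ (chartAt (Eu m) c).target) :
    ContMDiffAt 𝓘(ℝ, Eu m) (𝓡 m) ∞ (chartAt (Eu m) c).symm y :=
  (contMDiffOn_chart_symm (n := ∞) (I := 𝓡 m) (x := c)).contMDiffAt
    ((chartAt (Eu m) c).open_target.mem_nhds hy)

/-- Differentiate the identity obtained by composing the chart with its inverse; the differential of
the chart is `crd`, with inverse `frm`. -/
lemma hasMFDerivAt_chart_symm {c : N} {y : Eu m} (hy : y ∈ (chartAt (Eu m) c).target) :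
    HasMFDerivAt 𝓘(ℝ, Eu m) (𝓡 m) (chartAt (Eu m) c).symm y
      (frm c ((chartAt (Eu m) c).symm y)) := by
  have hx := (chartAt (Eu m) c).map_target hy
  have h1 := ((contMDiffAt_chart_symm hy).mdifferentiableAt (by simp)).hasMFDerivAt
  have h2 := HasMFDerivAt.comp y (hasMFDerivAt_chart hx) h1
  have h3 : HasMFDerivAt 𝓘(ℝ, Eu m) 𝓘(ℝ, Eu m)
      (chartAt (Eu m) c ∘ (chartAt (Eu m) c).symm) y (ContinuousLinearMap.id ℝ (Eu m)) :=
    (hasMFDerivAt_id y).congr_of_eventuallyEq (by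
      filter_upwards [(chartAt (Eu m) c).open_target.mem_nhds hy] with z hz using
        (chartAt (Eu m) c).right_inv hz)
  have h4 := hasMFDerivAt_unique h2 h3
  have h6 : mfderiv 𝓘(ℝ, Eu m) (𝓡 m) (chartAt (Eu m) c).symm y =
      frm c ((chartAt (Eu m) c).symm y) := by
    refine ContinuousLinearMap.ext fun u ↦ ?_
    have h5 : crd c _ (mfderiv 𝓘(ℝ, Eu m) (𝓡 m) (chartAt (Eu m) c).symm y u) = u :=
      congrArg (fun L ↦ L u) h4
    exact (frm_crd hx _).symm.trans (congrArg (frm c _) h5)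
  exact h6 ▸ h1

/-- Derivatives of vector valued functions in a chart. -/
lemma mvfderiv_eq_fderiv {F : Type*} [NormedAddCommGroup F] [NormedSpace ℝ F] {φ : N → F}
    {c x : N} (hx : x ∈ (chartAt (Eu m) c).source) (hφ : MDifferentiableAt (𝓡 m) 𝓘(ℝ, F) φ x)
    (v : TangentSpace (𝓡 m) x) :
    mvfderiv (𝓡 m) φ x v =
      fderiv ℝ (φ ∘ (chartAt (Eu m) c).symm) (chartAt (Eu m) c x) (crd c x v) := by
  have hy := (chartAt (Eu m) c).map_source hx
  have hxy := (chartAt (Eu m) c).left_inv hx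
  have h1 : HasMFDerivAt (𝓡 m) 𝓘(ℝ, F) φ ((chartAt (Eu m) c).symm (chartAt (Eu m) c x))
      (mfderiv (𝓡 m) 𝓘(ℝ, F) φ ((chartAt (Eu m) c).symm (chartAt (Eu m) c x))) := by
    refine MDifferentiableAt.hasMFDerivAt ?_
    rwa [hxy]
  obtain ⟨A, hA⟩ : ∃ A : Eu m →L[ℝ] F, A = ContinuousLinearMap.comp
      (mfderiv (𝓡 m) 𝓘(ℝ, F) φ ((chartAt (Eu m) c).symm (chartAt (Eu m) c x)))
      (frm c ((chartAt (Eu m) c).symm (chartAt (Eu m) c x))) := ⟨_, rfl⟩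
  have h2 : HasFDerivAt (φ ∘ (chartAt (Eu m) c).symm) A (chartAt (Eu m) c x) := by
    rw [hA]
    exact (HasMFDerivAt.comp _ h1 (hasMFDerivAt_chart_symm hy)).hasFDerivAt
  rw [h2.fderiv, hA]
  change _ = mfderiv (𝓡 m) 𝓘(ℝ, F) φ ((chartAt (Eu m) c).symm (chartAt (Eu m) c x))
    (frm c ((chartAt (Eu m) c).symm (chartAt (Eu m) c x)) (crd c x v))
  -- The base point here is the image of `x` under the chart and back, equal to `x` only by a proof.
  -- It is generalised to `x'` so that the equality can be substituted in the dependent types.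
  have h4 : ∀ (x' : N) (_ : x' = x), (mfderiv (𝓡 m) 𝓘(ℝ, F) φ x' (frm c x' (crd c x v)) : F) =
      mvfderiv (𝓡 m) φ x v := by
    rintro x' rfl
    rw [frm_crd hx]; rfl
  exact (h4 _ hxy).symm

/-- Coordinate fields are pull-backs of constant fields under the chart, and pull-back commutes with
the bracket. -/
lemma mlieBracket_frm {c x : N} (hx : x ∈ (chartAt (Eu m) c).source) (u v : Eu m) :
    mlieBracket (𝓡 m) (fun y ↦ frm c y u) (fun y ↦ frm c y v) x = 0 := by
  have hinv : ∀ y ∈ (chartAt (Eu m) c).source,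
      (mfderiv (𝓡 m) 𝓘(ℝ, Eu m) (chartAt (Eu m) c) y).inverse = frm c y := fun y hy ↦ by
    rw [(hasMFDerivAt_chart hy).mfderiv]
    exact ContinuousLinearMap.inverse_eq (ContinuousLinearMap.ext fun w ↦ crd_frm hy w)
      (ContinuousLinearMap.ext fun w ↦ frm_crd hy w)
  have he : ∀ w : Eu m, (fun y ↦ frm c y w) =ᶠ[𝓝 x]
      mpullback (𝓡 m) 𝓘(ℝ, Eu m) (chartAt (Eu m) c) (fun _ ↦ w) := fun w ↦ by
    filter_upwards [(chartAt (Eu m) c).open_source.mem_nhds hx] with y hy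
    exact (congrArg (fun A : Eu m →L[ℝ] TangentSpace (𝓡 m) y ↦ A w) (hinv y hy)).symm
  rw [(he u).mlieBracket_vectorField_eq (he v)]
  have hdiff : ∀ w : Eu m, MDifferentiableAt 𝓘(ℝ, Eu m) 𝓘(ℝ, Eu m).tangent
      (fun y ↦ (⟨y, w⟩ : TangentBundle 𝓘(ℝ, Eu m) (Eu m))) (chartAt (Eu m) c x) := fun w ↦
    (contMDiffAt_vectorSpace_iff_contDiffAt.2 (contDiffAt_const (c := w) (n := 1))).mdifferentiableAt
      (by simp)
  have : IsManifold (𝓡 m) (minSmoothness ℝ 2) N :=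
    IsManifold.of_le (n := ∞) (by simp only [minSmoothness_of_isRCLikeNormedField]; exact ENat.LEInfty.out)
  rw [← mpullback_mlieBracket (n := ∞) (hdiff u) (hdiff v)
    ((contMDiffOn_chart (n := ∞) (I := 𝓡 m) (x := c)).contMDiffAt
      ((chartAt (Eu m) c).open_source.mem_nhds hx)) (by simp only [minSmoothness_of_isRCLikeNormedField]; exact ENat.LEInfty.out)]
  have h0 : mlieBracket 𝓘(ℝ, Eu m) (fun y : Eu m ↦ (u : TangentSpace 𝓘(ℝ, Eu m) y))
      (fun y : Eu m ↦ (v : TangentSpace 𝓘(ℝ, Eu m) y)) (chartAt (Eu m) c x) = 0 := by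
    have h := congrFun (mlieBracketWithin_eq_lieBracketWithin (𝕜 := ℝ) (E := Eu m)
      (V := fun _ ↦ u) (W := fun _ ↦ v) (s := Set.univ)) (chartAt (Eu m) c x)
    refine Eq.trans ?_ (h.trans (by simp [lieBracketWithin]; rfl))
    exact (congrFun (mlieBracketWithin_univ (I := 𝓘(ℝ, Eu m))) _).symm
  refine (congrArg _ h0).trans (map_zero _)

end TangentCharts

/-! ### Christoffel symbols of the Levi-Civita connection. -/

section LocalMetric

variable {m : ℕ} {N : Type*} [TopologicalSpace N] [ChartedSpace (Eu m) N]
  [IsManifold (𝓡 m) ∞ N] (g : RMetric m N) (c : N)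

/-- The metric in the coordinates of the chart at `c`. -/
def locG (y : Eu m) : Eu m →L[ℝ] Eu m →L[ℝ] ℝ :=
  LinearMap.toContinuousLinearMap
    { toFun := fun u ↦ (g.inner ((chartAt (Eu m) c).symm y)
        (frm c ((chartAt (Eu m) c).symm y) u)).comp (frm c ((chartAt (Eu m) c).symm y))
      map_add' := fun u v ↦ by ext w; simp
      map_smul' := fun a v ↦ by ext w; simp }

lemma locG_apply (y u v : Eu m) : locG g c y u v = g.inner ((chartAt (Eu m) c).symm y)
    (frm c ((chartAt (Eu m) c).symm y) u) (frm c ((chartAt (Eu m) c).symm y) v) := rfl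

variable {g c}

lemma inner_eq_locG {x : N} (hx : x ∈ (chartAt (Eu m) c).source) (v w : TangentSpace (𝓡 m) x) :
    g.inner x v w = locG g c (chartAt (Eu m) c x) (crd c x v) (crd c x w) := by
  rw [locG_apply]
  have h : ∀ x', x' = x → g.inner x v w = g.inner x' (frm c x' (crd c x v))
      (frm c x' (crd c x w)) := by
    rintro x' rfl; rw [frm_crd hx, frm_crd hx]
  exact h _ ((chartAt (Eu m) c).left_inv hx)

lemma contMDiffAt_inner_along {A : Type*} [TopologicalSpace A] {EA HA : Type*}
    [NormedAddCommGroup EA] [NormedSpace ℝ EA] [TopologicalSpace HA]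
    {I : ModelWithCorners ℝ EA HA} [ChartedSpace HA A] (g : RMetric m N)
    {b : A → N} {Y Z : Π a, TangentSpace (𝓡 m) (b a)} {a : A}
    (hY : ContMDiffAt I (𝓡 m).tangent ∞ (fun a ↦ (⟨b a, Y a⟩ : TangentBundle (𝓡 m) N)) a)
    (hZ : ContMDiffAt I (𝓡 m).tangent ∞ (fun a ↦ (⟨b a, Z a⟩ : TangentBundle (𝓡 m) N)) a) :
    ContMDiffAt I 𝓘(ℝ) ∞ (fun a ↦ g.inner (b a) (Y a) (Z a)) a := by
  let _ : RiemannianBundle (fun x : N ↦ TangentSpace (𝓡 m) x) := ⟨g.toRiemannianMetric⟩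
  have : IsContMDiffRiemannianBundle (𝓡 m) ∞ (Eu m) (fun x : N ↦ TangentSpace (𝓡 m) x) :=
    inferInstance
  exact ContMDiffAt.inner_bundle hY hZ

lemma contDiffOn_locG : ContDiffOn ℝ ∞ (locG g c) (chartAt (Eu m) c).target := by
  refine contDiffOn_clm_apply.2 fun u ↦ contDiffOn_clm_apply.2 fun v y hy ↦ ?_
  have hx := (chartAt (Eu m) c).map_target hy
  have h := contMDiffAt_inner_along g (contMDiffAt_frm hx u) (contMDiffAt_frm hx v)
  exact (ContMDiffAt.comp y h (contMDiffAt_chart_symm hy)).contDiffAt.contDiffWithinAt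

lemma locG_symm (y u v : Eu m) : locG g c y u v = locG g c y v u := g.symm _ _ _

lemma locG_pos {y : Eu m} (hy : y ∈ (chartAt (Eu m) c).target) {u : Eu m} (hu : u ≠ 0) :
    0 < locG g c y u u := by
  refine g.pos _ _ fun h ↦ hu ?_
  rw [← crd_frm ((chartAt (Eu m) c).map_target hy) u, h, map_zero]

lemma diffAt_locG {y : Eu m} (hy : y ∈ (chartAt (Eu m) c).target) :
    DifferentiableAt ℝ (locG g c) y :=
  (contDiffOn_locG.contDiffAt ((chartAt (Eu m) c).open_target.mem_nhds hy)).differentiableAt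
    (by simp)

lemma fderiv_locG_apply {y : Eu m} (hy : y ∈ (chartAt (Eu m) c).target) (a u v : Eu m) :
    fderiv ℝ (fun z ↦ locG g c z u v) y a = fderiv ℝ (locG g c) y a u v := by
  have := (((diffAt_locG (g := g) hy).hasFDerivAt.clm_apply (hasFDerivAt_const u y)).clm_apply
      (hasFDerivAt_const v y)).fderiv
  rw [this]; simp

lemma fderiv_locG_symm {y : Eu m} (hy : y ∈ (chartAt (Eu m) c).target) (a u v : Eu m) :
    fderiv ℝ (locG g c) y a u v = fderiv ℝ (locG g c) y a v u := by
  rw [← fderiv_locG_apply hy, ← fderiv_locG_apply hy]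
  simp_rw [locG_symm _ u v]

variable (g c)

/-- The Christoffel symbols of the first kind. -/
def christoffel (y : Eu m) : Eu m →L[ℝ] Eu m →L[ℝ] Eu m →L[ℝ] ℝ :=
  (1 / 2 : ℝ) • (fderiv ℝ (locG g c) y + (fderiv ℝ (locG g c) y).flip -
    ((ContinuousLinearMap.flipₗᵢ ℝ (Eu m) (Eu m) ℝ).toContinuousLinearEquiv :
      (Eu m →L[ℝ] Eu m →L[ℝ] ℝ) →L[ℝ] (Eu m →L[ℝ] Eu m →L[ℝ] ℝ)) ∘L
      (fderiv ℝ (locG g c) y).flip)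

lemma christoffel_apply (y u v w : Eu m) : christoffel g c y u v w =
    1 / 2 * (fderiv ℝ (locG g c) y u v w + fderiv ℝ (locG g c) y v u w -
      fderiv ℝ (locG g c) y w u v) := by
  simp [christoffel]

/-- The Christoffel symbols of the Levi-Civita connection in the chart at `c`. -/
def locΓ (y : Eu m) : Eu m →L[ℝ] Eu m →L[ℝ] Eu m :=
  (ContinuousLinearMap.compL ℝ (Eu m) (Eu m →L[ℝ] ℝ) (Eu m) (locG g c y).inverse) ∘L
    christoffel g c y

lemma locΓ_apply (y u v : Eu m) :
    locΓ g c y u v = (locG g c y).inverse (christoffel g c y u v) := rfl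

variable {g c}

/-- Positivity gives injectivity into a dual space of the same dimension. Invertibility makes the
raised Christoffel symbols smooth, since inversion is smooth at invertible maps. -/
lemma locG_isInvertible {y : Eu m} (hy : y ∈ (chartAt (Eu m) c).target) :
    (locG g c y).IsInvertible := by
  have hinj : Function.Injective (locG g c y).toLinearMap := by
    refine (injective_iff_map_eq_zero _).2 fun u hu ↦ ?_
    by_contra hne
    have h := locG_pos (g := g) hy hne
    have h' : locG g c y u = 0 := hu
    simp [h'] at h
  have hd : Module.finrank ℝ (Eu m) = Module.finrank ℝ (Eu m →L[ℝ] ℝ) := by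
    rw [← (LinearMap.toContinuousLinearMap (𝕜 := ℝ) (E := Eu m) (F' := ℝ)).finrank_eq]
    exact Subspace.dual_finrank_eq.symm
  exact ⟨(LinearEquiv.ofInjectiveOfFinrankEq _ hinj hd).toContinuousLinearEquiv, by
    ext u v; rfl⟩

lemma locG_locΓ {y : Eu m} (hy : y ∈ (chartAt (Eu m) c).target) (u v w : Eu m) :
    locG g c y (locΓ g c y u v) w = christoffel g c y u v w := by
  obtain ⟨e, he⟩ := locG_isInvertible (g := g) hy
  rw [locΓ_apply, ← he, ContinuousLinearMap.inverse_equiv]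
  simp

lemma locG_ext {y : Eu m} (hy : y ∈ (chartAt (Eu m) c).target) {u v : Eu m}
    (h : ∀ w, locG g c y u w = locG g c y v w) : u = v := by
  by_contra hne
  have := locG_pos (g := g) hy (sub_ne_zero.2 hne)
  simp [h] at this

lemma locΓ_symm {y : Eu m} (hy : y ∈ (chartAt (Eu m) c).target) (u v : Eu m) :
    locΓ g c y u v = locΓ g c y v u := by
  refine locG_ext (g := g) hy fun w ↦ ?_
  rw [locG_locΓ hy, locG_locΓ hy, christoffel_apply, christoffel_apply, fderiv_locG_symm hy w u v]
  ring

lemma fderiv_locG {y : Eu m} (hy : y ∈ (chartAt (Eu m) c).target) (u v w : Eu m) :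
    fderiv ℝ (locG g c) y u v w =
      locG g c y (locΓ g c y u v) w + locG g c y v (locΓ g c y u w) := by
  rw [locG_symm y v, locG_locΓ hy, locG_locΓ hy, christoffel_apply, christoffel_apply,
    fderiv_locG_symm hy v u w, fderiv_locG_symm hy w u v, fderiv_locG_symm hy u w v]
  ring

lemma contDiffOn_locΓ : ContDiffOn ℝ ∞ (locΓ g c) (chartAt (Eu m) c).target := by
  have hD : ContDiffOn ℝ ∞ (fderiv ℝ (locG g c)) (chartAt (Eu m) c).target :=
    (contDiffOn_locG (g := g)).fderiv_of_isOpen (chartAt (Eu m) c).open_target (by simp)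
  have hD' : ∀ u v w, ContDiffOn ℝ ∞ (fun y ↦ fderiv ℝ (locG g c) y u v w)
      (chartAt (Eu m) c).target := fun u v w ↦
    ((hD.clm_apply contDiffOn_const).clm_apply contDiffOn_const).clm_apply contDiffOn_const
  refine contDiffOn_clm_apply.2 fun u ↦ contDiffOn_clm_apply.2 fun v ↦ ?_
  simp only [locΓ_apply]
  refine ContDiffOn.clm_apply (fun y hy ↦ ?_) (contDiffOn_clm_apply.2 fun w ↦ ?_)
  · obtain ⟨e, he⟩ := locG_isInvertible (g := g) hy
    have h1 : ContDiffAt ℝ ∞ ContinuousLinearMap.inverse (locG g c y) :=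
      he ▸ contDiffAt_map_inverse e
    exact h1.comp_contDiffWithinAt y (contDiffOn_locG y hy)
  · simp only [christoffel_apply]
    exact contDiffOn_const.mul (((hD' u v w).add (hD' v u w)).sub (hD' w u v))

lemma mvfderiv_inner_frm {x : N} (hx : x ∈ (chartAt (Eu m) c).source) (a u v : Eu m) :
    mvfderiv (𝓡 m) (fun y ↦ g.inner y (frm c y u) (frm c y v)) x (frm c x a) =
      fderiv ℝ (locG g c) (chartAt (Eu m) c x) a u v := by
  rw [mvfderiv_eq_fderiv hx (mdiff_inner g (diffField_frm hx u) (diffField_frm hx v)), crd_frm hx,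
    ← fderiv_locG_apply ((chartAt (Eu m) c).map_source hx)]
  rfl

/-- On coordinate fields the bracket terms of the Koszul expression vanish, and the three
derivatives of the metric form the Christoffel symbol of the first kind. -/
lemma leviCivita_frm {x : N} (hx : x ∈ (chartAt (Eu m) c).source) (u v : Eu m) :
    leviCivita g (fun y ↦ frm c y v) x (frm c x u) =
      frm c x (locΓ g c (chartAt (Eu m) c x) u v) := by
  refine metric_ext g fun z ↦ ?_
  have hy := (chartAt (Eu m) c).map_source hx
  rw [← frm_crd hx z, inner_eq_locG hx (frm c x _), crd_frm hx, crd_frm hx, locG_locΓ hy,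
    christoffel_apply]
  refine (inner_lcDeriv g (diffField_frm hx u) (diffField_frm hx v)
    (diffField_frm hx (crd c x z))).trans ?_
  simp only [koszul, mlieBracket_frm hx, mvfderiv_inner_frm hx]
  simp

lemma _root_.Filter.EventuallyEq.mvfderiv_eq {F : Type*} [NormedAddCommGroup F] [NormedSpace ℝ F]
    {φ χ : N → F} {x : N} (h : φ =ᶠ[𝓝 x] χ) : mvfderiv (𝓡 m) φ x = mvfderiv (𝓡 m) χ x := by
  ext v
  exact congrArg (fun A : TangentSpace (𝓡 m) x →L[ℝ] F ↦ A v) h.mfderiv_eq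

/-- Near `x` the field is a finite combination of coordinate fields with functions as coefficients.
Locality of the connection, the Leibniz rule and `leviCivita_frm` then give the formula by induction
on the number of terms. -/
lemma leviCivita_eq {x : N} (hx : x ∈ (chartAt (Eu m) c).source)
    {Y : Π x : N, TangentSpace (𝓡 m) x} (hY : DiffFieldAt Y x) (v : TangentSpace (𝓡 m) x) :
    leviCivita g Y x v = frm c x (mvfderiv (𝓡 m) (fun y ↦ crd c y (Y y)) x v +
      locΓ g c (chartAt (Eu m) c x) (crd c x v) (crd c x (Y x))) := by
  have hcov := (leviCivita g).isCovariantDerivativeOn (s := Set.univ)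
  have hcrd : ∀ {Y : Π x : N, TangentSpace (𝓡 m) x}, DiffFieldAt Y x →
      MDifferentiableAt (𝓡 m) 𝓘(ℝ, Eu m) (fun y ↦ crd c y (Y y)) x := fun hY ↦
    ((mdifferentiableAt_along_iff hx).1 hY).2
  have hsrc : ∀ᶠ y in 𝓝 x, y ∈ (chartAt (Eu m) c).source :=
    (chartAt (Eu m) c).open_source.mem_nhds hx
  let f : Fin m → N → ℝ := fun i y ↦ crd c y (Y y) i
  have hf : ∀ i, MDifferentiableAt (𝓡 m) 𝓘(ℝ) (f i) x := fun i ↦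
    (EuclideanSpace.proj (𝕜 := ℝ) i).mdifferentiableAt.comp x (hcrd hY)
  let e : Fin m → Eu m := fun i ↦ EuclideanSpace.single i 1
  let Ys : Finset (Fin m) → Π x : N, TangentSpace (𝓡 m) x :=
    fun s ↦ ∑ i ∈ s, f i • fun y ↦ frm c y (e i)
  have key : ∀ s, DiffFieldAt (Ys s) x ∧ leviCivita g (Ys s) x v =
      frm c x (mvfderiv (𝓡 m) (fun y ↦ crd c y (Ys s y)) x v +
        locΓ g c (chartAt (Eu m) c x) (crd c x v) (crd c x (Ys s x))) := by
    intro s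
    induction s using Finset.induction_on with
    | empty =>
      have h0 : Ys ∅ = 0 := by simp [Ys]
      rw [h0]
      refine ⟨mdifferentiableAt_zeroSection .., ?_⟩
      rw [hcov.zero]
      simp [mvfderiv_const]
    | insert i s hi ih =>
      have h1 : Ys (insert i s) = (f i • fun y ↦ frm c y (e i)) + Ys s := by
        simp only [Ys, Finset.sum_insert hi]
      have hs : DiffFieldAt (f i • fun y ↦ frm c y (e i)) x :=
        (hf i).smul_section (diffField_frm hx _)
      rw [h1]
      refine ⟨mdifferentiableAt_add_section hs ih.1, ?_⟩
      have h2 : (fun y ↦ crd c y ((f i • fun y ↦ frm c y (e i)) y)) =ᶠ[𝓝 x]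
          (f i • fun _ ↦ e i) := by
        filter_upwards [hsrc] with y hy
        simp [crd_frm hy]
      have h3 : (fun y ↦ crd c y (((f i • fun y ↦ frm c y (e i)) + Ys s) y)) =
          (fun y ↦ crd c y ((f i • fun y ↦ frm c y (e i)) y)) + fun y ↦ crd c y (Ys s y) := by
        ext1 y; simp
      rw [hcov.add hs ih.1, hcov.leibniz (diffField_frm hx _) (hf i), h3,
        mvfderiv_add (hcrd hs) (hcrd ih.1), h2.mvfderiv_eq,
        mvfderiv_smul (hf i) mdifferentiableAt_const]
      have h4 := leviCivita_frm (g := g) hx (crd c x v) (e i)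
      rw [frm_crd hx] at h4
      simp only [add_apply, smul_apply, ih.2, h4]
      simp [crd_frm hx, mvfderiv_const]
      abel
  have hYe : ∀ᶠ y in 𝓝 x, Y y = Ys Finset.univ y := by
    filter_upwards [hsrc] with y hy
    have : crd c y (Y y) = ∑ i, f i y • e i := by
      ext j; simp [f, e, Finset.sum_apply, Pi.single_apply]
    rw [← frm_crd hy (Y y), this]
    simp [Ys, Finset.sum_apply]
  have h5 := key Finset.univ
  rw [hcov.congr_of_eventuallyEq hY h5.1 Filter.univ_mem hYe, h5.2, hYe.self_of_nhds]
  have h6 : (fun y ↦ crd c y (Y y)) =ᶠ[𝓝 x] fun y ↦ crd c y (Ys Finset.univ y) := by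
    filter_upwards [hYe] with y hy; rw [hy]
  rw [h6.mvfderiv_eq]

end LocalMetric

/-! ### The complex structure in charts, and why it is parallel. -/

section LocalKahlerCharts

variable {n : ℕ} {M : Type*} [TopologicalSpace M] [ChartedSpace (Eu (2 * n)) M]
  [IsManifold (𝓡 (2 * n)) ∞ M]

lemma KahlerStructure.isHermPair (K : KahlerStructure n M) (x : M) :
    IsHermPair (fun v w ↦ K.g.inner x v w) (K.J x) where
  add_left u v w := by simp
  smul_left a v w := by simp
  symm v w := K.g.symm x v w
  pos v hv := K.g.pos x v hv
  J_add v w := by simp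
  J_smul a v := by simp
  J_sq v := K.J_sq x v
  J_orth v w := K.J_orthogonal x v w

/-- Integrability and closedness are assumed for globally smooth fields only. A bump function makes
a coordinate field global without changing it near `x`. -/
lemma exists_smoothField {m : ℕ} {N : Type*} [TopologicalSpace N] [ChartedSpace (Eu m) N]
    [IsManifold (𝓡 m) ∞ N] [T2Space N] {c x : N} (hx : x ∈ (chartAt (Eu m) c).source) (u : Eu m) :
    ∃ X : Π y : N, TangentSpace (𝓡 m) y, SmoothField X ∧ ∀ᶠ y in 𝓝 x, X y = frm c y u := by
  obtain ⟨f, -, hf⟩ := (SmoothBumpFunction.nhds_basis_tsupport (I := 𝓡 m) x).mem_iff.1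
    ((chartAt (Eu m) c).open_source.mem_nhds hx)
  refine ⟨(f : N → ℝ) • fun y ↦ frm c y u, fun y ↦ ?_, ?_⟩
  · by_cases hy : y ∈ tsupport f
    · exact f.contMDiffAt.smul_section (contMDiffAt_frm (hf hy) u)
    · have h0 : ∀ᶠ z in 𝓝 y, f z = 0 := by
        filter_upwards [(isClosed_tsupport f).isOpen_compl.mem_nhds hy] with z hz
        exact image_eq_zero_of_notMem_tsupport hz
      refine ((contMDiffAt_along_iff le_rfl (mem_chart_source (Eu m) y)).2
        ⟨contMDiffAt_id, ?_⟩)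
      refine (contMDiffAt_const (c := (0 : Eu m))).congr_of_eventuallyEq ?_
      filter_upwards [h0] with z hz
      simp [hz]
  · filter_upwards [f.eventuallyEq_one] with y hy
    simp [hy]

variable (K : KahlerStructure n M) (c : M)

/-- The complex structure in the coordinates of the chart at `c`. -/
def locJ (y : Eu (2 * n)) : Eu (2 * n) →L[ℝ] Eu (2 * n) :=
  (crd c ((chartAt (Eu (2 * n)) c).symm y)).comp
    ((K.J ((chartAt (Eu (2 * n)) c).symm y)).comp (frm c ((chartAt (Eu (2 * n)) c).symm y)))

lemma locJ_apply (y u : Eu (2 * n)) : locJ K c y u = crd c ((chartAt (Eu (2 * n)) c).symm y)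
    (K.J ((chartAt (Eu (2 * n)) c).symm y) (frm c ((chartAt (Eu (2 * n)) c).symm y) u)) := rfl

variable {K c}

lemma contMDiffAt_J_along {A : Type*} [TopologicalSpace A] {EA HA : Type*}
    [NormedAddCommGroup EA] [NormedSpace ℝ EA] [TopologicalSpace HA]
    {I : ModelWithCorners ℝ EA HA} [ChartedSpace HA A] (K : KahlerStructure n M)
    {b : A → M} {Y : Π a, TangentSpace (𝓡 (2 * n)) (b a)} {a : A}
    (hY : ContMDiffAt I (𝓡 (2 * n)).tangent ∞
      (fun a ↦ (⟨b a, Y a⟩ : TangentBundle (𝓡 (2 * n)) M)) a) :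
    ContMDiffAt I (𝓡 (2 * n)).tangent ∞
      (fun a ↦ (⟨b a, K.J (b a) (Y a)⟩ : TangentBundle (𝓡 (2 * n)) M)) a := by
  have hb := ((contMDiffAt_along_iff le_rfl (mem_chart_source _ _)).1 hY).1
  exact ContMDiffAt.clm_bundle_apply (F₁ := Eu (2 * n)) (F₂ := Eu (2 * n))
    (E₁ := fun x : M ↦ TangentSpace (𝓡 (2 * n)) x) (E₂ := fun x : M ↦ TangentSpace (𝓡 (2 * n)) x)
    ((K.smooth_J (b a)).comp a hb) hY

lemma crd_J {x : M} (hx : x ∈ (chartAt (Eu (2 * n)) c).source) (v : TangentSpace (𝓡 (2 * n)) x) :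
    crd c x (K.J x v) = locJ K c (chartAt (Eu (2 * n)) c x) (crd c x v) := by
  rw [locJ_apply]
  have h : ∀ x', x' = x → crd c x (K.J x v) = crd c x' (K.J x' (frm c x' (crd c x v))) := by
    rintro x' rfl; rw [frm_crd hx]
  exact h _ ((chartAt (Eu (2 * n)) c).left_inv hx)

lemma contDiffOn_locJ : ContDiffOn ℝ ∞ (locJ K c) (chartAt (Eu (2 * n)) c).target := by
  refine contDiffOn_clm_apply.2 fun u y hy ↦ ?_
  have hx := (chartAt (Eu (2 * n)) c).map_target hy
  have h := ((contMDiffAt_along_iff (b := fun y : M ↦ y) le_rfl hx).1 (contMDiffAt_J_along K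
    (b := fun y : M ↦ y) (contMDiffAt_frm hx u))).2
  exact (ContMDiffAt.comp y h (contMDiffAt_chart_symm hy)).contDiffAt.contDiffWithinAt

lemma isHermPair_loc {y : Eu (2 * n)} (hy : y ∈ (chartAt (Eu (2 * n)) c).target) :
    IsHermPair (fun u v ↦ locG K.g c y u v) (locJ K c y) := by
  have hx := (chartAt (Eu (2 * n)) c).map_target hy
  exact
  { add_left u v w := by simp
    smul_left a v w := by simp
    symm v w := locG_symm y v w
    pos v hv := locG_pos hy hv
    J_add v w := by simp
    J_smul a v := by simp
    J_sq v := by simp [locJ_apply, frm_crd hx, K.J_sq, crd_frm hx]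
    J_orth v w := by simp [locJ_apply, locG_apply, frm_crd hx, K.J_orthogonal] }

lemma diffAt_locJ {y : Eu (2 * n)} (hy : y ∈ (chartAt (Eu (2 * n)) c).target) :
    DifferentiableAt ℝ (locJ K c) y :=
  (contDiffOn_locJ.contDiffAt ((chartAt (Eu (2 * n)) c).open_target.mem_nhds hy)).differentiableAt
    (by simp)

lemma fderiv_locJ_apply {y : Eu (2 * n)} (hy : y ∈ (chartAt (Eu (2 * n)) c).target)
    (a u : Eu (2 * n)) :
    fderiv ℝ (fun z ↦ locJ K c z u) y a = fderiv ℝ (locJ K c) y a u := by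
  rw [((diffAt_locJ (K := K) hy).hasFDerivAt.clm_apply (hasFDerivAt_const u y)).fderiv]
  simp

variable (K c) in
/-- The covariant derivative of `J` in coordinates. -/
def nablaJ (y u v : Eu (2 * n)) : Eu (2 * n) :=
  fderiv ℝ (locJ K c) y u v + locΓ K.g c y u (locJ K c y v) - locJ K c y (locΓ K.g c y u v)

lemma diffField_J_frm {x : M} (hx : x ∈ (chartAt (Eu (2 * n)) c).source) (u : Eu (2 * n)) :
    DiffFieldAt (fun y ↦ K.J y (frm c y u)) x :=
  (contMDiffAt_J_along K (contMDiffAt_frm hx u)).mdifferentiableAt (by simp)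

lemma leviCivita_J_frm {x : M} (hx : x ∈ (chartAt (Eu (2 * n)) c).source)
    (u : Eu (2 * n)) (v : TangentSpace (𝓡 (2 * n)) x) :
    leviCivita K.g (fun y ↦ K.J y (frm c y u)) x v =
      frm c x (fderiv ℝ (locJ K c) (chartAt (Eu (2 * n)) c x) (crd c x v) u +
        locΓ K.g c (chartAt (Eu (2 * n)) c x) (crd c x v)
          (locJ K c (chartAt (Eu (2 * n)) c x) u)) := by
  have hy := (chartAt (Eu (2 * n)) c).map_source hx
  rw [leviCivita_eq hx (diffField_J_frm hx u), crd_J hx, crd_frm hx,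
    mvfderiv_eq_fderiv hx ((mdifferentiableAt_along_iff hx).1 (diffField_J_frm hx u)).2,
    ← fderiv_locJ_apply hy]
  rfl

lemma mlieBracket_eq {x : M} {X Y : Π x : M, TangentSpace (𝓡 (2 * n)) x} (hX : DiffFieldAt X x)
    (hY : DiffFieldAt Y x) (g : RMetric (2 * n) M) :
    mlieBracket (𝓡 (2 * n)) X Y x = leviCivita g Y x (X x) - leviCivita g X x (Y x) :=
  (((leviCivita g).torsion_eq_zero_iff.1 (leviCivita_torsion g)) hX hY).symm

lemma mlieBracket_frm_congr {x : M}
    {X X' Y Y' : Π x : M, TangentSpace (𝓡 (2 * n)) x} (hX : ∀ᶠ y in 𝓝 x, X y = X' y)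
    (hY : ∀ᶠ y in 𝓝 x, Y y = Y' y) :
    mlieBracket (𝓡 (2 * n)) X Y x = mlieBracket (𝓡 (2 * n)) X' Y' x :=
  Filter.EventuallyEq.mlieBracket_vectorField_eq hX hY

variable [T2Space M]

/-- The brackets in the Nijenhuis tensor of two coordinate fields are written with the torsion-free
connection; by symmetry the Christoffel symbols cancel and derivatives of `J` remain. -/
lemma nijenhuis_loc {y : Eu (2 * n)} (hy : y ∈ (chartAt (Eu (2 * n)) c).target)
    (u v : Eu (2 * n)) :
    fderiv ℝ (locJ K c) y (locJ K c y u) v - fderiv ℝ (locJ K c) y (locJ K c y v) u +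
      locJ K c y (fderiv ℝ (locJ K c) y v u) - locJ K c y (fderiv ℝ (locJ K c) y u v) = 0 := by
  obtain ⟨x, hx, rfl⟩ : ∃ x ∈ (chartAt (Eu (2 * n)) c).source, chartAt (Eu (2 * n)) c x = y :=
    ⟨_, (chartAt (Eu (2 * n)) c).map_target hy, (chartAt (Eu (2 * n)) c).right_inv hy⟩
  obtain ⟨X, hXs, hX⟩ := exists_smoothField hx u
  obtain ⟨Y, hYs, hY⟩ := exists_smoothField hx v
  have hJX : ∀ᶠ y in 𝓝 x, K.J y (X y) = K.J y (frm c y u) := by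
    filter_upwards [hX] with y hy; rw [hy]
  have hJY : ∀ᶠ y in 𝓝 x, K.J y (Y y) = K.J y (frm c y v) := by
    filter_upwards [hY] with y hy; rw [hy]
  have h := congrArg (crd c x) (K.integrable X Y hXs hYs x)
  rw [mlieBracket_frm_congr hJX hJY, mlieBracket_frm_congr hX hY, mlieBracket_frm_congr hJX hY,
    mlieBracket_frm_congr hX hJY, mlieBracket_frm hx,
    mlieBracket_eq (diffField_J_frm hx u) (diffField_J_frm hx v) K.g,
    mlieBracket_eq (diffField_J_frm hx u) (diffField_frm hx v) K.g,
    mlieBracket_eq (diffField_frm hx u) (diffField_J_frm hx v) K.g] at h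
  simp only [leviCivita_J_frm hx, leviCivita_eq hx (diffField_frm hx _), map_sub, map_zero,
    crd_J hx, crd_frm hx] at h
  have h0 : ∀ w : Eu (2 * n), mvfderiv (𝓡 (2 * n)) (fun y : M ↦ crd c y (frm c y w)) x = 0 := fun w ↦ by
    have : (fun y : M ↦ crd c y (frm c y w)) =ᶠ[𝓝 x] fun _ ↦ w := by
      filter_upwards [(chartAt (Eu (2 * n)) c).open_source.mem_nhds hx] with y hy using crd_frm hy w
    rw [this.mvfderiv_eq, mvfderiv_const]
  have hs := fun a b ↦ locΓ_symm (g := K.g) hy a b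
  simp only [h0, zero_apply, zero_add, map_add] at h
  rw [hs v, hs u, hs (locJ K c _ v) (locJ K c _ u)] at h
  rw [← h]
  abel

lemma hasFDerivAt_omega {y : Eu (2 * n)} (hy : y ∈ (chartAt (Eu (2 * n)) c).target)
    (a u v : Eu (2 * n)) :
    fderiv ℝ (fun z ↦ locG K.g c z (locJ K c z u) v) y a =
      locG K.g c y (nablaJ K c y a u) v + locG K.g c y (locJ K c y (locΓ K.g c y a u)) v +
        locG K.g c y (locJ K c y u) (locΓ K.g c y a v) := by
  have h := (((diffAt_locG (g := K.g) hy).hasFDerivAt.clm_apply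
    ((diffAt_locJ (K := K) hy).hasFDerivAt.clm_apply (hasFDerivAt_const u y))).clm_apply
      (hasFDerivAt_const v y)).fderiv
  rw [h]
  simp [nablaJ, fderiv_locG hy]
  ring

/-- For a torsion-free connection `dω` is the cyclic sum of `∇ω`, and `∇ω` is `g((∇J)·,·)`. -/
lemma closed_loc {y : Eu (2 * n)} (hy : y ∈ (chartAt (Eu (2 * n)) c).target)
    (u v w : Eu (2 * n)) :
    locG K.g c y (nablaJ K c y u v) w + locG K.g c y (nablaJ K c y v w) u +
      locG K.g c y (nablaJ K c y w u) v = 0 := by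
  obtain ⟨x, hx, rfl⟩ : ∃ x ∈ (chartAt (Eu (2 * n)) c).source, chartAt (Eu (2 * n)) c x = y :=
    ⟨_, (chartAt (Eu (2 * n)) c).map_target hy, (chartAt (Eu (2 * n)) c).right_inv hy⟩
  obtain ⟨X, hXs, hX⟩ := exists_smoothField hx u
  obtain ⟨Y, hYs, hY⟩ := exists_smoothField hx v
  obtain ⟨Z, hZs, hZ⟩ := exists_smoothField hx w
  have h := K.closed X Y Z hXs hYs hZs x
  rw [mlieBracket_frm_congr hX hY, mlieBracket_frm_congr hY hZ, mlieBracket_frm_congr hZ hX,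
    mlieBracket_frm hx, mlieBracket_frm hx, mlieBracket_frm hx, hX.self_of_nhds, hY.self_of_nhds,
    hZ.self_of_nhds] at h
  have key : ∀ {A B : Π x : M, TangentSpace (𝓡 (2 * n)) x} {a b d : Eu (2 * n)},
      (∀ᶠ y in 𝓝 x, A y = frm c y a) → (∀ᶠ y in 𝓝 x, B y = frm c y b) →
      mvfderiv (𝓡 (2 * n)) (fun y ↦ K.g.inner y (K.J y (A y)) (B y)) x (frm c x d) =
        fderiv ℝ (fun z ↦ locG K.g c z (locJ K c z a) b) (chartAt (Eu (2 * n)) c x) d := by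
    intro A B a b d hA hB
    have h1 : (fun y ↦ K.g.inner y (K.J y (A y)) (B y)) =ᶠ[𝓝 x]
        fun y ↦ K.g.inner y (K.J y (frm c y a)) (frm c y b) := by
      filter_upwards [hA, hB] with y hA hB; rw [hA, hB]
    rw [h1.mvfderiv_eq, mvfderiv_eq_fderiv hx
      (mdiff_inner K.g (diffField_J_frm hx a) (diffField_frm hx b)), crd_frm hx]
    refine congrArg (fun L : Eu (2 * n) →L[ℝ] ℝ ↦ L d) (Filter.EventuallyEq.fderiv_eq ?_)
    filter_upwards [(chartAt (Eu (2 * n)) c).open_target.mem_nhds hy] with z hz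
    simp [locG_apply, locJ_apply, frm_crd ((chartAt (Eu (2 * n)) c).map_target hz)]
  rw [key hY hZ, key hZ hX, key hX hY] at h
  simp only [hasFDerivAt_omega hy, map_zero, zero_apply, sub_zero] at h
  have hH := isHermPair_loc (K := K) hy
  have hω : ∀ u v, locG K.g c (chartAt (Eu (2 * n)) c x) (locJ K c (chartAt (Eu (2 * n)) c x) u) v =
      - locG K.g c (chartAt (Eu (2 * n)) c x) (locJ K c (chartAt (Eu (2 * n)) c x) v) u :=
    fun u v ↦ (locG_symm _ _ _).trans (hH.J_right v u)
  rw [locΓ_symm hy w v, locΓ_symm hy w u, locΓ_symm hy v u] at h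
  rw [hω v, hω u (locΓ _ _ _ v w), hω w] at h
  linarith

/-- The classical identity expresses `2 g((∇_u J)v, w)` through `dω(u,v,w)`, `dω(u,Jv,Jw)` and the
Nijenhuis tensor of `v, w` paired with `Ju`. All three vanish here. -/
lemma nablaJ_eq_zero {y : Eu (2 * n)} (hy : y ∈ (chartAt (Eu (2 * n)) c).target)
    (u v : Eu (2 * n)) : nablaJ K c y u v = 0 := by
  have hH := isHermPair_loc (K := K) hy
  set J := locJ K c y with hJ
  set G := locG K.g c y with hG
  set A := nablaJ K c y with hA
  have hJJ : ∀ v, J (J v) = -v := hH.J_sq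
  have hGs : ∀ v w, G v w = G w v := hH.symm
  have hJr : ∀ v w, G v (J w) = -G (J v) w := hH.J_right
  -- Differentiating `J² = -1` shows that `∇_u J` anticommutes with `J`.
  have hAJ : ∀ u v, A u (J v) = -J (A u v) := fun u v ↦ by
    have h1 := (((diffAt_locJ (K := K) hy).hasFDerivAt.clm_apply
      ((diffAt_locJ (K := K) hy).hasFDerivAt.clm_apply (hasFDerivAt_const v y)))).congr_of_eventuallyEq
        (f₁ := fun _ ↦ -v) (by
        filter_upwards [(chartAt (Eu (2 * n)) c).open_target.mem_nhds hy] with z hz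
        exact ((isHermPair_loc (K := K) hz).J_sq v).symm)
    have h2 := congrArg (fun L ↦ L u) (h1.unique (hasFDerivAt_const (-v) y))
    simp only [add_apply, ContinuousLinearMap.comp_apply, ContinuousLinearMap.flip_apply,
      zero_apply, ContinuousLinearMap.comp_zero, zero_add] at h2
    rw [← sub_eq_zero, ← h2]
    simp only [hA, nablaJ, map_add, map_sub, ← hJ, hJJ, map_neg]
    abel
  -- Differentiating the skew symmetry of `ω` shows that `∇_u J` is skew for the metric.
  have hAs : ∀ u v w, G (A u v) w = -G (A u w) v := fun u v w ↦ by
    have h1 := hasFDerivAt_omega (K := K) hy u v w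
    have h2 := hasFDerivAt_omega (K := K) hy u w v
    have h3 : (fun z ↦ locG K.g c z (locJ K c z v) w) =ᶠ[𝓝 y]
        fun z ↦ -locG K.g c z (locJ K c z w) v := by
      filter_upwards [(chartAt (Eu (2 * n)) c).open_target.mem_nhds hy] with z hz
      exact (locG_symm _ _ _).trans ((isHermPair_loc (K := K) hz).J_right w v)
    rw [h3.fderiv_eq, fderiv_fun_neg, neg_apply, h2] at h1
    simp only [← hJ, ← hG, ← hA] at h1
    rw [hGs (J (locΓ _ _ _ _ w)), hJr, hGs (J (locΓ _ _ _ _ v)), hJr] at h1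
    linarith
  have hN : ∀ u v, A (J u) v - A (J v) u + J (A v u) - J (A u v) = 0 := fun u v ↦ by
    rw [← nijenhuis_loc (K := K) hy u v]
    simp only [hA, nablaJ, map_add, map_sub, ← hJ, hJJ]
    rw [locΓ_symm hy (J u) (J v), locΓ_symm hy v (J u), locΓ_symm hy u (J v),
      locΓ_symm hy u v]
    abel
  refine locG_ext (g := K.g) hy fun w ↦ ?_
  have c1 := closed_loc (K := K) hy u v w
  have c2 := closed_loc (K := K) hy u (J v) (J w)
  have hN' := congrArg (fun z ↦ G z (J u)) (hN v w)
  simp only [← hG, ← hA, hAJ, map_add, map_sub, map_neg, add_apply, sub_apply, neg_apply,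
    hJr, hJJ, map_zero, zero_apply] at c1 c2 hN' ⊢
  have e1 := hAs (J v) w (J u)
  have e2 := hAs (J w) v (J u)
  have e3 := hAs v w u
  have e4 := hAs w v u
  simp only [hAJ, hJr, neg_apply, map_neg] at e1 e2 e3 e4
  linarith

variable (K c) in
/-- The Kähler structure in the coordinates of the chart at `c`. -/
def KahlerStructure.loc : LocalKahler (Eu (2 * n)) (chartAt (Eu (2 * n)) c).target where
  G := locG K.g c
  J := locJ K c
  Γ := locΓ K.g c
  isOpen := (chartAt (Eu (2 * n)) c).open_target
  smooth_G := contDiffOn_locG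
  smooth_J := contDiffOn_locJ
  smooth_Γ := contDiffOn_locΓ
  pair _ hy := isHermPair_loc hy
  Γ_symm _ hy := locΓ_symm hy
  dG _ hy := fderiv_locG hy
  dJ y hy u v := by
    have h := nablaJ_eq_zero (K := K) hy u v
    rw [nablaJ, sub_eq_zero] at h
    rw [← h]
    abel

end LocalKahlerCharts

/-! ### Curvature and Ricci tensor of the manifold in coordinates. -/

section RicciCharts

lemma mdifferentiableAt_comp_chart {m : ℕ} {N : Type*} [TopologicalSpace N] [ChartedSpace (Eu m) N]
    [IsManifold (𝓡 m) ∞ N] {F : Type*} [NormedAddCommGroup F] [NormedSpace ℝ F]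
    {c x : N} (hx : x ∈ (chartAt (Eu m) c).source) {φ : Eu m → F}
    (hφ : DifferentiableAt ℝ φ (chartAt (Eu m) c x)) :
    MDifferentiableAt (𝓡 m) 𝓘(ℝ, F) (fun y ↦ φ (chartAt (Eu m) c y)) x :=
  hφ.mdifferentiableAt.comp x (hasMFDerivAt_chart hx).mdifferentiableAt

lemma mvfderiv_comp_chart {m : ℕ} {N : Type*} [TopologicalSpace N] [ChartedSpace (Eu m) N]
    [IsManifold (𝓡 m) ∞ N] {F : Type*} [NormedAddCommGroup F] [NormedSpace ℝ F]
    {c x : N} (hx : x ∈ (chartAt (Eu m) c).source) {φ : Eu m → F}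
    (hφ : DifferentiableAt ℝ φ (chartAt (Eu m) c x)) (v : TangentSpace (𝓡 m) x) :
    mvfderiv (𝓡 m) (fun y ↦ φ (chartAt (Eu m) c y)) x v =
      fderiv ℝ φ (chartAt (Eu m) c x) (crd c x v) := by
  rw [mvfderiv_eq_fderiv hx (mdifferentiableAt_comp_chart hx hφ)]
  refine congrArg (fun L : Eu m →L[ℝ] F ↦ L _) (Filter.EventuallyEq.fderiv_eq ?_)
  filter_upwards [(chartAt (Eu m) c).open_target.mem_nhds ((chartAt (Eu m) c).map_source hx)]
    with z hz
  simp [(chartAt (Eu m) c).right_inv hz]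

variable {n : ℕ} {M : Type*} [TopologicalSpace M] [ChartedSpace (Eu (2 * n)) M]
  [IsManifold (𝓡 (2 * n)) ∞ M] [T2Space M] (K : KahlerStructure n M)

lemma leviCivita_extend {x y : M} (hy : y ∈ (chartAt (Eu (2 * n)) x).source)
    (v w : TangentSpace (𝓡 (2 * n)) x) :
    leviCivita K.g (FiberBundle.extend (Eu (2 * n)) w) y (FiberBundle.extend (Eu (2 * n)) v y) =
      frm x y ((K.loc x).Γ (chartAt (Eu (2 * n)) x y) (crd x x v) (crd x x w)) := by
  have he : ∀ᶠ z in 𝓝 y, frm x z (crd x x w) = FiberBundle.extend (Eu (2 * n)) w z := by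
    filter_upwards [(chartAt (Eu (2 * n)) x).open_source.mem_nhds hy] with z hz
    exact (extend_eq_frm w hz).symm
  have hd : DiffFieldAt (FiberBundle.extend (Eu (2 * n)) w) y := by
    refine (diffField_frm hy (crd x x w)).congr_of_eventuallyEq ?_
    filter_upwards [he] with z hz; rw [hz]
  rw [← (leviCivita K.g).isCovariantDerivativeOn.congr_of_eventuallyEq
    (diffField_frm hy (crd x x w)) hd Filter.univ_mem he, extend_eq_frm v hy, leviCivita_frm hy]
  rfl

/-- The extensions are coordinate fields of one chart: their bracket vanishes, and the inner
covariant derivative is a Christoffel symbol, whose derivative along the outer field produces the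
remaining terms of `Rc`. -/
lemma curvature_extend (x : M) (u v w : TangentSpace (𝓡 (2 * n)) x) :
    curvature K.g (FiberBundle.extend (Eu (2 * n)) u) (FiberBundle.extend (Eu (2 * n)) v)
      (FiberBundle.extend (Eu (2 * n)) w) x =
    frm x x ((K.loc x).Rc (chartAt (Eu (2 * n)) x x) (crd x x u) (crd x x v) (crd x x w)) := by
  have hx := mem_chart_source (Eu (2 * n)) x
  have hy := (chartAt (Eu (2 * n)) x).map_source hx
  have hΓ := (K.loc x).diffAt_Γ hy
  have key : ∀ a b : TangentSpace (𝓡 (2 * n)) x,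
      leviCivita K.g (fun y ↦ leviCivita K.g (FiberBundle.extend (Eu (2 * n)) w) y
        (FiberBundle.extend (Eu (2 * n)) b y)) x (FiberBundle.extend (Eu (2 * n)) a x) =
      frm x x (fderiv ℝ (K.loc x).Γ (chartAt (Eu (2 * n)) x x) (crd x x a) (crd x x b) (crd x x w) +
        (K.loc x).Γ (chartAt (Eu (2 * n)) x x) (crd x x a)
          ((K.loc x).Γ (chartAt (Eu (2 * n)) x x) (crd x x b) (crd x x w))) := by
    intro a b
    have hφ := (hΓ.hasFDerivAt.clm_apply (hasFDerivAt_const (crd x x b) _)).clm_apply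
      (hasFDerivAt_const (crd x x w) _)
    have h1 : ∀ᶠ y in 𝓝 x, leviCivita K.g (FiberBundle.extend (Eu (2 * n)) w) y
        (FiberBundle.extend (Eu (2 * n)) b y) =
        frm x y ((K.loc x).Γ (chartAt (Eu (2 * n)) x y) (crd x x b) (crd x x w)) := by
      filter_upwards [(chartAt (Eu (2 * n)) x).open_source.mem_nhds hx] with z hz
      exact leviCivita_extend K hz b w
    have h2 : (fun y ↦ crd x y (leviCivita K.g (FiberBundle.extend (Eu (2 * n)) w) y
        (FiberBundle.extend (Eu (2 * n)) b y))) =ᶠ[𝓝 x]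
        fun y ↦ (K.loc x).Γ (chartAt (Eu (2 * n)) x y) (crd x x b) (crd x x w) := by
      filter_upwards [h1, (chartAt (Eu (2 * n)) x).open_source.mem_nhds hx] with z hz hz'
      rw [hz, crd_frm hz']
    have h3 : DiffFieldAt (fun y ↦ leviCivita K.g (FiberBundle.extend (Eu (2 * n)) w) y
        (FiberBundle.extend (Eu (2 * n)) b y)) x :=
      (mdifferentiableAt_along_iff (b := fun y : M ↦ y) hx).2 ⟨mdifferentiableAt_id,
        (mdifferentiableAt_comp_chart hx hφ.differentiableAt).congr_of_eventuallyEq h2⟩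
    rw [leviCivita_eq hx h3, h2.mvfderiv_eq, mvfderiv_comp_chart hx hφ.differentiableAt, hφ.fderiv,
      h1.self_of_nhds, FiberBundle.extend_apply_self, crd_frm hx]
    simp
    rfl
  have hbr : mlieBracket (𝓡 (2 * n)) (FiberBundle.extend (Eu (2 * n)) u)
      (FiberBundle.extend (Eu (2 * n)) v) x = 0 := by
    have he : ∀ u : TangentSpace (𝓡 (2 * n)) x, ∀ᶠ z in 𝓝 x,
        FiberBundle.extend (Eu (2 * n)) u z = frm x z (crd x x u) := fun u ↦ by
      filter_upwards [(chartAt (Eu (2 * n)) x).open_source.mem_nhds hx] with z hz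
      exact extend_eq_frm u hz
    rw [mlieBracket_frm_congr (he u) (he v), mlieBracket_frm hx]
  rw [curvature, key, key, hbr, map_zero, sub_zero, LocalKahler.Rc_apply, ← map_sub]
  congr 1
  abel

lemma ricci_eq (x : M) (v w : TangentSpace (𝓡 (2 * n)) x) :
    ricci K.g x v w = ricContr ((K.loc x).Rc (chartAt (Eu (2 * n)) x x)) (crd x x v)
      (crd x x w) := by
  have hx := mem_chart_source (Eu (2 * n)) x
  simp only [ricci, curvature_extend]
  let e : Eu (2 * n) ≃ₗ[ℝ] TangentSpace (𝓡 (2 * n)) x :=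
    { (frm x x).toLinearMap with
      invFun := crd x x
      left_inv := fun u ↦ crd_frm hx u
      right_inv := fun u ↦ frm_crd hx u }
  let A : Eu (2 * n) →ₗ[ℝ] Eu (2 * n) :=
    ((((K.loc x).Rc (chartAt (Eu (2 * n)) x x)).flip (crd x x v)).flip (crd x x w)).toLinearMap
  have h : ricContr ((K.loc x).Rc (chartAt (Eu (2 * n)) x x)) (crd x x v) (crd x x w) =
      LinearMap.trace ℝ _ A := rfl
  rw [h, ← LinearMap.trace_conj' A e, ← traceOf_linear]
  rfl

lemma ricciForm_eq (x : M) (v w : TangentSpace (𝓡 (2 * n)) x) :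
    K.ricciForm x v w = ricContr ((K.loc x).Rc (chartAt (Eu (2 * n)) x x))
      ((K.loc x).J (chartAt (Eu (2 * n)) x x) (crd x x v)) (crd x x w) := by
  rw [KahlerStructure.ricciForm, ricci_eq, crd_J (mem_chart_source _ x)]
  rfl

end RicciCharts

/-! ### Complex frames along a map and their connection matrices. -/

section LocalFrames

open Matrix

variable {E : Type*} [NormedAddCommGroup E] [NormedSpace ℝ E] [FiniteDimensional ℝ E] {n : ℕ}
  {P : Type*} [NormedAddCommGroup P] [NormedSpace ℝ P]

lemma contDiffAt_det {𝔸 : Type*} [NormedCommRing 𝔸] [NormedAlgebra ℝ 𝔸] {k : WithTop ℕ∞}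
    {A : P → Matrix (Fin n) (Fin n) 𝔸} {p : P}
    (hA : ∀ i j, ContDiffAt ℝ k (fun q ↦ A q i j) p) : ContDiffAt ℝ k (fun q ↦ (A q).det) p := by
  simp only [det_apply]
  exact ContDiffAt.sum fun σ _ ↦ (contDiffAt_prod fun i _ ↦ hA _ _).const_smul _

namespace LocalKahler

variable {U : Set E} (K : LocalKahler E U) {f W V : P → E} {v : P → Fin n → E} {p : P}

lemma contDiffAt_hf (hU : f p ∈ U) (hf : ContDiffAt ℝ ∞ f p) (hW : ContDiffAt ℝ ∞ W p)
    (hV : ContDiffAt ℝ ∞ V p) : ContDiffAt ℝ ∞ (fun q ↦ K.hf (f q) (W q) (V q)) p := by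
  have hG : ContDiffAt ℝ ∞ (fun q ↦ K.G (f q)) p :=
    (K.smooth_G.contDiffAt (K.isOpen.mem_nhds hU)).comp p hf
  have hJ : ContDiffAt ℝ ∞ (fun q ↦ K.J (f q)) p :=
    (K.smooth_J.contDiffAt (K.isOpen.mem_nhds hU)).comp p hf
  have h1 : ContDiffAt ℝ ∞ (fun q ↦ K.G (f q) (W q) (V q)) p := (hG.clm_apply hW).clm_apply hV
  have h2 : ContDiffAt ℝ ∞ (fun q ↦ K.G (f q) (K.J (f q) (W q)) (V q)) p :=
    (hG.clm_apply (hJ.clm_apply hW)).clm_apply hV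
  exact (Complex.ofRealCLM.contDiff.contDiffAt.comp p h1).sub
    (contDiffAt_const.mul (Complex.ofRealCLM.contDiff.contDiffAt.comp p h2))

lemma contDiffAt_gm (hU : f p ∈ U) (hf : ContDiffAt ℝ ∞ f p)
    (hv : ∀ k, ContDiffAt ℝ ∞ (fun q ↦ v q k) p) (i j : Fin n) :
    ContDiffAt ℝ ∞ (fun q ↦ K.gm (f q) (v q) i j) p :=
  K.contDiffAt_hf hU hf (hv i) (hv j)

lemma contDiffAt_det_gm (hU : f p ∈ U) (hf : ContDiffAt ℝ ∞ f p)
    (hv : ∀ k, ContDiffAt ℝ ∞ (fun q ↦ v q k) p) :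
    ContDiffAt ℝ ∞ (fun q ↦ (K.gm (f q) (v q)).det) p :=
  contDiffAt_det (K.contDiffAt_gm hU hf hv)

lemma det_gm_ne_zero_iff {y : E} (hy : y ∈ U) (v : Fin n → E) :
    (K.gm y v).det ≠ 0 ↔ IsTRFrame (K.J y) v :=
  ((K.pair y hy).isTRFrame_iff v).symm

lemma eventually_isTRFrame (hU : f p ∈ U) (hf : ContDiffAt ℝ ∞ f p)
    (hv : ∀ k, ContDiffAt ℝ ∞ (fun q ↦ v q k) p) (hT : IsTRFrame (K.J (f p)) (v p)) :
    ∀ᶠ q in 𝓝 p, f q ∈ U ∧ IsTRFrame (K.J (f q)) (v q) := by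
  filter_upwards [hf.continuousAt.eventually (K.isOpen.mem_nhds hU),
    (K.contDiffAt_det_gm hU hf hv).continuousAt.eventually_ne
      ((K.det_gm_ne_zero_iff hU _).2 hT)] with q h1 h2
  exact ⟨h1, (K.det_gm_ne_zero_iff h1 _).1 h2⟩

lemma contDiffAt_cf (hU : f p ∈ U) (hf : ContDiffAt ℝ ∞ f p)
    (hv : ∀ k, ContDiffAt ℝ ∞ (fun q ↦ v q k) p) (hT : IsTRFrame (K.J (f p)) (v p))
    (hW : ContDiffAt ℝ ∞ W p) (i : Fin n) :
    ContDiffAt ℝ ∞ (fun q ↦ K.cf (f q) (v q) (W q) i) p := by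
  have hinv : ∀ j, ContDiffAt ℝ ∞ (fun q ↦ (K.gm (f q) (v q))⁻¹ j i) p := fun j ↦ by
    -- By Cramer's rule the entries of the inverse Gram matrix are smooth wherever its determinant
    -- does not vanish.
    simp only [Matrix.inv_def, Matrix.smul_apply, smul_eq_mul, Ring.inverse_eq_inv', Matrix.adjugate_apply]
    refine ((K.contDiffAt_det_gm hU hf hv).inv ((K.det_gm_ne_zero_iff hU _).2 hT)).mul
      (contDiffAt_det fun a b ↦ ?_)
    simp only [updateRow_apply]
    split_ifs
    · exact contDiffAt_const
    · exact K.contDiffAt_gm hU hf hv _ _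
  exact (ContDiffAt.sum (s := Finset.univ) fun j _ ↦
    (K.contDiffAt_hf hU hf hW (hv j)).mul (hinv j)).congr_of_eventuallyEq (.of_forall fun q ↦ rfl)

lemma contDiffAt_cov (hU : f p ∈ U) (hf : ContDiffAt ℝ ∞ f p) (hW : ContDiffAt ℝ ∞ W p) (a : P) :
    ContDiffAt ℝ ∞ (fun q ↦ K.cov (f q) (fderiv ℝ f q a) (W q) (fderiv ℝ W q a)) p := by
  have hΓ : ContDiffAt ℝ ∞ (fun q ↦ K.Γ (f q)) p :=
    (K.smooth_Γ.contDiffAt (K.isOpen.mem_nhds hU)).comp p hf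
  have hd : ∀ {X : P → E}, ContDiffAt ℝ ∞ X p → ContDiffAt ℝ ∞ (fun q ↦ fderiv ℝ X q a) p :=
    fun hX ↦ (hX.fderiv_right (m := ∞) (by simp)).clm_apply contDiffAt_const
  exact (hd hW).add ((hΓ.clm_apply (hd hf)).clm_apply hW)

/-- The complex connection matrix of the frame `v` along `f`, in the direction `a`. -/
def tau (f : P → E) (v : P → Fin n → E) (p a : P) : Matrix (Fin n) (Fin n) ℂ :=
  of fun i k ↦ K.cf (f p) (v p)
    (K.cov (f p) (fderiv ℝ f p a) (v p k) (fderiv ℝ (fun q ↦ v q k) p a)) i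

lemma contDiffAt_tau (hU : f p ∈ U) (hf : ContDiffAt ℝ ∞ f p)
    (hv : ∀ k, ContDiffAt ℝ ∞ (fun q ↦ v q k) p) (hT : IsTRFrame (K.J (f p)) (v p)) (a : P)
    (i k : Fin n) : ContDiffAt ℝ ∞ (fun q ↦ K.tau f v q a i k) p :=
  K.contDiffAt_cf hU hf hv hT (K.contDiffAt_cov hU hf (hv k) a) i

lemma tau_add (hU : f p ∈ U) (a b : P) : K.tau f v p (a + b) = K.tau f v p a + K.tau f v p b := by
  ext i k
  simp only [tau, of_apply, Matrix.add_apply]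
  rw [← Pi.add_apply]
  refine congrFun ?_ i
  have := (K.pair _ hU).coef_add (v p)
    (K.cov (f p) (fderiv ℝ f p a) (v p k) (fderiv ℝ (fun q ↦ v q k) p a))
    (K.cov (f p) (fderiv ℝ f p b) (v p k) (fderiv ℝ (fun q ↦ v q k) p b))
  refine Eq.trans ?_ this
  simp only [cf, cov]
  congr 1
  simp
  abel

lemma tau_smul (hU : f p ∈ U) (r : ℝ) (a : P) :
    K.tau f v p (r • a) = (r : ℂ) • K.tau f v p a := by
  ext i k
  simp only [tau, of_apply, Matrix.smul_apply]
  have := (K.pair _ hU).coef_smul (v p) r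
    (K.cov (f p) (fderiv ℝ f p a) (v p k) (fderiv ℝ (fun q ↦ v q k) p a))
  refine (congrFun (Eq.trans ?_ this) i).trans ?_
  · simp only [cf, cov]
    congr 1
    simp
  · simp [cf]

/-- With this, derivatives over an arbitrary parameter space reduce to the formulas along curves. -/
lemma fderiv_eq_of_line {F : Type*} [NormedAddCommGroup F] [NormedSpace ℝ F] {φ : P → F} {a : P}
    {φ' : F} (h : DifferentiableAt ℝ φ p) (h' : HasDerivAt (fun t : ℝ ↦ φ (p + t • a)) φ' 0) :
    fderiv ℝ φ p a = φ' :=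
  (hasDerivAt_line h a).unique h'

variable (hE : Module.finrank ℝ E = 2 * n)
include hE

lemma fderiv_det_gm (hU : f p ∈ U) (hf : ContDiffAt ℝ ∞ f p)
    (hv : ∀ k, ContDiffAt ℝ ∞ (fun q ↦ v q k) p) (hT : IsTRFrame (K.J (f p)) (v p)) (a : P) :
    fderiv ℝ (fun q ↦ (K.gm (f q) (v q)).det.re) p a =
      2 * (K.tau f v p a).trace.re * (K.gm (f p) (v p)).det.re := by
  have hd : DifferentiableAt ℝ (fun q ↦ (K.gm (f q) (v q)).det.re) p :=
    Complex.reCLM.differentiableAt.comp p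
      ((K.contDiffAt_det_gm hU hf hv).differentiableAt (by simp))
  refine fderiv_eq_of_line hd ?_
  have h := K.hasDerivAt_det_gm hE (γ := fun t : ℝ ↦ f (p + t • a)) (s := 0) (by simpa using hU)
    (hasDerivAt_line (hf.differentiableAt (by simp)) a) (v := fun t ↦ v (p + t • a))
    (fun k ↦ hasDerivAt_line ((hv k).differentiableAt (by simp)) a) (by simpa using hT)
  simpa [tau, Matrix.trace] using h

/-- In a complex frame the covariant derivative acts on the column `c` of coordinates as `dc + τ c`.
-/
lemma cf_cov (hU : f p ∈ U) (hf : ContDiffAt ℝ ∞ f p)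
    (hv : ∀ k, ContDiffAt ℝ ∞ (fun q ↦ v q k) p) (hT : IsTRFrame (K.J (f p)) (v p))
    (hW : ContDiffAt ℝ ∞ W p) (a : P) (i : Fin n) :
    K.cf (f p) (v p) (K.cov (f p) (fderiv ℝ f p a) (W p) (fderiv ℝ W p a)) i =
      fderiv ℝ (fun q ↦ K.cf (f q) (v q) (W q) i) p a +
        ∑ k, K.cf (f p) (v p) (W p) k * K.tau f v p a i k := by
  have hl : Filter.Tendsto (fun t : ℝ ↦ p + t • a) (𝓝 0) (𝓝 p) := by
    simpa using (line_hasDerivAt p a).continuousAt.tendsto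
  have h := K.cf_cov_combo (γ := fun t : ℝ ↦ f (p + t • a)) (s := 0) (by simpa using hU)
    (hasDerivAt_line (hf.differentiableAt (by simp)) a) (v := fun t ↦ v (p + t • a))
    (fun k ↦ hasDerivAt_line ((hv k).differentiableAt (by simp)) a)
    (c := fun t ↦ K.cf (f (p + t • a)) (v (p + t • a)) (W (p + t • a)))
    (fun k ↦ hasDerivAt_line ((K.contDiffAt_cf hU hf hv hT hW k).differentiableAt (by simp)) a)
    (by simpa using hT) (hasDerivAt_line (hW.differentiableAt (by simp)) a)
    (by
      filter_upwards [hl.eventually (K.eventually_isTRFrame hU hf hv hT)] with t ht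
      exact ((K.pair _ ht.1).combo_coef hE ht.2 _).symm) i
  simpa [tau] using h

omit hE [FiniteDimensional ℝ E] in
-- The second derivatives of `f` and `W` are symmetric and cancel; the derivative of `Γ` and the
-- products of two `Γ` are what defines the curvature.
lemma cov_comm (hU : f p ∈ U) (hf : ContDiffAt ℝ ∞ f p) (hW : ContDiffAt ℝ ∞ W p) (a b : P) :
    K.cov (f p) (fderiv ℝ f p a) (K.cov (f p) (fderiv ℝ f p b) (W p) (fderiv ℝ W p b))
        (fderiv ℝ (fun q ↦ K.cov (f q) (fderiv ℝ f q b) (W q) (fderiv ℝ W q b)) p a) -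
      K.cov (f p) (fderiv ℝ f p b) (K.cov (f p) (fderiv ℝ f p a) (W p) (fderiv ℝ W p a))
        (fderiv ℝ (fun q ↦ K.cov (f q) (fderiv ℝ f q a) (W q) (fderiv ℝ W q a)) p b) =
      K.Rc (f p) (fderiv ℝ f p a) (fderiv ℝ f p b) (W p) := by
  have hdd : ∀ {X : P → E}, ContDiffAt ℝ ∞ X p → HasFDerivAt (fderiv ℝ X) (fderiv ℝ (fderiv ℝ X) p) p :=
    fun hX ↦ ((hX.fderiv_right (m := ∞) (by simp)).differentiableAt (by simp)).hasFDerivAt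
  have hsymm : ∀ {X : P → E}, ContDiffAt ℝ ∞ X p → ∀ a b,
      fderiv ℝ (fderiv ℝ X) p a b = fderiv ℝ (fderiv ℝ X) p b a := fun hX a b ↦
    (hX.isSymmSndFDerivAt (by simp; exact ENat.LEInfty.out)).eq a b
  have key : ∀ a b, fderiv ℝ (fun q ↦ K.cov (f q) (fderiv ℝ f q b) (W q) (fderiv ℝ W q b)) p a =
      fderiv ℝ (fderiv ℝ W) p a b + (fderiv ℝ K.Γ (f p) (fderiv ℝ f p a) (fderiv ℝ f p b) (W p) +
        K.Γ (f p) (fderiv ℝ (fderiv ℝ f) p a b) (W p) +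
        K.Γ (f p) (fderiv ℝ f p b) (fderiv ℝ W p a)) := by
    intro a b
    have hΓ : HasFDerivAt (fun q ↦ K.Γ (f q)) ((fderiv ℝ K.Γ (f p)) ∘L fderiv ℝ f p) p :=
      (K.diffAt_Γ hU).hasFDerivAt.comp p (hf.differentiableAt (by simp)).hasFDerivAt
    have h := ((hdd hW).clm_apply (hasFDerivAt_const b p)).add
      ((hΓ.clm_apply ((hdd hf).clm_apply (hasFDerivAt_const b p))).clm_apply
        (hW.differentiableAt (by simp)).hasFDerivAt)
    refine (congrArg (fun L : P →L[ℝ] E ↦ L a) h.fderiv).trans ?_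
    simp
    abel
  rw [key, key, hsymm hW a b, hsymm hf a b, Rc_apply]
  simp only [cov, map_add]
  abel

/-- In the frame the curvature is `dτ + [τ, τ]`, and commutators have no trace. So the complex trace
of the curvature is exact, with primitive `tr τ`. -/
lemma sum_cf_Rc (hU : f p ∈ U) (hf : ContDiffAt ℝ ∞ f p)
    (hv : ∀ k, ContDiffAt ℝ ∞ (fun q ↦ v q k) p) (hT : IsTRFrame (K.J (f p)) (v p)) (a b : P) :
    ∑ k, K.cf (f p) (v p) (K.Rc (f p) (fderiv ℝ f p a) (fderiv ℝ f p b) (v p k)) k =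
      fderiv ℝ (fun q ↦ (K.tau f v q b).trace) p a -
        fderiv ℝ (fun q ↦ (K.tau f v q a).trace) p b := by
  have hd : ∀ a b, fderiv ℝ (fun q ↦ (K.tau f v q b).trace) p a =
      ∑ k, fderiv ℝ (fun q ↦ K.tau f v q b k k) p a := by
    intro a b
    simp only [Matrix.trace, diag_apply]
    rw [fderiv_fun_sum fun k _ ↦ (K.contDiffAt_tau hU hf hv hT b k k).differentiableAt (by simp)]
    simp
  have key : ∀ a b k, K.cf (f p) (v p) (K.cov (f p) (fderiv ℝ f p a)
        (K.cov (f p) (fderiv ℝ f p b) (v p k) (fderiv ℝ (fun q ↦ v q k) p b))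
        (fderiv ℝ (fun q ↦ K.cov (f q) (fderiv ℝ f q b) (v q k)
          (fderiv ℝ (fun q ↦ v q k) q b)) p a)) k =
      fderiv ℝ (fun q ↦ K.tau f v q b k k) p a + (K.tau f v p a * K.tau f v p b) k k := by
    intro a b k
    rw [K.cf_cov hE hU hf hv hT (K.contDiffAt_cov hU hf (hv k) b) a k, Matrix.mul_apply]
    congr 1
    exact Finset.sum_congr rfl fun j _ ↦ mul_comm _ _
  have hsub : ∀ x y, K.cf (f p) (v p) (x - y) = K.cf (f p) (v p) x - K.cf (f p) (v p) y :=
    fun x y ↦ map_sub ((K.pair _ hU).coefLin (v p)) x y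
  simp only [← K.cov_comm hU hf (hv _) a b, hsub, Pi.sub_apply, key, Finset.sum_sub_distrib,
    Finset.sum_add_distrib, hd]
  have : ∀ A B : Matrix (Fin n) (Fin n) ℂ, ∑ k, (A * B) k k = ∑ k, (B * A) k k :=
    fun A B ↦ trace_mul_comm A B
  rw [this]
  ring

end LocalKahler

end LocalFrames

/-! ### The canonical complex volume form of a totally real plane. -/

section CanonicalForms

open Matrix

variable {n : ℕ} {M : Type*} [TopologicalSpace M] [ChartedSpace (Eu (2 * n)) M]
  [IsManifold (𝓡 (2 * n)) ∞ M]

lemma finrank_tangentSpace {m : ℕ} {N : Type*} [TopologicalSpace N] [ChartedSpace (Eu m) N]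
    (x : N) : Module.finrank ℝ (TangentSpace (𝓡 m) x) = m :=
  (finrank_euclideanSpace (𝕜 := ℝ) (ι := Fin m)).trans (Fintype.card_fin m)

namespace KahlerStructure

variable (K : KahlerStructure n M) (x : M)

/-- The Gram matrix of tangent vectors for the Hermitian metric. -/
def gr (v : Fin n → TangentSpace (𝓡 (2 * n)) x) : Matrix (Fin n) (Fin n) ℂ :=
  gram (fun v w ↦ K.g.inner x v w) (K.J x) v

/-- The complex coordinates of a tangent vector in a totally real frame. -/
def co (v : Fin n → TangentSpace (𝓡 (2 * n)) x) (w : TangentSpace (𝓡 (2 * n)) x) : Fin n → ℂ :=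
  coef (fun v w ↦ K.g.inner x v w) (K.J x) v w

variable {x} {v w u : Fin n → TangentSpace (𝓡 (2 * n)) x}

lemma gr_eq_herm : K.gr x v = of fun i j ↦ K.herm x (v i) (v j) := rfl

/-- The form `v_i^* + i(Jv_i)^*` reads off the `i`-th complex coordinate, so the wedge of all of
them is the determinant of the coordinates. -/
lemma dualForm_apply (hv : IsTRFrame (K.J x) v) (i : Fin n) (z : TangentSpace (𝓡 (2 * n)) x) :
    K.dualForm x v i z = K.co x v z i := by
  have hs : ⊤ ≤ Submodule.span ℝ (Set.range (Sum.elim v fun j ↦ K.J x (v j))) :=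
    (hv.span_eq_top_of_card_eq_finrank' (by simp [finrank_tangentSpace]; ring)).ge
  rw [dualForm, dif_pos ⟨hv, hs⟩]
  have hb : Module.Basis.mk hv hs = IsHermPair.frameBasis (finrank_tangentSpace x) hv := by
    refine Module.Basis.eq_of_apply_eq fun i ↦ (Module.Basis.mk_apply _ _ i).trans ?_
    exact (congrFun (IsHermPair.frameBasis_apply (finrank_tangentSpace x) hv) i).symm
  have key := fun i ↦ congrFun ((K.isHermPair x).frameBasis_repr (finrank_tangentSpace x) hv z) i
  simp only [Module.Basis.equivFun_apply] at key
  simp only [hb, LinearMap.add_apply, LinearMap.comp_apply, Module.Basis.coord_apply]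
  rw [key, key]
  simp only [Sum.elim_inl, Sum.elim_inr]
  conv_rhs => rw [← Complex.re_add_im (K.co x v z i), mul_comm]
  rfl

/-- The matrix of complex coordinates of several vectors. -/
def coM (v w : Fin n → TangentSpace (𝓡 (2 * n)) x) : Matrix (Fin n) (Fin n) ℂ :=
  of fun i j ↦ K.co x v (w j) i

lemma det_gr_eq (hv : IsTRFrame (K.J x) v) (w : Fin n → TangentSpace (𝓡 (2 * n)) x) :
    (K.gr x w).det.re = ‖(K.coM v w).det‖ ^ 2 * (K.gr x v).det.re := by
  have h := (K.isHermPair x).det_gram_combo (K.coM v w)ᵀ v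
  rw [det_transpose] at h
  rw [gr, gr, ← h]
  congr 3
  ext1 j
  exact ((K.isHermPair x).combo_coef (finrank_tangentSpace x) hv (w j)).symm

lemma det_gr_pos (hv : IsTRFrame (K.J x) v) : 0 < (K.gr x v).det.re :=
  (K.isHermPair x).gram_det_re_pos hv

lemma coM_mul (v : Fin n → TangentSpace (𝓡 (2 * n)) x) (hw : IsTRFrame (K.J x) w)
    (u : Fin n → TangentSpace (𝓡 (2 * n)) x) : K.coM v u = K.coM v w * K.coM w u := by
  ext i j
  have h1 := (K.isHermPair x).combo_coef (finrank_tangentSpace x) hw (u j)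
  have h2 : ∀ z, K.co x v z = (K.isHermPair x).coefLin v z := fun _ ↦ rfl
  rw [Matrix.mul_apply]
  change K.co x v (u j) i = ∑ k, K.co x v (w k) i * K.co x w (u j) k
  conv_lhs => rw [← h1]
  rw [h2, combo, map_sum]
  simp only [IsHermPair.coefLin, LinearMap.coe_mk, AddHom.coe_mk, (K.isHermPair x).coef_csmul,
    Finset.sum_apply, Pi.smul_apply, smul_eq_mul]
  exact Finset.sum_congr rfl fun k _ ↦ mul_comm _ _

/-- By `det_gr_eq` every unitary frame gives the same value, and `exists_unitary` provides one; the
supremum is over a single number. -/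
lemma formNorm_wedge (hv : IsTRFrame (K.J x) v) :
    K.formNorm x (wedge (K.dualForm x v)) = (√(K.gr x v).det.re)⁻¹ := by
  have hd := K.det_gr_pos hv
  have key : ∀ u : Fin n → TangentSpace (𝓡 (2 * n)) x,
      (∀ i j, K.herm x (u i) (u j) = if i = j then 1 else 0) →
      ‖wedge (K.dualForm x v) u‖ = (√(K.gr x v).det.re)⁻¹ := by
    intro u hu
    have h1 : K.gr x u = 1 := by
      ext i j; rw [gr_eq_herm, of_apply, hu, one_apply]
    have h2 := K.det_gr_eq hv u
    rw [h1, det_one, Complex.one_re] at h2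
    have h3 : wedge (K.dualForm x v) u = (K.coM v u).det := by
      rw [wedge_apply]; simp only [K.dualForm_apply hv]; rfl
    rw [h3, eq_comm, inv_eq_of_mul_eq_one_left]
    rw [← Real.sqrt_sq (norm_nonneg _), ← Real.sqrt_mul (sq_nonneg _), ← h2, Real.sqrt_one]
  obtain ⟨u, hu⟩ := (K.isHermPair x).exists_unitary hv
  have hu' : ∀ i j, K.herm x (u i) (u j) = if i = j then 1 else 0 := fun i j ↦ by
    rw [← one_apply, ← hu]; rfl
  have : {r | ∃ u : Fin n → TangentSpace (𝓡 (2 * n)) x,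
      (∀ i j, K.herm x (u i) (u j) = if i = j then 1 else 0) ∧
        r = ‖wedge (K.dualForm x v) u‖} = {(√(K.gr x v).det.re)⁻¹} := by
    ext r
    constructor
    · rintro ⟨u, hu, rfl⟩; exact key u hu
    · rintro rfl; exact ⟨u, hu', (key u hu').symm⟩
  rw [formNorm, this, csSup_singleton]

lemma canonicalForm_apply (hv : IsTRFrame (K.J x) v) (w : Fin n → TangentSpace (𝓡 (2 * n)) x) :
    K.canonicalForm x v w = (√(K.gr x v).det.re : ℂ) * (K.coM v w).det := by
  rw [canonicalForm, K.formNorm_wedge hv, inv_inv, AlternatingMap.smul_apply, wedge_apply]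
  simp only [K.dualForm_apply hv]
  rfl

/-- The defining frame `v` has disappeared: by `det_gr_eq` the modulus depends on `w` alone. This
identifies the density of `Vol_J` with the root of a Hermitian Gram determinant. -/
lemma norm_canonicalForm (hv : IsTRFrame (K.J x) v) (w : Fin n → TangentSpace (𝓡 (2 * n)) x) :
    ‖K.canonicalForm x v w‖ = √(K.gr x w).det.re := by
  rw [K.canonicalForm_apply hv, K.det_gr_eq hv w, Real.sqrt_mul (sq_nonneg _),
    Real.sqrt_sq (norm_nonneg _), norm_mul, Complex.norm_real, Real.norm_of_nonneg (Real.sqrt_nonneg _)]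
  ring

lemma coM_real (hv : IsTRFrame (K.J x) v) (A : Matrix (Fin n) (Fin n) ℝ) :
    K.coM v (fun j ↦ ∑ i, A i j • v i) = A.map (fun r ↦ (r : ℂ)) := by
  ext i j
  have h := (K.isHermPair x).coef_combo hv (fun k ↦ (A k j : ℂ))
  rw [IsHermPair.combo_real] at h
  exact congrFun h i

/-- The canonical form of another basis of the same totally real plane. -/
lemma canonicalForm_change (hv : IsTRFrame (K.J x) v) (hw : IsTRFrame (K.J x) w)
    (A : Matrix (Fin n) (Fin n) ℝ) (hA : ∀ j, w j = ∑ i, A i j • v i) :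
    K.canonicalForm x w = (if 0 < A.det then (1 : ℝ) else -1) • K.canonicalForm x v := by
  obtain rfl : w = fun j ↦ ∑ i, A i j • v i := funext hA
  have hC := K.coM_real hv A
  have hdet : (K.coM v (fun j ↦ ∑ i, A i j • v i)).det = (A.det : ℂ) := by
    rw [hC]
    exact (RingHom.map_det Complex.ofRealHom A).symm
  have hg := K.det_gr_eq hv (fun j ↦ ∑ i, A i j • v i)
  rw [hdet, Complex.norm_real, Real.norm_eq_abs, sq_abs] at hg
  have hA0 : A.det ≠ 0 := by
    intro h0
    have := K.det_gr_pos hw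
    rw [hg, h0] at this
    simp at this
  -- The Gram roots of the two frames differ by `|det A|` and the coordinate determinants by `det
  -- A`; what remains is the sign of `det A`.
  ext u
  rw [AlternatingMap.smul_apply, K.canonicalForm_apply hv, K.canonicalForm_apply hw,
    K.coM_mul v hw u, det_mul, hdet, hg, Real.sqrt_mul (sq_nonneg _), Real.sqrt_sq_eq_abs]
  split_ifs with h
  · rw [abs_of_pos h]; push_cast; simp; ring
  · rw [abs_of_neg (lt_of_le_of_ne (not_lt.1 h) hA0)]; push_cast; simp; ring

end KahlerStructure

end CanonicalForms

/-! ### The pulled-back connection in arbitrary charts. -/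

section AlongMap

variable {n : ℕ} {M : Type*} [TopologicalSpace M] [ChartedSpace (Eu (2 * n)) M]
  [IsManifold (𝓡 (2 * n)) ∞ M] {L : Type*} [TopologicalSpace L] [ChartedSpace (Eu n) L]
  [IsManifold (𝓡 n) ∞ L] (K : KahlerStructure n M)

/-- A map in the charts at `c` and `x₀`. -/
def rep (c : L) (x₀ : M) (f : L → M) (y : Eu n) : Eu (2 * n) :=
  chartAt (Eu (2 * n)) x₀ (f ((chartAt (Eu n) c).symm y))

/-- A section along a map in the charts at `c` and `x₀`. -/
def repS (c : L) (x₀ : M) (f : L → M) (Z : Π p : L, TangentSpace (𝓡 (2 * n)) (f p)) (y : Eu n) :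
    Eu (2 * n) :=
  crd x₀ (f ((chartAt (Eu n) c).symm y)) (Z ((chartAt (Eu n) c).symm y))

/-- Differentiability of a section along a map. -/
abbrev DiffAlongAt (f : L → M) (Z : Π p : L, TangentSpace (𝓡 (2 * n)) (f p)) (p : L) : Prop :=
  MDifferentiableAt (𝓡 n) (𝓡 (2 * n)).tangent
    (fun q ↦ (⟨f q, Z q⟩ : TangentBundle (𝓡 (2 * n)) M)) p

variable {K} {c p : L} {x₀ : M} {f : L → M} {Z Z' : Π p : L, TangentSpace (𝓡 (2 * n)) (f p)}

lemma rep_apply (hp : p ∈ (chartAt (Eu n) c).source) :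
    rep c x₀ f (chartAt (Eu n) c p) = chartAt (Eu (2 * n)) x₀ (f p) := by
  rw [rep, (chartAt (Eu n) c).left_inv hp]

lemma repS_apply (hp : p ∈ (chartAt (Eu n) c).source) :
    repS c x₀ f Z (chartAt (Eu n) c p) = crd x₀ (f p) (Z p) := by
  rw [repS]
  exact congrArg (fun q ↦ crd x₀ (f q) (Z q)) ((chartAt (Eu n) c).left_inv hp)

lemma mvfderiv_comp_along {F : Type*} [NormedAddCommGroup F] [NormedSpace ℝ F] {χ : M → F}
    (hχ : MDifferentiableAt (𝓡 (2 * n)) 𝓘(ℝ, F) χ (f p))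
    (hf : MDifferentiableAt (𝓡 n) (𝓡 (2 * n)) f p) (X : TangentSpace (𝓡 n) p) :
    mvfderiv (𝓡 n) (fun q ↦ χ (f q)) p X = mvfderiv (𝓡 (2 * n)) χ (f p) (diffAt f p X) :=
  mfderiv_comp_apply p hχ hf X

lemma crd_diffAt (hp : p ∈ (chartAt (Eu n) c).source)
    (hx : f p ∈ (chartAt (Eu (2 * n)) x₀).source)
    (hf : MDifferentiableAt (𝓡 n) (𝓡 (2 * n)) f p) (v : TangentSpace (𝓡 n) p) :
    crd x₀ (f p) (diffAt f p v) =
      fderiv ℝ (rep c x₀ f) (chartAt (Eu n) c p) (crd c p v) := by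
  have h1 := (hasMFDerivAt_chart hx).comp p hf.hasMFDerivAt
  have h2 := mvfderiv_eq_fderiv hp h1.mdifferentiableAt v
  refine Eq.trans ?_ h2
  exact (congrArg (fun A : TangentSpace (𝓡 n) p →L[ℝ] Eu (2 * n) ↦ A v) h1.mfderiv).symm

lemma mvfderiv_crd_along (hp : p ∈ (chartAt (Eu n) c).source)
    (hx : f p ∈ (chartAt (Eu (2 * n)) x₀).source) (hZ : DiffAlongAt f Z p)
    (v : TangentSpace (𝓡 n) p) :
    mvfderiv (𝓡 n) (fun q ↦ crd x₀ (f q) (Z q)) p v =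
      fderiv ℝ (repS c x₀ f Z) (chartAt (Eu n) c p) (crd c p v) :=
  mvfderiv_eq_fderiv hp ((mdifferentiableAt_along_iff hx).1 hZ).2 v

-- In the chart at `f p` the extension of `Z p` has constant coordinates, so its covariant
-- derivative contributes the Christoffel term only.
variable (K) in
lemma covAlong_center (hf : ContinuousAt f p) (X : TangentSpace (𝓡 n) p) :
    K.covAlong f Z p X = frm (f p) (f p) (mvfderiv (𝓡 n) (fun q ↦ crd (f p) (f q) (Z q)) p X +
      locΓ K.g (f p) (chartAt (Eu (2 * n)) (f p) (f p)) (crd (f p) (f p) (diffAt f p X))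
        (crd (f p) (f p) (Z p))) := by
  have hs := mem_chart_source (Eu (2 * n)) (f p)
  have h1 : (fun q ↦ (trivializationAt (Eu (2 * n)) (TangentSpace (𝓡 (2 * n))) (f p)
      (⟨f q, Z q⟩ : TangentBundle (𝓡 (2 * n)) M)).2) =ᶠ[𝓝 p] fun q ↦ crd (f p) (f q) (Z q) := by
    filter_upwards [hf.eventually ((chartAt (Eu (2 * n)) (f p)).open_source.mem_nhds hs)]
      with q hq using triv_snd hq _
  have h2 : (fun y ↦ crd (f p) y (FiberBundle.extend (Eu (2 * n)) (Z p) y)) =ᶠ[𝓝 (f p)]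
      fun _ ↦ crd (f p) (f p) (Z p) := by
    filter_upwards [(chartAt (Eu (2 * n)) (f p)).open_source.mem_nhds hs] with y hy
    rw [extend_eq_frm _ hy, crd_frm hy]
  rw [KahlerStructure.covAlong, h1.mvfderiv_eq, leviCivita_eq hs (fieldAt_extend _), h2.mvfderiv_eq,
    mvfderiv_const, FiberBundle.extend_apply_self, map_add, map_add, zero_apply, map_zero, zero_add]
  rfl

lemma diffAlongAt_field {Y : Π x : M, TangentSpace (𝓡 (2 * n)) x}
    (hf : MDifferentiableAt (𝓡 n) (𝓡 (2 * n)) f p) (hY : DiffFieldAt Y (f p)) :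
    DiffAlongAt f (fun q ↦ Y (f q)) p :=
  hY.comp p hf

variable (K) in
lemma covAlong_field {Y : Π x : M, TangentSpace (𝓡 (2 * n)) x}
    (hf : MDifferentiableAt (𝓡 n) (𝓡 (2 * n)) f p) (hY : DiffFieldAt Y (f p))
    (X : TangentSpace (𝓡 n) p) :
    K.covAlong f (fun q ↦ Y (f q)) p X = leviCivita K.g Y (f p) (diffAt f p X) := by
  have hs := mem_chart_source (Eu (2 * n)) (f p)
  rw [covAlong_center K hf.continuousAt, leviCivita_eq hs hY,
    mvfderiv_comp_along (χ := fun y ↦ crd (f p) y (Y y)) 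
      ((mdifferentiableAt_along_iff (b := fun y : M ↦ y) hs).1 hY).2 hf]

lemma covAlong_add (hf : ContinuousAt f p) (hZ : DiffAlongAt f Z p) (hZ' : DiffAlongAt f Z' p)
    (X : TangentSpace (𝓡 n) p) :
    K.covAlong f (fun q ↦ Z q + Z' q) p X = K.covAlong f Z p X + K.covAlong f Z' p X := by
  have hs := mem_chart_source (Eu (2 * n)) (f p)
  have h : (fun q ↦ crd (f p) (f q) (Z q + Z' q)) =
      (fun q ↦ crd (f p) (f q) (Z q)) + fun q ↦ crd (f p) (f q) (Z' q) := by ext1 q; simp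
  rw [covAlong_center K hf, covAlong_center K hf, covAlong_center K hf, h,
    mvfderiv_add ((mdifferentiableAt_along_iff hs).1 hZ).2 ((mdifferentiableAt_along_iff hs).1 hZ').2,
    ← map_add]
  congr 1
  simp
  abel

lemma covAlong_smul (hf : ContinuousAt f p) {φ : L → ℝ}
    (hφ : MDifferentiableAt (𝓡 n) 𝓘(ℝ) φ p) (hZ : DiffAlongAt f Z p) (X : TangentSpace (𝓡 n) p) :
    K.covAlong f (fun q ↦ φ q • Z q) p X =
      φ p • K.covAlong f Z p X + mvfderiv (𝓡 n) φ p X • Z p := by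
  have hs := mem_chart_source (Eu (2 * n)) (f p)
  have h : (fun q ↦ crd (f p) (f q) (φ q • Z q)) =
      φ • fun q ↦ crd (f p) (f q) (Z q) := by ext1 q; simp
  rw [covAlong_center K hf, covAlong_center K hf, h,
    mvfderiv_smul hφ ((mdifferentiableAt_along_iff hs).1 hZ).2]
  have h2 : mvfderiv (𝓡 n) φ p X • Z p =
      frm (f p) (f p) (mvfderiv (𝓡 n) φ p X • crd (f p) (f p) (Z p)) := by
    rw [map_smul, frm_crd hs]
  rw [h2, ← map_smul, ← map_add]
  congr 1
  simp
  abel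

lemma covAlong_congr (hf : ContinuousAt f p) (h : ∀ᶠ q in 𝓝 p, Z q = Z' q)
    (X : TangentSpace (𝓡 n) p) : K.covAlong f Z p X = K.covAlong f Z' p X := by
  have h1 : (fun q ↦ crd (f p) (f q) (Z q)) =ᶠ[𝓝 p] fun q ↦ crd (f p) (f q) (Z' q) := by
    filter_upwards [h] with q hq; rw [hq]
  rw [covAlong_center K hf, covAlong_center K hf, h1.mvfderiv_eq, h.self_of_nhds]

lemma DiffAlongAt.add (hf : MDifferentiableAt (𝓡 n) (𝓡 (2 * n)) f p) (hZ : DiffAlongAt f Z p)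
    (hZ' : DiffAlongAt f Z' p) : DiffAlongAt f (fun q ↦ Z q + Z' q) p := by
  have hs := mem_chart_source (Eu (2 * n)) (f p)
  refine (mdifferentiableAt_along_iff hs).2 ⟨hf, ?_⟩
  simp only [map_add]
  exact ((mdifferentiableAt_along_iff hs).1 hZ).2.add ((mdifferentiableAt_along_iff hs).1 hZ').2

lemma DiffAlongAt.smul {φ : L → ℝ} (hf : MDifferentiableAt (𝓡 n) (𝓡 (2 * n)) f p)
    (hφ : MDifferentiableAt (𝓡 n) 𝓘(ℝ) φ p) (hZ : DiffAlongAt f Z p) :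
    DiffAlongAt f (fun q ↦ φ q • Z q) p := by
  have hs := mem_chart_source (Eu (2 * n)) (f p)
  refine (mdifferentiableAt_along_iff hs).2 ⟨hf, ?_⟩
  simp only [map_smul]
  exact hφ.smul ((mdifferentiableAt_along_iff hs).1 hZ).2

/-- Differentiability is proved in the same induction, since the sum rule for `covAlong` requires it
at each step. -/
lemma covAlong_sum {ι : Type*} (s : Finset ι) {φ : ι → L → ℝ}
    {Y : ι → Π x : M, TangentSpace (𝓡 (2 * n)) x}
    (hf : MDifferentiableAt (𝓡 n) (𝓡 (2 * n)) f p)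
    (hφ : ∀ i, MDifferentiableAt (𝓡 n) 𝓘(ℝ) (φ i) p) (hY : ∀ i, DiffFieldAt (Y i) (f p))
    (X : TangentSpace (𝓡 n) p) :
    DiffAlongAt f (fun q ↦ ∑ i ∈ s, φ i q • Y i (f q)) p ∧
      K.covAlong f (fun q ↦ ∑ i ∈ s, φ i q • Y i (f q)) p X =
        ∑ i ∈ s, (φ i p • leviCivita K.g (Y i) (f p) (diffAt f p X) +
          mvfderiv (𝓡 n) (φ i) p X • Y i (f p)) := by
  classical
  have hs := mem_chart_source (Eu (2 * n)) (f p)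
  induction s using Finset.induction_on with
  | empty =>
    simp only [Finset.sum_empty]
    refine ⟨(mdifferentiableAt_along_iff hs).2 ⟨hf, by simpa using mdifferentiableAt_const⟩, ?_⟩
    rw [covAlong_center K hf.continuousAt]
    simp [mvfderiv_const]
  | insert i s hi ih =>
    have h1 := DiffAlongAt.smul hf (hφ i) (diffAlongAt_field hf (hY i))
    simp only [Finset.sum_insert hi]
    refine ⟨h1.add hf ih.1, ?_⟩
    rw [covAlong_add hf.continuousAt h1 ih.1, ih.2,
      covAlong_smul hf.continuousAt (hφ i) (diffAlongAt_field hf (hY i)), covAlong_field K hf (hY i)]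

/-- The covariant derivative along a map in arbitrary charts. -/
lemma crd_covAlong [T2Space M] (hp : p ∈ (chartAt (Eu n) c).source)
    (hx : f p ∈ (chartAt (Eu (2 * n)) x₀).source)
    (hf : MDifferentiableAt (𝓡 n) (𝓡 (2 * n)) f p) (hZ : DiffAlongAt f Z p)
    (X : TangentSpace (𝓡 n) p) :
    crd x₀ (f p) (K.covAlong f Z p X) =
      (K.loc x₀).cov (rep c x₀ f (chartAt (Eu n) c p))
        (fderiv ℝ (rep c x₀ f) (chartAt (Eu n) c p) (crd c p X))
        (repS c x₀ f Z (chartAt (Eu n) c p))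
        (fderiv ℝ (repS c x₀ f Z) (chartAt (Eu n) c p) (crd c p X)) := by
  let e : Fin (2 * n) → Eu (2 * n) := fun i ↦ EuclideanSpace.single i 1
  let φ : Fin (2 * n) → L → ℝ := fun i q ↦ crd x₀ (f q) (Z q) i
  have hcrd := ((mdifferentiableAt_along_iff hx).1 hZ).2
  have hφ : ∀ i, MDifferentiableAt (𝓡 n) 𝓘(ℝ) (φ i) p := fun i ↦
    (EuclideanSpace.proj (𝕜 := ℝ) i).mdifferentiableAt.comp p hcrd
  have hexp : ∀ u : Eu (2 * n), u = ∑ i, u i • e i := fun u ↦ by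
    ext j; simp [e, Finset.sum_apply, Pi.single_apply]
  -- The definition of `covAlong` is tied to the chart at `f p`. Expanding `Z` in the coordinate
  -- fields of the chart at `x₀`, which are fields on `M`, and applying the Leibniz rule frees the
  -- formula from that choice.
  have h1 : ∀ᶠ q in 𝓝 p, Z q = ∑ i, φ i q • frm x₀ (f q) (e i) := by
    filter_upwards [hf.continuousAt.eventually
      ((chartAt (Eu (2 * n)) x₀).open_source.mem_nhds hx)] with q hq
    rw [← frm_crd hq (Z q), hexp (crd x₀ (f q) (Z q)), map_sum]
    simp [φ]
  have hdφ : ∀ i, mvfderiv (𝓡 n) (φ i) p X =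
      mvfderiv (𝓡 n) (fun q ↦ crd x₀ (f q) (Z q)) p X i := fun i ↦ by
    have h2 := ((EuclideanSpace.proj (𝕜 := ℝ) i : Eu (2 * n) →L[ℝ] ℝ).hasMFDerivAt
      (x := crd x₀ (f p) (Z p))).comp p hcrd.hasMFDerivAt
    exact congrArg (fun A : TangentSpace (𝓡 n) p →L[ℝ] ℝ ↦ A X) h2.mfderiv
  rw [covAlong_congr hf.continuousAt h1, (covAlong_sum Finset.univ hf hφ
    (fun i ↦ diffField_frm hx (e i)) X).2, map_sum, rep_apply hp, repS_apply hp,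
    ← crd_diffAt hp hx hf, ← mvfderiv_crd_along hp hx hZ]
  simp only [leviCivita_eq hx (diffField_frm hx _), map_add, map_smul, crd_frm hx]
  have h0 : ∀ i, mvfderiv (𝓡 (2 * n)) (fun y : M ↦ crd x₀ y (frm x₀ y (e i))) (f p) = 0 :=
    fun i ↦ by
    have : (fun y : M ↦ crd x₀ y (frm x₀ y (e i))) =ᶠ[𝓝 (f p)] fun _ ↦ e i := by
      filter_upwards [(chartAt (Eu (2 * n)) x₀).open_source.mem_nhds hx] with y hy
        using crd_frm hy (e i)
    rw [this.mvfderiv_eq, mvfderiv_const]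
  simp only [h0, zero_apply, zero_add, hdφ, Finset.sum_add_distrib, ← map_smul, ← map_sum,
    ← hexp]
  rw [LocalKahler.cov, add_comm]
  congr 2
  exact (hexp _).symm

end AlongMap

/-! ### Coordinate frames of an immersion and the projection `π_J`. -/

section Frames

open Matrix

variable {n : ℕ} {M : Type*} [TopologicalSpace M] [ChartedSpace (Eu (2 * n)) M]
  [IsManifold (𝓡 (2 * n)) ∞ M] {L : Type*} [TopologicalSpace L] [ChartedSpace (Eu n) L]
  [IsManifold (𝓡 n) ∞ L] {K : KahlerStructure n M}
  {c p : L} {x₀ : M} {f : L → M} {Z : Π p : L, TangentSpace (𝓡 (2 * n)) (f p)}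

lemma contDiffAt_rep (hp : p ∈ (chartAt (Eu n) c).source)
    (hx : f p ∈ (chartAt (Eu (2 * n)) x₀).source) (hf : ContMDiffAt (𝓡 n) (𝓡 (2 * n)) ∞ f p) :
    ContDiffAt ℝ ∞ (rep c x₀ f) (chartAt (Eu n) c p) := by
  have h1 : ContMDiffAt (𝓡 (2 * n)) 𝓘(ℝ, Eu (2 * n)) ∞ (chartAt (Eu (2 * n)) x₀) (f p) :=
    (contMDiffOn_chart (n := ∞) (I := 𝓡 (2 * n)) (x := x₀)).contMDiffAt
      ((chartAt (Eu (2 * n)) x₀).open_source.mem_nhds hx)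
  have h2 := ContMDiffAt.comp_of_eq (h1.comp p hf)
    (contMDiffAt_chart_symm ((chartAt (Eu n) c).map_source hp)) ((chartAt (Eu n) c).left_inv hp)
  exact h2.contDiffAt

lemma contDiffAt_repS (hp : p ∈ (chartAt (Eu n) c).source)
    (hx : f p ∈ (chartAt (Eu (2 * n)) x₀).source)
    (hZ : ContMDiffAt (𝓡 n) (𝓡 (2 * n)).tangent ∞
      (fun q ↦ (⟨f q, Z q⟩ : TangentBundle (𝓡 (2 * n)) M)) p) :
    ContDiffAt ℝ ∞ (repS c x₀ f Z) (chartAt (Eu n) c p) := by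
  have h2 := ContMDiffAt.comp_of_eq ((contMDiffAt_along_iff le_rfl hx).1 hZ).2
    (contMDiffAt_chart_symm ((chartAt (Eu n) c).map_source hp)) ((chartAt (Eu n) c).left_inv hp)
  exact h2.contDiffAt

/-- The basis of a tangent space given by a chart. -/
def frmBasis {m : ℕ} {N : Type*} [TopologicalSpace N] [ChartedSpace (Eu m) N]
    [IsManifold (𝓡 m) ∞ N] {c p : N} (hp : p ∈ (chartAt (Eu m) c).source) :
    Module.Basis (Fin m) ℝ (TangentSpace (𝓡 m) p) :=
  (EuclideanSpace.basisFun (Fin m) ℝ).toBasis.map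
    { (frm c p).toLinearMap with
      invFun := crd c p
      left_inv := fun u ↦ crd_frm hp u
      right_inv := fun u ↦ frm_crd hp u }

lemma frmBasis_apply {m : ℕ} {N : Type*} [TopologicalSpace N] [ChartedSpace (Eu m) N]
    [IsManifold (𝓡 m) ∞ N] {c p : N} (hp : p ∈ (chartAt (Eu m) c).source) (i : Fin m) :
    frmBasis hp i = frm c p (EuclideanSpace.single i 1) := by
  simp only [frmBasis, Module.Basis.map_apply]
  rw [OrthonormalBasis.coe_toBasis, EuclideanSpace.basisFun_apply]
  rfl

lemma frmBasis_repr {m : ℕ} {N : Type*} [TopologicalSpace N] [ChartedSpace (Eu m) N]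
    [IsManifold (𝓡 m) ∞ N] {c p : N} (hp : p ∈ (chartAt (Eu m) c).source)
    (v : TangentSpace (𝓡 m) p) (i : Fin m) : (frmBasis hp).repr v i = crd c p v i := rfl

/-- The partial derivatives of a map. -/
def jf {E : Type*} [NormedAddCommGroup E] [NormedSpace ℝ E] (φ : Eu n → E) (y : Eu n)
    (k : Fin n) : E :=
  fderiv ℝ φ y (EuclideanSpace.single k 1)

lemma contDiffAt_jf {E : Type*} [NormedAddCommGroup E] [NormedSpace ℝ E] {φ : Eu n → E} {y : Eu n}
    (h : ContDiffAt ℝ ∞ φ y) (k : Fin n) : ContDiffAt ℝ ∞ (fun z ↦ jf φ z k) y :=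
  (h.fderiv_right (m := ∞) (by simp)).clm_apply contDiffAt_const

lemma crd_diffAt_frm (hp : p ∈ (chartAt (Eu n) c).source)
    (hx : f p ∈ (chartAt (Eu (2 * n)) x₀).source)
    (hf : MDifferentiableAt (𝓡 n) (𝓡 (2 * n)) f p) (k : Fin n) :
    crd x₀ (f p) (diffAt f p (frmBasis hp k)) = jf (rep c x₀ f) (chartAt (Eu n) c p) k := by
  rw [crd_diffAt hp hx hf, frmBasis_apply, crd_frm hp, jf]

lemma linearIndependent_sum_J {f : L → M} (hinj : Function.Injective (diffAt (n := n) f p))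
    (hd : tangentPlane f p ⊓ K.jPlane f p = ⊥)
    (b : Module.Basis (Fin n) ℝ (TangentSpace (𝓡 n) p)) :
    IsTRFrame (K.J (f p)) (fun i ↦ diffAt f p (b i)) := by
  have hJ : Function.Injective (K.J (f p)) := fun v w h ↦ by
    have := congrArg (K.J (f p)) h
    rwa [K.J_sq, K.J_sq, neg_inj] at this
  have h1 : LinearIndependent ℝ (fun i ↦ diffAt f p (b i)) :=
    b.linearIndependent.map' (diffAt f p).toLinearMap (LinearMap.ker_eq_bot.2 hinj)
  refine h1.sum_type (h1.map' (K.J (f p)).toLinearMap (LinearMap.ker_eq_bot.2 hJ)) ?_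
  refine (disjoint_iff.2 hd).mono (Submodule.span_le.2 ?_) (Submodule.span_le.2 ?_)
  · rintro _ ⟨i, rfl⟩; exact ⟨b i, rfl⟩
  · rintro _ ⟨i, rfl⟩; exact ⟨_, ⟨b i, rfl⟩, rfl⟩

lemma KahlerStructure.IsTotallyReal.isTRFrame (hf : K.IsTotallyReal f)
    (b : Module.Basis (Fin n) ℝ (TangentSpace (𝓡 n) p)) :
    IsTRFrame (K.J (f p)) (fun i ↦ diffAt f p (b i)) :=
  linearIndependent_sum_J (hf.injective p) (hf.disjoint p) b

lemma diffAt_eq_sum (b : Module.Basis (Fin n) ℝ (TangentSpace (𝓡 n) p))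
    (v : TangentSpace (𝓡 n) p) : diffAt f p v = ∑ k, b.repr v k • diffAt f p (b k) := by
  conv_lhs => rw [← b.sum_repr v, map_sum]
  simp only [map_smul]

/-- The complex coordinates of a tangent vector are its real coordinates. -/
lemma co_diffAt {b : Module.Basis (Fin n) ℝ (TangentSpace (𝓡 n) p)}
    (hT : IsTRFrame (K.J (f p)) (fun i ↦ diffAt f p (b i))) (v : TangentSpace (𝓡 n) p) :
    K.co (f p) (fun i ↦ diffAt f p (b i)) (diffAt f p v) = fun k ↦ (b.repr v k : ℂ) := by
  rw [diffAt_eq_sum b, ← IsHermPair.combo_real (J := K.J (f p))]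
  exact (K.isHermPair (f p)).coef_combo hT _

/-- Tangent vectors have real coordinates in the frame and their images under `J` imaginary ones, so
a common vector is zero. -/
lemma disjoint_of_isTRFrame {b : Module.Basis (Fin n) ℝ (TangentSpace (𝓡 n) p)}
    (hT : IsTRFrame (K.J (f p)) (fun i ↦ diffAt f p (b i))) :
    Function.Injective (diffAt (n := n) f p) ∧ tangentPlane f p ⊓ K.jPlane f p = ⊥ := by
  constructor
  · refine (injective_iff_map_eq_zero _).2 fun v hv ↦ ?_
    have h1 := co_diffAt hT v
    rw [hv] at h1
    refine b.repr.injective ?_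
    ext k
    have h2 := congrFun h1 k
    have h3 : K.co (f p) (fun i ↦ diffAt f p (b i)) 0 = 0 :=
      map_zero ((K.isHermPair (f p)).coefLin _)
    rw [h3] at h2
    simpa using h2.symm
  · rw [eq_bot_iff]
    rintro _ ⟨⟨v, rfl⟩, ⟨_, ⟨w, rfl⟩, hw⟩⟩
    have h1 := co_diffAt hT v
    have h2 := (K.isHermPair (f p)).coef_J (fun i ↦ diffAt f p (b i)) (diffAt f p w)
    have h3 : ∀ k, b.repr v k = 0 := fun k ↦ by
      have h4 := congrFun (co_diffAt hT w) k
      have h5 : K.J (f p) (diffAt f p w) = diffAt f p v := hw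
      have h6 : K.co (f p) (fun i ↦ diffAt f p (b i)) (diffAt f p v) k =
          Complex.I * K.co (f p) (fun i ↦ diffAt f p (b i)) (diffAt f p w) k := by
        rw [← h5]; exact congrFun h2 k
      rw [h1, h4] at h6
      simpa using congrArg Complex.re h6
    have : v = 0 := b.repr.injective (by ext k; simpa using h3 k)
    rw [this]; simp

lemma isTotallyReal_of_isTRFrame (hf : ContMDiff (𝓡 n) (𝓡 (2 * n)) ∞ f)
    (h : ∀ p, ∃ b : Module.Basis (Fin n) ℝ (TangentSpace (𝓡 n) p),
      IsTRFrame (K.J (f p)) (fun i ↦ diffAt f p (b i))) : K.IsTotallyReal f where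
  smooth := hf
  injective p := (disjoint_of_isTRFrame (h p).choose_spec).1
  disjoint p := (disjoint_of_isTRFrame (h p).choose_spec).2

/-- Splitting complex coordinates into real and imaginary parts is the splitting into the tangent
plane and its image under `J`; `π_J` keeps the imaginary parts. -/
lemma piJ_apply {b : Module.Basis (Fin n) ℝ (TangentSpace (𝓡 n) p)}
    (hT : IsTRFrame (K.J (f p)) (fun i ↦ diffAt f p (b i)))
    (w : TangentSpace (𝓡 (2 * n)) (f p)) :
    K.piJ f p w = K.J (f p) (diffAt f p
      (∑ k, (K.co (f p) (fun i ↦ diffAt f p (b i)) w k).im • b k)) := by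
  set a := K.co (f p) (fun i ↦ diffAt f p (b i)) w
  have hw : w = diffAt f p (∑ k, (a k).re • b k) + K.J (f p) (diffAt f p (∑ k, (a k).im • b k)) := by
    have := (K.isHermPair (f p)).combo_coef (finrank_tangentSpace (f p)) hT w
    conv_lhs => rw [← this]
    simp [combo, csmul, Finset.sum_add_distrib, a, KahlerStructure.co]
  have hc : IsCompl (K.jPlane f p) (tangentPlane f p) := by
    refine ⟨(disjoint_iff.2 (disjoint_of_isTRFrame hT).2).symm, codisjoint_iff.2 ?_⟩
    rw [eq_top_iff]
    intro z _
    have := (K.isHermPair (f p)).combo_coef (finrank_tangentSpace (f p)) hT z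
    rw [← this, combo]
    refine Submodule.sum_mem _ fun k _ ↦ add_mem ?_ ?_
    · exact Submodule.mem_sup_right (Submodule.smul_mem _ _ ⟨b k, rfl⟩)
    · exact Submodule.mem_sup_left (Submodule.smul_mem _ _ ⟨_, ⟨b k, rfl⟩, rfl⟩)
  rw [KahlerStructure.piJ, dif_pos hc]
  conv_lhs => rw [hw]
  have h1 : (K.jPlane f p).projection (tangentPlane f p) hc
      (diffAt f p (∑ k, (a k).re • b k)) = 0 :=
    (Submodule.projection_apply_eq_zero_iff hc).2 ⟨_, rfl⟩
  rw [map_add, h1, zero_add]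
  exact Submodule.projection_apply_of_mem_left hc ⟨_, ⟨_, rfl⟩, rfl⟩

section Transport

variable {x : M} [T2Space M]

lemma hform_eq_hf (hx : x ∈ (chartAt (Eu (2 * n)) x₀).source)
    (v w : TangentSpace (𝓡 (2 * n)) x) :
    hform (fun v w ↦ K.g.inner x v w) (K.J x) v w =
      (K.loc x₀).hf (chartAt (Eu (2 * n)) x₀ x) (crd x₀ x v) (crd x₀ x w) := by
  simp only [hform, LocalKahler.hf, inner_eq_locG hx, crd_J hx]
  rfl

lemma gr_eq_gm (hx : x ∈ (chartAt (Eu (2 * n)) x₀).source)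
    (v : Fin n → TangentSpace (𝓡 (2 * n)) x) :
    K.gr x v = (K.loc x₀).gm (chartAt (Eu (2 * n)) x₀ x) (fun k ↦ crd x₀ x (v k)) := by
  ext i j
  exact hform_eq_hf hx _ _

lemma co_eq_cf (hx : x ∈ (chartAt (Eu (2 * n)) x₀).source)
    (v : Fin n → TangentSpace (𝓡 (2 * n)) x) (w : TangentSpace (𝓡 (2 * n)) x) :
    K.co x v w = (K.loc x₀).cf (chartAt (Eu (2 * n)) x₀ x) (fun k ↦ crd x₀ x (v k))
      (crd x₀ x w) := by
  have h := gr_eq_gm (K := K) hx v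
  simp only [KahlerStructure.gr, LocalKahler.gm] at h
  simp only [KahlerStructure.co, LocalKahler.cf, coef, h]
  congr 1
  ext1 j
  exact hform_eq_hf hx _ _

lemma isTRFrame_crd_iff (hx : x ∈ (chartAt (Eu (2 * n)) x₀).source)
    (v : Fin n → TangentSpace (𝓡 (2 * n)) x) :
    IsTRFrame (K.J x) v ↔
      IsTRFrame ((K.loc x₀).J (chartAt (Eu (2 * n)) x₀ x)) (fun k ↦ crd x₀ x (v k)) := by
  rw [(K.isHermPair x).isTRFrame_iff, ← (K.loc x₀).det_gm_ne_zero_iff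
    ((chartAt (Eu (2 * n)) x₀).map_source hx), ← gr_eq_gm (K := K) hx]
  rfl

end Transport

end Frames

/-! ### The Maslov form, the divergence and the canonical section in charts. -/

section MaslovOmega

open Matrix

variable {n : ℕ} {M : Type*} [TopologicalSpace M] [ChartedSpace (Eu (2 * n)) M]
  [IsManifold (𝓡 (2 * n)) ∞ M] {L : Type*} [TopologicalSpace L] [ChartedSpace (Eu n) L]
  [IsManifold (𝓡 n) ∞ L] {K : KahlerStructure n M}
  {c p : L} {x₀ : M} {f : L → M} {Z : Π p : L, TangentSpace (𝓡 (2 * n)) (f p)}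

lemma contMDiffAt_diffAt (hf : ContMDiff (𝓡 n) (𝓡 (2 * n)) ∞ f)
    {Y : Π p : L, TangentSpace (𝓡 n) p}
    (hY : ContMDiffAt (𝓡 n) (𝓡 n).tangent ∞ (fun q ↦ (⟨q, Y q⟩ : TangentBundle (𝓡 n) L)) p) :
    ContMDiffAt (𝓡 n) (𝓡 (2 * n)).tangent ∞
      (fun q ↦ (⟨f q, diffAt f q (Y q)⟩ : TangentBundle (𝓡 (2 * n)) M)) p :=
  ((hf.contMDiff_tangentMap (m := ∞) (by simp)).contMDiffAt).comp p hY

lemma exists_covAlong_linear (hf : ContinuousAt f p) :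
    ∃ A : TangentSpace (𝓡 n) p →L[ℝ] TangentSpace (𝓡 (2 * n)) (f p),
      ∀ X, K.covAlong f Z p X = A X := by
  refine ⟨frm (f p) (f p) ∘L (mvfderiv (𝓡 n) (fun q ↦ crd (f p) (f q) (Z q)) p +
    (locΓ K.g (f p) (chartAt (Eu (2 * n)) (f p) (f p))).flip (crd (f p) (f p) (Z p)) ∘L
      crd (f p) (f p) ∘L diffAt f p), fun X ↦ ?_⟩
  rw [covAlong_center K hf]
  rfl

variable [T2Space M]

lemma isTRFrame_jf (hp : p ∈ (chartAt (Eu n) c).source)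
    (hx : f p ∈ (chartAt (Eu (2 * n)) x₀).source)
    (hf : MDifferentiableAt (𝓡 n) (𝓡 (2 * n)) f p) :
    IsTRFrame (K.J (f p)) (fun k ↦ diffAt f p (frmBasis hp k)) ↔
      IsTRFrame ((K.loc x₀).J (rep c x₀ f (chartAt (Eu n) c p)))
        (jf (rep c x₀ f) (chartAt (Eu n) c p)) := by
  rw [isTRFrame_crd_iff hx, rep_apply hp]
  simp only [crd_diffAt_frm hp hx hf]

lemma co_covAlong (hp : p ∈ (chartAt (Eu n) c).source)
    (hx : f p ∈ (chartAt (Eu (2 * n)) x₀).source)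
    (hf : MDifferentiableAt (𝓡 n) (𝓡 (2 * n)) f p) (hZ : DiffAlongAt f Z p)
    (X : TangentSpace (𝓡 n) p) :
    K.co (f p) (fun k ↦ diffAt f p (frmBasis hp k)) (K.covAlong f Z p X) =
      (K.loc x₀).cf (rep c x₀ f (chartAt (Eu n) c p)) (jf (rep c x₀ f) (chartAt (Eu n) c p))
        ((K.loc x₀).cov (rep c x₀ f (chartAt (Eu n) c p))
          (fderiv ℝ (rep c x₀ f) (chartAt (Eu n) c p) (crd c p X))
          (repS c x₀ f Z (chartAt (Eu n) c p))
          (fderiv ℝ (repS c x₀ f Z) (chartAt (Eu n) c p) (crd c p X))) := by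
  rw [co_eq_cf hx, crd_covAlong hp hx hf hZ, rep_apply hp]
  simp only [crd_diffAt_frm hp hx hf]

lemma rep_mem (hp : p ∈ (chartAt (Eu n) c).source)
    (hx : f p ∈ (chartAt (Eu (2 * n)) x₀).source) :
    rep c x₀ f (chartAt (Eu n) c p) ∈ (chartAt (Eu (2 * n)) x₀).target := by
  rw [rep_apply hp]
  exact (chartAt (Eu (2 * n)) x₀).map_source hx

lemma eventually_chart (hp : p ∈ (chartAt (Eu n) c).source) {Q : L → Prop}
    (h : ∀ᶠ q in 𝓝 p, Q q) :
    ∀ᶠ y in 𝓝 (chartAt (Eu n) c p), Q ((chartAt (Eu n) c).symm y) ∧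
      (chartAt (Eu n) c).symm y ∈ (chartAt (Eu n) c).source ∧
        chartAt (Eu n) c ((chartAt (Eu n) c).symm y) = y := by
  have hy := (chartAt (Eu n) c).map_source hp
  have h1 := ((chartAt (Eu n) c).continuousAt_symm hy).tendsto
  rw [(chartAt (Eu n) c).left_inv hp] at h1
  filter_upwards [h1.eventually h, (chartAt (Eu n) c).open_target.mem_nhds hy] with y h2 h3
  exact ⟨h2, (chartAt (Eu n) c).map_target h3, (chartAt (Eu n) c).right_inv h3⟩

lemma eventually_isTRFrame_chart (hp : p ∈ (chartAt (Eu n) c).source)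
    (hx : f p ∈ (chartAt (Eu (2 * n)) x₀).source) (hf : ContMDiff (𝓡 n) (𝓡 (2 * n)) ∞ f)
    (hT : IsTRFrame (K.J (f p)) (fun k ↦ diffAt f p (frmBasis hp k))) :
    ∀ᶠ q in 𝓝 p, f q ∈ (chartAt (Eu (2 * n)) x₀).source ∧ ∀ hq : q ∈ (chartAt (Eu n) c).source,
      IsTRFrame (K.J (f q)) (fun k ↦ diffAt f q (frmBasis hq k)) := by
  have hfd : ∀ q, MDifferentiableAt (𝓡 n) (𝓡 (2 * n)) f q := fun q ↦
    (hf q).mdifferentiableAt (by simp)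
  have hF := contDiffAt_rep hp hx (hf p)
  have h1 := (K.loc x₀).eventually_isTRFrame (rep_mem (f := f) hp hx) hF (contDiffAt_jf hF)
    ((isTRFrame_jf hp hx (hfd p)).1 hT)
  have h2 := ((chartAt (Eu n) c).continuousAt hp).eventually h1
  filter_upwards [h2, (hf p).continuousAt.eventually
    ((chartAt (Eu (2 * n)) x₀).open_source.mem_nhds hx)] with q h3 h4
  exact ⟨h4, fun hq ↦ (isTRFrame_jf hq h4 (hfd q)).2 h3.2⟩

lemma cf_repS_diffAt {q : L} (hq : q ∈ (chartAt (Eu n) c).source)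
    (hx : f q ∈ (chartAt (Eu (2 * n)) x₀).source)
    (hf : MDifferentiableAt (𝓡 n) (𝓡 (2 * n)) f q)
    (W : Π p : L, TangentSpace (𝓡 (2 * n)) (f p)) :
    (K.loc x₀).cf (rep c x₀ f (chartAt (Eu n) c q)) (jf (rep c x₀ f) (chartAt (Eu n) c q))
      (repS c x₀ f W (chartAt (Eu n) c q)) =
    K.co (f q) (fun k ↦ diffAt f q (frmBasis hq k)) (W q) := by
  rw [co_eq_cf hx, rep_apply hq, repS_apply hq]
  simp only [crd_diffAt_frm hq hx hf]

/-- The imaginary part of the covariant derivative of a tangential field. -/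
lemma im_co_covAlong_diffAt (hp : p ∈ (chartAt (Eu n) c).source)
    (hx : f p ∈ (chartAt (Eu (2 * n)) x₀).source) (hf : ContMDiff (𝓡 n) (𝓡 (2 * n)) ∞ f)
    (hT : IsTRFrame (K.J (f p)) (fun k ↦ diffAt f p (frmBasis hp k)))
    {Y : Π p : L, TangentSpace (𝓡 n) p}
    (hY : ContMDiffAt (𝓡 n) (𝓡 n).tangent ∞ (fun q ↦ (⟨q, Y q⟩ : TangentBundle (𝓡 n) L)) p)
    (X : TangentSpace (𝓡 n) p) (i : Fin n) :
    (K.co (f p) (fun k ↦ diffAt f p (frmBasis hp k))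
      (K.covAlong f (fun q ↦ diffAt f q (Y q)) p X) i).im =
      ∑ k, ((K.loc x₀).tau (rep c x₀ f) (jf (rep c x₀ f)) (chartAt (Eu n) c p) (crd c p X) i k).im *
        (frmBasis hp).repr (Y p) k := by
  have hfd : ∀ q, MDifferentiableAt (𝓡 n) (𝓡 (2 * n)) f q := fun q ↦
    (hf q).mdifferentiableAt (by simp)
  have hW := contMDiffAt_diffAt hf hY
  have hF := contDiffAt_rep hp hx (hf p)
  have hU := rep_mem (f := f) hp hx
  have hT' := (isTRFrame_jf hp hx (hfd p)).1 hT
  have hWc := contDiffAt_repS hp hx hW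
  -- A tangential field has real coordinates near `p`, so their derivative has no imaginary part
  -- either. In `dc + τ c` only the connection term contributes.
  have h1 : ∀ᶠ y in 𝓝 (chartAt (Eu n) c p), ((K.loc x₀).cf (rep c x₀ f y) (jf (rep c x₀ f) y)
      (repS c x₀ f (fun q ↦ diffAt f q (Y q)) y) i).im = 0 := by
    filter_upwards [eventually_chart hp (eventually_isTRFrame_chart hp hx hf hT)]
      with y ⟨⟨hx', hT'⟩, hq, hqy⟩
    rw [← hqy, cf_repS_diffAt hq hx' (hfd _), co_diffAt (hT' hq)]
    simp
  have h2 : (fderiv ℝ (fun y ↦ (K.loc x₀).cf (rep c x₀ f y) (jf (rep c x₀ f) y)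
      (repS c x₀ f (fun q ↦ diffAt f q (Y q)) y) i) (chartAt (Eu n) c p) (crd c p X)).im = 0 := by
    have hd := ((K.loc x₀).contDiffAt_cf hU hF (contDiffAt_jf hF) hT' hWc i).differentiableAt
      (by simp)
    have h3 := (Complex.imCLM.hasFDerivAt.comp _ hd.hasFDerivAt).unique
      ((hasFDerivAt_const (0 : ℝ) (chartAt (Eu n) c p)).congr_of_eventuallyEq h1)
    exact congrArg (fun A : Eu n →L[ℝ] ℝ ↦ A (crd c p X)) h3
  rw [co_covAlong hp hx (hfd p) (hW.mdifferentiableAt (by simp)),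
    (K.loc x₀).cf_cov (by simp) hU hF (contDiffAt_jf hF) hT' hWc, Complex.add_im, h2, zero_add,
    Complex.im_sum]
  refine Finset.sum_congr rfl fun k _ ↦ ?_
  rw [cf_repS_diffAt hp hx (hfd p), co_diffAt hT, Complex.im_ofReal_mul, mul_comm]

lemma traceOf_eq_matrix_trace {V : Type*} [AddCommGroup V] [Module ℝ V] [FiniteDimensional ℝ V]
    (b : Module.Basis (Fin n) ℝ V) (A : V → V) (m : Matrix (Fin n) (Fin n) ℝ)
    (h : ∀ v, A v = ∑ i, (∑ k, m i k * b.repr v k) • b i) : traceOf A = m.trace := by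
  have h1 : A = Matrix.toLin b b m := by
    ext v
    rw [h, Matrix.toLin_apply]
    rfl
  rw [h1, traceOf_linear, LinearMap.trace_eq_matrix_trace ℝ b, LinearMap.toMatrix_toLin]

/-- The Maslov form in charts. -/
lemma maslovForm_eq (hp : p ∈ (chartAt (Eu n) c).source)
    (hx : f p ∈ (chartAt (Eu (2 * n)) x₀).source) (hf : ContMDiff (𝓡 n) (𝓡 (2 * n)) ∞ f)
    (hT : IsTRFrame (K.J (f p)) (fun k ↦ diffAt f p (frmBasis hp k)))
    (X : TangentSpace (𝓡 n) p) :
    K.maslovForm f p X =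
      -((K.loc x₀).tau (rep c x₀ f) (jf (rep c x₀ f)) (chartAt (Eu n) c p) (crd c p X)).trace.im := by
  have hinj := (disjoint_of_isTRFrame hT).1
  rw [KahlerStructure.maslovForm, traceOf_eq_matrix_trace (frmBasis hp) _
    (of fun i k ↦ -((K.loc x₀).tau (rep c x₀ f) (jf (rep c x₀ f)) (chartAt (Eu n) c p)
      (crd c p X) i k).im)]
  · simp [Matrix.trace]
  · intro v
    have hY : ContMDiffAt (𝓡 n) (𝓡 n).tangent ∞
        (fun q ↦ (⟨q, FiberBundle.extend (Eu n) v q⟩ : TangentBundle (𝓡 n) L)) p := by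
      refine (contMDiffAt_frm (mem_chart_source _ p) (crd p p v)).congr_of_eventuallyEq ?_
      filter_upwards [(chartAt (Eu n) p).open_source.mem_nhds (mem_chart_source _ p)] with q hq
      rw [extend_eq_frm v hq]
    -- Applying `J` to `π_J w` gives minus the tangent vector with the imaginary parts as
    -- coordinates. This is the sign in the formula for the Maslov form.
    rw [piJ_apply hT, K.J_sq, ← map_neg, Function.leftInverse_invFun hinj, ← Finset.sum_neg_distrib]
    refine Finset.sum_congr rfl fun i _ ↦ ?_
    rw [im_co_covAlong_diffAt hp hx hf hT hY, ← neg_smul, ← Finset.sum_neg_distrib]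
    simp only [FiberBundle.extend_apply_self, of_apply, neg_mul]

/-- The divergence, with respect to the `J`-volume, of a section along an immersion. -/
def KahlerStructure.divJ (K : KahlerStructure n M) (f : L → M)
    (Z : Π p : L, TangentSpace (𝓡 (2 * n)) (f p)) (p : L) : ℝ :=
  traceOf fun X : TangentSpace (𝓡 n) p ↦ Function.invFun (diffAt f p)
    (K.covAlong f Z p X - K.piJ f p (K.covAlong f Z p X))

lemma sub_piJ {b : Module.Basis (Fin n) ℝ (TangentSpace (𝓡 n) p)}
    (hT : IsTRFrame (K.J (f p)) (fun i ↦ diffAt f p (b i)))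
    (w : TangentSpace (𝓡 (2 * n)) (f p)) :
    w - K.piJ f p w = diffAt f p
      (∑ k, (K.co (f p) (fun i ↦ diffAt f p (b i)) w k).re • b k) := by
  rw [piJ_apply hT, sub_eq_iff_eq_add]
  have := (K.isHermPair (f p)).combo_coef (finrank_tangentSpace (f p)) hT w
  conv_lhs => rw [← this]
  simp [combo, csmul, Finset.sum_add_distrib, KahlerStructure.co]

/-- Removing the `π_J` component keeps the real parts of the coordinates, so the divergence is the
real part of the complex trace of `∇Z`. -/
lemma divJ_eq (hp : p ∈ (chartAt (Eu n) c).source)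
    (hx : f p ∈ (chartAt (Eu (2 * n)) x₀).source) (hf : ContMDiff (𝓡 n) (𝓡 (2 * n)) ∞ f)
    (hT : IsTRFrame (K.J (f p)) (fun k ↦ diffAt f p (frmBasis hp k))) (hZ : DiffAlongAt f Z p) :
    K.divJ f Z p = (∑ k, (K.loc x₀).cf (rep c x₀ f (chartAt (Eu n) c p))
      (jf (rep c x₀ f) (chartAt (Eu n) c p))
        ((K.loc x₀).cov (rep c x₀ f (chartAt (Eu n) c p)) (jf (rep c x₀ f) (chartAt (Eu n) c p) k)
          (repS c x₀ f Z (chartAt (Eu n) c p)) (jf (repS c x₀ f Z) (chartAt (Eu n) c p) k)) k).re := by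
  have hinj := (disjoint_of_isTRFrame hT).1
  have hfd := (hf p).mdifferentiableAt (n := ∞) (by simp)
  obtain ⟨A, hA⟩ := exists_covAlong_linear (K := K) (Z := Z) (hf p).continuousAt
  rw [KahlerStructure.divJ, traceOf_eq_matrix_trace (frmBasis hp) _
    (of fun i k ↦ (K.co (f p) (fun k ↦ diffAt f p (frmBasis hp k))
      (K.covAlong f Z p (frmBasis hp k)) i).re)]
  · rw [Complex.re_sum]
    refine Finset.sum_congr rfl fun k _ ↦ ?_
    rw [diag_apply, of_apply, co_covAlong hp hx hfd hZ, frmBasis_apply, crd_frm hp]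
    rfl
  · intro v
    rw [sub_piJ hT, Function.leftInverse_invFun hinj]
    refine Finset.sum_congr rfl fun i _ ↦ ?_
    congr 1
    have h1 : K.covAlong f Z p v =
        ∑ k, (frmBasis hp).repr v k • K.covAlong f Z p (frmBasis hp k) := by
      simp only [hA]
      conv_lhs => rw [← (frmBasis hp).sum_repr v, map_sum]
      simp only [map_smul]
    have h2 : ∀ w, K.co (f p) (fun k ↦ diffAt f p (frmBasis hp k)) w =
      (K.isHermPair (f p)).coefLin (fun k ↦ diffAt f p (frmBasis hp k)) w := fun _ ↦ rfl
    rw [h1, h2, map_sum, Finset.sum_apply, Complex.re_sum]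
    refine Finset.sum_congr rfl fun k _ ↦ ?_
    rw [map_smul, ← h2, Pi.smul_apply, Complex.real_smul, Complex.re_ofReal_mul, of_apply, mul_comm]

/-! ### The canonical section -/

/-- Any basis may replace the fixed one of the definition: the sign from the change of basis
combines with the sign relative to the given orientation. -/
lemma OmegaJ_eq (o : ManifoldOrientation n L) (hf : K.IsTotallyReal f)
    (e : Module.Basis (Fin n) ℝ (TangentSpace (𝓡 n) p)) :
    K.OmegaJ o f p = open Classical in (if e.orientation = o.at' p then (1 : ℝ) else -1) •
      K.canonicalForm (f p) (fun i ↦ diffAt f p (e i)) := by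
  classical
  set b : Module.Basis (Fin n) ℝ (TangentSpace (𝓡 n) p) :=
    (EuclideanSpace.basisFun (Fin n) ℝ).toBasis with hb
  have h1 := K.canonicalForm_change (hf.isTRFrame b) (hf.isTRFrame e) (b.toMatrix e) (fun j ↦ by
    rw [diffAt_eq_sum b]; rfl)
  have h2 : (0 < (b.toMatrix e).det) ↔ b.orientation = e.orientation := by
    rw [Module.Basis.orientation_eq_iff_det_pos, Module.Basis.det_apply]
  have h3 : K.OmegaJ o f p = (if b.orientation = o.at' p then (1 : ℝ) else -1) •
      K.canonicalForm (f p) (fun i ↦ diffAt f p (b i)) := by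
    rw [KahlerStructure.OmegaJ]
    split_ifs <;> simp
    · rfl
    · rfl
  rw [h3, h1, smul_smul]
  congr 1
  simp only [h2]
  have hne : e.orientation ≠ -e.orientation := Module.Ray.ne_neg_self _
  rcases b.orientation_eq_or_eq_neg (o.at' p) with ho | ho <;>
    rcases e.orientation_eq_or_eq_neg b.orientation with he | he <;>
    simp [ho, he, hne, hne.symm]

/-- In the trivialization at `p` the coordinate frame becomes the standard basis and the orientation
is locally constant. Hence whether the frame is positive does not depend on `q` near `p`. -/
lemma orientation_frmBasis (o : ManifoldOrientation n L) (p : L) :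
    ∃ s : Prop, ∀ᶠ q in 𝓝 p, ∀ hq : q ∈ (chartAt (Eu n) p).source,
      ((frmBasis hq).orientation = o.at' q ↔ s) := by
  refine ⟨(EuclideanSpace.basisFun (Fin n) ℝ).toBasis.orientation =
    Orientation.map (Fin n) ((trivializationAt (Eu n) (TangentSpace (𝓡 n)) p
        ).continuousLinearEquivAt ℝ p
          (FiberBundle.mem_baseSet_trivializationAt (Eu n) (TangentSpace (𝓡 n)) p)).toLinearEquiv
        (o.at' p), ?_⟩
  filter_upwards [o.locally_constant p] with q ⟨hq', h⟩ hq
  rw [← h, ← (Orientation.map (Fin n) ((trivializationAt (Eu n) (TangentSpace (𝓡 n)) p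
        ).continuousLinearEquivAt ℝ q hq').toLinearEquiv).injective.eq_iff,
    ← Module.Basis.orientation_map]
  have : (frmBasis hq).map ((trivializationAt (Eu n) (TangentSpace (𝓡 n)) p
        ).continuousLinearEquivAt ℝ q hq').toLinearEquiv =
      (EuclideanSpace.basisFun (Fin n) ℝ).toBasis := by
    refine Module.Basis.eq_of_apply_eq fun i ↦ ?_
    rw [Module.Basis.map_apply, frmBasis_apply, OrthonormalBasis.coe_toBasis,
      EuclideanSpace.basisFun_apply]
    refine Eq.trans ?_ (crd_frm hq (EuclideanSpace.single i (1 : ℝ)))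
    exact congrFun (Trivialization.coe_continuousLinearEquivAt_eq _ hq') _
  rw [this]

/-- Pointwise choices of basis and sign are replaced by the coordinate frame and one constant, so
that `OmegaJ` can be differentiated. -/
lemma OmegaJ_chart (o : ManifoldOrientation n L) (hf : K.IsTotallyReal f) (p : L) :
    ∃ s : ℝ, s ≠ 0 ∧ ∀ᶠ q in 𝓝 p, ∀ hq : q ∈ (chartAt (Eu n) p).source,
      K.OmegaJ o f q = s • K.canonicalForm (f q) (fun i ↦ diffAt f q (frmBasis hq i)) := by
  classical
  obtain ⟨s, hs⟩ := orientation_frmBasis o p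
  refine ⟨if s then 1 else -1, by split_ifs <;> norm_num, ?_⟩
  filter_upwards [hs] with q hq hq'
  rw [OmegaJ_eq o hf (frmBasis hq')]
  simp only [hq hq']

/-- The `J`-volume density. -/
lemma volJDensity_eq (o : ManifoldOrientation n L) (hf : K.IsTotallyReal f)
    (v : Fin n → TangentSpace (𝓡 n) p) :
    K.volJDensity o f p v = √(K.gr (f p) (fun i ↦ diffAt f p (v i))).det.re := by
  classical
  let b : Module.Basis (Fin n) ℝ (TangentSpace (𝓡 n) p) :=
    (EuclideanSpace.basisFun (Fin n) ℝ).toBasis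
  rw [KahlerStructure.volJDensity, OmegaJ_eq o hf b, AlternatingMap.smul_apply, norm_smul,
    K.norm_canonicalForm (hf.isTRFrame b)]
  split_ifs <;> simp

end MaslovOmega

/-! ### The covariant derivative of the canonical section. -/

section ParallelForm

open Matrix

section Local

variable {E : Type*} [NormedAddCommGroup E] [NormedSpace ℝ E] [FiniteDimensional ℝ E] {n : ℕ}
  {P : Type*} [NormedAddCommGroup P] [NormedSpace ℝ P]

namespace LocalKahler

variable {U : Set E} (K : LocalKahler E U) {f : P → E} {v : P → Fin n → E} {p : P}
  {W : Fin n → P → E}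

/-- The value of the normalized complex volume form of a totally real frame. -/
def volForm (K : LocalKahler E U) (f : P → E) (v : P → Fin n → E) (W : Fin n → P → E) (q : P) : ℂ :=
  (√(K.gm (f q) (v q)).det.re : ℂ) * (of fun i j ↦ K.cf (f q) (v q) (W j q) i).det

variable (hE : Module.finrank ℝ E = 2 * n)
include hE

/-- The root of the Gram determinant has logarithmic derivative `Re tr τ`. The coordinate
determinant yields the terms in `∇W_j` together with `-tr τ`. Their sum leaves `-i Im tr τ`. -/
lemma hasDerivAt_volForm (hU : f p ∈ U) (hf : ContDiffAt ℝ ∞ f p)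
    (hv : ∀ k, ContDiffAt ℝ ∞ (fun q ↦ v q k) p) (hT : IsTRFrame (K.J (f p)) (v p))
    (hW : ∀ j, ContDiffAt ℝ ∞ (W j) p) (a : P) :
    DifferentiableAt ℝ (K.volForm f v W) p ∧ fderiv ℝ (K.volForm f v W) p a =
      (√(K.gm (f p) (v p)).det.re : ℂ) *
          ∑ j, ((of fun i j ↦ K.cf (f p) (v p) (W j p) i).updateCol j
            (K.cf (f p) (v p) (K.cov (f p) (fderiv ℝ f p a) (W j p) (fderiv ℝ (W j) p a)))).det -
        Complex.I * (K.tau f v p a).trace.im * K.volForm f v W p := by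
  have hpos : 0 < (K.gm (f p) (v p)).det.re := (K.pair _ hU).gram_det_re_pos hT
  have hD : ContDiffAt ℝ ∞ (fun q ↦ (K.gm (f q) (v q)).det.re) p :=
    Complex.reCLM.contDiff.contDiffAt.comp p (K.contDiffAt_det_gm hU hf hv)
  have hC := fun i j ↦ K.contDiffAt_cf hU hf hv hT (hW j) i
  have hs : ContDiffAt ℝ ∞ (fun q ↦ (√(K.gm (f q) (v q)).det.re : ℂ)) p :=
    Complex.ofRealCLM.contDiff.contDiffAt.comp p (hD.sqrt hpos.ne')
  have hg : DifferentiableAt ℝ (K.volForm f v W) p :=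
    (hs.mul (contDiffAt_det (A := fun q ↦ of fun i j ↦ K.cf (f q) (v q) (W j q) i)
      hC)).differentiableAt (by simp)
  refine ⟨hg, fderiv_eq_of_line hg ?_⟩
  set τ := K.tau f v p a with hτ
  set C : Matrix (Fin n) (Fin n) ℂ := of fun i j ↦ K.cf (f p) (v p) (W j p) i with hCdef
  set B : Matrix (Fin n) (Fin n) ℂ := of fun i j ↦
    K.cf (f p) (v p) (K.cov (f p) (fderiv ℝ f p a) (W j p) (fderiv ℝ (W j) p a)) i with hB
  have h1 := ((hasDerivAt_line (hD.differentiableAt (by simp)) a).sqrt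
    (by simpa using hpos.ne')).ofReal_comp
  -- By `cf_cov` the coordinate matrix `C` of the `W_j` has derivative `B - τC`, where `B` holds the
  -- coordinates of the `∇W_j`.
  have h2 := hasDerivAt_det (M := fun t ↦ of fun i j ↦
      K.cf (f (p + t • a)) (v (p + t • a)) (W j (p + t • a)) i) (M' := B - τ * C) (s := 0)
    (fun i j ↦ (hasDerivAt_line ((hC i j).differentiableAt (by simp)) a).congr_deriv (by
      have := K.cf_cov hE hU hf hv hT (hW j) a i
      rw [Matrix.sub_apply, Matrix.mul_apply, hB, of_apply, this]
      simp [hCdef, hτ, mul_comm]))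
  refine (h1.mul h2).congr_deriv ?_
  rw [K.fderiv_det_gm hE hU hf hv hT a]
  simp only [zero_smul, add_zero]
  rw [sub_eq_add_neg, ← Matrix.neg_mul, sum_det_updateCol_add, sum_det_updateCol_mul_left,
    trace_neg]
  have h3 : ((2 * τ.trace.re * (K.gm (f p) (v p)).det.re / (2 * √(K.gm (f p) (v p)).det.re) : ℝ) : ℂ) =
      (√(K.gm (f p) (v p)).det.re : ℂ) * τ.trace.re := by
    rw [← Complex.ofReal_mul]
    congr 1
    have := Real.sq_sqrt hpos.le
    have h0 := (Real.sqrt_pos.2 hpos).ne'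
    field_simp
    rw [this]
  rw [h3, volForm]
  have h4 : ∀ j, (fun i ↦ B i j) =
    K.cf (f p) (v p) (K.cov (f p) (fderiv ℝ f p a) (W j p) (fderiv ℝ (W j) p a)) := fun j ↦ rfl
  simp only [h4]
  rw [← hCdef]
  have h5 := Complex.re_add_im τ.trace
  linear_combination ((√(K.gm (f p) (v p)).det.re : ℂ) * C.det) * h5

end LocalKahler

end Local

variable {n : ℕ} {M : Type*} [TopologicalSpace M] [T2Space M] [ChartedSpace (Eu (2 * n)) M]
  [IsManifold (𝓡 (2 * n)) ∞ M] {L : Type*} [TopologicalSpace L] [ChartedSpace (Eu n) L]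
  [IsManifold (𝓡 n) ∞ L] {K : KahlerStructure n M} {p : L} {f : L → M}
  {o : ManifoldOrientation n L}

/-- The covariant derivative of the canonical section is given by the Maslov form. -/
lemma mvfderiv_OmegaJ (hf : K.IsTotallyReal f)
    {W : Fin n → Π p : L, TangentSpace (𝓡 (2 * n)) (f p)}
    (hW : ∀ k, ContMDiffAt (𝓡 n) (𝓡 (2 * n)).tangent ∞
      (fun q ↦ (⟨f q, W k q⟩ : TangentBundle (𝓡 (2 * n)) M)) p) (X : TangentSpace (𝓡 n) p) :
    MDifferentiableAt (𝓡 n) 𝓘(ℝ, ℂ) (fun q ↦ K.OmegaJ o f q (fun k ↦ W k q)) p ∧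
      mvfderiv (𝓡 n) (fun q ↦ K.OmegaJ o f q (fun k ↦ W k q)) p X =
        ∑ k, K.OmegaJ o f p (Function.update (fun j ↦ W j p) k (K.covAlong f (W k) p X)) +
          Complex.I * K.maslovForm f p X * K.OmegaJ o f p (fun k ↦ W k p) := by
  have hp := mem_chart_source (Eu n) p
  have hx := mem_chart_source (Eu (2 * n)) (f p)
  have hfd : ∀ q, MDifferentiableAt (𝓡 n) (𝓡 (2 * n)) f q := fun q ↦
    (hf.smooth q).mdifferentiableAt (by simp)
  have hT := hf.isTRFrame (frmBasis hp)
  obtain ⟨s, -, hs⟩ := OmegaJ_chart o hf p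
  set g : Eu n → ℂ := fun y ↦ (s : ℂ) * (K.loc (f p)).volForm (rep p (f p) f)
    (jf (rep p (f p) f)) (fun k ↦ repS p (f p) f (W k)) y with hg
  have hF := contDiffAt_rep hp hx (hf.smooth p)
  have hU := rep_mem (f := f) hp hx
  have hT' := (isTRFrame_jf hp hx (hfd p)).1 hT
  obtain ⟨hd, hv⟩ := (K.loc (f p)).hasDerivAt_volForm (by simp) hU hF (contDiffAt_jf hF) hT'
    (fun k ↦ contDiffAt_repS hp hx (hW k)) (crd p p X)
  have key : ∀ {q : L} (hq : q ∈ (chartAt (Eu n) p).source), f q ∈ (chartAt (Eu (2 * n)) (f p)).source →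
      ∀ w : Fin n → TangentSpace (𝓡 (2 * n)) (f q),
      K.canonicalForm (f q) (fun i ↦ diffAt f q (frmBasis hq i)) w =
        (√((K.loc (f p)).gm (rep p (f p) f (chartAt (Eu n) p q))
          (jf (rep p (f p) f) (chartAt (Eu n) p q))).det.re : ℂ) *
        (of fun i j ↦ K.co (f q) (fun i ↦ diffAt f q (frmBasis hq i)) (w j) i).det := by
    intro q hq hx' w
    rw [K.canonicalForm_apply (hf.isTRFrame (frmBasis hq)), gr_eq_gm hx', rep_apply hq]
    simp only [crd_diffAt_frm hq hx' (hfd q)]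
    rfl
  have heq : ∀ᶠ q in 𝓝 p, K.OmegaJ o f q (fun k ↦ W k q) = g (chartAt (Eu n) p q) := by
    filter_upwards [hs, (chartAt (Eu n) p).open_source.mem_nhds hp,
      (hf.smooth p).continuousAt.eventually ((chartAt (Eu (2 * n)) (f p)).open_source.mem_nhds hx)]
      with q h1 hq hx'
    rw [h1 hq, AlternatingMap.smul_apply, key hq hx', Complex.real_smul]
    simp only [hg, LocalKahler.volForm]
    congr 3
    ext i j
    exact congrFun (cf_repS_diffAt hq hx' (hfd q) (W j)).symm i
  have hgd : DifferentiableAt ℝ g (chartAt (Eu n) p p) := hd.const_mul _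
  refine ⟨(mdifferentiableAt_comp_chart hp hgd).congr_of_eventuallyEq heq, ?_⟩
  rw [Filter.EventuallyEq.mvfderiv_eq heq, mvfderiv_comp_chart hp hgd, heq.self_of_nhds]
  have h1 : fderiv ℝ g (chartAt (Eu n) p p) (crd p p X) = s * fderiv ℝ
      ((K.loc (f p)).volForm (rep p (f p) f) (jf (rep p (f p) f))
        (fun k ↦ repS p (f p) f (W k))) (chartAt (Eu n) p p) (crd p p X) := by
    rw [hg, fderiv_const_mul hd]
    rfl
  rw [h1, hv, maslovForm_eq hp hx hf.smooth hT, hs.self_of_nhds hp, mul_sub]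
  have h2 : ∀ k, (s • K.canonicalForm (f p) (fun i ↦ diffAt f p (frmBasis hp i)))
      (Function.update (fun j ↦ W j p) k (K.covAlong f (W k) p X)) =
      s * ((√((K.loc (f p)).gm (rep p (f p) f (chartAt (Eu n) p p))
          (jf (rep p (f p) f) (chartAt (Eu n) p p))).det.re : ℂ) *
      ((of fun i j ↦ (K.loc (f p)).cf (rep p (f p) f (chartAt (Eu n) p p))
        (jf (rep p (f p) f) (chartAt (Eu n) p p)) (repS p (f p) f (W j) (chartAt (Eu n) p p)) i).updateCol k
            ((K.loc (f p)).cf (rep p (f p) f (chartAt (Eu n) p p))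
        (jf (rep p (f p) f) (chartAt (Eu n) p p)) ((K.loc (f p)).cov (rep p (f p) f (chartAt (Eu n) p p))
          (fderiv ℝ (rep p (f p) f) (chartAt (Eu n) p p) (crd p p X))
          (repS p (f p) f (W k) (chartAt (Eu n) p p))
          (fderiv ℝ (repS p (f p) f (W k)) (chartAt (Eu n) p p) (crd p p X))))).det) := by
    intro k
    rw [AlternatingMap.smul_apply, key hp hx, Complex.real_smul]
    congr 3
    ext i j
    rw [updateCol_apply, of_apply, Function.update_apply]
    split_ifs with h
    · subst h
      exact congrFun (co_covAlong hp hx (hfd p) ((hW j).mdifferentiableAt (by simp)) X) i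
    · exact congrFun (cf_repS_diffAt hp hx (hfd p) (W j)).symm i
  simp only [h2]
  rw [← Finset.mul_sum, ← Finset.mul_sum]
  push_cast
  simp only [hg]
  ring

/-- The canonical section is parallel if and only if the Maslov form vanishes. -/
lemma isParallel_iff (hf : K.IsTotallyReal f) :
    K.IsParallel f (K.OmegaJ o f) ↔ ∀ p X, K.maslovForm f p X = 0 := by
  constructor
  · intro h p X
    have hp := mem_chart_source (Eu n) p
    have hx := mem_chart_source (Eu (2 * n)) (f p)
    -- Parallelism is tested on globally smooth sections, so the tangent frame at `p` is extended by
    -- global fields of `M` and these are restricted to `L`.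
    choose Y hY hY' using fun k ↦ exists_smoothField hx
      (crd (f p) (f p) (diffAt f p (frmBasis hp k)))
    have hW : ∀ k, SmoothAlong f (fun q ↦ Y k (f q)) := fun k ↦ (hY k).comp hf.smooth
    have h1 := (h (fun k q ↦ Y k (f q)) hW p).2 X
    rw [(mvfderiv_OmegaJ hf (fun k ↦ hW k p) X).2] at h1
    -- On a tangent frame `Ω_J` is nonzero, so the coefficient `i ξ(X)` has to vanish.
    have h2 : K.OmegaJ o f p (fun k ↦ Y k (f p)) ≠ 0 := by
      obtain ⟨s, hs0, hs⟩ := OmegaJ_chart o hf p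
      have h3 : (fun k ↦ Y k (f p)) = fun i ↦ diffAt f p (frmBasis hp i) := by
        ext1 k; rw [(hY' k).self_of_nhds, frm_crd hx]
      rw [hs.self_of_nhds hp, h3, AlternatingMap.smul_apply, ← norm_ne_zero_iff, norm_smul,
        K.norm_canonicalForm (hf.isTRFrame _)]
      exact mul_ne_zero (norm_ne_zero_iff.2 hs0)
        (Real.sqrt_pos.2 (K.det_gr_pos (hf.isTRFrame _))).ne'
    have h3 : Complex.I * K.maslovForm f p X * K.OmegaJ o f p (fun k ↦ Y k (f p)) = 0 := by
      simpa using h1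
    simpa [h2] using h3
  · intro h W hW p
    refine ⟨(mvfderiv_OmegaJ hf (fun k ↦ hW k p) 0).1, fun X ↦ ?_⟩
    rw [(mvfderiv_OmegaJ hf (fun k ↦ hW k p) X).2, h]
    simp

end ParallelForm

/-! ### The exterior derivative of the Maslov form is the pulled-back Ricci form. -/

section RicciLagrangian

variable {n : ℕ} {M : Type*} [TopologicalSpace M] [T2Space M] [ChartedSpace (Eu (2 * n)) M]
  [IsManifold (𝓡 (2 * n)) ∞ M] {L : Type*} [TopologicalSpace L] [ChartedSpace (Eu n) L]
  [IsManifold (𝓡 n) ∞ L] {K : KahlerStructure n M} {f : L → M}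

/-- The Maslov form is a primitive of the Ricci form. -/
lemma isRicciLagrangian_of_maslovForm (hf : K.IsTotallyReal f)
    (h : ∀ p X, K.maslovForm f p X = 0) : K.IsRicciLagrangian f := by
  intro p v w
  have hp := mem_chart_source (Eu n) p
  have hx := mem_chart_source (Eu (2 * n)) (f p)
  have hfd : ∀ q, MDifferentiableAt (𝓡 n) (𝓡 (2 * n)) f q := fun q ↦
    (hf.smooth q).mdifferentiableAt (by simp)
  have hF := contDiffAt_rep hp hx (hf.smooth p)
  have hU := rep_mem (f := f) hp hx
  have hT' := (isTRFrame_jf hp hx (hfd p)).1 (hf.isTRFrame (frmBasis hp))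
  -- In the chart at `p`, `Im tr τ(b)` is minus the Maslov form on a coordinate field. It vanishes
  -- at all nearby points, and so do its partial derivatives.
  have h1 : ∀ a b : Eu n, (fderiv ℝ (fun y ↦ ((K.loc (f p)).tau (rep p (f p) f)
      (jf (rep p (f p) f)) y b).trace) (chartAt (Eu n) p p) a).im = 0 := by
    intro a b
    have hd : DifferentiableAt ℝ (fun y ↦ ((K.loc (f p)).tau (rep p (f p) f)
        (jf (rep p (f p) f)) y b).trace) (chartAt (Eu n) p p) :=
      DifferentiableAt.fun_sum fun i _ ↦ ((K.loc (f p)).contDiffAt_tau hU hF (contDiffAt_jf hF)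
        hT' b i i).differentiableAt (by simp)
    have h2 : ∀ᶠ y in 𝓝 (chartAt (Eu n) p p), (((K.loc (f p)).tau (rep p (f p) f)
        (jf (rep p (f p) f)) y b).trace).im = 0 := by
      filter_upwards [eventually_chart hp ((hf.smooth p).continuousAt.eventually
        ((chartAt (Eu (2 * n)) (f p)).open_source.mem_nhds hx))] with y ⟨hx', hq, hqy⟩
      have h3 := maslovForm_eq hq hx' hf.smooth (hf.isTRFrame (frmBasis hq))
        (frm p ((chartAt (Eu n) p).symm y) b)
      rw [h, crd_frm hq, hqy] at h3
      linarith
    have h3 := (Complex.imCLM.hasFDerivAt.comp _ hd.hasFDerivAt).unique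
      ((hasFDerivAt_const (0 : ℝ) (chartAt (Eu n) p p)).congr_of_eventuallyEq h2)
    exact congrArg (fun A : Eu n →L[ℝ] ℝ ↦ A a) h3
  have h2 := congrArg Complex.im ((K.loc (f p)).sum_cf_Rc (by simp) hU hF (contDiffAt_jf hF) hT'
    (crd p p v) (crd p p w))
  rw [Complex.sub_im, h1, h1, sub_zero, Complex.im_sum] at h2
  set y := rep p (f p) f (chartAt (Eu n) p p)
  have hpair := (K.loc (f p)).pair _ hU
  have hcurv := (K.loc (f p)).isKahlerCurvature hU
  set u := fderiv ℝ (rep p (f p) f) (chartAt (Eu n) p p) (crd p p v) with hu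
  set z := fderiv ℝ (rep p (f p) f) (chartAt (Eu n) p p) (crd p p w) with hz
  -- Twice the Ricci form equals `-2 Im` of the complex trace of the curvature, and that imaginary
  -- part is zero by `h2`.
  have h3 := hcurv.trace_J_curvature hpair (n := n) (by simp) hT' u z
  rw [hpair.trace_J_comp (by simp) hT' ((K.loc (f p)).Rc y u z).toLinearMap
    (fun w ↦ (K.loc (f p)).Rc_comm hU u z w) _ (fun w ↦ rfl)] at h3
  have h4 : ricContr ((K.loc (f p)).Rc y) ((K.loc (f p)).J y u) z = 0 := by
    have : -2 * ∑ k, (coef (fun u v ↦ (K.loc (f p)).G y u v) ((K.loc (f p)).J y)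
      (jf (rep p (f p) f) (chartAt (Eu n) p p))
      (((K.loc (f p)).Rc y u z) (jf (rep p (f p) f) (chartAt (Eu n) p p) k)) k).im = 0 :=
      mul_eq_zero_of_right _ h2
    linarith [h3.symm.trans this]
  rw [ricciForm_eq, crd_diffAt hp hx (hfd p), crd_diffAt hp hx (hfd p), ← rep_apply hp]
  exact h4

lemma isLagrangian_of_isRicciLagrangian {c : ℝ} (hc : c ≠ 0) (hK : K.IsEinstein c)
    (h : K.IsRicciLagrangian f) : K.IsLagrangian f := by
  intro p v w
  have := h p v w
  rw [KahlerStructure.ricciForm, hK] at this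
  exact (mul_eq_zero.1 this).resolve_left hc

end RicciLagrangian

/-! ### Integrals of functions supported in a compact part of an open set. -/

section CutoffIntegrals

variable {E : Type*} [NormedAddCommGroup E] [NormedSpace ℝ E] [FiniteDimensional ℝ E]
  [MeasurableSpace E] [BorelSpace E] {μ : Measure E} [μ.IsAddHaarMeasure]
  {U C : Set E}

lemma integrableOn_of_eq_zero_off_compact (hU : IsOpen U) (hC : IsCompact C) (hCU : C ⊆ U)
    {φ : E → ℝ} (hφ : ContinuousOn φ U) (h0 : ∀ y ∈ U, y ∉ C → φ y = 0) :
    IntegrableOn φ U μ := by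
  have h1 : IntegrableOn φ C μ := (hφ.mono hCU).integrableOn_compact hC
  have h2 : IntegrableOn φ (U \ C) μ :=
    (integrableOn_zero : IntegrableOn (fun _ : E ↦ (0 : ℝ)) (U \ C) μ).congr_fun (fun y hy ↦ (h0 y hy.1 hy.2).symm)
      (hU.measurableSet.diff hC.measurableSet)
  exact (h1.union h2).mono_set fun y hy ↦ by
    by_cases h : y ∈ C
    · exact Or.inl h
    · exact Or.inr ⟨hy, h⟩

/-- The extension of `φ` by zero is `C¹` with compact support on the whole space; integration by
parts against the constant `1` gives the claim. -/
lemma setIntegral_fderiv_eq_zero (hU : IsOpen U) (hC : IsCompact C) (hCU : C ⊆ U)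
    {φ : E → ℝ} (hφ : ContDiffOn ℝ 1 φ U) (h0 : ∀ y ∈ U, y ∉ C → φ y = 0) (v : E) :
    ∫ y in U, fderiv ℝ φ y v ∂μ = 0 := by
  set ψ : E → ℝ := U.indicator φ with hψ
  have hin : ∀ y ∈ U, ψ =ᶠ[𝓝 y] φ := fun y hy ↦ by
    filter_upwards [hU.mem_nhds hy] with z hz using Set.indicator_of_mem hz φ
  have hout : ∀ y ∉ C, ψ =ᶠ[𝓝 y] fun _ ↦ 0 := fun y hy ↦ by
    filter_upwards [hC.isClosed.isOpen_compl.mem_nhds hy] with z hz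
    by_cases hzU : z ∈ U
    · rw [hψ, Set.indicator_of_mem hzU, h0 z hzU hz]
    · exact Set.indicator_of_notMem hzU φ
  have hsmooth : ContDiff ℝ 1 ψ := contDiff_iff_contDiffAt.2 fun y ↦ by
    by_cases hy : y ∈ U
    · exact (hφ.contDiffAt (hU.mem_nhds hy)).congr_of_eventuallyEq (hin y hy)
    · exact contDiffAt_const.congr_of_eventuallyEq (hout y fun h ↦ hy (hCU h))
  have hsupp : HasCompactSupport ψ := HasCompactSupport.intro hC fun y hy ↦ (hout y hy).self_of_nhds
  have hd : Differentiable ℝ ψ := hsmooth.differentiable (by simp)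
  have hcd : Continuous (fun y ↦ fderiv ℝ ψ y v) :=
    (hsmooth.continuous_fderiv (by simp)).clm_apply continuous_const
  have hsd : HasCompactSupport (fun y ↦ fderiv ℝ ψ y v) := hsupp.fderiv_apply ℝ v
  have key : ∫ y, fderiv ℝ ψ y v ∂μ = 0 := by
    have := integral_bilinear_hasLineDerivAt_right_eq_neg_left_of_integrable (μ := μ)
      (f := fun _ : E ↦ (1 : ℝ)) (f' := fun _ ↦ 0) (g := ψ) (g' := fun y ↦ fderiv ℝ ψ y v) (v := v)
      (B := ContinuousLinearMap.mul ℝ ℝ) (by simp)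
      (by simpa using hcd.integrable_of_hasCompactSupport hsd)
      (by simpa using hsmooth.continuous.integrable_of_hasCompactSupport hsupp)
      (fun y _ ↦ by simpa using (hasFDerivAt_const (1 : ℝ) y).hasLineDerivAt v)
      (fun y _ ↦ (hd y).hasFDerivAt.hasLineDerivAt v)
    simpa using this
  have h1 : ∫ y in U, fderiv ℝ φ y v ∂μ = ∫ y in U, fderiv ℝ ψ y v ∂μ :=
    setIntegral_congr_fun hU.measurableSet fun y hy ↦ by
      simp only [(hin y hy).fderiv_eq]
  rw [h1, setIntegral_eq_integral_of_forall_compl_eq_zero, key]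
  intro y hy
  rw [(hout y fun h ↦ hy (hCU h)).fderiv_eq]
  simp

/-- Differentiation under the integral sign, for integrands supported in a fixed compact set. -/
lemma hasDerivAt_setIntegral_of_contDiffOn (hU : IsOpen U) (hC : IsCompact C) (hCU : C ⊆ U)
    {χ : E → ℝ} (hχ : ContinuousOn χ U) (h0 : ∀ y ∈ U, y ∉ C → χ y = 0)
    {φ φ' : ℝ → E → ℝ} {I : Set ℝ} (hI : IsOpen I) {s : ℝ} (hs : s ∈ I)
    (hφ : ∀ t ∈ I, ContinuousOn (φ t) U)
    (hφ' : ContinuousOn (fun z : ℝ × E ↦ φ' z.1 z.2) (I ×ˢ U))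
    (hd : ∀ t ∈ I, ∀ y ∈ U, HasDerivAt (fun t ↦ φ t y) (φ' t y) t) :
    HasDerivAt (fun t ↦ ∫ y in U, χ y * φ t y ∂μ) (∫ y in U, χ y * φ' s y ∂μ) s := by
  obtain ⟨ε, hε, hεI⟩ := Metric.nhds_basis_closedBall.mem_iff.1 (hI.mem_nhds hs)
  have hint : ∀ t ∈ I, IntegrableOn (fun y ↦ χ y * φ t y) U μ := fun t ht ↦
    integrableOn_of_eq_zero_off_compact hU hC hCU (hχ.mul (hφ t ht)) fun y hy hyC ↦ by
      rw [h0 y hy hyC, zero_mul]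
  have hφs : ContinuousOn (φ' s) U := by
    have : ContinuousOn (fun y : E ↦ ((s, y) : ℝ × E)) U := by fun_prop
    exact hφ'.comp this fun y hy ↦ ⟨hs, hy⟩
  have hint' : IntegrableOn (fun y ↦ χ y * φ' s y) U μ :=
    integrableOn_of_eq_zero_off_compact hU hC hCU (hχ.mul hφs) fun y hy hyC ↦ by
      rw [h0 y hy hyC, zero_mul]
  have hcomp : IsCompact (Metric.closedBall s ε ×ˢ C) := (isCompact_closedBall s ε).prod hC
  have hcont : ContinuousOn (fun z : ℝ × E ↦ χ z.2 * φ' z.1 z.2) (Metric.closedBall s ε ×ˢ C) :=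
    ((hχ.mono hCU).comp continuousOn_snd fun z hz ↦ hz.2).mul
      (hφ'.mono (Set.prod_mono hεI hCU))
  -- The derivative is bounded on a compact product of a time interval with `C`, and the cut-off
  -- vanishes off `C`; so `B` on `C` and zero elsewhere dominates.
  obtain ⟨B, hB⟩ := hcomp.exists_bound_of_continuousOn hcont
  refine (hasDerivAt_integral_of_dominated_loc_of_deriv_le (μ := μ.restrict U)
    (F := fun t y ↦ χ y * φ t y)
    (bound := C.indicator fun _ ↦ B) (F' := fun t y ↦ χ y * φ' t y)
    (Metric.ball_mem_nhds s hε) ?_ (hint s hs) hint'.aestronglyMeasurable ?_ ?_ ?_).2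
  · filter_upwards [hI.mem_nhds hs] with t ht using (hint t ht).aestronglyMeasurable
  · filter_upwards [ae_restrict_mem hU.measurableSet] with y hy t ht
    by_cases hyC : y ∈ C
    · rw [Set.indicator_of_mem hyC]
      exact hB (t, y) ⟨Metric.ball_subset_closedBall ht, hyC⟩
    · rw [Set.indicator_of_notMem hyC, h0 y hy hyC]; simp
  · refine Integrable.mono_measure ?_ Measure.restrict_le_self
    exact (integrable_indicator_iff hC.measurableSet).2 (integrableOn_const hC.measure_ne_top)
  · filter_upwards [ae_restrict_mem hU.measurableSet] with y hy t ht
    exact (hd t (hεI (Metric.ball_subset_closedBall ht)) y hy).const_mul _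

end CutoffIntegrals

/-! ### Densities and their integrals on a compact manifold. -/

section Densities

variable {n : ℕ} {L : Type*} [TopologicalSpace L] [ChartedSpace (Eu n) L] [IsManifold (𝓡 n) ∞ L]

/-- The value of a density on the frame of the chart at `c`. -/
def dens (D : Π p : L, (Fin n → TangentSpace (𝓡 n) p) → ℝ) (c p : L) : ℝ :=
  D p (fun i ↦ frm c p (EuclideanSpace.single i 1))

/-- Continuous densities on a manifold. -/
structure IsContDensity (D : Π p : L, (Fin n → TangentSpace (𝓡 n) p) → ℝ) : Prop where
  cont : ∀ c, ContinuousOn (dens D c) (chartAt (Eu n) c).source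
  change : ∀ (p : L) (v : Fin n → TangentSpace (𝓡 n) p) (A : Matrix (Fin n) (Fin n) ℝ),
    D p (fun j ↦ ∑ i, A i j • v i) = |A.det| * D p v

lemma coordFrame_eq {c : L} {y : Eu n} (hy : y ∈ (chartAt (Eu n) c).target) :
    coordFrame c y = fun i ↦ frm c ((chartAt (Eu n) c).symm y) (EuclideanSpace.single i 1) := by
  ext1 i
  rw [coordFrame, (hasMFDerivAt_chart_symm hy).mfderiv]
  rfl

lemma dens_change {D : Π p : L, (Fin n → TangentSpace (𝓡 n) p) → ℝ} (hD : IsContDensity D)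
    {c d p : L} (hc : p ∈ (chartAt (Eu n) c).source) :
    dens D d p = |((crd c p : TangentSpace (𝓡 n) p →L[ℝ] Eu n) ∘L frm d p).det| * dens D c p := by
  set A := (crd c p : TangentSpace (𝓡 n) p →L[ℝ] Eu n) ∘L frm d p with hA
  set b := (EuclideanSpace.basisFun (Fin n) ℝ).toBasis with hb
  have h1 : A.det = (LinearMap.toMatrix b b A.toLinearMap).det :=
    (LinearMap.det_toMatrix b A.toLinearMap).symm
  rw [h1, dens, dens, ← hD.change]
  congr 1
  ext1 j
  have h2 := (frmBasis hc).sum_repr (frm d p (EuclideanSpace.single j 1))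
  rw [← h2]
  refine Finset.sum_congr rfl fun i _ ↦ ?_
  rw [frmBasis_repr, frmBasis_apply, LinearMap.toMatrix_apply]
  congr 1
  simp [hb, hA]

/-- The integrals of a density in two charts agree. -/
lemma setIntegral_chart_swap {D : Π p : L, (Fin n → TangentSpace (𝓡 n) p) → ℝ}
    (hD : IsContDensity D) {c d : L} {G : L → ℝ}
    (hc : ∀ p ∉ (chartAt (Eu n) c).source, G p = 0)
    (hd : ∀ p ∉ (chartAt (Eu n) d).source, G p = 0) :
    ∫ y in (chartAt (Eu n) c).target, G ((chartAt (Eu n) c).symm y) *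
        dens D c ((chartAt (Eu n) c).symm y) =
      ∫ y in (chartAt (Eu n) d).target, G ((chartAt (Eu n) d).symm y) *
        dens D d ((chartAt (Eu n) d).symm y) := by
  set ψ := (chartAt (Eu n) d).symm.trans (chartAt (Eu n) c) with hψ
  have hsrc : ∀ y, y ∈ ψ.source ↔ y ∈ (chartAt (Eu n) d).target ∧
      (chartAt (Eu n) d).symm y ∈ (chartAt (Eu n) c).source := fun y ↦ by
    simp [hψ]
  have htgt : ∀ y, y ∈ ψ.target ↔ y ∈ (chartAt (Eu n) c).target ∧
      (chartAt (Eu n) c).symm y ∈ (chartAt (Eu n) d).source := fun y ↦ by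
    simp [hψ]
  -- Since `G` vanishes outside either chart domain, both integrals reduce to the overlap. There the
  -- transition map and the Jacobian factor of the density match the change of variables formula.
  rw [setIntegral_eq_of_subset_of_forall_sdiff_eq_zero (s := ψ.target)
      (chartAt (Eu n) c).open_target.measurableSet (fun y hy ↦ ((htgt y).1 hy).1)
      (fun y hy ↦ by
        rw [hd _ fun h ↦ hy.2 ((htgt y).2 ⟨hy.1, h⟩), zero_mul]),
    setIntegral_eq_of_subset_of_forall_sdiff_eq_zero (s := ψ.source)
      (chartAt (Eu n) d).open_target.measurableSet (fun y hy ↦ ((hsrc y).1 hy).1)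
      (fun y hy ↦ by
        rw [hc _ fun h ↦ hy.2 ((hsrc y).2 ⟨hy.1, h⟩), zero_mul]),
    ← ψ.image_source_eq_target]
  have hder : ∀ y ∈ ψ.source, HasFDerivAt ψ
      ((crd c ((chartAt (Eu n) d).symm y) : TangentSpace (𝓡 n) ((chartAt (Eu n) d).symm y) →L[ℝ] Eu n)
        ∘L frm d ((chartAt (Eu n) d).symm y)) y := fun y hy ↦
    (HasMFDerivAt.comp y (hasMFDerivAt_chart ((hsrc y).1 hy).2)
      (hasMFDerivAt_chart_symm ((hsrc y).1 hy).1)).hasFDerivAt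
  rw [integral_image_eq_integral_abs_det_fderiv_smul volume ψ.open_source.measurableSet
    (fun y hy ↦ (hder y hy).hasFDerivWithinAt) ψ.injOn]
  refine setIntegral_congr_fun ψ.open_source.measurableSet fun y hy ↦ ?_
  have h1 : (chartAt (Eu n) c).symm (ψ y) = (chartAt (Eu n) d).symm y :=
    (chartAt (Eu n) c).left_inv ((hsrc y).1 hy).2
  simp only [h1]
  rw [dens_change hD (d := d) ((hsrc y).1 hy).2, smul_eq_mul]
  ring

section Compact

variable [T2Space L] [CompactSpace L]

lemma tsupport_chartPartition (c : L) :
    tsupport (chartPartition n L c) ⊆ (chartAt (Eu n) c).source :=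
  (SmoothPartitionOfUnity.exists_isSubordinate_chartAt_source (𝓡 n) L).choose_spec c

variable (n L) in
/-- The indices of the nonzero functions of the partition of unity. -/
def chartIndex : Finset L :=
  ((chartPartition n L).locallyFinite.finite_nonempty_of_compact).toFinset

lemma chartPartition_eq_zero {c : L} (hc : c ∉ chartIndex n L) (p : L) :
    chartPartition n L c p = 0 := by
  by_contra h
  exact hc ((Set.Finite.mem_toFinset _).2 ⟨p, h⟩)

lemma sum_chartPartition (p : L) : ∑ c ∈ chartIndex n L, chartPartition n L c p = 1 := by
  rw [← (chartPartition n L).sum_eq_one (Set.mem_univ p), eq_comm]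
  refine finsum_eq_sum_of_support_subset _ fun c hc ↦ ?_
  by_contra h
  exact hc (chartPartition_eq_zero h p)

lemma chart_compact {F : L → ℝ} {c : L} (hF : tsupport F ⊆ (chartAt (Eu n) c).source) :
    IsCompact (chartAt (Eu n) c '' tsupport F) ∧
      chartAt (Eu n) c '' tsupport F ⊆ (chartAt (Eu n) c).target ∧
      ∀ y ∈ (chartAt (Eu n) c).target, y ∉ chartAt (Eu n) c '' tsupport F →
        (chartAt (Eu n) c).symm y ∉ tsupport F := by
  refine ⟨(isClosed_tsupport F).isCompact.image_of_continuousOn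
    ((chartAt (Eu n) c).continuousOn.mono hF), ?_, fun y hy hy' h ↦
      hy' ⟨_, h, (chartAt (Eu n) c).right_inv hy⟩⟩
  rintro _ ⟨p, hp, rfl⟩
  exact (chartAt (Eu n) c).map_source (hF hp)

lemma continuousOn_comp_symm {φ : L → ℝ} {c : L}
    (hφ : ContinuousOn φ (chartAt (Eu n) c).source) :
    ContinuousOn (fun y ↦ φ ((chartAt (Eu n) c).symm y)) (chartAt (Eu n) c).target :=
  hφ.comp (chartAt (Eu n) c).continuousOn_symm fun _ hy ↦ (chartAt (Eu n) c).map_target hy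

lemma integrableOn_chart {F : L → ℝ} {c : L} (hF : tsupport F ⊆ (chartAt (Eu n) c).source)
    {φ : L → ℝ} (hφ : ContinuousOn φ (chartAt (Eu n) c).source)
    (h0 : ∀ p ∉ tsupport F, φ p = 0) :
    IntegrableOn (fun y ↦ φ ((chartAt (Eu n) c).symm y)) (chartAt (Eu n) c).target := by
  obtain ⟨h1, h2, h3⟩ := chart_compact hF
  exact integrableOn_of_eq_zero_off_compact (chartAt (Eu n) c).open_target h1 h2
    (continuousOn_comp_symm hφ) fun y hy hy' ↦ h0 _ (h3 y hy hy')

variable {D : Π p : L, (Fin n → TangentSpace (𝓡 n) p) → ℝ}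

lemma integralDensity_eq_sum (D : Π p : L, (Fin n → TangentSpace (𝓡 n) p) → ℝ) :
    integralDensity D = ∑ c ∈ chartIndex n L, ∫ y in (chartAt (Eu n) c).target,
      chartPartition n L c ((chartAt (Eu n) c).symm y) * dens D c ((chartAt (Eu n) c).symm y) := by
  have h : ∀ c : L, (∫ y in (chartAt (Eu n) c).target,
      chartPartition n L c ((chartAt (Eu n) c).symm y) *
        D ((chartAt (Eu n) c).symm y) (coordFrame c y)) = ∫ y in (chartAt (Eu n) c).target,
      chartPartition n L c ((chartAt (Eu n) c).symm y) * dens D c ((chartAt (Eu n) c).symm y) :=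
    fun c ↦ setIntegral_congr_fun (chartAt (Eu n) c).open_target.measurableSet fun y hy ↦ by
      simp only [coordFrame_eq hy, dens]
  rw [integralDensity]
  simp only [h]
  refine finsum_eq_sum_of_support_subset _ fun c hc ↦ ?_
  by_contra hn
  exact hc (by simp [chartPartition_eq_zero hn])

/-- The integral of a function against a density. -/
def wint (D : Π p : L, (Fin n → TangentSpace (𝓡 n) p) → ℝ) (F : L → ℝ) : ℝ :=
  integralDensity fun p v ↦ F p * D p v

lemma wint_eq_sum (D : Π p : L, (Fin n → TangentSpace (𝓡 n) p) → ℝ) (F : L → ℝ) :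
    wint D F = ∑ c ∈ chartIndex n L, ∫ y in (chartAt (Eu n) c).target,
      chartPartition n L c ((chartAt (Eu n) c).symm y) *
        (F ((chartAt (Eu n) c).symm y) * dens D c ((chartAt (Eu n) c).symm y)) :=
  integralDensity_eq_sum _

lemma integrableOn_wint (hD : IsContDensity D) {F : L → ℝ} (hF : Continuous F) (c : L) :
    IntegrableOn (fun y ↦ chartPartition n L c ((chartAt (Eu n) c).symm y) *
        (F ((chartAt (Eu n) c).symm y) * dens D c ((chartAt (Eu n) c).symm y)))
      (chartAt (Eu n) c).target :=
  integrableOn_chart (tsupport_chartPartition c)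
    (φ := fun p ↦ chartPartition n L c p * (F p * dens D c p))
    ((chartPartition n L c).contMDiff.continuous.continuousOn.mul
      (hF.continuousOn.mul (hD.cont c))) fun p hp ↦ by
      rw [image_eq_zero_of_notMem_tsupport hp, zero_mul]

lemma wint_sum (hD : IsContDensity D) {κ : Type*} (s : Finset κ) {F : κ → L → ℝ}
    (hF : ∀ k ∈ s, Continuous (F k)) : wint D (fun p ↦ ∑ k ∈ s, F k p) = ∑ k ∈ s, wint D (F k) := by
  simp only [wint_eq_sum]
  rw [Finset.sum_comm]
  refine Finset.sum_congr rfl fun c _ ↦ ?_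
  rw [← integral_finsetSum s fun k hk ↦ integrableOn_wint hD (hF k hk) c]
  simp only [Finset.mul_sum, Finset.sum_mul]

lemma wint_add (hD : IsContDensity D) {F G : L → ℝ} (hF : Continuous F) (hG : Continuous G) :
    wint D (fun p ↦ F p + G p) = wint D F + wint D G := by
  simp only [wint_eq_sum, ← Finset.sum_add_distrib]
  refine Finset.sum_congr rfl fun c _ ↦ ?_
  rw [← integral_add (integrableOn_wint hD hF c) (integrableOn_wint hD hG c)]
  simp only [mul_add, add_mul]

lemma wint_neg (D : Π p : L, (Fin n → TangentSpace (𝓡 n) p) → ℝ) (F : L → ℝ) :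
    wint D (fun p ↦ -F p) = -wint D F := by
  simp only [wint_eq_sum, neg_mul, mul_neg, integral_neg, Finset.sum_neg_distrib]

lemma wint_zero (D : Π p : L, (Fin n → TangentSpace (𝓡 n) p) → ℝ) :
    wint D (fun _ ↦ 0) = 0 := by
  simp [wint_eq_sum]

/-- The integral of a function supported in a chart. -/
lemma wint_eq_setIntegral (hD : IsContDensity D) {F : L → ℝ} (hF : Continuous F) {d : L}
    (hs : tsupport F ⊆ (chartAt (Eu n) d).source) :
    wint D F = ∫ y in (chartAt (Eu n) d).target, F ((chartAt (Eu n) d).symm y) *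
      dens D d ((chartAt (Eu n) d).symm y) := by
  -- Each term of the partition of unity is moved to the chart at `d`, where the partition functions
  -- add up to one.
  have h1 : ∀ c, (∫ y in (chartAt (Eu n) c).target,
      chartPartition n L c ((chartAt (Eu n) c).symm y) *
        (F ((chartAt (Eu n) c).symm y) * dens D c ((chartAt (Eu n) c).symm y))) =
      ∫ y in (chartAt (Eu n) d).target, chartPartition n L c ((chartAt (Eu n) d).symm y) *
        (F ((chartAt (Eu n) d).symm y) * dens D d ((chartAt (Eu n) d).symm y)) := fun c ↦ by
    simp only [← mul_assoc]
    exact setIntegral_chart_swap hD (G := fun p ↦ chartPartition n L c p * F p)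
      (fun p hp ↦ by
        rw [image_eq_zero_of_notMem_tsupport fun h ↦ hp (tsupport_chartPartition c h), zero_mul])
      (fun p hp ↦ by
        rw [image_eq_zero_of_notMem_tsupport (f := F) fun h ↦ hp (hs h), mul_zero])
  rw [wint_eq_sum]
  simp only [h1]
  rw [← integral_finsetSum _ fun c _ ↦ integrableOn_chart hs
    (φ := fun p ↦ chartPartition n L c p * (F p * dens D d p))
    ((chartPartition n L c).contMDiff.continuous.continuousOn.mul
      (hF.continuousOn.mul (hD.cont d))) fun p hp ↦ by
      rw [image_eq_zero_of_notMem_tsupport (f := F) hp]; simp]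
  simp only [← Finset.sum_mul, sum_chartPartition, one_mul]

/-- A nonnegative function with integral zero against a positive density vanishes. -/
lemma eq_zero_of_wint_eq_zero (hD : IsContDensity D)
    (hpos : ∀ c, ∀ p ∈ (chartAt (Eu n) c).source, 0 < dens D c p) {F : L → ℝ} (hF : Continuous F)
    (h0 : ∀ p, 0 ≤ F p) (hint : wint D F = 0) (p : L) : F p = 0 := by
  by_contra hne
  obtain ⟨c, hc⟩ := (chartPartition n L).exists_pos_of_mem (Set.mem_univ p)
  have hcs : p ∈ (chartAt (Eu n) c).source :=
    tsupport_chartPartition c (subset_tsupport _ hc.ne')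
  have hnn : ∀ d, ∀ y ∈ (chartAt (Eu n) d).target,
      0 ≤ chartPartition n L d ((chartAt (Eu n) d).symm y) *
        (F ((chartAt (Eu n) d).symm y) * dens D d ((chartAt (Eu n) d).symm y)) := fun d y hy ↦
    mul_nonneg ((chartPartition n L).nonneg _ _) (mul_nonneg (h0 _)
      (hpos d _ ((chartAt (Eu n) d).map_target hy)).le)
  rw [wint_eq_sum] at hint
  have h1 := (Finset.sum_eq_zero_iff_of_nonneg fun d _ ↦
    setIntegral_nonneg (chartAt (Eu n) d).open_target.measurableSet (hnn d)).1 hint c (by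
      by_contra h; exact hc.ne' (chartPartition_eq_zero h p))
  set φ : Eu n → ℝ := fun y ↦ chartPartition n L c ((chartAt (Eu n) c).symm y) *
        (F ((chartAt (Eu n) c).symm y) * dens D c ((chartAt (Eu n) c).symm y)) with hφ
  have hcont : ContinuousOn φ (chartAt (Eu n) c).target :=
    continuousOn_comp_symm (φ := fun p ↦ chartPartition n L c p * (F p * dens D c p))
      ((chartPartition n L c).contMDiff.continuous.continuousOn.mul
        (hF.continuousOn.mul (hD.cont c)))
  have h2 := (setIntegral_eq_zero_iff_of_nonneg_ae
    (ae_restrict_of_forall_mem (chartAt (Eu n) c).open_target.measurableSet (hnn c))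
    (integrableOn_wint hD hF c)).1 h1
  -- A vanishing integral gives zero almost everywhere, and continuity upgrades this to every point
  -- of the open target.
  have h3 : Set.EqOn φ 0 (chartAt (Eu n) c).target :=
    Measure.eqOn_open_of_ae_eq h2 (chartAt (Eu n) c).open_target hcont continuousOn_const
  have h4 := h3 ((chartAt (Eu n) c).map_source hcs)
  simp only [hφ, (chartAt (Eu n) c).left_inv hcs, Pi.zero_apply] at h4
  exact (mul_pos hc (mul_pos (lt_of_le_of_ne (h0 p) (Ne.symm hne)) (hpos c p hcs))).ne' h4

end Compact

end Densities

/-! ### The divergence theorem for densities. -/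

section DivergenceTheorem

variable {n : ℕ} {L : Type*} [TopologicalSpace L] [ChartedSpace (Eu n) L] [IsManifold (𝓡 n) ∞ L]

lemma contDiffOn_comp_symm {F : Type*} [NormedAddCommGroup F] [NormedSpace ℝ F] {φ : L → F} {c : L}
    (hφ : ContMDiffOn (𝓡 n) 𝓘(ℝ, F) ∞ φ (chartAt (Eu n) c).source) :
    ContDiffOn ℝ ∞ (fun y ↦ φ ((chartAt (Eu n) c).symm y)) (chartAt (Eu n) c).target :=
  (hφ.comp (contMDiffOn_chart_symm (I := 𝓡 n) (n := ∞))
    fun _ hy ↦ (chartAt (Eu n) c).map_target hy).contDiffOn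

lemma contMDiffOn_crd {Y : Π p : L, TangentSpace (𝓡 n) p} (hY : SmoothField Y) (c : L) :
    ContMDiffOn (𝓡 n) 𝓘(ℝ, Eu n) ∞ (fun p ↦ crd c p (Y p)) (chartAt (Eu n) c).source :=
  fun p hp ↦ ((contMDiffAt_along_iff (b := fun p : L ↦ p) le_rfl hp).1
    (hY p)).2.contMDiffWithinAt

/-- The derivative of a function along a vector field, in coordinates. -/
lemma mvfderiv_symm {φ : L → ℝ} (hφ : ContMDiff (𝓡 n) 𝓘(ℝ) ∞ φ) {c : L} {y : Eu n}
    (hy : y ∈ (chartAt (Eu n) c).target) (v : TangentSpace (𝓡 n) ((chartAt (Eu n) c).symm y)) :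
    mvfderiv (𝓡 n) φ ((chartAt (Eu n) c).symm y) v =
      fderiv ℝ (fun z ↦ φ ((chartAt (Eu n) c).symm z)) y
        (crd c ((chartAt (Eu n) c).symm y) v) := by
  rw [mvfderiv_eq_fderiv ((chartAt (Eu n) c).map_target hy) ((hφ _).mdifferentiableAt (by simp)),
    (chartAt (Eu n) c).right_inv hy]
  rfl

lemma continuous_mvfderiv_apply {φ : L → ℝ} (hφ : ContMDiff (𝓡 n) 𝓘(ℝ) ∞ φ)
    {Y : Π p : L, TangentSpace (𝓡 n) p} (hY : SmoothField Y) :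
    Continuous (fun p ↦ mvfderiv (𝓡 n) φ p (Y p)) := by
  refine continuous_iff_continuousAt.2 fun p ↦ ?_
  have hp := mem_chart_source (Eu n) p
  have hd : ContinuousAt (fun y ↦ fderiv ℝ (fun z ↦ φ ((chartAt (Eu n) p).symm z)) y)
      (chartAt (Eu n) p p) :=
    (((contDiffOn_comp_symm hφ.contMDiffOn).contDiffAt ((chartAt (Eu n) p).open_target.mem_nhds
      ((chartAt (Eu n) p).map_source hp))).fderiv_right (m := ∞) (by simp)).continuousAt
  have hc : ContinuousAt (fun q ↦ crd p q (Y q)) p :=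
    (contMDiffOn_crd hY p).continuousOn.continuousAt ((chartAt (Eu n) p).open_source.mem_nhds hp)
  refine ((hd.comp (f := chartAt (Eu n) p) ((chartAt (Eu n) p).continuousAt hp)).clm_apply
    hc).congr_of_eventuallyEq ?_
  filter_upwards [(chartAt (Eu n) p).open_source.mem_nhds hp] with q hq
  rw [mvfderiv_eq_fderiv hq ((hφ _).mdifferentiableAt (by simp))]
  rfl

variable [T2Space L] [CompactSpace L] {D : Π p : L, (Fin n → TangentSpace (𝓡 n) p) → ℝ}

lemma mvfderiv_eq_zero_of_notMem {φ : L → ℝ} {p : L} (hp : p ∉ tsupport φ)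
    (v : TangentSpace (𝓡 n) p) : mvfderiv (𝓡 n) φ p v = 0 := by
  have h : φ =ᶠ[𝓝 p] fun _ ↦ (0 : ℝ) := by
    filter_upwards [(isClosed_tsupport φ).isOpen_compl.mem_nhds hp] with q hq using
      image_eq_zero_of_notMem_tsupport hq
  rw [h.mvfderiv_eq, mvfderiv_const]
  rfl

lemma sum_mvfderiv_chartPartition (p : L) (v : TangentSpace (𝓡 n) p) :
    ∑ c ∈ chartIndex n L, mvfderiv (𝓡 n) (chartPartition n L c) p v = 0 := by
  have hp := mem_chart_source (Eu n) p
  have hd : ∀ c, DifferentiableAt ℝ (fun y ↦ chartPartition n L c ((chartAt (Eu n) p).symm y))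
      (chartAt (Eu n) p p) := fun c ↦
    ((contDiffOn_comp_symm (chartPartition n L c).contMDiff.contMDiffOn).contDiffAt
      ((chartAt (Eu n) p).open_target.mem_nhds ((chartAt (Eu n) p).map_source hp))).differentiableAt
      (by simp)
  have h1 : ∀ c, mvfderiv (𝓡 n) (chartPartition n L c) p v =
      fderiv ℝ (fun y ↦ chartPartition n L c ((chartAt (Eu n) p).symm y)) (chartAt (Eu n) p p)
        (crd p p v) := fun c ↦ by
    rw [mvfderiv_eq_fderiv hp
      ((chartPartition n L c).contMDiff.contMDiffAt.mdifferentiableAt (by simp))]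
    rfl
  simp only [h1]
  rw [← sum_apply, ← fderiv_fun_sum fun c _ ↦ hd c]
  simp [sum_chartPartition]

/-- The divergence theorem on a compact manifold without boundary. -/
lemma wint_divergence (hD : IsContDensity D)
    (hDs : ∀ c, ContDiffOn ℝ ∞ (fun y ↦ dens D c ((chartAt (Eu n) c).symm y))
      (chartAt (Eu n) c).target)
    {Y : Π p : L, TangentSpace (𝓡 n) p} (hY : SmoothField Y) {δ : L → ℝ} (hδ : Continuous δ)
    (h : ∀ c, ∀ y ∈ (chartAt (Eu n) c).target,
      δ ((chartAt (Eu n) c).symm y) * dens D c ((chartAt (Eu n) c).symm y) =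
        ∑ k, fderiv ℝ (fun y ↦ crd c ((chartAt (Eu n) c).symm y) (Y ((chartAt (Eu n) c).symm y)) k *
          dens D c ((chartAt (Eu n) c).symm y)) y (EuclideanSpace.single k 1)) :
    wint D δ = 0 := by
  have hdY := fun c : L ↦ continuous_mvfderiv_apply (chartPartition n L c).contMDiff hY
  have hs : ∀ c : L, tsupport (fun p ↦ mvfderiv (𝓡 n) (chartPartition n L c) p (Y p)) ⊆
      tsupport (chartPartition n L c) := fun c ↦
    closure_minimal (fun p hp ↦ by
      by_contra h
      exact hp (mvfderiv_eq_zero_of_notMem h _)) (isClosed_tsupport _)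
  -- The divergence of the cut-off field `ρ_c Y` has integral zero in the chart, so `∫ ρ_c δ = -∫
  -- dρ_c(Y)`. Summed over `c` the right-hand side vanishes, because `∑ ρ_c = 1` has derivative
  -- zero.
  have key : ∀ c : L, (∫ y in (chartAt (Eu n) c).target,
      chartPartition n L c ((chartAt (Eu n) c).symm y) *
        (δ ((chartAt (Eu n) c).symm y) * dens D c ((chartAt (Eu n) c).symm y))) =
      -wint D (fun p ↦ mvfderiv (𝓡 n) (chartPartition n L c) p (Y p)) := by
    intro c
    have hU := (chartAt (Eu n) c).open_target
    obtain ⟨hC1, hC2, hC3⟩ := chart_compact (tsupport_chartPartition (n := n) c)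
    rw [wint_eq_setIntegral hD (hdY c) ((hs c).trans (tsupport_chartPartition c)),
      eq_neg_iff_add_eq_zero, ← integral_add (integrableOn_wint hD hδ c)
      (integrableOn_chart (tsupport_chartPartition c)
        (φ := fun p ↦ mvfderiv (𝓡 n) (chartPartition n L c) p (Y p) * dens D c p)
        ((hdY c).continuousOn.mul (hD.cont c)) fun p hp ↦ by
          rw [mvfderiv_eq_zero_of_notMem hp, zero_mul])]
    set ρ : Eu n → ℝ := fun y ↦ chartPartition n L c ((chartAt (Eu n) c).symm y) with hρ
    set a : Fin n → Eu n → ℝ := fun k y ↦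
      crd c ((chartAt (Eu n) c).symm y) (Y ((chartAt (Eu n) c).symm y)) k *
          dens D c ((chartAt (Eu n) c).symm y) with ha
    have hρs : ContDiffOn ℝ ∞ ρ (chartAt (Eu n) c).target :=
      contDiffOn_comp_symm (chartPartition n L c).contMDiff.contMDiffOn
    have has : ∀ k, ContDiffOn ℝ ∞ (a k) (chartAt (Eu n) c).target := fun k ↦
      ((EuclideanSpace.proj (𝕜 := ℝ) k).contDiff.comp_contDiffOn
        (contDiffOn_comp_symm (contMDiffOn_crd hY c))).mul (hDs c)
    have h0 : ∀ k, ∀ y ∈ (chartAt (Eu n) c).target,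
        y ∉ chartAt (Eu n) c '' tsupport (chartPartition n L c) → ρ y * a k y = 0 :=
      fun k y hy hy' ↦ by
        rw [hρ]
        simp only
        rw [image_eq_zero_of_notMem_tsupport (hC3 y hy hy'), zero_mul]
    have hint : ∀ k, IntegrableOn (fun y ↦ fderiv ℝ (fun y ↦ ρ y * a k y) y
        (EuclideanSpace.single k 1)) (chartAt (Eu n) c).target := fun k ↦ by
      refine integrableOn_of_eq_zero_off_compact hU hC1 hC2
        ((((hρs.mul (has k)).continuousOn_fderiv_of_isOpen hU (by simp))).clm_apply
          continuousOn_const) fun y hy hy' ↦ ?_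
      have : (fun y ↦ ρ y * a k y) =ᶠ[𝓝 y] fun _ ↦ 0 := by
        filter_upwards [hU.mem_nhds hy, hC1.isClosed.isOpen_compl.mem_nhds hy'] with z h1 h2
          using h0 k z h1 h2
      rw [this.fderiv_eq]
      simp
    have hsum : ∫ y in (chartAt (Eu n) c).target, ∑ k, fderiv ℝ (fun y ↦ ρ y * a k y) y
        (EuclideanSpace.single k 1) = 0 := by
      rw [integral_finsetSum _ fun k _ ↦ hint k]
      exact Finset.sum_eq_zero fun k _ ↦ setIntegral_fderiv_eq_zero hU hC1 hC2
        ((hρs.mul (has k)).of_le (by simp)) (h0 k) _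
    rw [← hsum]
    refine setIntegral_congr_fun hU.measurableSet fun y hy ↦ ?_
    have hρd := (hρs.contDiffAt (hU.mem_nhds hy)).differentiableAt (by simp)
    have hadd := fun k ↦ ((has k).contDiffAt (hU.mem_nhds hy)).differentiableAt (by simp)
    rw [h c y hy, mvfderiv_symm (chartPartition n L c).contMDiff hy]
    have hexp : crd c ((chartAt (Eu n) c).symm y) (Y ((chartAt (Eu n) c).symm y)) =
        ∑ k, crd c ((chartAt (Eu n) c).symm y) (Y ((chartAt (Eu n) c).symm y)) k •
          EuclideanSpace.single k (1 : ℝ) := by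
      ext j; simp [Finset.sum_apply, Pi.single_apply]
    conv_lhs => rw [hexp]
    rw [map_sum, Finset.sum_mul, Finset.mul_sum, ← Finset.sum_add_distrib]
    refine Finset.sum_congr rfl fun k _ ↦ ?_
    rw [fderiv_fun_mul hρd (hadd k), map_smul]
    simp only [ha, add_apply, smul_apply, smul_eq_mul]
    ring
  rw [wint_eq_sum]
  simp only [key]
  rw [Finset.sum_neg_distrib, ← wint_sum hD _ fun c _ ↦ hdY c]
  simp only [sum_mvfderiv_chartPartition, wint_zero, neg_zero]

end DivergenceTheorem

/-! ### Smooth families of maps and their volume densities. -/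

section Families

open Matrix

variable {n : ℕ} {M : Type*} [TopologicalSpace M] [ChartedSpace (Eu (2 * n)) M]
  [IsManifold (𝓡 (2 * n)) ∞ M] {L : Type*} [TopologicalSpace L] [ChartedSpace (Eu n) L]
  [IsManifold (𝓡 n) ∞ L] {K : KahlerStructure n M}
  {c : L} {x₀ : M} {F : ℝ → L → M}

/-- A family of maps in charts. -/
def repF (c : L) (x₀ : M) (F : ℝ → L → M) (z : ℝ × Eu n) : Eu (2 * n) := rep c x₀ (F z.1) z.2

/-- The partial derivatives of a family of maps in the directions of the manifold. -/
def jF (c : L) (x₀ : M) (F : ℝ → L → M) (z : ℝ × Eu n) (k : Fin n) : Eu (2 * n) :=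
  fderiv ℝ (repF c x₀ F) z (0, EuclideanSpace.single k 1)

/-- Joint smoothness of a family of maps. -/
abbrev SmoothFamily (F : ℝ → L → M) : Prop :=
  ContMDiff (𝓘(ℝ, ℝ).prod (𝓡 n)) (𝓡 (2 * n)) ∞ (fun z : ℝ × L ↦ F z.1 z.2)

lemma SmoothFamily.smooth (hF : SmoothFamily (n := n) F) (t : ℝ) :
    ContMDiff (𝓡 n) (𝓡 (2 * n)) ∞ (F t) :=
  hF.comp (contMDiff_const.prodMk contMDiff_id)

lemma SmoothFamily.smooth_time (hF : SmoothFamily (n := n) F) (p : L) :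
    ContMDiff 𝓘(ℝ, ℝ) (𝓡 (2 * n)) ∞ (fun t ↦ F t p) :=
  hF.comp (contMDiff_id.prodMk contMDiff_const)

lemma contDiffAt_repF (hF : SmoothFamily (n := n) F) {z : ℝ × Eu n}
    (hz : z.2 ∈ (chartAt (Eu n) c).target)
    (hx : F z.1 ((chartAt (Eu n) c).symm z.2) ∈ (chartAt (Eu (2 * n)) x₀).source) :
    ContDiffAt ℝ ∞ (repF c x₀ F) z := by
  have h1 : ContMDiffAt 𝓘(ℝ, ℝ × Eu n) (𝓘(ℝ, ℝ).prod (𝓡 n)) ∞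
      (fun w : ℝ × Eu n ↦ (w.1, (chartAt (Eu n) c).symm w.2)) z :=
    contDiff_fst.contDiffAt.contMDiffAt.prodMk
      ((contMDiffAt_chart_symm hz).comp z contDiff_snd.contDiffAt.contMDiffAt)
  have h2 : ContMDiffAt 𝓘(ℝ, ℝ × Eu n) (𝓡 (2 * n)) ∞
      (fun w : ℝ × Eu n ↦ F w.1 ((chartAt (Eu n) c).symm w.2)) z :=
    (hF.contMDiffAt (x := (z.1, (chartAt (Eu n) c).symm z.2))).comp z h1
  have h3 : ContMDiffAt (𝓡 (2 * n)) 𝓘(ℝ, Eu (2 * n)) ∞ (chartAt (Eu (2 * n)) x₀)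
      (F z.1 ((chartAt (Eu n) c).symm z.2)) :=
    (contMDiffOn_chart (n := ∞) (I := 𝓡 (2 * n)) (x := x₀)).contMDiffAt
      ((chartAt (Eu (2 * n)) x₀).open_source.mem_nhds hx)
  exact (h3.comp z h2).contDiffAt

lemma contDiffAt_jF (hF : SmoothFamily (n := n) F) {z : ℝ × Eu n}
    (hz : z.2 ∈ (chartAt (Eu n) c).target)
    (hx : F z.1 ((chartAt (Eu n) c).symm z.2) ∈ (chartAt (Eu (2 * n)) x₀).source) (k : Fin n) :
    ContDiffAt ℝ ∞ (fun w ↦ jF c x₀ F w k) z :=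
  ((contDiffAt_repF hF hz hx).fderiv_right (m := ∞) (by simp)).clm_apply contDiffAt_const

lemma jF_eq (hF : SmoothFamily (n := n) F) {z : ℝ × Eu n}
    (hz : z.2 ∈ (chartAt (Eu n) c).target)
    (hx : F z.1 ((chartAt (Eu n) c).symm z.2) ∈ (chartAt (Eu (2 * n)) x₀).source) (k : Fin n) :
    jF c x₀ F z k = jf (rep c x₀ (F z.1)) z.2 k := by
  have h1 : HasFDerivAt (fun y : Eu n ↦ ((z.1, y) : ℝ × Eu n)) (ContinuousLinearMap.inr ℝ ℝ (Eu n))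
      z.2 := hasFDerivAt_prodMk_right _ _
  have h2 := ((contDiffAt_repF hF hz hx).differentiableAt (by simp)).hasFDerivAt.comp z.2 h1
  have h3 : fderiv ℝ (rep c x₀ (F z.1)) z.2 =
    (fderiv ℝ (repF c x₀ F) z).comp (ContinuousLinearMap.inr ℝ ℝ (Eu n)) := h2.fderiv
  rw [jf, h3]
  rfl

lemma eventually_family (hF : SmoothFamily (n := n) F) {z : ℝ × Eu n}
    (hz : z.2 ∈ (chartAt (Eu n) c).target)
    (hx : F z.1 ((chartAt (Eu n) c).symm z.2) ∈ (chartAt (Eu (2 * n)) x₀).source) :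
    ∀ᶠ w in 𝓝 z, w.2 ∈ (chartAt (Eu n) c).target ∧
      F w.1 ((chartAt (Eu n) c).symm w.2) ∈ (chartAt (Eu (2 * n)) x₀).source := by
  have h1 : ContinuousAt (fun w : ℝ × Eu n ↦ F w.1 ((chartAt (Eu n) c).symm w.2)) z :=
    (hF.continuous.continuousAt (x := (z.1, (chartAt (Eu n) c).symm z.2))).comp
      (f := fun w : ℝ × Eu n ↦ (w.1, (chartAt (Eu n) c).symm w.2))
      (continuousAt_fst.prodMk (((chartAt (Eu n) c).continuousAt_symm hz).comp continuousAt_snd))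
  filter_upwards [continuousAt_snd.eventually ((chartAt (Eu n) c).open_target.mem_nhds hz),
    h1.eventually ((chartAt (Eu (2 * n)) x₀).open_source.mem_nhds hx)] with w h2 h3
  exact ⟨h2, h3⟩

section Density

variable [T2Space L] [CompactSpace L]

/-- The derivative of the integral of a family of densities. -/
lemma hasDerivAt_integralDensity {D : ℝ → Π p : L, (Fin n → TangentSpace (𝓡 n) p) → ℝ}
    (hD : ∀ c, ∀ z : ℝ × Eu n, z.2 ∈ (chartAt (Eu n) c).target →
      ContDiffAt ℝ ∞ (fun w : ℝ × Eu n ↦ dens (D w.1) c ((chartAt (Eu n) c).symm w.2)) z) (s : ℝ) :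
    HasDerivAt (fun t ↦ integralDensity (D t)) (∑ c ∈ chartIndex n L,
      ∫ y in (chartAt (Eu n) c).target, chartPartition n L c ((chartAt (Eu n) c).symm y) *
        fderiv ℝ (fun w : ℝ × Eu n ↦ dens (D w.1) c ((chartAt (Eu n) c).symm w.2)) (s, y) (1, 0))
      s := by
  simp only [integralDensity_eq_sum]
  refine HasDerivAt.fun_sum fun c _ ↦ ?_
  obtain ⟨h1, h2, h3⟩ := chart_compact (tsupport_chartPartition (n := n) c)
  refine hasDerivAt_setIntegral_of_contDiffOn (chartAt (Eu n) c).open_target h1 h2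
    (continuousOn_comp_symm (chartPartition n L c).contMDiff.continuous.continuousOn)
    (fun y hy hy' ↦ image_eq_zero_of_notMem_tsupport (h3 y hy hy')) isOpen_univ (Set.mem_univ s)
    (φ := fun t y ↦ dens (D t) c ((chartAt (Eu n) c).symm y))
    (φ' := fun t y ↦ fderiv ℝ (fun w : ℝ × Eu n ↦ dens (D w.1) c ((chartAt (Eu n) c).symm w.2))
      (t, y) (1, 0)) ?_ ?_ ?_
  · intro t _ y hy
    exact ((hD c (t, y) hy).continuousAt.comp (f := fun y : Eu n ↦ ((t, y) : ℝ × Eu n))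
      (by fun_prop)).continuousWithinAt
  · intro z hz
    exact (((hD c z hz.2).fderiv_right (m := ∞) (by simp)).clm_apply
      contDiffAt_const).continuousAt.continuousWithinAt
  · intro t _ y hy
    exact ((hD c (t, y) hy).differentiableAt (by simp)).hasFDerivAt.comp_hasDerivAt
      (f := fun t : ℝ ↦ ((t, y) : ℝ × Eu n)) t
      ((hasDerivAt_id t).prodMk (hasDerivAt_const t y))

end Density

variable [T2Space M]

lemma posDef_inner {m k : ℕ} {N : Type*} [TopologicalSpace N] [ChartedSpace (Eu m) N]
    [IsManifold (𝓡 m) ∞ N] (g : RMetric m N) {x : N} {v : Fin k → TangentSpace (𝓡 m) x}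
    (hv : LinearIndependent ℝ v) : (of fun i j ↦ g.inner x (v i) (v j)).PosDef := by
  refine Matrix.PosDef.of_dotProduct_mulVec_pos ?_ fun a ha ↦ ?_
  · ext i j; simp [conjTranspose_apply, g.symm x (v j)]
  · have h1 : star a ⬝ᵥ ((of fun i j ↦ g.inner x (v i) (v j)) *ᵥ a) =
        g.inner x (∑ i, a i • v i) (∑ j, a j • v j) := by
      simp [dotProduct, mulVec, map_sum, _root_.sum_apply, Finset.mul_sum]
      refine Finset.sum_congr rfl fun i _ ↦ Finset.sum_congr rfl fun j _ ↦ by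
        rw [g.symm x (v j) (v i)]; ring
    rw [h1]
    exact g.pos x _ fun h0 ↦ ha (funext fun i ↦ Fintype.linearIndependent_iff.1 hv a h0 i)

lemma gr_frm_eq {f : L → M} {p : L} (hp : p ∈ (chartAt (Eu n) c).source)
    (hx : f p ∈ (chartAt (Eu (2 * n)) x₀).source)
    (hf : MDifferentiableAt (𝓡 n) (𝓡 (2 * n)) f p) :
    K.gr (f p) (fun k ↦ diffAt f p (frm c p (EuclideanSpace.single k 1))) =
      (K.loc x₀).gm (rep c x₀ f (chartAt (Eu n) c p)) (jf (rep c x₀ f) (chartAt (Eu n) c p)) := by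
  rw [gr_eq_gm hx, rep_apply hp]
  simp only [← frmBasis_apply hp, crd_diffAt_frm hp hx hf]

lemma dens_volJ {o : ManifoldOrientation n L} {f : L → M} (hf : K.IsTotallyReal f) {p : L}
    (hp : p ∈ (chartAt (Eu n) c).source) (hx : f p ∈ (chartAt (Eu (2 * n)) x₀).source) :
    dens (K.volJDensity o f) c p = √((K.loc x₀).gm (rep c x₀ f (chartAt (Eu n) c p))
      (jf (rep c x₀ f) (chartAt (Eu n) c p))).det.re := by
  rw [dens, volJDensity_eq o hf, gr_frm_eq hp hx ((hf.smooth p).mdifferentiableAt (by simp))]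

lemma gm_jF (hF : SmoothFamily (n := n) F) {z : ℝ × Eu n}
    (hz : z.2 ∈ (chartAt (Eu n) c).target)
    (hx : F z.1 ((chartAt (Eu n) c).symm z.2) ∈ (chartAt (Eu (2 * n)) x₀).source) :
    (K.loc x₀).gm (repF c x₀ F z) (jF c x₀ F z) = K.gr (F z.1 ((chartAt (Eu n) c).symm z.2))
      (fun k ↦ diffAt (F z.1) ((chartAt (Eu n) c).symm z.2)
        (frm c ((chartAt (Eu n) c).symm z.2) (EuclideanSpace.single k 1))) := by
  rw [gr_frm_eq ((chartAt (Eu n) c).map_target hz) hx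
    (((hF.smooth z.1) _).mdifferentiableAt (by simp)), (chartAt (Eu n) c).right_inv hz]
  congr 1
  ext1 k
  exact jF_eq hF hz hx k

lemma isTRFrame_jF (hF : SmoothFamily (n := n) F) {z : ℝ × Eu n}
    (hz : z.2 ∈ (chartAt (Eu n) c).target)
    (hx : F z.1 ((chartAt (Eu n) c).symm z.2) ∈ (chartAt (Eu (2 * n)) x₀).source) :
    IsTRFrame ((K.loc x₀).J (repF c x₀ F z)) (jF c x₀ F z) ↔
      IsTRFrame (K.J (F z.1 ((chartAt (Eu n) c).symm z.2)))
      (fun k ↦ diffAt (F z.1) ((chartAt (Eu n) c).symm z.2)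
        (frmBasis ((chartAt (Eu n) c).map_target hz) k)) := by
  rw [isTRFrame_jf _ hx (((hF.smooth z.1) _).mdifferentiableAt (by simp)),
    (chartAt (Eu n) c).right_inv hz]
  have : jF c x₀ F z = jf (rep c x₀ (F z.1)) z.2 := funext fun k ↦ jF_eq hF hz hx k
  rw [this]
  rfl

/-- Totally real is an open condition in families. -/
lemma eventually_isTotallyReal [CompactSpace L] (hF : SmoothFamily (n := n) F)
    (h0 : K.IsTotallyReal (F 0)) : ∀ᶠ t in 𝓝 (0 : ℝ), K.IsTotallyReal (F t) := by
  have key : ∀ᶠ t in 𝓝 (0 : ℝ), ∀ p ∈ (Set.univ : Set L),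
      ∃ b : Module.Basis (Fin n) ℝ (TangentSpace (𝓡 n) p),
        IsTRFrame (K.J (F t p)) (fun i ↦ diffAt (F t) p (b i)) := by
    -- By compactness of `L` it suffices to argue near each point `(0, p)`, where a nonzero Gram
    -- determinant stays nonzero.
    refine isCompact_univ.eventually_forall_of_forall_eventually fun p _ ↦ ?_
    have hp := mem_chart_source (Eu n) p
    have hz := (chartAt (Eu n) p).map_source hp
    have hx : F 0 ((chartAt (Eu n) p).symm (chartAt (Eu n) p p)) ∈
        (chartAt (Eu (2 * n)) (F 0 p)).source := by
      rw [(chartAt (Eu n) p).left_inv hp]; exact mem_chart_source _ _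
    have h1 := (K.loc (F 0 p)).eventually_isTRFrame (p := ((0 : ℝ), chartAt (Eu n) p p))
      ((chartAt (Eu (2 * n)) (F 0 p)).map_source hx) (contDiffAt_repF hF hz hx)
      (contDiffAt_jF hF hz hx) ((isTRFrame_jF hF hz hx).2 (h0.isTRFrame _))
    have h2 : ContinuousAt (fun w : ℝ × L ↦ (w.1, chartAt (Eu n) p w.2)) ((0 : ℝ), p) :=
      continuousAt_fst.prodMk (((chartAt (Eu n) p).continuousAt hp).comp continuousAt_snd)
    filter_upwards [h2.eventually h1, h2.eventually (eventually_family hF hz hx),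
      continuousAt_snd.eventually ((chartAt (Eu n) p).open_source.mem_nhds hp)] with w h3 h4 h5
    have h6 := (isTRFrame_jF hF h4.1 h4.2).1 h3.2
    have h7 : (chartAt (Eu n) p).symm (chartAt (Eu n) p w.2) = w.2 :=
      (chartAt (Eu n) p).left_inv h5
    have h8 : ∃ b : Module.Basis (Fin n) ℝ
        (TangentSpace (𝓡 n) ((chartAt (Eu n) p).symm (chartAt (Eu n) p w.2))),
        IsTRFrame (K.J (F w.1 ((chartAt (Eu n) p).symm (chartAt (Eu n) p w.2))))
          (fun i ↦ diffAt (F w.1) ((chartAt (Eu n) p).symm (chartAt (Eu n) p w.2)) (b i)) := ⟨_, h6⟩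
    rwa [h7] at h8
  filter_upwards [key] with t ht
  exact isTotallyReal_of_isTRFrame (hF.smooth t) fun p ↦ ht p (Set.mem_univ p)

/-- The densities of a family are jointly smooth. -/
lemma contDiffAt_dens_volJ {o : ManifoldOrientation n L} (hF : SmoothFamily (n := n) F)
    (hT : ∀ t, K.IsTotallyReal (F t)) (c : L) (z : ℝ × Eu n)
    (hz : z.2 ∈ (chartAt (Eu n) c).target) :
    ContDiffAt ℝ ∞ (fun w : ℝ × Eu n ↦
      dens (K.volJDensity o (F w.1)) c ((chartAt (Eu n) c).symm w.2)) z := by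
  have hx := mem_chart_source (Eu (2 * n)) (F z.1 ((chartAt (Eu n) c).symm z.2))
  have hU : repF c (F z.1 ((chartAt (Eu n) c).symm z.2)) F z ∈ (chartAt (Eu (2 * n))
    (F z.1 ((chartAt (Eu n) c).symm z.2))).target := (chartAt (Eu (2 * n)) _).map_source hx
  have h1 := (K.loc _).contDiffAt_det_gm hU (contDiffAt_repF hF hz hx) (contDiffAt_jF hF hz hx)
  have h2 := (Complex.reCLM.contDiff.contDiffAt.comp z h1).sqrt (by
    simp only [Function.comp_apply, Complex.reCLM_apply]
    rw [gm_jF hF hz hx]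
    simp only [← frmBasis_apply ((chartAt (Eu n) c).map_target hz)]
    exact (K.det_gr_pos ((hT z.1).isTRFrame (frmBasis ((chartAt (Eu n) c).map_target hz)))).ne')
  refine h2.congr_of_eventuallyEq ?_
  filter_upwards [eventually_family hF hz hx] with w hw
  rw [dens, volJDensity_eq o (hT w.1)]
  simp only [Function.comp_apply, Complex.reCLM_apply]
  rw [gm_jF hF hw.1 hw.2]

/-- The density is the root of a Gram determinant that is positive because the maps are immersions,
so the root is smooth. -/
lemma contDiffAt_dens_vol (hF : SmoothFamily (n := n) F)
    (hI : ∀ t, IsSmoothImmersion (n := n) (F t)) (c : L) (z : ℝ × Eu n)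
    (hz : z.2 ∈ (chartAt (Eu n) c).target) :
    ContDiffAt ℝ ∞ (fun w : ℝ × Eu n ↦
      dens (K.volDensity (F w.1)) c ((chartAt (Eu n) c).symm w.2)) z := by
  have hx := mem_chart_source (Eu (2 * n)) (F z.1 ((chartAt (Eu n) c).symm z.2))
  have hG : ContDiffAt ℝ ∞ (fun w ↦ (K.loc (F z.1 ((chartAt (Eu n) c).symm z.2))).G
      (repF c (F z.1 ((chartAt (Eu n) c).symm z.2)) F w)) z :=
    ((K.loc _).smooth_G.contDiffAt ((K.loc _).isOpen.mem_nhds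
      ((chartAt (Eu (2 * n)) _).map_source hx))).comp z (contDiffAt_repF hF hz hx)
  have h1 : ContDiffAt ℝ ∞ (fun w ↦ (of fun i j ↦ (K.loc (F z.1 ((chartAt (Eu n) c).symm z.2))).G
      (repF c (F z.1 ((chartAt (Eu n) c).symm z.2)) F w)
      (jF c (F z.1 ((chartAt (Eu n) c).symm z.2)) F w i)
      (jF c (F z.1 ((chartAt (Eu n) c).symm z.2)) F w j) : Matrix (Fin n) (Fin n) ℝ).det) z :=
    contDiffAt_det fun i j ↦ (hG.clm_apply (contDiffAt_jF hF hz hx i)).clm_apply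
      (contDiffAt_jF hF hz hx j)
  have key : ∀ w : ℝ × Eu n, w.2 ∈ (chartAt (Eu n) c).target →
      F w.1 ((chartAt (Eu n) c).symm w.2) ∈
        (chartAt (Eu (2 * n)) (F z.1 ((chartAt (Eu n) c).symm z.2))).source → ∀ i j,
      (K.loc (F z.1 ((chartAt (Eu n) c).symm z.2))).G
      (repF c (F z.1 ((chartAt (Eu n) c).symm z.2)) F w)
      (jF c (F z.1 ((chartAt (Eu n) c).symm z.2)) F w i)
      (jF c (F z.1 ((chartAt (Eu n) c).symm z.2)) F w j) =
      K.g.inner (F w.1 ((chartAt (Eu n) c).symm w.2))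
        (diffAt (F w.1) ((chartAt (Eu n) c).symm w.2)
        (frm c ((chartAt (Eu n) c).symm w.2) (EuclideanSpace.single i 1)))
        (diffAt (F w.1) ((chartAt (Eu n) c).symm w.2)
        (frm c ((chartAt (Eu n) c).symm w.2) (EuclideanSpace.single j 1))) := by
    intro w h3 h4 i j
    have h5 := congrArg Complex.re (congrFun (congrFun (gm_jF (K := K) hF h3 h4) i) j)
    simpa [LocalKahler.gm, KahlerStructure.gr, gram, hform] using h5
  have h2 := h1.sqrt (by
    simp only [key z hz hx, ← frmBasis_apply ((chartAt (Eu n) c).map_target hz)]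
    have hli : LinearIndependent ℝ (fun k ↦ diffAt (F z.1) ((chartAt (Eu n) c).symm z.2)
        (frmBasis ((chartAt (Eu n) c).map_target hz) k)) :=
      (frmBasis ((chartAt (Eu n) c).map_target hz)).linearIndependent.map'
        (diffAt (F z.1) _).toLinearMap (LinearMap.ker_eq_bot.2 ((hI z.1).injective _))
    exact (posDef_inner K.g hli).det_pos.ne')
  refine h2.congr_of_eventuallyEq ?_
  filter_upwards [eventually_family hF hz hx] with w hw
  simp only [key w hw.1 hw.2]
  rfl

end Families

/-! ### The divergence of a section along a map, in coordinates. -/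

section LocalDivergence

variable {E : Type*} [NormedAddCommGroup E] [NormedSpace ℝ E] [FiniteDimensional ℝ E] {n : ℕ}

namespace LocalKahler

section Param

variable {P : Type*} [NormedAddCommGroup P] [NormedSpace ℝ P] {U : Set E} (K : LocalKahler E U)
  {f : P → E} {v : P → Fin n → E} {p : P}

lemma trace_tau_sum (hU : f p ∈ U) {κ : Type*} (s : Finset κ) (r : κ → ℝ) (a : κ → P) :
    (K.tau f v p (∑ k ∈ s, r k • a k)).trace = ∑ k ∈ s, (r k : ℂ) * (K.tau f v p (a k)).trace := by
  classical
  induction s using Finset.induction_on with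
  | empty =>
    have := K.tau_smul (v := v) hU 0 0
    simp only [zero_smul, Complex.ofReal_zero] at this
    simp [this]
  | insert i s hi ih =>
    rw [Finset.sum_insert hi, Finset.sum_insert hi, K.tau_add hU, K.tau_smul hU, Matrix.trace_add,
      Matrix.trace_smul, ih, smul_eq_mul]

/-- The derivative of the volume density of a family of frames. -/
lemma fderiv_sqrt_det_gm (hE : Module.finrank ℝ E = 2 * n) (hU : f p ∈ U)
    (hf : ContDiffAt ℝ ∞ f p) (hv : ∀ k, ContDiffAt ℝ ∞ (fun q ↦ v q k) p)
    (hT : IsTRFrame (K.J (f p)) (v p)) (a : P) :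
    ContDiffAt ℝ ∞ (fun q ↦ √(K.gm (f q) (v q)).det.re) p ∧
    fderiv ℝ (fun q ↦ √(K.gm (f q) (v q)).det.re) p a =
      (K.tau f v p a).trace.re * √(K.gm (f p) (v p)).det.re := by
  have hpos : 0 < (K.gm (f p) (v p)).det.re := (K.pair _ hU).gram_det_re_pos hT
  have hD : ContDiffAt ℝ ∞ (fun q ↦ (K.gm (f q) (v q)).det.re) p :=
    Complex.reCLM.contDiff.contDiffAt.comp p (K.contDiffAt_det_gm hU hf hv)
  refine ⟨hD.sqrt hpos.ne', ?_⟩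
  rw [((hD.differentiableAt (by simp)).hasFDerivAt.sqrt hpos.ne').fderiv]
  simp only [smul_apply, smul_eq_mul]
  rw [K.fderiv_det_gm hE hU hf hv hT a]
  have := Real.sq_sqrt hpos.le
  have h0 := (Real.sqrt_pos.2 hpos).ne'
  field_simp
  rw [this, mul_comm]

end Param

variable {U : Set E} (K : LocalKahler E U) {f Z : Eu n → E} {y : Eu n}

/-- The connection is torsion free on coordinate frames. -/
lemma tau_jf_symm (hU : f y ∈ U) (hf : ContDiffAt ℝ ∞ f y) (i j k : Fin n) :
    K.tau f (jf f) y (EuclideanSpace.single k 1) i j =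
      K.tau f (jf f) y (EuclideanSpace.single j 1) i k := by
  have h1 : ∀ a b : Eu n, fderiv ℝ (fun z ↦ fderiv ℝ f z b) y a = fderiv ℝ (fderiv ℝ f) y a b := by
    intro a b
    have := ((hf.fderiv_right (m := ∞) (by simp)).differentiableAt (by simp)).hasFDerivAt.clm_apply
      (hasFDerivAt_const b y)
    rw [this.fderiv]
    simp
  simp only [tau, Matrix.of_apply, jf, h1, cov]
  rw [(hf.isSymmSndFDerivAt (by simp; exact ENat.LEInfty.out)).eq, K.Γ_symm _ hU]

/-- The divergence of a section in coordinates. -/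
lemma divergence_eq (hE : Module.finrank ℝ E = 2 * n) (hU : f y ∈ U) (hf : ContDiffAt ℝ ∞ f y)
    (hT : IsTRFrame (K.J (f y)) (jf f y)) (hZ : ContDiffAt ℝ ∞ Z y) :
    (∑ k, K.cf (f y) (jf f y) (K.cov (f y) (jf f y k) (Z y) (jf Z y k)) k).re *
        √(K.gm (f y) (jf f y)).det.re =
      ∑ k, fderiv ℝ (fun z ↦ (K.cf (f z) (jf f z) (Z z) k).re *
        √(K.gm (f z) (jf f z)).det.re) y (EuclideanSpace.single k 1) -
      ∑ k, (K.cf (f y) (jf f y) (Z y) k).im *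
        (K.tau f (jf f) y (EuclideanSpace.single k 1)).trace.im * √(K.gm (f y) (jf f y)).det.re := by
  have h1 := fun k ↦ K.cf_cov hE hU hf (contDiffAt_jf hf) hT hZ (EuclideanSpace.single k 1) k
  have h2 := fun k : Fin n ↦ K.fderiv_sqrt_det_gm hE hU hf (contDiffAt_jf hf) hT
    (EuclideanSpace.single k 1)
  have h3 : ∀ k, DifferentiableAt ℝ (fun z ↦ K.cf (f z) (jf f z) (Z z) k) y := fun k ↦
    (K.contDiffAt_cf hU hf (contDiffAt_jf hf) hT hZ k).differentiableAt (by simp)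
  have h4 : ∀ k, fderiv ℝ (fun z ↦ (K.cf (f z) (jf f z) (Z z) k).re *
        √(K.gm (f z) (jf f z)).det.re) y (EuclideanSpace.single k 1) =
      (K.cf (f y) (jf f y) (Z y) k).re * ((K.tau f (jf f) y (EuclideanSpace.single k 1)).trace.re *
        √(K.gm (f y) (jf f y)).det.re) + √(K.gm (f y) (jf f y)).det.re *
      (fderiv ℝ (fun z ↦ K.cf (f z) (jf f z) (Z z) k) y (EuclideanSpace.single k 1)).re := by
    intro k
    have h5 : HasFDerivAt (fun z ↦ (K.cf (f z) (jf f z) (Z z) k).re) _ y :=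
      Complex.reCLM.hasFDerivAt.comp y (h3 k).hasFDerivAt
    rw [(h5.fun_mul ((h2 k).1.differentiableAt (by simp)).hasFDerivAt).fderiv]
    simp only [add_apply, smul_apply, smul_eq_mul]
    rw [(h2 k).2]
    rfl
  simp only [h4]
  -- Summing `dc + τ c` produces the entries `τ(e_k)_{kj}`. By `tau_jf_symm` they equal
  -- `τ(e_j)_{kk}`, so the sum over `k` is the trace of `τ(e_j)`.
  have h6 : ∑ k, K.cf (f y) (jf f y) (K.cov (f y) (jf f y k) (Z y) (jf Z y k)) k =
      ∑ k, fderiv ℝ (fun z ↦ K.cf (f z) (jf f z) (Z z) k) y (EuclideanSpace.single k 1) +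
        ∑ k, K.cf (f y) (jf f y) (Z y) k *
          (K.tau f (jf f) y (EuclideanSpace.single k 1)).trace := by
    have h7 : ∑ k, K.cf (f y) (jf f y) (Z y) k *
        (K.tau f (jf f) y (EuclideanSpace.single k 1)).trace =
      ∑ k, ∑ j, K.cf (f y) (jf f y) (Z y) j *
        K.tau f (jf f) y (EuclideanSpace.single k 1) k j := by
      rw [Finset.sum_comm]
      refine Finset.sum_congr rfl fun j _ ↦ ?_
      rw [Matrix.trace, Finset.mul_sum]
      refine Finset.sum_congr rfl fun k _ ↦ ?_
      rw [K.tau_jf_symm hU hf k j k]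
      rfl
    rw [h7, ← Finset.sum_add_distrib]
    exact Finset.sum_congr rfl fun k _ ↦ h1 k
  rw [h6, Complex.add_re, Complex.re_sum, Complex.re_sum, add_mul, Finset.sum_mul, Finset.sum_mul,
    ← Finset.sum_add_distrib, ← Finset.sum_sub_distrib]
  refine Finset.sum_congr rfl fun k _ ↦ ?_
  -- Of the real part of `c_k tr τ(e_k)`, the product of real parts belongs to the derivative of the
  -- density. The product of imaginary parts remains and is the Maslov term.
  rw [Complex.mul_re]
  ring

end LocalKahler

end LocalDivergence

/-! ### Tangential and normal parts of sections, and the integral of the divergence. -/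

section TangentialParts

open Matrix

variable {n : ℕ} {M : Type*} [TopologicalSpace M] [T2Space M] [ChartedSpace (Eu (2 * n)) M]
  [IsManifold (𝓡 (2 * n)) ∞ M] {L : Type*} [TopologicalSpace L] [ChartedSpace (Eu n) L]
  [IsManifold (𝓡 n) ∞ L] {K : KahlerStructure n M} {o : ManifoldOrientation n L}
  {c p : L} {f : L → M} {Z : Π p : L, TangentSpace (𝓡 (2 * n)) (f p)}

lemma contMDiffAt_comp_chart {m : ℕ} {N : Type*} [TopologicalSpace N] [ChartedSpace (Eu m) N]
    [IsManifold (𝓡 m) ∞ N] {F : Type*} [NormedAddCommGroup F] [NormedSpace ℝ F]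
    {c x : N} (hx : x ∈ (chartAt (Eu m) c).source) {φ : Eu m → F}
    (hφ : ContDiffAt ℝ ∞ φ (chartAt (Eu m) c x)) :
    ContMDiffAt (𝓡 m) 𝓘(ℝ, F) ∞ (fun y ↦ φ (chartAt (Eu m) c y)) x :=
  hφ.contMDiffAt.comp x ((contMDiffOn_chart (n := ∞) (I := 𝓡 m) (x := c)).contMDiffAt
    ((chartAt (Eu m) c).open_source.mem_nhds hx))

/-- A field with smooth coordinates is smooth. -/
lemma contMDiffAt_of_coordinates (hp : p ∈ (chartAt (Eu n) c).source)
    {Y : Π p : L, TangentSpace (𝓡 n) p} {a : Fin n → L → ℝ}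
    (ha : ∀ k, ContMDiffAt (𝓡 n) 𝓘(ℝ) ∞ (a k) p)
    (h : ∀ᶠ q in 𝓝 p, ∀ k, crd c q (Y q) k = a k q) :
    ContMDiffAt (𝓡 n) (𝓡 n).tangent ∞ (fun q ↦ (⟨q, Y q⟩ : TangentBundle (𝓡 n) L)) p := by
  refine (contMDiffAt_along_iff (b := fun q : L ↦ q) le_rfl hp).2 ⟨contMDiffAt_id, ?_⟩
  have h1 : ContMDiffAt (𝓡 n) 𝓘(ℝ, Eu n) ∞
      (fun q ↦ ∑ k, a k q • EuclideanSpace.single k (1 : ℝ)) p :=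
    contMDiffAt_finsetSum fun k _ ↦ (ha k).smul contMDiffAt_const
  refine h1.congr_of_eventuallyEq ?_
  filter_upwards [h] with q hq
  ext j
  simp [hq, Finset.sum_apply, Pi.single_apply]

/-- The complex coordinates of a section in a coordinate frame. -/
def coF (K : KahlerStructure n M) (f : L → M) (c : L)
    (Z : Π p : L, TangentSpace (𝓡 (2 * n)) (f p)) (q : L) : Fin n → ℂ :=
  K.co (f q) (fun k ↦ diffAt f q (frm c q (EuclideanSpace.single k 1))) (Z q)

lemma coF_frmBasis (hp : p ∈ (chartAt (Eu n) c).source) :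
    K.co (f p) (fun k ↦ diffAt f p (frmBasis hp k)) (Z p) = coF K f c Z p := by
  simp only [frmBasis_apply hp]
  rfl

lemma coF_eq {x₀ : M} (hp : p ∈ (chartAt (Eu n) c).source)
    (hx : f p ∈ (chartAt (Eu (2 * n)) x₀).source)
    (hf : MDifferentiableAt (𝓡 n) (𝓡 (2 * n)) f p) :
    coF K f c Z p = (K.loc x₀).cf (rep c x₀ f (chartAt (Eu n) c p))
      (jf (rep c x₀ f) (chartAt (Eu n) c p)) (repS c x₀ f Z (chartAt (Eu n) c p)) := by
  rw [cf_repS_diffAt hp hx hf, coF_frmBasis hp]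

lemma contMDiffAt_coF (hf : K.IsTotallyReal f) (hp : p ∈ (chartAt (Eu n) c).source)
    (hZ : ContMDiffAt (𝓡 n) (𝓡 (2 * n)).tangent ∞
      (fun q ↦ (⟨f q, Z q⟩ : TangentBundle (𝓡 (2 * n)) M)) p) (k : Fin n) :
    ContMDiffAt (𝓡 n) 𝓘(ℝ, ℂ) ∞ (fun q ↦ coF K f c Z q k) p := by
  have hx := mem_chart_source (Eu (2 * n)) (f p)
  have hF := contDiffAt_rep hp hx (hf.smooth p)
  have hT := (isTRFrame_jf hp hx ((hf.smooth p).mdifferentiableAt (by simp))).1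
    (hf.isTRFrame (frmBasis hp))
  refine (contMDiffAt_comp_chart hp ((K.loc (f p)).contDiffAt_cf (rep_mem (f := f) hp hx) hF
    (contDiffAt_jf hF) hT (contDiffAt_repS hp hx hZ) k)).congr_of_eventuallyEq ?_
  filter_upwards [(chartAt (Eu n) c).open_source.mem_nhds hp,
    (hf.smooth p).continuousAt.eventually ((chartAt (Eu (2 * n)) (f p)).open_source.mem_nhds hx)]
    with q hq hx'
  rw [coF_eq hq hx' ((hf.smooth q).mdifferentiableAt (by simp))]

/-- The tangential part of a section along a totally real immersion. -/
def KahlerStructure.tanPart (K : KahlerStructure n M) (f : L → M)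
    (Z : Π p : L, TangentSpace (𝓡 (2 * n)) (f p)) (p : L) : TangentSpace (𝓡 n) p :=
  Function.invFun (diffAt f p) (Z p - K.piJ f p (Z p))

/-- The tangent field `W` with `π_J Z = J ι_* W`. -/
def KahlerStructure.norPart (K : KahlerStructure n M) (f : L → M)
    (Z : Π p : L, TangentSpace (𝓡 (2 * n)) (f p)) (p : L) : TangentSpace (𝓡 n) p :=
  Function.invFun (diffAt f p) (-K.J (f p) (K.piJ f p (Z p)))

lemma crd_tanPart (hf : K.IsTotallyReal f) (hp : p ∈ (chartAt (Eu n) c).source) (k : Fin n) :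
    crd c p (K.tanPart f Z p) k = (coF K f c Z p k).re := by
  rw [KahlerStructure.tanPart, sub_piJ (hf.isTRFrame (frmBasis hp)),
    Function.leftInverse_invFun (hf.injective p), ← frmBasis_repr hp, Module.Basis.repr_sum_self,
    coF_frmBasis hp]

lemma piJ_eq_norPart (hf : K.IsTotallyReal f) (p : L) :
    K.piJ f p (Z p) = K.J (f p) (diffAt f p (K.norPart f Z p)) := by
  have hp := mem_chart_source (Eu n) p
  have h := piJ_apply (hf.isTRFrame (frmBasis hp)) (Z p)
  rw [KahlerStructure.norPart, h, K.J_sq, neg_neg, Function.leftInverse_invFun (hf.injective p)]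

lemma crd_norPart (hf : K.IsTotallyReal f) (hp : p ∈ (chartAt (Eu n) c).source) (k : Fin n) :
    crd c p (K.norPart f Z p) k = (coF K f c Z p k).im := by
  rw [KahlerStructure.norPart, piJ_apply (hf.isTRFrame (frmBasis hp)), K.J_sq, neg_neg,
    Function.leftInverse_invFun (hf.injective p), ← frmBasis_repr hp, Module.Basis.repr_sum_self,
    coF_frmBasis hp]

lemma smoothField_tanPart (hf : K.IsTotallyReal f) (hZ : SmoothAlong f Z) :
    SmoothField (K.tanPart f Z) := fun p ↦ by
  have hp := mem_chart_source (Eu n) p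
  refine contMDiffAt_of_coordinates hp (a := fun k q ↦ (coF K f p Z q k).re) (fun k ↦
    (Complex.reCLM.contDiff.contMDiff.contMDiffAt).comp p (contMDiffAt_coF hf hp (hZ p) k)) ?_
  filter_upwards [(chartAt (Eu n) p).open_source.mem_nhds hp] with q hq k
  rw [crd_tanPart hf hq]

/-- The coordinates of the Maslov form are smooth. -/
lemma contMDiffAt_maslovForm_frm (hf : K.IsTotallyReal f) (hp : p ∈ (chartAt (Eu n) c).source)
    (u : Eu n) :
    ContMDiffAt (𝓡 n) 𝓘(ℝ) ∞ (fun q ↦ K.maslovForm f q (frm c q u)) p := by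
  have hx := mem_chart_source (Eu (2 * n)) (f p)
  have hF := contDiffAt_rep hp hx (hf.smooth p)
  have hT := (isTRFrame_jf hp hx ((hf.smooth p).mdifferentiableAt (by simp))).1
    (hf.isTRFrame (frmBasis hp))
  have h1 : ContDiffAt ℝ ∞ (fun y ↦ ((K.loc (f p)).tau (rep c (f p) f) (jf (rep c (f p) f)) y
      u).trace) (chartAt (Eu n) c p) :=
    ContDiffAt.sum (s := Finset.univ) fun i _ ↦ (K.loc (f p)).contDiffAt_tau
      (rep_mem (f := f) hp hx) hF (contDiffAt_jf hF) hT u i i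
  have h2 : ContDiffAt ℝ ∞ (fun y ↦ -((K.loc (f p)).tau (rep c (f p) f) (jf (rep c (f p) f)) y
      u).trace.im) (chartAt (Eu n) c p) :=
    (Complex.imCLM.contDiff.contDiffAt.comp _ h1).neg
  refine (contMDiffAt_comp_chart hp h2).congr_of_eventuallyEq ?_
  filter_upwards [(chartAt (Eu n) c).open_source.mem_nhds hp,
    (hf.smooth p).continuousAt.eventually ((chartAt (Eu (2 * n)) (f p)).open_source.mem_nhds hx)]
    with q hq hx'
  rw [maslovForm_eq hq hx' hf.smooth (hf.isTRFrame (frmBasis hq)), crd_frm hq]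

lemma maslovForm_coordinates (hf : K.IsTotallyReal f) (hp : p ∈ (chartAt (Eu n) c).source)
    (X : TangentSpace (𝓡 n) p) : K.maslovForm f p X =
      ∑ k, crd c p X k * K.maslovForm f p (frm c p (EuclideanSpace.single k 1)) := by
  have hx := mem_chart_source (Eu (2 * n)) (f p)
  have hexp : crd c p X = ∑ k, crd c p X k • EuclideanSpace.single k (1 : ℝ) := by
    ext j; simp [Finset.sum_apply, Pi.single_apply]
  simp only [maslovForm_eq hp hx hf.smooth (hf.isTRFrame (frmBasis hp)), crd_frm hp]
  conv_lhs => rw [hexp]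
  rw [(K.loc (f p)).trace_tau_sum (rep_mem (f := f) hp hx), Complex.im_sum]
  simp

lemma continuous_maslovForm_norPart (hf : K.IsTotallyReal f) (hZ : SmoothAlong f Z) :
    Continuous (fun p ↦ K.maslovForm f p (K.norPart f Z p)) := by
  refine continuous_iff_continuousAt.2 fun p ↦ ?_
  have hp := mem_chart_source (Eu n) p
  have h : ContMDiffAt (𝓡 n) 𝓘(ℝ) ∞ (fun q ↦ ∑ k, (coF K f p Z q k).im *
      K.maslovForm f q (frm p q (EuclideanSpace.single k 1))) p :=
    contMDiffAt_finsetSum fun k _ ↦ ((Complex.imCLM.contDiff.contMDiff.contMDiffAt).comp p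
      (contMDiffAt_coF hf hp (hZ p) k)).mul (contMDiffAt_maslovForm_frm hf hp _)
  refine h.continuousAt.congr ?_
  filter_upwards [(chartAt (Eu n) p).open_source.mem_nhds hp] with q hq
  rw [maslovForm_coordinates hf hq]
  simp only [crd_norPart hf hq]

/-! ### The density of the `J`-volume -/

lemma contMDiffAt_dens_volJ (hf : K.IsTotallyReal f) (hp : p ∈ (chartAt (Eu n) c).source) :
    ContMDiffAt (𝓡 n) 𝓘(ℝ) ∞ (dens (K.volJDensity o f) c) p := by
  have hx := mem_chart_source (Eu (2 * n)) (f p)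
  have hF := contDiffAt_rep hp hx (hf.smooth p)
  have hT := (isTRFrame_jf hp hx ((hf.smooth p).mdifferentiableAt (by simp))).1
    (hf.isTRFrame (frmBasis hp))
  refine (contMDiffAt_comp_chart hp ((K.loc (f p)).fderiv_sqrt_det_gm (by simp)
    (rep_mem (f := f) hp hx) hF (contDiffAt_jf hF) hT 0).1).congr_of_eventuallyEq ?_
  filter_upwards [(chartAt (Eu n) c).open_source.mem_nhds hp,
    (hf.smooth p).continuousAt.eventually ((chartAt (Eu (2 * n)) (f p)).open_source.mem_nhds hx)]
    with q hq hx'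
  rw [dens_volJ hf hq hx']

lemma isContDensity_volJ (hf : K.IsTotallyReal f) : IsContDensity (K.volJDensity o f) where
  cont c p hp := (contMDiffAt_dens_volJ hf hp).continuousAt.continuousWithinAt
  change p v A := by
    rw [volJDensity_eq o hf, volJDensity_eq o hf]
    have h := (K.isHermPair (f p)).det_gram_combo (A.map (fun r ↦ (r : ℂ)))ᵀ
      (fun i ↦ diffAt f p (v i))
    have h1 : (fun j ↦ combo (K.J (f p)) ((A.map (fun r ↦ (r : ℂ)))ᵀ j)
        (fun i ↦ diffAt f p (v i))) = fun j ↦ diffAt f p (∑ i, A i j • v i) := by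
      ext1 j
      rw [map_sum]
      simp only [map_smul]
      exact IsHermPair.combo_real (fun i ↦ A i j) _
    have h2 : ((A.map (fun r ↦ (r : ℂ)))ᵀ).det = (A.det : ℂ) := by
      rw [det_transpose]
      exact (RingHom.map_det Complex.ofRealHom A).symm
    rw [h1, h2, Complex.norm_real, Real.norm_eq_abs] at h
    rw [KahlerStructure.gr, KahlerStructure.gr, h, Real.sqrt_mul (sq_nonneg _),
      Real.sqrt_sq (abs_nonneg _)]

lemma dens_volJ_pos (hf : K.IsTotallyReal f) (hp : p ∈ (chartAt (Eu n) c).source) :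
    0 < dens (K.volJDensity o f) c p := by
  rw [dens, volJDensity_eq o hf]
  simp only [← frmBasis_apply hp]
  exact Real.sqrt_pos.2 (K.det_gr_pos (hf.isTRFrame _))

/-- The divergence of a section in terms of its tangential part and the Maslov form. -/
lemma divJ_sub_maslovForm (hf : K.IsTotallyReal f) (hZ : SmoothAlong f Z)
    (hp : p ∈ (chartAt (Eu n) c).source) :
    (K.divJ f Z p - K.maslovForm f p (K.norPart f Z p)) * dens (K.volJDensity o f) c p =
    ∑ k, fderiv ℝ (fun y ↦ crd c ((chartAt (Eu n) c).symm y)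
      (K.tanPart f Z ((chartAt (Eu n) c).symm y)) k *
        dens (K.volJDensity o f) c ((chartAt (Eu n) c).symm y)) (chartAt (Eu n) c p)
          (EuclideanSpace.single k 1) := by
  have hx := mem_chart_source (Eu (2 * n)) (f p)
  have hF := contDiffAt_rep hp hx (hf.smooth p)
  have hU := rep_mem (f := f) hp hx
  have hT := (isTRFrame_jf hp hx ((hf.smooth p).mdifferentiableAt (by simp))).1
    (hf.isTRFrame (frmBasis hp))
  have h1 : ∀ k, fderiv ℝ (fun y ↦ crd c ((chartAt (Eu n) c).symm y)
      (K.tanPart f Z ((chartAt (Eu n) c).symm y)) k *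
        dens (K.volJDensity o f) c ((chartAt (Eu n) c).symm y)) (chartAt (Eu n) c p) =
      fderiv ℝ (fun z ↦ ((K.loc (f p)).cf (rep c (f p) f z) (jf (rep c (f p) f) z)
        (repS c (f p) f Z z) k).re * √((K.loc (f p)).gm (rep c (f p) f z)
          (jf (rep c (f p) f) z)).det.re) (chartAt (Eu n) c p) := by
    intro k
    refine Filter.EventuallyEq.fderiv_eq ?_
    filter_upwards [eventually_chart hp ((hf.smooth p).continuousAt.eventually
      ((chartAt (Eu (2 * n)) (f p)).open_source.mem_nhds hx))] with z ⟨hx', hq, hqz⟩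
    rw [crd_tanPart hf hq, coF_eq hq hx' ((hf.smooth _).mdifferentiableAt (by simp)),
      dens_volJ hf hq hx', hqz]
  simp only [h1]
  have h2 := (K.loc (f p)).divergence_eq (by simp) hU hF hT (contDiffAt_repS hp hx (hZ p))
  rw [dens_volJ hf hp hx, sub_mul,
    divJ_eq hp hx hf.smooth (hf.isTRFrame (frmBasis hp)) ((hZ p).mdifferentiableAt (by simp)), h2,
    maslovForm_coordinates hf hp]
  simp only [maslovForm_eq hp hx hf.smooth (hf.isTRFrame (frmBasis hp)), crd_frm hp,
    crd_norPart hf hp, coF_eq hp hx ((hf.smooth p).mdifferentiableAt (n := ∞) (by simp))]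
  rw [Finset.sum_mul, sub_sub, ← Finset.sum_add_distrib]
  simp

variable [T2Space L] [CompactSpace L]

lemma contDiffOn_dens_volJ (hf : K.IsTotallyReal f) (c : L) :
    ContDiffOn ℝ ∞ (fun y ↦ dens (K.volJDensity o f) c ((chartAt (Eu n) c).symm y))
      (chartAt (Eu n) c).target :=
  contDiffOn_comp_symm fun _ hp ↦ (contMDiffAt_dens_volJ hf hp).contMDiffWithinAt

/-- The integral of the divergence of a section is determined by the Maslov form. -/
lemma wint_divJ (hf : K.IsTotallyReal f) (hZ : SmoothAlong f Z) :
    wint (K.volJDensity o f) (K.divJ f Z) =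
      wint (K.volJDensity o f) (fun p ↦ K.maslovForm f p (K.norPart f Z p)) := by
  set δ : L → ℝ := fun p ↦ K.divJ f Z p - K.maslovForm f p (K.norPart f Z p) with hδ
  -- Locally `δ` is a smooth coordinate divergence divided by the positive density.
  have hcont : Continuous δ := by
    refine continuous_iff_continuousAt.2 fun p ↦ ?_
    have hp := mem_chart_source (Eu n) p
    have hy := (chartAt (Eu n) p).map_source hp
    have hpos := fun {q : L} ↦ dens_volJ_pos (o := o) (c := p) (p := q) hf
    have h1 : ContDiffOn ℝ ∞ (fun y ↦ ∑ k, fderiv ℝ (fun y ↦ crd p ((chartAt (Eu n) p).symm y)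
      (K.tanPart f Z ((chartAt (Eu n) p).symm y)) k *
        dens (K.volJDensity o f) p ((chartAt (Eu n) p).symm y)) y (EuclideanSpace.single k 1))
        (chartAt (Eu n) p).target := by
      refine ContDiffOn.sum fun k _ ↦ ?_
      have h2 : ContDiffOn ℝ ∞ (fun y ↦ crd p ((chartAt (Eu n) p).symm y)
        (K.tanPart f Z ((chartAt (Eu n) p).symm y)) k *
        dens (K.volJDensity o f) p ((chartAt (Eu n) p).symm y)) (chartAt (Eu n) p).target :=
        ((EuclideanSpace.proj (𝕜 := ℝ) k).contDiff.comp_contDiffOn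
          (contDiffOn_comp_symm (contMDiffOn_crd (smoothField_tanPart hf hZ) p))).mul
          (contDiffOn_dens_volJ hf p)
      exact (h2.fderiv_of_isOpen (chartAt (Eu n) p).open_target (by simp)).clm_apply
        contDiffOn_const
    have h3 := ((h1.continuousOn.continuousAt ((chartAt (Eu n) p).open_target.mem_nhds hy)).comp
      (f := chartAt (Eu n) p) ((chartAt (Eu n) p).continuousAt hp)).div
      (contMDiffAt_dens_volJ (o := o) hf hp).continuousAt (hpos hp).ne'
    refine h3.congr ?_
    filter_upwards [(chartAt (Eu n) p).open_source.mem_nhds hp] with q hq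
    have h4 := divJ_sub_maslovForm (o := o) hf hZ hq
    simp only [Pi.div_apply, Function.comp_apply]
    rw [← h4, mul_div_cancel_right₀ _ (hpos hq).ne']
  have h1 := wint_divergence (isContDensity_volJ (o := o) hf) (contDiffOn_dens_volJ hf)
    (smoothField_tanPart hf hZ) hcont fun c y hy ↦ by
      rw [divJ_sub_maslovForm hf hZ ((chartAt (Eu n) c).map_target hy),
        (chartAt (Eu n) c).right_inv hy]
  have h2 := wint_add (isContDensity_volJ (o := o) hf) hcont (continuous_maslovForm_norPart hf hZ)
  rw [h1, zero_add] at h2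
  rw [← h2]
  congr 1
  ext1 p
  simp [hδ]

end TangentialParts

/-! ### The first variation of the `J`-volume. -/

section FirstVariation

open Matrix

variable {n : ℕ} {M : Type*} [TopologicalSpace M] [T2Space M] [ChartedSpace (Eu (2 * n)) M]
  [IsManifold (𝓡 (2 * n)) ∞ M] {L : Type*} [TopologicalSpace L] [ChartedSpace (Eu n) L]
  [IsManifold (𝓡 n) ∞ L] {K : KahlerStructure n M} {o : ManifoldOrientation n L}
  {c p : L} {x₀ : M} {F : ℝ → L → M}

/-- The initial velocity of a family of maps. -/
def vel (F : ℝ → L → M) (p : L) : TangentSpace (𝓡 (2 * n)) (F 0 p) :=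
  mfderiv 𝓘(ℝ, ℝ) (𝓡 (2 * n)) (fun t : ℝ ↦ F t p) 0 (1 : ℝ)

/-- In coordinates the velocity is the time derivative of the joint representation, which makes
mixed partial derivatives available. -/
lemma repS_vel (hF : SmoothFamily (n := n) F) {y : Eu n}
    (hy : y ∈ (chartAt (Eu n) c).target)
    (hx : F 0 ((chartAt (Eu n) c).symm y) ∈ (chartAt (Eu (2 * n)) x₀).source) :
    repS c x₀ (F 0) (vel F) y = fderiv ℝ (repF c x₀ F) (0, y) (1, 0) := by
  have h1 : HasMFDerivAt 𝓘(ℝ, ℝ) (𝓡 (2 * n)) (fun t : ℝ ↦ F t ((chartAt (Eu n) c).symm y)) 0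
      (mfderiv 𝓘(ℝ, ℝ) (𝓡 (2 * n)) (fun t : ℝ ↦ F t ((chartAt (Eu n) c).symm y)) 0) :=
    ((hF.smooth_time _).contMDiffAt.mdifferentiableAt (by simp)).hasMFDerivAt
  have h2 := (HasMFDerivAt.comp (0 : ℝ) (hasMFDerivAt_chart hx) h1).hasFDerivAt
  have h3 : HasFDerivAt (fun t : ℝ ↦ ((t, y) : ℝ × Eu n)) (ContinuousLinearMap.inl ℝ ℝ (Eu n)) 0 :=
    hasFDerivAt_prodMk_left _ _
  have h4 := ((contDiffAt_repF (z := ((0 : ℝ), y)) hF hy hx).differentiableAt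
    (by simp)).hasFDerivAt.comp (0 : ℝ) h3
  have h5 := congrArg (fun A : ℝ →L[ℝ] Eu (2 * n) ↦ A 1)
    (HasFDerivAt.unique (𝕜 := ℝ) (E := ℝ) (F := Eu (2 * n)) h2 h4)
  exact h5

lemma smoothAlong_vel (hF : SmoothFamily (n := n) F) : SmoothAlong (n := n) (F 0) (vel (n := n) F) := by
  intro p
  have hp := mem_chart_source (Eu n) p
  have hx := mem_chart_source (Eu (2 * n)) (F 0 p)
  have hz := (chartAt (Eu n) p).map_source hp
  refine (contMDiffAt_along_iff le_rfl hx).2 ⟨hF.smooth 0 p, ?_⟩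
  have hx' : F 0 ((chartAt (Eu n) p).symm (chartAt (Eu n) p p)) ∈
      (chartAt (Eu (2 * n)) (F 0 p)).source := by
    rw [(chartAt (Eu n) p).left_inv hp]; exact hx
  have h1 : ContDiffAt ℝ ∞ (fun y : Eu n ↦ fderiv ℝ (repF p (F 0 p) F) (0, y) (1, 0))
      (chartAt (Eu n) p p) :=
    (((contDiffAt_repF (z := ((0 : ℝ), chartAt (Eu n) p p)) hF hz hx').fderiv_right (m := ∞)
      (by simp)).clm_apply contDiffAt_const).comp (chartAt (Eu n) p p)
      (contDiffAt_const.prodMk contDiffAt_id)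
  refine (contMDiffAt_comp_chart hp h1).congr_of_eventuallyEq ?_
  filter_upwards [(chartAt (Eu n) p).open_source.mem_nhds hp,
    (hF.smooth 0 p).continuousAt.eventually ((chartAt (Eu (2 * n)) (F 0 p)).open_source.mem_nhds hx)]
    with q hq hxq
  rw [← repS_vel hF ((chartAt (Eu n) p).map_source hq) (by
    rw [(chartAt (Eu n) p).left_inv hq]; exact hxq), repS_apply hq]

/-- The derivative of the density of a family. -/
lemma fderiv_dens_volJ (hF : SmoothFamily (n := n) F) (hT : ∀ t, K.IsTotallyReal (F t)) {y : Eu n}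
    (hy : y ∈ (chartAt (Eu n) c).target) :
    fderiv ℝ (fun w : ℝ × Eu n ↦ dens (K.volJDensity o (F w.1)) c ((chartAt (Eu n) c).symm w.2))
      (0, y) (1, 0) = K.divJ (F 0) (vel F) ((chartAt (Eu n) c).symm y) *
        dens (K.volJDensity o (F 0)) c ((chartAt (Eu n) c).symm y) := by
  obtain ⟨p, hp, rfl⟩ : ∃ p ∈ (chartAt (Eu n) c).source, y = chartAt (Eu n) c p :=
    ⟨_, (chartAt (Eu n) c).map_target hy, ((chartAt (Eu n) c).right_inv hy).symm⟩
  have hx := mem_chart_source (Eu (2 * n)) (F 0 p)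
  have hx' : F 0 ((chartAt (Eu n) c).symm (chartAt (Eu n) c p)) ∈
      (chartAt (Eu (2 * n)) (F 0 p)).source := by
    rw [(chartAt (Eu n) c).left_inv hp]; exact hx
  set z : ℝ × Eu n := (0, chartAt (Eu n) c p) with hz
  have hfd := ((hF.smooth 0) p).mdifferentiableAt (n := ∞) (by simp)
  have hf := contDiffAt_repF (z := z) hF hy hx'
  have hv := contDiffAt_jF (z := z) hF hy hx'
  have hU : repF c (F 0 p) F z ∈ (chartAt (Eu (2 * n)) (F 0 p)).target :=
    rep_mem (f := F 0) hp hx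
  have hTF := (isTRFrame_jF (z := z) hF hy hx').2 ((hT 0).isTRFrame _)
  have hjF : jF c (F 0 p) F z = jf (rep c (F 0 p) (F 0)) (chartAt (Eu n) c p) :=
    funext fun k ↦ jF_eq (z := z) hF hy hx' k
  have h1 : (fun w : ℝ × Eu n ↦ dens (K.volJDensity o (F w.1)) c ((chartAt (Eu n) c).symm w.2))
      =ᶠ[𝓝 z] fun w ↦ √((K.loc (F 0 p)).gm (repF c (F 0 p) F w) (jF c (F 0 p) F w)).det.re := by
    filter_upwards [eventually_family (z := z) hF hy hx'] with w hw
    rw [dens, volJDensity_eq o (hT w.1), gm_jF hF hw.1 hw.2]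
  rw [h1.fderiv_eq, ((K.loc (F 0 p)).fderiv_sqrt_det_gm (by simp) hU hf hv hTF (1, 0)).2]
  have h2 : K.divJ (F 0) (vel F) p * dens (K.volJDensity o (F 0)) c p =
      ((K.loc (F 0 p)).tau (repF c (F 0 p) F) (jF c (F 0 p) F) z (1, 0)).trace.re *
        √((K.loc (F 0 p)).gm (repF c (F 0 p) F z) (jF c (F 0 p) F z)).det.re := by
    rw [dens_volJ (hT 0) hp hx, divJ_eq hp hx (hF.smooth 0) ((hT 0).isTRFrame (frmBasis hp))
      ((smoothAlong_vel hF p).mdifferentiableAt (by simp)), hjF]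
    congr 2
    refine Finset.sum_congr rfl fun k _ ↦ ?_
    rw [diag_apply, LocalKahler.tau, of_apply, hjF]
    have hd : ∀ a b : ℝ × Eu n, fderiv ℝ (fun w ↦ fderiv ℝ (repF c (F 0 p) F) w b) z a =
        fderiv ℝ (fderiv ℝ (repF c (F 0 p) F)) z a b := by
      intro a b
      have := ((hf.fderiv_right (m := ∞) (by simp)).differentiableAt (by simp)).hasFDerivAt.clm_apply
        (hasFDerivAt_const b z)
      rw [this.fderiv]
      simp
    -- The mixed partial derivatives agree: the `k`-th derivative of the velocity is the time
    -- derivative of the `k`-th tangent vector.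
    have h3 : jf (repS c (F 0 p) (F 0) (vel F)) (chartAt (Eu n) c p) k =
        fderiv ℝ (fun w ↦ jF c (F 0 p) F w k) z (1, 0) := by
      have h4 : repS c (F 0 p) (F 0) (vel F) =ᶠ[𝓝 (chartAt (Eu n) c p)]
          fun y ↦ fderiv ℝ (repF c (F 0 p) F) (0, y) (1, 0) := by
        filter_upwards [eventually_chart hp ((hF.smooth 0 p).continuousAt.eventually
          ((chartAt (Eu (2 * n)) (F 0 p)).open_source.mem_nhds hx)),
          (chartAt (Eu n) c).open_target.mem_nhds hy] with y hy1 hy2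
        exact repS_vel hF hy2 hy1.1
      have h5 : HasFDerivAt (fun y : Eu n ↦ fderiv ℝ (repF c (F 0 p) F) (0, y) (1, 0)) _
          (chartAt (Eu n) c p) :=
        (((hf.fderiv_right (m := ∞) (by simp)).clm_apply (contDiffAt_const
          (c := ((1, 0) : ℝ × Eu n)))).differentiableAt (by simp)).hasFDerivAt.comp
          (chartAt (Eu n) c p) (hasFDerivAt_prodMk_right (0 : ℝ) (chartAt (Eu n) c p))
      rw [jf, h4.fderiv_eq, h5.fderiv]
      refine (hd _ _).trans ?_
      rw [(hf.isSymmSndFDerivAt (by simp; exact ENat.LEInfty.out)).eq]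
      exact (hd _ _).symm
    have h6 : repS c (F 0 p) (F 0) (vel F) (chartAt (Eu n) c p) =
        fderiv ℝ (repF c (F 0 p) F) z (1, 0) := repS_vel hF hy hx'
    rw [h3, h6]
    -- With the symmetry of `Γ` this becomes `∇_t ∂_k F = ∇_k ∂_t F`.
    change (K.loc (F 0 p)).cf _ _ (_ + (K.loc (F 0 p)).Γ _ _ _) k =
      (K.loc (F 0 p)).cf _ _ (_ + (K.loc (F 0 p)).Γ _ _ _) k
    rw [(K.loc (F 0 p)).Γ_symm _ hU]
    rfl
  rw [← h2, ← (congrArg (fun q ↦ K.divJ (F 0) (vel F) q * dens (K.volJDensity o (F 0)) c q)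
    ((chartAt (Eu n) c).left_inv hp))]

variable [T2Space L] [CompactSpace L]

/-- The first variation of the `J`-volume. -/
lemma hasDerivAt_VolJ (hF : SmoothFamily (n := n) F) (hT : ∀ t, K.IsTotallyReal (F t)) :
    HasDerivAt (fun t ↦ K.VolJ o (F t)) (wint (K.volJDensity o (F 0)) fun p ↦
      K.maslovForm (F 0) p (K.norPart (F 0) (vel F) p)) 0 := by
  refine (hasDerivAt_integralDensity (D := fun t ↦ K.volJDensity o (F t))
    (contDiffAt_dens_volJ hF hT) 0).congr_deriv ?_
  rw [← wint_divJ (hT 0) (smoothAlong_vel hF), wint_eq_sum]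
  refine Finset.sum_congr rfl fun c _ ↦
    setIntegral_congr_fun (chartAt (Eu n) c).open_target.measurableSet fun y hy ↦ ?_
  simp only [fderiv_dens_volJ hF hT hy]

end FirstVariation

/-! ### The `J`-mean curvature field determined by the Maslov form. -/

section MeanCurvature

open Matrix

lemma contDiffAt_inv_apply {P : Type*} [NormedAddCommGroup P] [NormedSpace ℝ P] {n : ℕ}
    {A : P → Matrix (Fin n) (Fin n) ℝ} {p : P} (hA : ∀ i j, ContDiffAt ℝ ∞ (fun q ↦ A q i j) p)
    (h0 : (A p).det ≠ 0) (i j : Fin n) : ContDiffAt ℝ ∞ (fun q ↦ (A q)⁻¹ i j) p := by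
  simp only [Matrix.inv_def, Matrix.smul_apply, smul_eq_mul, Ring.inverse_eq_inv',
    Matrix.adjugate_apply]
  refine ((contDiffAt_det hA).inv h0).mul (contDiffAt_det fun a b ↦ ?_)
  simp only [updateRow_apply]
  split_ifs
  · exact contDiffAt_const
  · exact hA _ _

variable {n : ℕ} {M : Type*} [TopologicalSpace M] [T2Space M] [ChartedSpace (Eu (2 * n)) M]
  [IsManifold (𝓡 (2 * n)) ∞ M] {L : Type*} [TopologicalSpace L] [ChartedSpace (Eu n) L]
  [IsManifold (𝓡 n) ∞ L] {K : KahlerStructure n M} {o : ManifoldOrientation n L}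
  {c p : L} {f : L → M}

namespace KahlerStructure

/-- The Gram matrix of the induced metric in a chart. -/
def gramF (K : KahlerStructure n M) (f : L → M) (c q : L) : Matrix (Fin n) (Fin n) ℝ :=
  of fun i j ↦ K.g.inner (f q) (diffAt f q (frm c q (EuclideanSpace.single i 1)))
    (diffAt f q (frm c q (EuclideanSpace.single j 1)))

/-- The coordinates of the vector field dual to the Maslov form. -/
def sharpF (K : KahlerStructure n M) (f : L → M) (c q : L) : Fin n → ℝ :=
  (K.gramF f c q)⁻¹ *ᵥ fun j ↦ K.maslovForm f q (frm c q (EuclideanSpace.single j 1))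

/-- The vector field dual to the Maslov form. -/
def sharp (K : KahlerStructure n M) (f : L → M) (p : L) : TangentSpace (𝓡 n) p :=
  ∑ k, K.sharpF f p p k • frm p p (EuclideanSpace.single k 1)

/-- The `J`-mean curvature field, as determined by the Maslov form. -/
def maslovField (K : KahlerStructure n M) (f : L → M) (p : L) : TangentSpace (𝓡 (2 * n)) (f p) :=
  K.J (f p) (diffAt f p (-K.sharp f p))

end KahlerStructure

lemma gramF_posDef (hf : K.IsTotallyReal f) (hp : p ∈ (chartAt (Eu n) c).source) :
    (K.gramF f c p).PosDef := by
  have hli : LinearIndependent ℝ (fun k : Fin n ↦ diffAt f p (frm c p (EuclideanSpace.single k 1))) := by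
    simp only [← frmBasis_apply hp]
    exact (frmBasis hp).linearIndependent.map' (diffAt f p).toLinearMap
      (LinearMap.ker_eq_bot.2 (hf.injective p))
  exact posDef_inner K.g hli

lemma inner_sharpF (hf : K.IsTotallyReal f) (hp : p ∈ (chartAt (Eu n) c).source)
    (w : TangentSpace (𝓡 n) p) :
    K.g.inner (f p) (diffAt f p (∑ k, K.sharpF f c p k • frm c p (EuclideanSpace.single k 1)))
      (diffAt f p w) = K.maslovForm f p w := by
  have h1 : K.gramF f c p *ᵥ K.sharpF f c p =
      fun j ↦ K.maslovForm f p (frm c p (EuclideanSpace.single j 1)) := by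
    rw [KahlerStructure.sharpF, mulVec_mulVec, mul_nonsing_inv _
      (isUnit_iff_ne_zero.2 (gramF_posDef hf hp).det_pos.ne'), one_mulVec]
  rw [maslovForm_coordinates hf hp, diffAt_eq_sum (frmBasis hp) w]
  simp only [map_sum, map_smul, _root_.sum_apply, _root_.smul_apply, smul_eq_mul]
  refine Finset.sum_congr rfl fun j _ ↦ ?_
  rw [frmBasis_repr, ← congrFun h1 j]
  congr 1
  rw [mulVec, dotProduct]
  refine Finset.sum_congr rfl fun i _ ↦ ?_
  rw [frmBasis_apply, KahlerStructure.gramF, of_apply, mul_comm, K.g.symm]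

/-- The dual field is defined at each point in the chart centred there. Duality to the Maslov form
determines it, so a fixed chart gives the same vector and smoothness can be read in it. -/
lemma sharp_eq (hf : K.IsTotallyReal f) (hp : p ∈ (chartAt (Eu n) c).source) :
    K.sharp f p = ∑ k, K.sharpF f c p k • frm c p (EuclideanSpace.single k 1) := by
  set a := ∑ k, K.sharpF f c p k • frm c p (EuclideanSpace.single k 1) with ha
  have h : ∀ w, K.g.inner (f p) (diffAt f p (K.sharp f p - a)) (diffAt f p w) = 0 := by
    intro w
    have h1 := inner_sharpF hf (mem_chart_source (Eu n) p) w
    have h2 := inner_sharpF hf hp w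
    rw [map_sub, map_sub, _root_.sub_apply]
    exact sub_eq_zero.2 (h1.trans h2.symm)
  by_contra hne
  have h3 : diffAt f p (K.sharp f p - a) ≠ 0 := fun h0 ↦ hne (sub_eq_zero.1
    (hf.injective p (h0.trans (map_zero _).symm)))
  exact (K.g.pos _ _ h3).ne' (h _)

lemma inner_sharp (hf : K.IsTotallyReal f) (w : TangentSpace (𝓡 n) p) :
    K.g.inner (f p) (diffAt f p (K.sharp f p)) (diffAt f p w) = K.maslovForm f p w :=
  inner_sharpF hf (mem_chart_source (Eu n) p) w

lemma smoothField_sharp (hf : K.IsTotallyReal f) : SmoothField (fun p ↦ -K.sharp f p) := by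
  intro p
  have hp := mem_chart_source (Eu n) p
  have hy := (chartAt (Eu n) p).map_source hp
  have hof : ∀ {φ : L → ℝ}, ContMDiffAt (𝓡 n) 𝓘(ℝ) ∞ φ p →
      ContDiffAt ℝ ∞ (fun y ↦ φ ((chartAt (Eu n) p).symm y)) (chartAt (Eu n) p p) := fun hφ ↦
    (ContMDiffAt.comp_of_eq hφ (contMDiffAt_chart_symm hy)
      ((chartAt (Eu n) p).left_inv hp)).contDiffAt
  have he : ∀ k, ContMDiffAt (𝓡 n) (𝓡 (2 * n)).tangent ∞ (fun q ↦ (⟨f q, diffAt f q (frm p q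
      (EuclideanSpace.single k 1))⟩ : TangentBundle (𝓡 (2 * n)) M)) p := fun k ↦
    contMDiffAt_diffAt hf.smooth (contMDiffAt_frm hp _)
  have hA : ∀ i j, ContDiffAt ℝ ∞ (fun y ↦ K.gramF f p ((chartAt (Eu n) p).symm y) i j)
      (chartAt (Eu n) p p) := fun i j ↦
    hof (φ := fun q ↦ K.gramF f p q i j) (contMDiffAt_inner_along K.g (he i) (he j))
  have h0 : (K.gramF f p ((chartAt (Eu n) p).symm (chartAt (Eu n) p p))).det ≠ 0 := by
    rw [(chartAt (Eu n) p).left_inv hp]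
    exact (gramF_posDef hf hp).det_pos.ne'
  have h1 : ∀ k, ContDiffAt ℝ ∞ (fun y ↦ -K.sharpF f p ((chartAt (Eu n) p).symm y) k)
      (chartAt (Eu n) p p) := fun k ↦
    (ContDiffAt.sum (s := Finset.univ) fun j _ ↦ (contDiffAt_inv_apply hA h0 k j).mul
      (hof (contMDiffAt_maslovForm_frm hf hp (EuclideanSpace.single j 1)))).neg
  refine contMDiffAt_of_coordinates hp (fun k ↦ contMDiffAt_comp_chart hp (h1 k)) ?_
  filter_upwards [(chartAt (Eu n) p).open_source.mem_nhds hp] with q hq k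
  rw [sharp_eq hf hq, map_neg, (chartAt (Eu n) p).left_inv hq]
  simp only [map_sum, map_smul, crd_frm hq]
  simp [Finset.sum_apply, Pi.single_apply]

lemma smoothAlong_maslovField (hf : K.IsTotallyReal f) : SmoothAlong f (K.maslovField f) :=
  fun p ↦ contMDiffAt_J_along K (contMDiffAt_diffAt hf.smooth (smoothField_sharp hf p))

lemma maslovField_mem (p : L) : K.maslovField f p ∈ K.jPlane f p :=
  ⟨_, ⟨_, rfl⟩, rfl⟩

/-- With `π_J Z = Jι_*W` and the field equal to `-Jι_*ξ^♯`, orthogonality of `J` reduces the pairing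
to `-ξ(W)`. -/
lemma inner_piJ_maslovField (hf : K.IsTotallyReal f)
    {Z : Π p : L, TangentSpace (𝓡 (2 * n)) (f p)} (p : L) :
    K.g.inner (f p) (K.piJ f p (Z p)) (K.maslovField f p) =
      -K.maslovForm f p (K.norPart f Z p) := by
  rw [piJ_eq_norPart hf, KahlerStructure.maslovField, K.J_orthogonal, K.g.symm, map_neg, map_neg,
    _root_.neg_apply, inner_sharp hf]

lemma maslovField_eq_zero_iff (hf : K.IsTotallyReal f) (p : L) :
    K.maslovField f p = 0 ↔ ∀ X, K.maslovForm f p X = 0 := by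
  constructor
  · intro h X
    have h1 : K.g.inner (f p) (K.maslovField f p) (K.J (f p) (diffAt f p X)) = 0 := by
      rw [h]; simp
    rw [KahlerStructure.maslovField, K.J_orthogonal, map_neg, map_neg, _root_.neg_apply,
      inner_sharp hf] at h1
    linarith
  · intro h
    have h1 : diffAt f p (K.sharp f p) = 0 := by
      by_contra hne
      have := K.g.pos _ _ hne
      rw [inner_sharp hf, h] at this
      exact lt_irrefl _ this
    rw [KahlerStructure.maslovField, map_neg, h1, neg_zero, map_zero]

variable [T2Space L] [CompactSpace L]

/-- The two minus signs, in the field and in the definition of the gradient, cancel against the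
first variation `∫ ξ(W) vol_J`. -/
lemma isJMeanCurvature_maslovField (hf : K.IsTotallyReal f) :
    K.IsJMeanCurvature o f (K.maslovField f) where
  smooth := smoothAlong_maslovField hf
  mem := maslovField_mem
  first_variation := by
    rintro F ⟨hF, rfl⟩ hT Z hZ
    obtain rfl : Z = vel (n := n) F := by
      ext1 p
      simpa [vel] using hZ p
    refine (hasDerivAt_VolJ hF hT).congr_deriv ?_
    simp only [inner_piJ_maslovField hf]
    change _ = -wint (K.volJDensity o (F 0)) fun p ↦ -K.maslovForm (F 0) p (K.norPart (F 0) (vel F) p)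
    rw [wint_neg, neg_neg]

end MeanCurvature

/-! ### Construction of variations with prescribed velocity. -/

section LocalVariations

/-- Reparametrizations of time with small values. -/
lemma exists_reparametrization {s : Set ℝ} (hs : s ∈ 𝓝 (0 : ℝ)) :
    ∃ σ : ℝ → ℝ, ContDiff ℝ ∞ σ ∧ σ 0 = 0 ∧ HasDerivAt σ 1 0 ∧ ∀ t, σ t ∈ s := by
  obtain ⟨ε, hε, hεs⟩ := Metric.nhds_basis_closedBall.mem_iff.1 hs
  -- The function `ε sin(t/ε)` has derivative one at zero and never leaves `[-ε, ε]`.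
  refine ⟨fun t ↦ ε * Real.sin (t / ε), ?_, by simp, ?_, fun t ↦ hεs ?_⟩
  · exact contDiff_const.mul (Real.contDiff_sin.comp (contDiff_id.div_const ε))
  · have h := (((hasDerivAt_id (0 : ℝ)).div_const ε).sin).const_mul ε
    refine h.congr_deriv ?_
    simp [hε.ne']
  · rw [mem_closedBall_zero_iff, Real.norm_eq_abs, abs_mul, abs_of_pos hε]
    exact mul_le_of_le_one_right hε.le (Real.abs_sin_le_one _)

variable {n : ℕ} {M : Type*} [TopologicalSpace M] [ChartedSpace (Eu (2 * n)) M]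
  [IsManifold (𝓡 (2 * n)) ∞ M] {L : Type*} [TopologicalSpace L] [ChartedSpace (Eu n) L]
  [IsManifold (𝓡 n) ∞ L] {K : KahlerStructure n M} {o : ManifoldOrientation n L}
  {f : L → M} {F : ℝ → L → M}

lemma SmoothFamily.reparametrize (hF : SmoothFamily (n := n) F) {σ : ℝ → ℝ}
    (hσ : ContDiff ℝ ∞ σ) : SmoothFamily (n := n) (fun t ↦ F (σ t)) :=
  hF.comp ((hσ.contMDiff.comp contMDiff_fst).prodMk contMDiff_snd)

lemma isVelocity_reparametrize (hF : SmoothFamily (n := n) F)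
    {Z : Π p : L, TangentSpace (𝓡 (2 * n)) (f p)} (hZ : IsVelocity (n := n) f F Z) {σ : ℝ → ℝ}
    (h0 : σ 0 = 0) (h1 : HasDerivAt σ 1 0) : IsVelocity (n := n) f (fun t ↦ F (σ t)) Z := by
  intro p
  have hA : HasMFDerivAt 𝓘(ℝ, ℝ) (𝓡 (2 * n)) (fun t : ℝ ↦ F t p) (σ 0)
      (mfderiv 𝓘(ℝ, ℝ) (𝓡 (2 * n)) (fun t : ℝ ↦ F t p) (σ 0)) :=
    ((hF.smooth_time p).contMDiffAt.mdifferentiableAt (by simp)).hasMFDerivAt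
  have hB := HasMFDerivAt.comp (0 : ℝ) hA h1.hasFDerivAt.hasMFDerivAt
  have hC : mfderiv 𝓘(ℝ, ℝ) (𝓡 (2 * n)) (fun t : ℝ ↦ F (σ t) p) 0 (1 : ℝ) =
      mfderiv 𝓘(ℝ, ℝ) (𝓡 (2 * n)) (fun t : ℝ ↦ F t p) (σ 0) (1 : ℝ) := by
    have h2 := hB.mfderiv
    refine (congrArg (fun A : ℝ →L[ℝ] Eu (2 * n) ↦ A 1) h2).trans ?_
    refine congrArg (mfderiv 𝓘(ℝ, ℝ) (𝓡 (2 * n)) (fun t : ℝ ↦ F t p) (σ 0)) ?_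
    exact one_smul ℝ (1 : ℝ)
  refine (hZ p).trans ?_
  rw [hC]
  exact congrArg (fun s : ℝ ↦ (⟨F s p, mfderiv 𝓘(ℝ, ℝ) (𝓡 (2 * n)) (fun t : ℝ ↦ F t p) s
    (1 : ℝ)⟩ : TangentBundle (𝓡 (2 * n)) M)) h0.symm

/-- Variations with prescribed velocity near a point. -/
lemma exists_variation [CompactSpace L] [T2Space L]
    (hf : ContMDiff (𝓡 n) (𝓡 (2 * n)) ∞ f) {X : Π p : L, TangentSpace (𝓡 (2 * n)) (f p)}
    (hX : SmoothAlong f X) (p₀ : L) :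
    ∃ (F : ℝ → L → M) (χ : L → ℝ), IsVariation (n := n) f F ∧ Continuous χ ∧ (∀ p, 0 ≤ χ p) ∧
      χ p₀ = 1 ∧ IsVelocity (n := n) f F (fun p ↦ χ p • X p) := by
  classical
  set x₀ := f p₀ with hx₀
  set ψ := chartAt (Eu (2 * n)) x₀ with hψ
  have hx := mem_chart_source (Eu (2 * n)) x₀
  obtain ⟨r, hr, hrt⟩ := Metric.nhds_basis_ball.mem_iff.1 (ψ.open_target.mem_nhds (ψ.map_source hx))
  set N : Set L := f ⁻¹' (ψ.source ∩ ψ ⁻¹' Metric.ball (ψ x₀) (r / 2)) with hN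
  have hNo : IsOpen N :=
    (ψ.continuousOn.isOpen_inter_preimage ψ.open_source Metric.isOpen_ball).preimage hf.continuous
  have hNp : p₀ ∈ N := ⟨hx, Metric.mem_ball_self (by positivity)⟩
  obtain ⟨χ, -, hχ⟩ := (SmoothBumpFunction.nhds_basis_tsupport (I := 𝓡 n) p₀).mem_iff.1
    (hNo.mem_nhds hNp)
  set w : L → Eu (2 * n) := fun q ↦ χ q • crd x₀ (f q) (X q) with hw
  have hw0 : ∀ q ∉ tsupport χ, w q = 0 := fun q hq ↦ by
    simp only [hw]
    rw [image_eq_zero_of_notMem_tsupport hq, zero_smul]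
  have hwN : ∀ q ∈ N, ContMDiffAt (𝓡 n) 𝓘(ℝ, Eu (2 * n)) ∞ w q := fun q hq ↦
    χ.contMDiffAt.smul ((contMDiffAt_along_iff le_rfl hq.1).1 (hX q)).2
  have hcN : ∀ q ∉ N, ∀ᶠ q' in 𝓝 q, q' ∉ tsupport χ := fun q hq ↦
    (isClosed_tsupport χ).isOpen_compl.mem_nhds fun h ↦ hq (hχ h)
  have hwc : Continuous w := continuous_iff_continuousAt.2 fun q ↦ by
    by_cases hq : q ∈ N
    · exact (hwN q hq).continuousAt
    · refine (continuousAt_const (y := (0 : Eu (2 * n)))).congr ?_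
      filter_upwards [hcN q hq] with q' hq' using (hw0 q' hq').symm
  obtain ⟨C, hC⟩ := isCompact_univ.exists_bound_of_continuousOn hwc.continuousOn
  have hC0 : 0 ≤ C := (norm_nonneg _).trans (hC p₀ (Set.mem_univ _))
  -- Points of `f '' N` lie within `r / 2` of the centre, and `|σ t| ‖w‖ < r / 2` because `‖w‖ ≤ C`;
  -- so all displaced points stay in the chart. The denominator `C + 1` avoids division by zero.
  obtain ⟨σ, hσ, hσ0, hσ1, hσs⟩ := exists_reparametrization
    (Metric.ball_mem_nhds (0 : ℝ) (ε := r / 2 / (C + 1)) (by positivity))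
  have htgt : ∀ t, ∀ q ∈ N, ψ (f q) + σ t • w q ∈ ψ.target := fun t q hq ↦ hrt (by
    have h1 : dist (ψ (f q)) (ψ x₀) < r / 2 := hq.2
    have h2 : ‖σ t‖ < r / 2 / (C + 1) := mem_ball_zero_iff.1 (hσs t)
    have h3 : ‖σ t • w q‖ ≤ r / 2 := by
      rw [norm_smul]
      calc ‖σ t‖ * ‖w q‖ ≤ r / 2 / (C + 1) * (C + 1) :=
            mul_le_mul h2.le ((hC q (Set.mem_univ _)).trans (by linarith)) (norm_nonneg _)
              (by positivity)
        _ = r / 2 := by field_simp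
    rw [Metric.mem_ball, dist_eq_norm] at *
    calc ‖ψ (f q) + σ t • w q - ψ x₀‖ = ‖(ψ (f q) - ψ x₀) + σ t • w q‖ := by congr 1; abel
      _ ≤ ‖ψ (f q) - ψ x₀‖ + ‖σ t • w q‖ := norm_add_le _ _
      _ < r := by linarith)
  -- The variation moves along straight lines in the chart; off the support of `χ` it is stationary,
  -- so the two branches fit together smoothly.
  set F : ℝ → L → M := fun t q ↦ if q ∈ N then ψ.symm (ψ (f q) + σ t • w q) else f q with hF
  have hFout : ∀ t, ∀ q ∉ tsupport χ, F t q = f q := fun t q hq ↦ by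
    simp only [hF]
    split_ifs with h
    · rw [hw0 q hq, smul_zero, add_zero, ψ.left_inv h.1]
    · rfl
  refine ⟨F, χ, ⟨?_, ?_⟩, χ.continuous, fun p ↦ χ.nonneg, χ.eq_one, ?_⟩
  · rintro ⟨t, q⟩
    by_cases hq : q ∈ N
    · have h1 : ContMDiffAt (𝓘(ℝ, ℝ).prod (𝓡 n)) 𝓘(ℝ, Eu (2 * n)) ∞
          (fun z : ℝ × L ↦ ψ (f z.2) + σ z.1 • w z.2) (t, q) := by
        have h2 : ContMDiffAt (𝓡 n) 𝓘(ℝ, Eu (2 * n)) ∞ (fun q ↦ ψ (f q)) q :=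
          ((contMDiffOn_chart (n := ∞) (I := 𝓡 (2 * n)) (x := x₀)).contMDiffAt
            (ψ.open_source.mem_nhds hq.1)).comp q (hf q)
        exact (ContMDiffAt.comp (t, q) h2 contMDiffAt_snd).add
          ((hσ.contMDiff.contMDiffAt.comp (t, q) contMDiffAt_fst).smul
            (ContMDiffAt.comp (t, q) (hwN q hq) contMDiffAt_snd))
      refine (ContMDiffAt.comp (t, q) (contMDiffAt_chart_symm (htgt t q hq)) h1).congr_of_eventuallyEq
        ?_
      filter_upwards [continuousAt_snd.eventually (hNo.mem_nhds hq)] with z hz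
      exact if_pos hz
    · refine (ContMDiffAt.comp (t, q) (hf q) contMDiffAt_snd).congr_of_eventuallyEq ?_
      filter_upwards [(continuousAt_snd : ContinuousAt (Prod.snd : ℝ × L → L) (t, q)).eventually
        (hcN q hq)] with z hz
      exact hFout _ _ hz
  · ext1 q
    simp only [hF]
    split_ifs with h
    · rw [hσ0, zero_smul, add_zero, ψ.left_inv h.1]
    · rfl
  · intro p
    by_cases hp : p ∈ N
    · have h1 : (fun t ↦ F t p) = fun t ↦ ψ.symm (ψ (f p) + σ t • w p) := funext fun t ↦ if_pos hp
      refine Eq.trans ?_ (congrArg (fun g : ℝ → M ↦ (⟨g 0, mfderiv 𝓘(ℝ, ℝ) (𝓡 (2 * n)) g 0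
        (1 : ℝ)⟩ : TangentBundle (𝓡 (2 * n)) M)) h1.symm)
      have h2 : HasDerivAt (fun t ↦ ψ (f p) + σ t • w p) (w p) 0 := by
        simpa using (hσ1.smul_const (w p)).const_add (ψ (f p))
      have h3 := HasMFDerivAt.comp (0 : ℝ) (hasMFDerivAt_chart_symm (htgt 0 p hp))
        h2.hasFDerivAt.hasMFDerivAt
      have h4 : mfderiv 𝓘(ℝ, ℝ) (𝓡 (2 * n)) (fun t : ℝ ↦ ψ.symm (ψ (f p) + σ t • w p)) 0 (1 : ℝ) =
          frm x₀ (ψ.symm (ψ (f p) + σ 0 • w p)) (w p) := by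
        refine (congrArg (fun A : ℝ →L[ℝ] Eu (2 * n) ↦ A 1) h3.mfderiv).trans ?_
        refine congrArg (frm x₀ (ψ.symm (ψ (f p) + σ 0 • w p))) ?_
        exact one_smul ℝ (w p)
      rw [h4]
      have h5 : ψ.symm (ψ (f p) + σ 0 • w p) = f p := by
        rw [hσ0, zero_smul, add_zero, ψ.left_inv hp.1]
      refine Eq.trans ?_ (congrArg (fun q : M ↦ (⟨q, frm x₀ q (w p)⟩ :
        TangentBundle (𝓡 (2 * n)) M)) h5.symm)
      have h6 : frm x₀ (f p) (w p) = χ p • X p := by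
        rw [hw]
        simp only [map_smul]
        rw [frm_crd hp.1]
      rw [h6]
    · have hp' : p ∉ tsupport χ := (hcN p hp).self_of_nhds
      have h1 : (fun t ↦ F t p) = fun _ ↦ f p := funext fun t ↦ hFout t p hp'
      refine Eq.trans ?_ (congrArg (fun g : ℝ → M ↦ (⟨g 0, mfderiv 𝓘(ℝ, ℝ) (𝓡 (2 * n)) g 0
        (1 : ℝ)⟩ : TangentBundle (𝓡 (2 * n)) M)) h1.symm)
      have h2 : χ p • X p = 0 := by
        rw [image_eq_zero_of_notMem_tsupport hp', zero_smul]
      rw [mfderiv_const]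
      exact congrArg (fun v ↦ (⟨f p, v⟩ : TangentBundle (𝓡 (2 * n)) M)) h2

end LocalVariations

open Matrix

/-! ### Uniqueness of the gradient and the criticality criterion. -/

section Gradient

variable {n : ℕ} {M : Type*} [TopologicalSpace M] [ChartedSpace (Eu (2 * n)) M]
  [IsManifold (𝓡 (2 * n)) ∞ M] {L : Type*} [TopologicalSpace L] [ChartedSpace (Eu n) L]
  [IsManifold (𝓡 n) ∞ L] {K : KahlerStructure n M} {o : ManifoldOrientation n L}
  {f : L → M} {p : L} [T2Space M]

lemma piJ_of_mem_jPlane (hf : K.IsTotallyReal f) {w : TangentSpace (𝓡 (2 * n)) (f p)}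
    (hw : w ∈ K.jPlane f p) : K.piJ f p w = w := by
  obtain ⟨_, ⟨Y, rfl⟩, rfl⟩ := hw
  have hT := hf.isTRFrame (frmBasis (mem_chart_source (Eu n) p))
  set b := frmBasis (mem_chart_source (Eu n) p)
  have h2 := (K.isHermPair (f p)).coef_J (fun i ↦ diffAt f p (b i)) (diffAt f p Y)
  have h3 : ∀ k, (K.co (f p) (fun i ↦ diffAt f p (b i)) (K.J (f p) (diffAt f p Y)) k).im =
      b.repr Y k := fun k ↦ by
    have h4 : K.co (f p) (fun i ↦ diffAt f p (b i)) (K.J (f p) (diffAt f p Y)) k =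
        Complex.I * K.co (f p) (fun i ↦ diffAt f p (b i)) (diffAt f p Y) k := congrFun h2 k
    rw [h4, congrFun (co_diffAt hT Y) k]
    simp
  have h5 := piJ_apply hT (K.J (f p) (diffAt f p Y))
  simp only [h3] at h5
  rw [b.sum_repr] at h5
  exact h5

lemma continuous_inner_along {Y Z : Π p : L, TangentSpace (𝓡 (2 * n)) (f p)}
    (hY : SmoothAlong f Y) (hZ : SmoothAlong f Z) :
    Continuous fun p ↦ K.g.inner (f p) (Y p) (Z p) :=
  continuous_iff_continuousAt.2 fun p ↦ (contMDiffAt_inner_along K.g (hY p) (hZ p)).continuousAt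

lemma SmoothAlong.sub {Y Z : Π p : L, TangentSpace (𝓡 (2 * n)) (f p)}
    (hY : SmoothAlong f Y) (hZ : SmoothAlong f Z) :
    SmoothAlong f (fun p ↦ Y p - Z p) := by
  intro p
  have hx := mem_chart_source (Eu (2 * n)) (f p)
  obtain ⟨h1, h2⟩ := (contMDiffAt_along_iff le_rfl hx).1 (hY p)
  obtain ⟨-, h3⟩ := (contMDiffAt_along_iff le_rfl hx).1 (hZ p)
  refine (contMDiffAt_along_iff le_rfl hx).2 ⟨h1, (h2.sub h3).congr_of_eventuallyEq ?_⟩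
  exact .of_forall fun q ↦ map_sub (crd (f p) (f q)) _ _

variable [T2Space L] [CompactSpace L]

/-- Variations through totally real immersions with prescribed velocity near a point. -/
lemma exists_totallyReal_variation (hf : K.IsTotallyReal f)
    {X : Π p : L, TangentSpace (𝓡 (2 * n)) (f p)} (hX : SmoothAlong f X) (p₀ : L) :
    ∃ (F : ℝ → L → M) (χ : L → ℝ), IsVariation (n := n) f F ∧ (∀ t, K.IsTotallyReal (F t)) ∧
      Continuous χ ∧ (∀ p, 0 ≤ χ p) ∧ χ p₀ = 1 ∧
      IsVelocity (n := n) f F (fun p ↦ χ p • X p) := by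
  obtain ⟨F, χ, ⟨hF, hF0⟩, h1, h2, h3, h4⟩ := exists_variation hf.smooth hX p₀
  obtain ⟨σ, hσ, hσ0, hσ1, hσs⟩ := exists_reparametrization
    (eventually_isTotallyReal (K := K) (n := n) (F := F) hF (hF0 ▸ hf))
  exact ⟨fun t ↦ F (σ t), χ, ⟨SmoothFamily.reparametrize hF hσ, by simp only [hσ0, hF0]⟩, hσs, h1,
    h2, h3, isVelocity_reparametrize hF h4 hσ0 hσ1⟩

/-- A section of `J(TL)` is determined by the first variations in its own direction. -/
lemma eq_zero_of_variations (hf : K.IsTotallyReal f)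
    {X : Π p : L, TangentSpace (𝓡 (2 * n)) (f p)} (hX : SmoothAlong f X)
    (h : ∀ F χ, IsVariation (n := n) f F → (∀ t, K.IsTotallyReal (F t)) → Continuous χ →
      IsVelocity (n := n) f F (fun p ↦ χ p • X p) →
      wint (K.volJDensity o f) (fun p ↦ χ p * K.g.inner (f p) (X p) (X p)) = 0) (p : L) :
    X p = 0 := by
  obtain ⟨F, χ, hF, hT, h1, h2, h3, h4⟩ := exists_totallyReal_variation hf hX p
  have hnn : ∀ q, 0 ≤ K.g.inner (f q) (X q) (X q) := fun q ↦ by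
    by_cases hq : X q = 0
    · rw [hq]; simp
    · exact (K.g.pos _ _ hq).le
  -- The integrand `χ |X|²` is continuous and nonnegative with integral zero, hence zero at `p`,
  -- where `χ = 1`.
  have h5 := eq_zero_of_wint_eq_zero (isContDensity_volJ (o := o) hf)
    (fun c q hq ↦ dens_volJ_pos hf hq) (h1.mul (continuous_inner_along (K := K) hX hX))
    (fun q ↦ mul_nonneg (h2 q) (hnn q)) (h F χ hF hT h1 h4) p
  rw [Pi.mul_apply, h3, one_mul] at h5
  by_contra hne
  exact (K.g.pos _ _ hne).ne' h5

lemma first_variation_smul (hf : K.IsTotallyReal f)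
    {H X : Π p : L, TangentSpace (𝓡 (2 * n)) (f p)} (hH : K.IsJMeanCurvature o f H)
    (hX : ∀ p, X p ∈ K.jPlane f p) {F : ℝ → L → M} {χ : L → ℝ} (hF : IsVariation (n := n) f F)
    (hT : ∀ t, K.IsTotallyReal (F t)) (hZ : IsVelocity (n := n) f F (fun p ↦ χ p • X p)) :
    HasDerivAt (fun t ↦ K.VolJ o (F t))
      (-wint (K.volJDensity o f) fun p ↦ χ p * K.g.inner (f p) (X p) (H p)) 0 := by
  have h := hH.first_variation F hF hT _ hZ
  have h1 : ∀ p, K.g.inner (f p) (K.piJ f p (χ p • X p)) (H p) =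
      χ p * K.g.inner (f p) (X p) (H p) := fun p ↦ by
    rw [map_smul, piJ_of_mem_jPlane hf (hX p), map_smul, _root_.smul_apply, smul_eq_mul]
  simp only [h1] at h
  exact h

/-- The `J`-mean curvature field is unique. -/
lemma KahlerStructure.IsJMeanCurvature.unique (hf : K.IsTotallyReal f)
    {H H' : Π p : L, TangentSpace (𝓡 (2 * n)) (f p)} (hH : K.IsJMeanCurvature o f H)
    (hH' : K.IsJMeanCurvature o f H') : H = H' := by
  funext p
  refine sub_eq_zero.1 (eq_zero_of_variations (o := o) hf (SmoothAlong.sub hH.smooth hH'.smooth)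
    (fun F χ hF hT hχ hZ ↦ ?_) p)
  -- Both fields compute the same derivative along a variation with velocity `χ (H - H')`; the
  -- difference of the two formulas is `∫ χ |H - H'|²`.
  have hX : ∀ p, H p - H' p ∈ K.jPlane f p := fun p ↦ sub_mem (hH.mem p) (hH'.mem p)
  have h1 := (first_variation_smul hf hH hX hF hT hZ).unique
    (first_variation_smul hf hH' hX hF hT hZ)
  have hs := SmoothAlong.sub hH.smooth hH'.smooth
  have h2 := wint_add (isContDensity_volJ (o := o) hf)
    (F := fun p ↦ χ p * K.g.inner (f p) (H p - H' p) (H p))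
    (G := fun p ↦ -(χ p * K.g.inner (f p) (H p - H' p) (H' p)))
    (hχ.mul (continuous_inner_along (K := K) hs hH.smooth))
    (hχ.mul (continuous_inner_along (K := K) hs hH'.smooth)).neg
  rw [wint_neg] at h2
  have h3 : ∀ p, χ p * K.g.inner (f p) (H p - H' p) (H p - H' p) =
      χ p * K.g.inner (f p) (H p - H' p) (H p) +
      -(χ p * K.g.inner (f p) (H p - H' p) (H' p)) := fun p ↦ by
    rw [map_sub (K.g.inner (f p) (H p - H' p))]; ring
  simp only [h3]
  exact h2.trans (by linarith)

lemma isJMinimal_of_eq_zero {H : Π p : L, TangentSpace (𝓡 (2 * n)) (f p)}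
    (hH : K.IsJMeanCurvature o f H) (h : ∀ p, H p = 0) : K.IsJMinimal o f := by
  rintro F ⟨hF, rfl⟩ hT
  have h1 := hH.first_variation F ⟨hF, rfl⟩ hT (vel (n := n) F) (fun p ↦ rfl)
  simp only [h, map_zero] at h1
  exact h1.congr_deriv (neg_eq_zero.2 (wint_zero (K.volJDensity o (F 0))))

/-- The variations with velocity `χ H` have first variation `-∫ χ |H|² vol_J`, which criticality
makes zero. -/
lemma eq_zero_of_isJMinimal (hf : K.IsTotallyReal f)
    {H : Π p : L, TangentSpace (𝓡 (2 * n)) (f p)} (hH : K.IsJMeanCurvature o f H)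
    (h : K.IsJMinimal o f) (p : L) : H p = 0 := by
  refine eq_zero_of_variations (o := o) hf hH.smooth (fun F χ hF hT hχ hZ ↦ ?_) p
  have h1 := (first_variation_smul hf hH hH.mem hF hT hZ).unique (h F hF hT)
  linarith

lemma isJMinimal_iff_maslovForm (hf : K.IsTotallyReal f) :
    K.IsJMinimal o f ↔ ∀ p X, K.maslovForm f p X = 0 := by
  have h := isJMeanCurvature_maslovField (o := o) hf
  simp only [← maslovField_eq_zero_iff hf]
  exact ⟨eq_zero_of_isJMinimal hf h, isJMinimal_of_eq_zero h⟩

/-- The choice operator returns some `J`-mean curvature field, since one exists; uniqueness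
identifies it. -/
lemma HJ_eq (hf : K.IsTotallyReal f) : K.HJ o f = K.maslovField f :=
  KahlerStructure.IsJMeanCurvature.unique (o := o) hf
    (Classical.epsilon_spec ⟨_, isJMeanCurvature_maslovField hf⟩) (isJMeanCurvature_maslovField hf)

end Gradient

open Matrix

/-! ### Comparison of the `J`-volume with the Riemannian volume. -/

section Comparison

variable {n : ℕ} {M : Type*} [TopologicalSpace M] [ChartedSpace (Eu (2 * n)) M]
  [IsManifold (𝓡 (2 * n)) ∞ M] {L : Type*} [TopologicalSpace L] [ChartedSpace (Eu n) L]
  [IsManifold (𝓡 n) ∞ L] {K : KahlerStructure n M} {o : ManifoldOrientation n L}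
  {f : L → M} {F : ℝ → L → M} {p : L} [T2Space M]

lemma map_re_gr {x : M} (v : Fin n → TangentSpace (𝓡 (2 * n)) x) :
    (K.gr x v).map Complex.re = of fun i j ↦ K.g.inner x (v i) (v j) := by
  ext i j
  simp [KahlerStructure.gr, gram, hform]

/-- The `J`-volume is bounded by the Riemannian volume. -/
lemma volJDensity_le (hf : K.IsTotallyReal f) (b : Module.Basis (Fin n) ℝ (TangentSpace (𝓡 n) p)) :
    K.volJDensity o f p b ≤ K.volDensity f p b := by
  rw [volJDensity_eq o hf, KahlerStructure.volDensity, ← map_re_gr]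
  exact Real.sqrt_le_sqrt (det_re_le_det_map_re ((K.isHermPair (f p)).gram_posDef (hf.isTRFrame b)))

/-- The imaginary parts of the Hermitian Gram matrix are values of `ω` on tangent vectors, so for a
Lagrangian it is the real Gram matrix. -/
lemma volJDensity_eq_volDensity (hf : K.IsTotallyReal f) (hL : K.IsLagrangian f)
    (v : Fin n → TangentSpace (𝓡 n) p) : K.volJDensity o f p v = K.volDensity f p v := by
  rw [volJDensity_eq o hf, KahlerStructure.volDensity]
  congr 1
  have h1 : K.gr (f p) (fun i ↦ diffAt f p (v i)) = Complex.ofRealHom.mapMatrix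
      (of fun i j ↦ K.g.inner (f p) (diffAt f p (v i)) (diffAt f p (v j))) := by
    ext i j
    have h2 : K.g.inner (f p) (K.J (f p) (diffAt f p (v i))) (diffAt f p (v j)) = 0 := hL p _ _
    simp [KahlerStructure.gr, gram, hform, h2]
  rw [h1, ← RingHom.map_det]
  exact Complex.ofReal_re _

variable [T2Space L] [CompactSpace L]

lemma integralDensity_mono {D D' : Π p : L, (Fin n → TangentSpace (𝓡 n) p) → ℝ}
    (hD : ∀ c, ContinuousOn (dens D c) (chartAt (Eu n) c).source)
    (hD' : ∀ c, ContinuousOn (dens D' c) (chartAt (Eu n) c).source)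
    (h : ∀ c, ∀ p ∈ (chartAt (Eu n) c).source, dens D c p ≤ dens D' c p) :
    integralDensity D ≤ integralDensity D' := by
  have key : ∀ (D : Π p : L, (Fin n → TangentSpace (𝓡 n) p) → ℝ),
      (∀ c, ContinuousOn (dens D c) (chartAt (Eu n) c).source) → ∀ c,
      IntegrableOn (fun y ↦ chartPartition n L c ((chartAt (Eu n) c).symm y) *
        dens D c ((chartAt (Eu n) c).symm y)) (chartAt (Eu n) c).target := fun D hD c ↦
    integrableOn_chart (tsupport_chartPartition c) (φ := fun p ↦ chartPartition n L c p * dens D c p)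
      ((chartPartition n L c).contMDiff.continuous.continuousOn.mul (hD c)) fun p hp ↦ by
        rw [image_eq_zero_of_notMem_tsupport hp, zero_mul]
  rw [integralDensity_eq_sum, integralDensity_eq_sum]
  refine Finset.sum_le_sum fun c _ ↦ setIntegral_mono_on (key D hD c) (key D' hD' c)
    (chartAt (Eu n) c).open_target.measurableSet fun y hy ↦ ?_
  exact mul_le_mul_of_nonneg_left (h c _ ((chartAt (Eu n) c).map_target hy))
    ((chartPartition n L).nonneg _ _)

lemma continuousOn_dens_of_family {D : ℝ → Π p : L, (Fin n → TangentSpace (𝓡 n) p) → ℝ}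
    (hD : ∀ c, ∀ z : ℝ × Eu n, z.2 ∈ (chartAt (Eu n) c).target →
      ContDiffAt ℝ ∞ (fun w : ℝ × Eu n ↦ dens (D w.1) c ((chartAt (Eu n) c).symm w.2)) z) (t : ℝ)
    (c : L) : ContinuousOn (dens (D t) c) (chartAt (Eu n) c).source := by
  intro p hp
  have h1 := (hD c (t, chartAt (Eu n) c p) ((chartAt (Eu n) c).map_source hp)).continuousAt
  have h2 : ContinuousAt (fun q : L ↦ (t, chartAt (Eu n) c q)) p :=
    continuousAt_const.prodMk ((chartAt (Eu n) c).continuousAt hp)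
  refine ((ContinuousAt.comp (f := fun q : L ↦ (t, chartAt (Eu n) c q)) h1 h2).congr ?_).continuousWithinAt
  filter_upwards [(chartAt (Eu n) c).open_source.mem_nhds hp] with q hq
  simp only [Function.comp_apply]
  rw [(chartAt (Eu n) c).left_inv hq]

lemma VolJ_le_Vol (hF : SmoothFamily (n := n) F) (hT : ∀ t, K.IsTotallyReal (F t)) (t : ℝ) :
    K.VolJ o (F t) ≤ K.Vol (F t) := by
  refine integralDensity_mono
    (continuousOn_dens_of_family (D := fun t ↦ K.volJDensity o (F t)) (contDiffAt_dens_volJ hF hT) t)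
    (continuousOn_dens_of_family (D := fun t ↦ K.volDensity (F t))
      (contDiffAt_dens_vol hF fun t ↦ (hT t).toIsSmoothImmersion) t) fun c p hp ↦ ?_
  simp only [dens, ← frmBasis_apply hp]
  exact volJDensity_le (hT t) _

lemma VolJ_eq_Vol (hf : K.IsTotallyReal f) (hL : K.IsLagrangian f) : K.VolJ o f = K.Vol f := by
  have : K.volJDensity o f = K.volDensity f := by
    funext p v
    exact volJDensity_eq_volDensity hf hL v
  rw [KahlerStructure.VolJ, KahlerStructure.Vol, this]

/-- At a Lagrangian immersion the two volumes have the same first variation. -/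
lemma first_variation_eq (hF : SmoothFamily (n := n) F) (hT : ∀ t, K.IsTotallyReal (F t))
    (hL : K.IsLagrangian (F 0)) {a b : ℝ} (ha : HasDerivAt (fun t ↦ K.VolJ o (F t)) a 0)
    (hb : HasDerivAt (fun t ↦ K.Vol (F t)) b 0) : a = b := by
  -- The difference of the volumes is nonnegative and vanishes at time zero, so its derivative there
  -- is zero.
  have h1 : IsLocalMin (fun t ↦ K.Vol (F t) - K.VolJ o (F t)) 0 := .of_forall fun t ↦ by
    simp only
    rw [VolJ_eq_Vol (hT 0) hL, sub_self]
    exact sub_nonneg.2 (VolJ_le_Vol hF hT t)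
  have h2 := h1.hasDerivAt_eq_zero (hb.sub ha)
  linarith

/-- A variation through immersions is totally real only for small times. Slowing time down by `σ`
keeps it in that range without changing the derivative at zero, so the two first variations can be
compared. -/
lemma isMinimal_of_isJMinimal (hf : K.IsTotallyReal f) (hL : K.IsLagrangian f)
    (h : K.IsJMinimal o f) : K.IsMinimal f := by
  rintro F ⟨hF, rfl⟩ hI
  have hd := hasDerivAt_integralDensity (D := fun t ↦ K.volDensity (F t))
    (contDiffAt_dens_vol hF hI) 0
  obtain ⟨σ, hσ, hσ0, hσ1, hσs⟩ := exists_reparametrization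
    (eventually_isTotallyReal (K := K) hF hf)
  have h0 : F (σ 0) = F 0 := by rw [hσ0]
  have hG : SmoothFamily (n := n) (fun t ↦ F (σ t)) := SmoothFamily.reparametrize hF hσ
  rw [← hσ0] at hd
  have h1 := hd.comp (0 : ℝ) hσ1
  rw [mul_one] at h1
  have h2 := first_variation_eq (F := fun t ↦ F (σ t)) hG hσs (by rwa [h0]) (h _ ⟨hG, h0⟩ hσs) h1
  rw [hσ0] at hd h2
  exact hd.congr_deriv h2.symm

lemma isJMinimal_of_isMinimal (hL : K.IsLagrangian f) (h : K.IsMinimal f) :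
    K.IsJMinimal o f := by
  rintro F ⟨hF, rfl⟩ hT
  have h1 := hasDerivAt_integralDensity (D := fun t ↦ K.volJDensity o (F t))
    (contDiffAt_dens_volJ hF hT) 0
  exact h1.congr_deriv (first_variation_eq hF hT hL h1
    (h F ⟨hF, rfl⟩ fun t ↦ (hT t).toIsSmoothImmersion))

end Comparison

end TotRealGeom
end

theorem mainTheorem4 {n : ℕ}
    {M : Type*} [TopologicalSpace M] [T2Space M] [SecondCountableTopology M]
    [ChartedSpace (Eu (2 * n)) M] [IsManifold (𝓡 (2 * n)) ∞ M]
    {L : Type*} [TopologicalSpace L] [T2Space L] [CompactSpace L]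
    [ChartedSpace (Eu n) L] [IsManifold (𝓡 n) ∞ L]
    (K : KahlerStructure n M) (o : ManifoldOrientation n L)
    (ι : L → M) (hι : K.IsTotallyReal ι) :
    (∃! H : Π p : L, TangentSpace (𝓡 (2 * n)) (ι p), K.IsJMeanCurvature o ι H) ∧
    List.TFAE [
      K.IsJMinimal o ι,
      ∀ p, K.HJ o ι p = 0,
      ∀ p X, K.maslovForm ι p X = 0,
      K.IsParallel ι (K.OmegaJ o ι)] ∧
    (∀ c : ℝ, c ≠ 0 → K.IsEinstein c →
      (K.IsJMinimal o ι ↔ K.IsMinimal ι ∧ K.IsLagrangian ι)) ∧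
    (K.HasDefiniteRicci → K.IsJMinimal o ι → K.IsRicciLagrangian ι) := by
  have hJ := isJMeanCurvature_maslovField (o := o) hι
  have hm := isJMinimal_iff_maslovForm (o := o) hι
  refine ⟨⟨_, hJ, fun H hH ↦ hH.unique hι hJ⟩, ?_, ?_, ?_⟩
  · tfae_have 1 ↔ 3 := hm
    tfae_have 2 ↔ 3 := by
      rw [HJ_eq hι]
      exact forall_congr' fun p ↦ maslovField_eq_zero_iff hι p
    tfae_have 4 ↔ 3 := isParallel_iff hι
    tfae_finish
  · intro c hc hE
    refine ⟨fun h ↦ ?_, fun h ↦ isJMinimal_of_isMinimal h.2 h.1⟩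
    -- Lagrangian comes before minimal: the comparison of the two volumes is available only at a
    -- Lagrangian immersion.
    have hL := isLagrangian_of_isRicciLagrangian hc hE
      (isRicciLagrangian_of_maslovForm hι (hm.1 h))
    exact ⟨isMinimal_of_isJMinimal hι hL h, hL⟩
  · exact fun _ h ↦ isRicciLagrangian_of_maslovForm hι (hm.1 h)
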